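/- Let $\mathbb K$ be an algebraically closed field, let $A=(a_{ij})_{i,j\in I}$ be a symmetrizable Borcherds–Cartan matrix ($a_{ii}\in\{2,0,-2,-4,\dots\}$, $a_{ij}\in\mathbb Z_{\le 0}$ for $i\neq j$) with positive integers $r_i$ such that $r_ia_{ij}=r_ja_{ji}$, and put $(\alpha_i,\alpha_j)=r_ia_{ij}$. An index $i$ is real if $a_{ii}=2$ and imaginary if $a_{ii}\le 0$. For $\nu\in\mathbb N[I]$ of height $m$ let $R(\nu)$ be the graded KLR algebra with generators $1_{\mathbf i}$ (degree $0$), $x_{k,\mathbf i}$ (degree $2r_{i_k}$), $\tau_{k,\mathbf i}$ (degree $-(\alpha_{i_k},\alpha_{i_{k+1}})$), where $\mathbf i=i_1\cdots i_m$ runs over the sequences of weight $\nu$. The $1_{\mathbf i}$ are orthogonal idempotents with sum $1$, $x_{k,\mathbf i}\in 1_{\mathbf i}R(\nu)1_{\mathbf i}$, $\tau_{k,\mathbf i}\in 1_{s_k\mathbf i}R(\nu)1_{\mathbf i}$; the $x$'s commute with each other, $\tau_k$ commutes with $x_l$ for $l\ne k,k+1$ and with $\tau_l$ for $|k-l|>1$;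 and, with $x_k=\sum_{\mathbf i}x_{k,\mathbf i}$, $\tau_k=\sum_{\mathbf i}\tau_{k,\mathbf i}$, $i=i_k$, $j=i_{k+1}$: * $\tau_k^2 1_{\mathbf i}$ is $0$ if $i=j$, is $1_{\mathbf i}$ if $i\neq j$ and $(\alpha_i,\alpha_j)=0$, and is $(x_k^{-a_{ij}}+x_{k+1}^{-a_{ji}})1_{\mathbf i}$ if $i\ne j$ and $(\alpha_i,\alpha_j)\neq 0$; * $(x_k\tau_k-\tau_kx_{k+1})1_{\mathbf i}=(\tau_kx_k-x_{k+1}\tau_k)1_{\mathbf i}$, and this is $1_{\mathbf i}$ if $i=j$ is real and $0$ otherwise; * $(\tau_k\tau_{k+1}\tau_k-\tau_{k+1}\tau_k\tau_{k+1})1_{\mathbf i}$ is $\sum_{c=0}^{-a_{ij}-1}x_k^cx_{k+2}^{-a_{ij}-1-c}1_{\mathbf i}$ if $i_{k+2}=i$ is real, $i\neq j$ and $(\alpha_i,\alpha_j)\neq0$, and is $0$ otherwise. All modules are $\mathbb Z$-graded left modules, isomorphisms preserve degrees, and $M\{d\}_n=M_{n-d}$. A graded module is gr-irreducible if it is nonzero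 and has no graded submodules except $0$ and itself; $\operatorname{hd}M$ is the quotient of $M$ by the intersection of its maximal graded submodules. Placing diagrams side by side gives a (non-unital) homomorphism $R(\nu)\otimes R(\nu')\to R(\nu+\nu')$, whose value at $1$ is the idempotent $1_{\nu,\nu'}$; put $\operatorname{Ind}_{\nu,\nu'}W=R(\nu+\nu')1_{\nu,\nu'}\otimes_{R(\nu)\otimes R(\nu')}W$. For an $R(\nu)$-module $M$ let $\Delta_{i^n}M=1_{\nu-ni,\,ni}M$, an $R(\nu-ni)\otimes R(ni)$-module (and $\Delta_{i^n}M=0$ if $\nu-ni\notin\mathbb N[I]$), and $\varepsilon_i(M)=\max\{n\ge0\mid\Delta_{i^n}M\neq0\}$. Let $V(i^n)$ be the gr-irreducible $R(ni)$-module which for real $i$ is $\big(R(ni)\otimes_{\mathbb K[x_1,\dots,x_n]}\mathbb K\big)\{\tfrac{n(n-1)}2r_i\}$, with all $x_k$ acting on $\mathbb K$ by $0$, and for imaginary $i$ is the one-dimensional module in degree $0$ on which all $x_k$ and $\tau_k$ act by $0$. **Proposition.** Let $i\in I$, let $N$ be a finite-dimensional gr-irreducible $R(\nu)$-module with $\varepsilon_i(N)=a$,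 and suppose $\Delta_{i^a}N\cong K\otimes V(i^a)$ for a finite-dimensional gr-irreducible $R(\nu-ai)$-module $K$ with $\varepsilon_i(K)=0$. Let $n\ge0$ and $M=\operatorname{Ind}_{\nu,ni}N\otimes V(i^n)$. Then $$\operatorname{hd}M\;\cong\;\big(\operatorname{hd}\operatorname{Ind}_{\nu-ai,(a+n)i}K\otimes V(i^{a+n})\big)\{d\},\qquad d=\begin{cases}-r_i\,a\,n&\text{if } i \text{ is real},\\ 0&\text{if } i\text{ is imaginary,}\end{cases}$$ the module $\operatorname{hd}M$ is gr-irreducible, and $\varepsilon_i(\operatorname{hd}M)=a+n$. Moreover, if $i$ is real, then $M$ has a graded composition series, and in every graded composition series of $M$ there is a factor isomorphic to $\operatorname{hd}M$ such that all other factors $L$ satisfy $\varepsilon_i(L)<a+n$. -/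

import Mathlib

noncomputable section

namespace KLR

open DirectSum TensorProduct

section Gradings

variable {𝕜 : Type*} [Field 𝕜]
variable {M : Type*} [AddCommGroup M] [Module 𝕜 M]
variable {N : Type*} [AddCommGroup N] [Module 𝕜 N]

/-- A family of subspaces that spans is a grading as soon as there is a linear map
`M → ⨁ M` which sends `x` in the `n`-th subspace to `x` placed in degree `n`. -/
theorem isInternal_of_coaction (ℳ : ℤ → Submodule 𝕜 M) (c : M →ₗ[𝕜] (ℤ →₀ M))
    (hc : ∀ n, ∀ x ∈ ℳ n, c x = Finsupp.single n x) (htop : ⨆ n, ℳ n = ⊤) :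
    DirectSum.IsInternal ℳ := by
  have key : ∀ (x : ⨁ n, ℳ n) (n : ℤ), c (DirectSum.coeAddMonoidHom ℳ x) n = (x n : M) := by
    intro x n
    induction x using DirectSum.induction_on with
    | zero => simp
    | of m y =>
      rw [DirectSum.coeAddMonoidHom_of, hc m _ y.2]
      by_cases h : m = n
      · subst h; simp
      · rw [Finsupp.single_eq_of_ne' h, DirectSum.of_eq_of_ne _ _ _ (Ne.symm h)]; simp
    | add x y hx hy => simp [hx, hy]
  constructor
  · rw [injective_iff_map_eq_zero]
    intro x hx
    refine DFinsupp.ext fun n => Subtype.ext ?_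
    have := key x n
    rw [hx] at this
    simpa using this.symm
  · intro x
    have hx : x ∈ ⨆ n, ℳ n := htop ▸ Submodule.mem_top
    induction hx using Submodule.iSup_induction' with
    | mem n y hy => exact ⟨DirectSum.of (fun n => ℳ n) n ⟨y, hy⟩, by simp⟩
    | zero => exact ⟨0, by simp⟩
    | add x y _ _ hx hy =>
      obtain ⟨a, rfl⟩ := hx
      obtain ⟨b, rfl⟩ := hy
      exact ⟨a + b, by simp⟩

/-- The map which records the homogeneous components of an element. -/
def coaction (ℳ : ℤ → Submodule 𝕜 M) [Decomposition ℳ] : M →ₗ[𝕜] (ℤ →₀ M) :=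
  (DirectSum.toModule 𝕜 ℤ (ℤ →₀ M) fun n => (Finsupp.lsingle n).comp (ℳ n).subtype).comp
    (decomposeLinearEquiv ℳ).toLinearMap

theorem coaction_of_mem (ℳ : ℤ → Submodule 𝕜 M) [Decomposition ℳ] {n : ℤ} {x : M}
    (hx : x ∈ ℳ n) : coaction ℳ x = Finsupp.single n x := by
  have h : decomposeLinearEquiv ℳ x = DirectSum.lof 𝕜 ℤ (fun n => ℳ n) n ⟨x, hx⟩ :=
    decompose_of_mem ℳ hx
  rw [coaction, LinearMap.comp_apply, LinearEquiv.coe_coe, h, DirectSum.toModule_lof]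
  rfl

theorem iSup_eq_top_of_decomposition (ℳ : ℤ → Submodule 𝕜 M) [Decomposition ℳ] :
    ⨆ n, ℳ n = ⊤ :=
  (Decomposition.isInternal ℳ).submodule_iSup_eq_top

/-- A homogeneous subspace `φ : X → M` is graded by the `X ∩ M_n`. -/
theorem comap_isInternal (ℳ : ℤ → Submodule 𝕜 M) [Decomposition ℳ] (φ : N →ₗ[𝕜] M)
    (hφ : Function.Injective φ)
    (hX : ∀ n x, (decompose ℳ (φ x) n : M) ∈ LinearMap.range φ) :
    DirectSum.IsInternal fun n => (ℳ n).comap φ := by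
  classical
  rw [DirectSum.isInternal_submodule_iff_iSupIndep_and_iSup_eq_top]
  constructor
  · have h := (Decomposition.isInternal ℳ).submodule_iSupIndep
    rw [iSupIndep_def] at h ⊢
    intro n
    rw [Submodule.disjoint_def]
    intro x hx hx'
    refine hφ ((Submodule.disjoint_def.1 (h n) (φ x) hx ?_).trans (map_zero φ).symm)
    have : φ x ∈ (⨆ j, ⨆ (_ : j ≠ n), (ℳ j).comap φ).map φ := Submodule.mem_map_of_mem hx'
    refine (Submodule.map_le_iff_le_comap.2 ?_) this
    refine iSup₂_le fun j hj y hy => ?_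
    exact Submodule.mem_iSup_of_mem j (Submodule.mem_iSup_of_mem hj hy)
  · rw [eq_top_iff]
    rintro x -
    choose y hy using fun n => hX n x
    have : x = ∑ n ∈ (decompose ℳ (φ x)).support, y n := by
      apply hφ
      rw [map_sum]
      simp_rw [hy]
      exact (sum_support_decompose ℳ (φ x)).symm
    rw [this]
    refine Submodule.sum_mem _ fun n _ => Submodule.mem_iSup_of_mem n ?_
    rw [Submodule.mem_comap, hy]
    exact (decompose ℳ (φ x) n).2

/-- The quotient by a homogeneous subspace is graded by the images of the `M_n`. -/
theorem map_isInternal (ℳ : ℤ → Submodule 𝕜 M) [Decomposition ℳ] (π : M →ₗ[𝕜] N)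
    (hπ : Function.Surjective π)
    (hX : ∀ n, ∀ x ∈ LinearMap.ker π, (decompose ℳ x n : M) ∈ LinearMap.ker π) :
    DirectSum.IsInternal fun n => (ℳ n).map π := by
  classical
  have hcoact : ∀ x n, coaction ℳ x n = (decompose ℳ x n : M) := by
    intro x n
    induction x using Decomposition.inductionOn ℳ with
    | zero => simp
    | @homogeneous m y =>
      rw [coaction_of_mem ℳ y.2, decompose_coe]
      by_cases h : m = n
      · subst h; simp
      · rw [Finsupp.single_eq_of_ne' h, DirectSum.of_eq_of_ne _ _ _ (Ne.symm h)]; simp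
    | add x y hx hy => simp [hx, hy]
  let e := π.quotKerEquivOfSurjective hπ
  let c₀ : M →ₗ[𝕜] (ℤ →₀ N) := (Finsupp.mapRange.linearMap π).comp (coaction ℳ)
  have hker : LinearMap.ker π ≤ LinearMap.ker c₀ := by
    intro x hx
    rw [LinearMap.mem_ker]
    refine Finsupp.ext fun n => ?_
    have h := hX n x hx
    rw [← hcoact, LinearMap.mem_ker] at h
    simpa [c₀] using h
  refine isInternal_of_coaction _ (((LinearMap.ker π).liftQ c₀ hker).comp e.symm.toLinearMap) ?_ ?_
  · rintro n _ ⟨x, hx, rfl⟩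
    have : e.symm (π x) = (LinearMap.ker π).mkQ x := by
      rw [LinearEquiv.symm_apply_eq]; rfl
    simp only [LinearMap.comp_apply, LinearEquiv.coe_coe, this]
    simp [c₀, coaction_of_mem ℳ hx]
  · rw [← Submodule.map_iSup, iSup_eq_top_of_decomposition ℳ, Submodule.map_top,
      LinearMap.range_eq_top.2 hπ]

/-- The total grading of a tensor product: degree `n` is spanned by the `x ⊗ y` with
`deg x + deg y = n`. -/
def tensorDeg (ℳ : ℤ → Submodule 𝕜 M) (𝒩 : ℤ → Submodule 𝕜 N) (n : ℤ) :
    Submodule 𝕜 (M ⊗[𝕜] N) :=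
  Submodule.span 𝕜 {z | ∃ p q : ℤ, p + q = n ∧ ∃ x ∈ ℳ p, ∃ y ∈ 𝒩 q, z = x ⊗ₜ[𝕜] y}

theorem tmul_mem_tensorDeg {ℳ : ℤ → Submodule 𝕜 M} {𝒩 : ℤ → Submodule 𝕜 N} {p q : ℤ}
    {x : M} {y : N} (hx : x ∈ ℳ p) (hy : y ∈ 𝒩 q) : x ⊗ₜ[𝕜] y ∈ tensorDeg ℳ 𝒩 (p + q) :=
  Submodule.subset_span ⟨p, q, rfl, x, hx, y, hy, rfl⟩

theorem tensorDeg_isInternal (ℳ : ℤ → Submodule 𝕜 M) [Decomposition ℳ]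
    (𝒩 : ℤ → Submodule 𝕜 N) [Decomposition 𝒩] : DirectSum.IsInternal (tensorDeg ℳ 𝒩) := by
  let b : (ℤ →₀ M) →ₗ[𝕜] (ℤ →₀ N) →ₗ[𝕜] (ℤ →₀ M ⊗[𝕜] N) :=
    Finsupp.lsum 𝕜 fun p => LinearMap.flip (Finsupp.lsum 𝕜 fun q =>
      LinearMap.flip ((TensorProduct.mk 𝕜 M N).compr₂ (Finsupp.lsingle (p + q))))
  have hb : ∀ p q x y, b (Finsupp.single p x) (Finsupp.single q y)
      = Finsupp.single (p + q) (x ⊗ₜ[𝕜] y) := by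
    intro p q x y
    simp [b]
  refine isInternal_of_coaction _
    ((TensorProduct.lift b).comp (TensorProduct.map (coaction ℳ) (coaction 𝒩))) ?_ ?_
  · intro n z hz
    induction hz using Submodule.span_induction with
    | mem z hz =>
      obtain ⟨p, q, rfl, x, hx, y, hy, rfl⟩ := hz
      simp [coaction_of_mem _ hx, coaction_of_mem _ hy, hb]
    | zero => simp
    | add x y _ _ hx hy => rw [map_add, hx, hy, Finsupp.single_add]
    | smul a x _ hx => rw [map_smul, hx, Finsupp.smul_single]
  · rw [eq_top_iff]
    rintro z -
    induction z using TensorProduct.induction_on with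
    | zero => exact zero_mem _
    | add x y hx hy => exact add_mem hx hy
    | tmul x y =>
      induction x using Decomposition.inductionOn ℳ with
      | zero => simp
      | add x x' hx hx' => rw [TensorProduct.add_tmul]; exact add_mem hx hx'
      | homogeneous x =>
        induction y using Decomposition.inductionOn 𝒩 with
        | zero => simp
        | add y y' hy hy' => rw [TensorProduct.tmul_add]; exact add_mem hy hy'
        | homogeneous y =>
          exact Submodule.mem_iSup_of_mem _ (tmul_mem_tensorDeg x.2 y.2)

instance tensorDeg_decomposition (ℳ : ℤ → Submodule 𝕜 M) [Decomposition ℳ]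
    (𝒩 : ℤ → Submodule 𝕜 N) [Decomposition 𝒩] : Decomposition (tensorDeg ℳ 𝒩) :=
  (tensorDeg_isInternal ℳ 𝒩).chooseDecomposition

/-- The tensor product of two graded algebras is a graded algebra. -/
instance tensorDeg_gradedAlgebra {A B : Type*} [Ring A] [Algebra 𝕜 A] [Ring B] [Algebra 𝕜 B]
    (𝒜 : ℤ → Submodule 𝕜 A) (ℬ : ℤ → Submodule 𝕜 B) [GradedAlgebra 𝒜] [GradedAlgebra ℬ] :
    GradedAlgebra (tensorDeg 𝒜 ℬ) where
  one_mem := by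
    have := tmul_mem_tensorDeg (SetLike.GradedOne.one_mem (A := 𝒜))
      (SetLike.GradedOne.one_mem (A := ℬ))
    rw [Algebra.TensorProduct.one_def]
    simpa using this
  mul_mem := by
    intro m n z w hz hw
    induction hz using Submodule.span_induction with
    | zero => simp
    | add x y _ _ hx hy => rw [add_mul]; exact add_mem hx hy
    | smul c x _ hx => rw [smul_mul_assoc]; exact Submodule.smul_mem _ c hx
    | mem z hz =>
      obtain ⟨p, q, rfl, x, hx, y, hy, rfl⟩ := hz
      induction hw using Submodule.span_induction with
      | zero => simp
      | add x y _ _ hx hy => rw [mul_add]; exact add_mem hx hy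
      | smul c x _ hx => rw [mul_smul_comm]; exact Submodule.smul_mem _ c hx
      | mem w hw =>
        obtain ⟨p', q', rfl, x', hx', y', hy', rfl⟩ := hw
        rw [Algebra.TensorProduct.tmul_mul_tmul, add_add_add_comm]
        exact tmul_mem_tensorDeg (SetLike.GradedMul.mul_mem hx hx')
          (SetLike.GradedMul.mul_mem hy hy')

end Gradings

section Modules

universe w

/-- A `ℤ`-graded left module over a `𝕜`-algebra `A` with grading `𝒜`. -/
structure GrMod {𝕜 A : Type*} [Field 𝕜] [Ring A] [Algebra 𝕜 A] (𝒜 : ℤ → Submodule 𝕜 A) where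
  carrier : Type w
  [addCommGroup : AddCommGroup carrier]
  [scalars : Module 𝕜 carrier]
  [action : Module A carrier]
  [tower : IsScalarTower 𝕜 A carrier]
  deg : ℤ → Submodule 𝕜 carrier
  [decomposition : Decomposition deg]
  [gradedSMul : SetLike.GradedSMul 𝒜 deg]

namespace GrMod

variable {𝕜 A : Type*} [Field 𝕜] [Ring A] [Algebra 𝕜 A] {𝒜 : ℤ → Submodule 𝕜 A}

instance : CoeSort (GrMod 𝒜) (Type _) := ⟨carrier⟩

attribute [instance] addCommGroup scalars action tower decomposition gradedSMul

theorem smul_mem_deg (M : GrMod 𝒜) {p q : ℤ} {a : A} {m : M} (ha : a ∈ 𝒜 p)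
    (hm : m ∈ M.deg q) : a • m ∈ M.deg (p + q) :=
  SetLike.GradedSMul.smul_mem ha hm

/-- Isomorphism of graded modules; isomorphisms preserve degrees. -/
def Iso (M N : GrMod 𝒜) : Prop :=
  ∃ e : M ≃ₗ[A] N, ∀ n m, m ∈ M.deg n ↔ e m ∈ N.deg n

/-- The degree shift `M{d}`, with `M{d}_n = M_{n-d}`. -/
def shift (M : GrMod 𝒜) (d : ℤ) : GrMod 𝒜 where
  carrier := M
  deg n := M.deg (n - d)
  decomposition := DirectSum.IsInternal.chooseDecomposition _ <| by
    refine isInternal_of_coaction _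
      ((Finsupp.lmapDomain M 𝕜 fun n => n + d).comp (coaction M.deg)) ?_ ?_
    · intro n x hx
      simp [coaction_of_mem _ hx, Finsupp.mapDomain_single]
    · rw [← iSup_eq_top_of_decomposition M.deg]
      exact (Equiv.subRight d).iSup_comp (g := M.deg)
  gradedSMul := ⟨fun {p q a m} ha hm => by
    have := M.smul_mem_deg ha hm
    rwa [← add_sub_assoc] at this⟩

/-- A submodule is graded if it contains the homogeneous components of its elements. -/
def IsGraded (M : GrMod 𝒜) (X : Submodule A M) : Prop := X.IsHomogeneous M.deg

/-- Nonzero, without proper nonzero graded submodule. -/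
def IsIrreducible (M : GrMod 𝒜) : Prop :=
  Nontrivial M ∧ ∀ X : Submodule A M, M.IsGraded X → X = ⊥ ∨ X = ⊤

/-- A graded submodule, as a graded module. -/
def sub (M : GrMod 𝒜) (X : Submodule A M) (hX : M.IsGraded X) : GrMod 𝒜 where
  carrier := X
  deg n := (M.deg n).comap (X.subtype.restrictScalars 𝕜)
  decomposition := (comap_isInternal M.deg (X.subtype.restrictScalars 𝕜) X.subtype_injective
    fun n x => ⟨⟨_, hX n x.2⟩, rfl⟩).chooseDecomposition
  gradedSMul := ⟨fun {_ _ _ _} ha hm => M.smul_mem_deg ha hm⟩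

/-- The quotient by a graded submodule, with the image grading. -/
def quot (M : GrMod 𝒜) (X : Submodule A M) (hX : M.IsGraded X) : GrMod 𝒜 where
  carrier := M ⧸ X
  deg n := (M.deg n).map (X.mkQ.restrictScalars 𝕜)
  decomposition := (map_isInternal M.deg (X.mkQ.restrictScalars 𝕜) X.mkQ_surjective (by
    intro n x hx
    have hx' : x ∈ X := by simpa using hx
    simpa using hX n hx')).chooseDecomposition
  gradedSMul := ⟨fun {_ _ a _} ha hm => by
    obtain ⟨x, hx, rfl⟩ := hm
    exact ⟨a • x, M.smul_mem_deg ha hx, by simp⟩⟩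

theorem isGraded_sInf (M : GrMod 𝒜) (S : Set (Submodule A M)) (hS : ∀ X ∈ S, M.IsGraded X) :
    M.IsGraded (sInf S) := by
  intro n x hx
  rw [Submodule.mem_sInf] at hx ⊢
  exact fun X hX => hS X hX n (hx X hX)

/-- The maximal graded submodules: maximal among the proper graded submodules. -/
def maximalGraded (M : GrMod 𝒜) : Set (Submodule A M) :=
  {X | Maximal (fun Y => M.IsGraded Y ∧ Y ≠ ⊤) X}

/-- The graded radical: the intersection of all maximal graded submodules. -/
def radical (M : GrMod 𝒜) : Submodule A M := sInf M.maximalGraded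

theorem isGraded_radical (M : GrMod 𝒜) : M.IsGraded M.radical :=
  M.isGraded_sInf _ fun _ hX => Maximal.prop (P := fun Y => M.IsGraded Y ∧ Y ≠ ⊤) hX |>.1

/-- The graded head `hd M`. -/
def head (M : GrMod 𝒜) : GrMod 𝒜 := M.quot M.radical M.isGraded_radical

/-- For graded submodules `X` and `Y`, the submodule `X ∩ Y` of `X`. -/
def inter (M : GrMod 𝒜) (X Y : Submodule A M) (hX : M.IsGraded X) : Submodule A (M.sub X hX) :=
  Y.comap X.subtype

theorem inter_isGraded (M : GrMod 𝒜) (X Y : Submodule A M) (hX : M.IsGraded X)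
    (hY : M.IsGraded Y) : (M.sub X hX).IsGraded (M.inter X Y hX) := by
  let φ : M.sub X hX →ₗ[A] M := X.subtype
  intro n x hx
  have key : ∀ z : M.sub X hX, φ (decompose (M.sub X hX).deg z n)
      = (decompose M.deg (φ z) n : M) := by
    intro z
    induction z using Decomposition.inductionOn (M.sub X hX).deg with
    | zero => simp
    | @homogeneous m y =>
      have hy : φ y ∈ M.deg m := y.2
      rw [decompose_of_mem M.deg hy, decompose_coe]
      by_cases h : m = n
      · subst h; simp
      · rw [DirectSum.of_eq_of_ne _ _ _ (Ne.symm h), DirectSum.of_eq_of_ne _ _ _ (Ne.symm h)]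
        simp
    | add x y hx hy => simp [hx, hy, decompose_add]
  change φ _ ∈ Y
  rw [key]
  exact hY n hx

/-- The subquotient `X / Y` for graded submodules `Y ≤ X` of `M`. -/
def subquot (M : GrMod 𝒜) (X Y : Submodule A M) (hX : M.IsGraded X) (hY : M.IsGraded Y) :
    GrMod 𝒜 :=
  (M.sub X hX).quot (M.inter X Y hX) (M.inter_isGraded X Y hX hY)

/-- A finite chain `0 = M_0 < M_1 < ... < M_l = M` of graded submodules with gr-irreducible
successive quotients. -/
structure CompositionSeries (M : GrMod 𝒜) where
  length : ℕ
  term : ℕ → Submodule A M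
  isGraded : ∀ k, M.IsGraded (term k)
  term_zero : term 0 = ⊥
  term_length : term length = ⊤
  le_succ : ∀ k, term k ≤ term (k + 1)
  irreducible : ∀ k < length,
    (M.subquot (term (k + 1)) (term k) (isGraded _) (isGraded _)).IsIrreducible

/-- The `k`-th composition factor `M_{k+1} / M_k`. -/
def CompositionSeries.factor {M : GrMod 𝒜} (F : M.CompositionSeries) (k : ℕ) : GrMod 𝒜 :=
  M.subquot (F.term (k + 1)) (F.term k) (F.isGraded _) (F.isGraded _)

/-- The algebra as a graded left module over itself. -/
def regular (𝒜 : ℤ → Submodule 𝕜 A) [GradedAlgebra 𝒜] : GrMod 𝒜 where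
  carrier := A
  deg := 𝒜
  gradedSMul := ⟨fun {_ _ _ _} ha hm => SetLike.GradedMul.mul_mem ha hm⟩

/-- A submodule generated by homogeneous elements is graded. -/
theorem isGraded_span [GradedAlgebra 𝒜] (M : GrMod 𝒜) (S : Set M)
    (hS : ∀ x ∈ S, ∃ n, x ∈ M.deg n) : M.IsGraded (Submodule.span A S) := by
  have key : ∀ (a : A) (x : M), x ∈ S → ∀ n,
      (decompose M.deg (a • x) n : M) ∈ Submodule.span A S := by
    intro a x hx n
    obtain ⟨m, hm⟩ := hS x hx
    induction a using Decomposition.inductionOn 𝒜 with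
    | zero => simp
    | add a b ha hb =>
      rw [add_smul, decompose_add, DirectSum.add_apply, Submodule.coe_add]
      exact add_mem ha hb
    | @homogeneous p a =>
      have h := M.smul_mem_deg a.2 hm
      by_cases hn : p + m = n
      · subst hn
        rw [decompose_of_mem_same _ h]
        exact Submodule.smul_mem _ _ (Submodule.subset_span hx)
      · rw [decompose_of_mem_ne _ h hn]
        exact zero_mem _
  intro n x hx
  rw [Submodule.mem_span_set'] at hx
  obtain ⟨k, f, g, rfl⟩ := hx
  rw [decompose_sum, DFinsupp.finsetSum_apply, AddSubmonoidClass.coe_finsetSum]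
  exact Submodule.sum_mem _ fun j _ => key _ _ (g j).2 n

section Tensor

variable {B : Type*} [Ring B] [Algebra 𝕜 B] {ℬ : ℤ → Submodule 𝕜 B}

/-- The action of `A ⊗ B` on `M ⊗ N`, with `(a ⊗ b)(m ⊗ n) = am ⊗ bn`. -/
def tensorAction (M : GrMod 𝒜) (N : GrMod ℬ) :
    A ⊗[𝕜] B →ₐ[𝕜] Module.End 𝕜 (M ⊗[𝕜] N) :=
  (Module.endTensorEndAlgHom (R := 𝕜) (A := 𝕜) (M := M) (N := N)).comp
    (Algebra.TensorProduct.map (Algebra.lsmul 𝕜 𝕜 M) (Algebra.lsmul 𝕜 𝕜 N))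

theorem tensorAction_tmul (M : GrMod 𝒜) (N : GrMod ℬ) (a : A) (b : B) (m : M) (n : N) :
    tensorAction M N (a ⊗ₜ b) (m ⊗ₜ n) = (a • m) ⊗ₜ (b • n) := rfl

/-- The outer tensor product `M ⊗ N`, a graded module over `A ⊗ B`. -/
def tensor (M : GrMod 𝒜) (N : GrMod ℬ) : GrMod (tensorDeg 𝒜 ℬ) where
  carrier := M ⊗[𝕜] N
  action := Module.compHom (M ⊗[𝕜] N) (tensorAction M N).toRingHom
  tower := letI := Module.compHom (M ⊗[𝕜] N) (tensorAction M N).toRingHom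
    ⟨fun c z t => by
      change tensorAction M N (c • z) t = c • tensorAction M N z t
      rw [map_smul, LinearMap.smul_apply]⟩
  deg := tensorDeg M.deg N.deg
  gradedSMul := letI := Module.compHom (M ⊗[𝕜] N) (tensorAction M N).toRingHom
    ⟨fun {i j z t} hz ht => by
      change tensorAction M N z t ∈ _
      rw [vadd_eq_add]
      induction hz using Submodule.span_induction with
      | zero => simp
      | add x y _ _ hx hy => rw [map_add]; exact add_mem hx hy
      | smul c x _ hx => rw [map_smul]; exact Submodule.smul_mem _ c hx
      | mem z hz =>
        obtain ⟨p, q, rfl, a, ha, b, hb, rfl⟩ := hz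
        induction ht using Submodule.span_induction with
        | zero => simp
        | add x y _ _ hx hy => rw [map_add]; exact add_mem hx hy
        | smul c x _ hx => rw [map_smul]; exact Submodule.smul_mem _ c hx
        | mem t ht =>
          obtain ⟨p', q', rfl, m, hm, n, hn, rfl⟩ := ht
          rw [tensorAction_tmul, add_add_add_comm]
          exact tmul_mem_tensorDeg (M.smul_mem_deg ha hm) (N.smul_mem_deg hb hn)⟩

end Tensor

section Functors

variable {S : Type*} [Ring S] [Algebra 𝕜 S] {𝒮 : ℤ → Submodule 𝕜 S}
variable [GradedAlgebra 𝒮] [GradedAlgebra 𝒜]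

/-- The space `f(1) M`. -/
def resSpace (f : S →ₙₐ[𝕜] A) (M : GrMod 𝒜) : Submodule 𝕜 M :=
  LinearMap.range (Algebra.lsmul 𝕜 𝕜 M (f 1))

/-- The action of `S` on `f(1) M`, where `s` acts by `f(s)`. -/
instance resAction (f : S →ₙₐ[𝕜] A) (M : GrMod 𝒜) : Module S (resSpace f M) where
  smul s m := ⟨f s • (m : M), f s • (m : M), by
    change f 1 • f s • (m : M) = f s • (m : M)
    rw [← mul_smul, ← map_mul, one_mul]⟩
  one_smul := by
    rintro ⟨_, m, rfl⟩
    apply Subtype.ext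
    change f 1 • f 1 • m = f 1 • m
    rw [← mul_smul, ← map_mul, one_mul]
  mul_smul s t m := Subtype.ext <| by
    change f (s * t) • (m : M) = f s • f t • (m : M)
    rw [map_mul, mul_smul]
  smul_zero s := Subtype.ext (smul_zero (f s))
  smul_add s m m' := Subtype.ext (smul_add (f s) (m : M) (m' : M))
  add_smul s t m := Subtype.ext <| by
    change f (s + t) • (m : M) = f s • (m : M) + f t • (m : M)
    rw [map_add, add_smul]
  zero_smul m := Subtype.ext <| by
    change f 0 • (m : M) = 0
    rw [map_zero, zero_smul]

/-- Restriction along a non-unital graded homomorphism `f : S → A`: the space `f(1) M` with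
`s ∈ S` acting by `f(s)`. -/
def res (f : S →ₙₐ[𝕜] A) (hf : ∀ p, ∀ s ∈ 𝒮 p, f s ∈ 𝒜 p) (M : GrMod 𝒜) : GrMod 𝒮 where
  carrier := resSpace f M
  action := resAction f M
  tower := ⟨fun c s m => Subtype.ext <| by
    change f (c • s) • (m : M) = c • f s • (m : M)
    rw [map_smul, smul_assoc]⟩
  deg n := (M.deg n).comap (resSpace f M).subtype
  decomposition := (comap_isInternal M.deg _ (resSpace f M).subtype_injective (by
    have h1 : f 1 ∈ 𝒜 0 := hf 0 1 SetLike.GradedOne.one_mem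
    rintro n ⟨_, m, rfl⟩
    rw [Submodule.range_subtype]
    refine ⟨decompose M.deg m n, ?_⟩
    change f 1 • (decompose M.deg m n : M) = decompose M.deg (f 1 • m) n
    induction m using Decomposition.inductionOn M.deg with
    | zero => simp
    | add x y hx hy => simp [hx, hy]
    | @homogeneous q m =>
      have h := M.smul_mem_deg h1 m.2
      rw [zero_add] at h
      rw [decompose_of_mem _ h, decompose_coe]
      by_cases hq : q = n
      · subst hq; simp
      · rw [DirectSum.of_eq_of_ne _ _ _ (Ne.symm hq), DirectSum.of_eq_of_ne _ _ _ (Ne.symm hq)]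
        simp)).chooseDecomposition
  gradedSMul := ⟨fun {_ _ _ _} hs hm => M.smul_mem_deg (hf _ _ hs) hm⟩

/-- The graded left `A`-module `A ⊗_𝕜 W`. -/
def extend (𝒜 : ℤ → Submodule 𝕜 A) [GradedAlgebra 𝒜] (W : GrMod 𝒮) : GrMod 𝒜 where
  carrier := A ⊗[𝕜] W
  deg := tensorDeg 𝒜 W.deg
  gradedSMul := ⟨fun {i j a t} ha ht => by
    rw [vadd_eq_add]
    induction ht using Submodule.span_induction with
    | zero => simp
    | add x y _ _ hx hy => rw [smul_add]; exact add_mem hx hy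
    | smul c x _ hx => rw [smul_comm]; exact Submodule.smul_mem _ c hx
    | mem t ht =>
      obtain ⟨p, q, rfl, b, hb, w, hw, rfl⟩ := ht
      rw [TensorProduct.smul_tmul', smul_eq_mul, ← add_assoc]
      exact tmul_mem_tensorDeg (SetLike.GradedMul.mul_mem ha hb) hw⟩

/-- The relations `a f(s) ⊗ w = a ⊗ sw` of the tensor product over `S`. -/
def balance (f : S →ₙₐ[𝕜] A) (W : GrMod 𝒮) : Submodule A (A ⊗[𝕜] W) :=
  Submodule.span A {z | ∃ (s : S) (w : W), z = f s ⊗ₜ[𝕜] w - 1 ⊗ₜ[𝕜] (s • w)}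

theorem balance_isGraded (f : S →ₙₐ[𝕜] A) (hf : ∀ p, ∀ s ∈ 𝒮 p, f s ∈ 𝒜 p) (W : GrMod 𝒮) :
    (extend 𝒜 W).IsGraded (balance f W) := by
  have h : balance f W = Submodule.span A {z | ∃ p q, ∃ s ∈ 𝒮 p, ∃ w ∈ W.deg q,
      z = f s ⊗ₜ[𝕜] w - 1 ⊗ₜ[𝕜] (s • w)} := by
    apply le_antisymm
    · refine Submodule.span_le.2 ?_
      rintro _ ⟨s, w, rfl⟩
      rw [SetLike.mem_coe]
      induction s using Decomposition.inductionOn 𝒮 with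
      | zero => simp
      | add s t hs ht =>
        rw [map_add, TensorProduct.add_tmul, add_smul, TensorProduct.tmul_add, add_sub_add_comm]
        exact add_mem hs ht
      | @homogeneous p s =>
        induction w using Decomposition.inductionOn W.deg with
        | zero => simp
        | add w w' hw hw' =>
          rw [TensorProduct.tmul_add, smul_add, TensorProduct.tmul_add, add_sub_add_comm]
          exact add_mem hw hw'
        | @homogeneous q w => exact Submodule.subset_span ⟨p, q, s, s.2, w, w.2, rfl⟩
    · refine Submodule.span_mono ?_
      rintro _ ⟨_, _, s, _, w, _, rfl⟩
      exact ⟨s, w, rfl⟩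
  rw [h]
  refine isGraded_span (extend 𝒜 W) _ ?_
  rintro _ ⟨p, q, s, hs, w, hw, rfl⟩
  refine ⟨p + q, Submodule.sub_mem _ (tmul_mem_tensorDeg (hf p s hs) hw) ?_⟩
  have := tmul_mem_tensorDeg (SetLike.GradedOne.one_mem (A := 𝒜)) (W.smul_mem_deg hs hw)
  rwa [zero_add] at this

/-- Induction along a non-unital graded homomorphism `f : S → A`: the module
`A f(1) ⊗_S W`. It is built as the quotient of `A ⊗_𝕜 W` by the relations
`a f(s) ⊗ w = a ⊗ sw`; these with `s = 1` identify `a ⊗ w` with `a f(1) ⊗ w`. -/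
def ind (f : S →ₙₐ[𝕜] A) (hf : ∀ p, ∀ s ∈ 𝒮 p, f s ∈ 𝒜 p) (W : GrMod 𝒮) : GrMod 𝒜 :=
  (extend 𝒜 W).quot (balance f W) (balance_isGraded f hf W)

end Functors

end GrMod

end Modules

section Algebra

universe v

/-- A symmetrizable Borcherds-Cartan matrix `a`, with symmetrizing integers `r`. -/
structure BorcherdsCartan (I : Type v) where
  a : I → I → ℤ
  r : I → ℕ
  a_self : ∀ i, a i i = 2 ∨ (a i i ≤ 0 ∧ Even (a i i))
  a_nonpos : ∀ i j, i ≠ j → a i j ≤ 0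
  r_pos : ∀ i, 0 < r i
  symm : ∀ i j, (r i : ℤ) * a i j = r j * a j i

namespace BorcherdsCartan

variable {I : Type v} (C : BorcherdsCartan I)

/-- The bilinear form on simple roots, `(α_i, α_j) = r_i a_ij`. -/
def form (i j : I) : ℤ := C.r i * C.a i j

/-- Real indices; the other indices are the imaginary ones, `a_ii ≤ 0`. -/
def IsReal (i : I) : Prop := C.a i i = 2

end BorcherdsCartan

variable {I : Type v}

/-- Exchange the entries at positions `k` and `k + 1` (counted from `0`). -/
def swapList : ℕ → List I → List I
  | 0, a :: b :: l => b :: a :: l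
  | k + 1, a :: l => a :: swapList k l
  | _, l => l

theorem swapList_perm (k : ℕ) (l : List I) : (swapList k l).Perm l := by
  fun_induction swapList k l with
  | case1 a b l => exact List.Perm.swap a b l
  | case2 k a l ih => exact ih.cons a
  | case3 => exact List.Perm.refl _

theorem swapList_getElem? (k : ℕ) (l : List I) (hk : k + 1 < l.length) (m : ℕ) :
    (swapList k l)[m]? = l[Equiv.swap k (k + 1) m]? := by
  induction k generalizing l m with
  | zero =>
    obtain _ | ⟨a, _ | ⟨b, l⟩⟩ := l
    · simp at hk
    · simp at hk
    · obtain _ | _ | m := m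
      · simp [swapList]
      · simp [swapList]
      · rw [Equiv.swap_apply_of_ne_of_ne (by omega) (by omega)]
        simp [swapList]
  | succ k ih =>
    obtain _ | ⟨a, l⟩ := l
    · simp at hk
    · obtain _ | m := m
      · rw [Equiv.swap_apply_of_ne_of_ne (by omega) (by omega)]
        simp [swapList]
      · have h := ih l (by simpa using hk) m
        have h2 : Equiv.swap (k + 1) (k + 1 + 1) (m + 1) = Equiv.swap k (k + 1) m + 1 := by
          simp only [Equiv.swap_apply_def]
          split_ifs <;> omega
        rw [h2]
        simpa [swapList] using h

theorem swapList_append_left (k : ℕ) (l l' : List I) (hk : k + 1 < l.length) :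
    swapList k (l ++ l') = swapList k l ++ l' := by
  fun_induction swapList k l with
  | case1 a b l => simp [swapList]
  | case2 k a l ih => simp [swapList, ih (by simpa using hk)]
  | case3 k l h1 h2 =>
    exfalso
    obtain _ | k := k
    · obtain _ | ⟨a, _ | ⟨b, l⟩⟩ := l
      · simp at hk
      · simp at hk
      · exact h1 a b l rfl rfl
    · obtain _ | ⟨a, l⟩ := l
      · simp at hk
      · exact h2 k a l rfl rfl

theorem swapList_append_right (k : ℕ) (l l' : List I) :
    swapList (l.length + k) (l ++ l') = l ++ swapList k l' := by
  induction l with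
  | nil => simp
  | cons a l ih =>
    rw [List.length_cons, show l.length + 1 + k = (l.length + k) + 1 by omega]
    simp [swapList, ih]

/-- `Seq ν`: the sequences in `I` whose entries, counted with multiplicity, form `ν`. The
elements `ν` of `ℕ[I]` are multisets. -/
def Seq (ν : Multiset I) : Type v := {l : List I // (l : Multiset I) = ν}

namespace Seq

variable {μ ν ρ : Multiset I}

instance (ν : Multiset I) : Finite (Seq ν) := by
  classical
  induction ν using Quotient.inductionOn with
  | h l =>
    refine Finite.of_injective
      (fun s : Seq (l : Multiset I) => (⟨s.1, ?_⟩ : {l' // l' ∈ l.permutations})) ?_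
    · exact List.mem_permutations.2 (Multiset.coe_eq_coe.1 s.2)
    · intro s t h
      exact Subtype.ext (by simpa using h)

instance (ν : Multiset I) : Fintype (Seq ν) := Fintype.ofFinite _

theorem length_eq (s : Seq ν) : s.1.length = Multiset.card ν := by
  rw [← Multiset.coe_card]
  exact congrArg _ s.2

/-- The entry of `s` at position `k` (counted from `0`). -/
def entry (s : Seq ν) (k : ℕ) (hk : k < Multiset.card ν) : I := s.1[k]'(by rwa [length_eq])

/-- The sequence `s` with the entries at positions `k` and `k + 1` exchanged. -/
def swap (k : ℕ) (s : Seq ν) : Seq ν :=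
  ⟨swapList k s.1, (Multiset.coe_eq_coe.2 (swapList_perm k s.1)).trans s.2⟩

/-- Concatenation of sequences. -/
def append (h : μ + ν = ρ) (s : Seq μ) (t : Seq ν) : Seq ρ :=
  ⟨s.1 ++ t.1, by rw [← Multiset.coe_add, s.2, t.2, h]⟩

theorem entry_eq_iff (s : Seq ν) (k : ℕ) (hk : k < Multiset.card ν) (i : I) :
    s.entry k hk = i ↔ s.1[k]? = some i := by
  rw [List.getElem?_eq_getElem (by rwa [length_eq]), Option.some_inj]
  rfl

theorem entry_swap (s : Seq ν) (k m m' : ℕ) (hk : k + 1 < Multiset.card ν)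
    (hm : m < Multiset.card ν) (hm' : m' < Multiset.card ν)
    (h : Equiv.swap k (k + 1) m = m') : (s.swap k).entry m hm = s.entry m' hm' := by
  rw [entry_eq_iff]
  change (swapList k s.1)[m]? = _
  rw [swapList_getElem? k s.1 (by rwa [length_eq]) m, h, ← entry_eq_iff]

theorem entry_swap_left (s : Seq ν) (k : ℕ) (hk : k + 1 < Multiset.card ν)
    (hk' : k < Multiset.card ν) : (s.swap k).entry k hk' = s.entry (k + 1) hk :=
  entry_swap s k k (k + 1) hk _ _ (by simp)

theorem entry_swap_right (s : Seq ν) (k : ℕ) (hk : k + 1 < Multiset.card ν) :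
    (s.swap k).entry (k + 1) hk = s.entry k (by omega) :=
  entry_swap s k (k + 1) k hk _ _ (by simp)

theorem entry_swap_other (s : Seq ν) (k m : ℕ) (hk : k + 1 < Multiset.card ν)
    (hm : m < Multiset.card ν) (h : m ≠ k) (h' : m ≠ k + 1) :
    (s.swap k).entry m hm = s.entry m hm :=
  entry_swap s k m m hk _ _ (Equiv.swap_apply_of_ne_of_ne h h')

theorem ext_entry {s t : Seq ν} (h : ∀ k hk, s.entry k hk = t.entry k hk) : s = t := by
  refine Subtype.ext (List.ext_getElem (by rw [s.length_eq, t.length_eq]) fun k h1 _ => ?_)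
  exact h k (by rwa [length_eq] at h1)

end Seq

/-- The generators `1_s`, `x_{k,s}`, `τ_{k,s}`; positions are counted from `0`. -/
inductive Gen (ν : Multiset I) : Type v
  | e (s : Seq ν) : Gen ν
  | x (k : ℕ) (hk : k < Multiset.card ν) (s : Seq ν) : Gen ν
  | t (k : ℕ) (hk : k + 1 < Multiset.card ν) (s : Seq ν) : Gen ν

/-- The degrees of the generators. -/
def Gen.deg (C : BorcherdsCartan I) {ν : Multiset I} : Gen ν → ℤ
  | .e _ => 0
  | .x k hk s => 2 * C.r (s.entry k hk)
  | .t k hk s => -C.form (s.entry k (by omega)) (s.entry (k + 1) hk)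

/-- The condition under which the braid relation at position `k` of `s` has a correction term:
the labels are `i, j, i` with `i` real, `i ≠ j` and `(α_i, α_j) ≠ 0`. -/
def BraidCorrected (C : BorcherdsCartan I) {ν : Multiset I} (k : ℕ)
    (hk : k + 2 < Multiset.card ν) (s : Seq ν) : Prop :=
  s.entry k (by omega) = s.entry (k + 2) hk ∧ s.entry k (by omega) ≠ s.entry (k + 1) (by omega) ∧
    C.IsReal (s.entry k (by omega)) ∧
    C.form (s.entry k (by omega)) (s.entry (k + 1) (by omega)) ≠ 0

/-- The defining relations, for a family `φ` of elements indexed by the generators.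
A product `ab` stands for the diagram `a` on top of the diagram `b`, and `τ_{k,s}` has the
sequence `s` at its bottom. -/
inductive Rel (C : BorcherdsCartan I) {ν : Multiset I} {B : Type*} [Ring B] (φ : Gen ν → B) :
    B → B → Prop
  | idem (s : Seq ν) : Rel C φ (φ (.e s) * φ (.e s)) (φ (.e s))
  | orth (s s' : Seq ν) (h : s ≠ s') : Rel C φ (φ (.e s) * φ (.e s')) 0
  | unit : Rel C φ (∑ s, φ (.e s)) 1
  | e_x (k : ℕ) (hk : k < Multiset.card ν) (s : Seq ν) :
      Rel C φ (φ (.e s) * φ (.x k hk s)) (φ (.x k hk s))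
  | x_e (k : ℕ) (hk : k < Multiset.card ν) (s : Seq ν) :
      Rel C φ (φ (.x k hk s) * φ (.e s)) (φ (.x k hk s))
  | e_t (k : ℕ) (hk : k + 1 < Multiset.card ν) (s : Seq ν) :
      Rel C φ (φ (.e (s.swap k)) * φ (.t k hk s)) (φ (.t k hk s))
  | t_e (k : ℕ) (hk : k + 1 < Multiset.card ν) (s : Seq ν) :
      Rel C φ (φ (.t k hk s) * φ (.e s)) (φ (.t k hk s))
  -- distant dots and crossings commute
  | x_x (k l : ℕ) (hk : k < Multiset.card ν) (hl : l < Multiset.card ν) (s : Seq ν) :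
      Rel C φ (φ (.x k hk s) * φ (.x l hl s)) (φ (.x l hl s) * φ (.x k hk s))
  | x_t (k l : ℕ) (hk : k + 1 < Multiset.card ν) (hl : l < Multiset.card ν) (s : Seq ν)
      (h : l ≠ k) (h' : l ≠ k + 1) :
      Rel C φ (φ (.x l hl (s.swap k)) * φ (.t k hk s)) (φ (.t k hk s) * φ (.x l hl s))
  | t_t (k l : ℕ) (hk : k + 1 < Multiset.card ν) (hl : l + 1 < Multiset.card ν) (s : Seq ν)
      (h : k + 1 < l) :
      Rel C φ (φ (.t l hl (s.swap k)) * φ (.t k hk s)) (φ (.t k hk (s.swap l)) * φ (.t l hl s))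
  -- double crossings
  | quad_same (k : ℕ) (hk : k + 1 < Multiset.card ν) (s : Seq ν)
      (h : s.entry k (by omega) = s.entry (k + 1) hk) :
      Rel C φ (φ (.t k hk (s.swap k)) * φ (.t k hk s)) 0
  | quad_orth (k : ℕ) (hk : k + 1 < Multiset.card ν) (s : Seq ν)
      (h : s.entry k (by omega) ≠ s.entry (k + 1) hk)
      (h' : C.form (s.entry k (by omega)) (s.entry (k + 1) hk) = 0) :
      Rel C φ (φ (.t k hk (s.swap k)) * φ (.t k hk s)) (φ (.e s))
  | quad (k : ℕ) (hk : k + 1 < Multiset.card ν) (s : Seq ν)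
      (h : s.entry k (by omega) ≠ s.entry (k + 1) hk)
      (h' : C.form (s.entry k (by omega)) (s.entry (k + 1) hk) ≠ 0) :
      Rel C φ (φ (.t k hk (s.swap k)) * φ (.t k hk s))
        (φ (.x k (by omega) s) ^ (-C.a (s.entry k (by omega)) (s.entry (k + 1) hk)).toNat +
          φ (.x (k + 1) hk s) ^ (-C.a (s.entry (k + 1) hk) (s.entry k (by omega))).toNat)
  -- dots sliding through crossings
  | slide_left_real (k : ℕ) (hk : k + 1 < Multiset.card ν) (s : Seq ν)
      (h : s.entry k (by omega) = s.entry (k + 1) hk) (h' : C.IsReal (s.entry (k + 1) hk)) :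
      Rel C φ (φ (.x k (by omega) (s.swap k)) * φ (.t k hk s))
        (φ (.t k hk s) * φ (.x (k + 1) hk s) + φ (.e s))
  | slide_right_real (k : ℕ) (hk : k + 1 < Multiset.card ν) (s : Seq ν)
      (h : s.entry k (by omega) = s.entry (k + 1) hk) (h' : C.IsReal (s.entry (k + 1) hk)) :
      Rel C φ (φ (.t k hk s) * φ (.x k (by omega) s))
        (φ (.x (k + 1) hk (s.swap k)) * φ (.t k hk s) + φ (.e s))
  | slide_left (k : ℕ) (hk : k + 1 < Multiset.card ν) (s : Seq ν)
      (h : ¬(s.entry k (by omega) = s.entry (k + 1) hk ∧ C.IsReal (s.entry (k + 1) hk))) :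
      Rel C φ (φ (.x k (by omega) (s.swap k)) * φ (.t k hk s))
        (φ (.t k hk s) * φ (.x (k + 1) hk s))
  | slide_right (k : ℕ) (hk : k + 1 < Multiset.card ν) (s : Seq ν)
      (h : ¬(s.entry k (by omega) = s.entry (k + 1) hk ∧ C.IsReal (s.entry (k + 1) hk))) :
      Rel C φ (φ (.t k hk s) * φ (.x k (by omega) s))
        (φ (.x (k + 1) hk (s.swap k)) * φ (.t k hk s))
  -- braid relations
  | braid_corrected (k : ℕ) (hk : k + 2 < Multiset.card ν) (s : Seq ν)
      (h : BraidCorrected C k hk s) :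
      Rel C φ (φ (.t k (by omega) ((s.swap k).swap (k + 1))) *
          (φ (.t (k + 1) hk (s.swap k)) * φ (.t k (by omega) s)))
        (φ (.t (k + 1) hk ((s.swap (k + 1)).swap k)) *
          (φ (.t k (by omega) (s.swap (k + 1))) * φ (.t (k + 1) hk s)) +
        ∑ c ∈ Finset.range (-C.a (s.entry k (by omega)) (s.entry (k + 1) (by omega))).toNat,
          φ (.x k (by omega) s) ^ c * (φ (.x (k + 2) hk s) ^
            ((-C.a (s.entry k (by omega)) (s.entry (k + 1) (by omega))).toNat - 1 - c) *
              φ (.e s)))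
  | braid (k : ℕ) (hk : k + 2 < Multiset.card ν) (s : Seq ν)
      (h : ¬BraidCorrected C k hk s) :
      Rel C φ (φ (.t k (by omega) ((s.swap k).swap (k + 1))) *
          (φ (.t (k + 1) hk (s.swap k)) * φ (.t k (by omega) s)))
        (φ (.t (k + 1) hk ((s.swap (k + 1)).swap k)) *
          (φ (.t k (by omega) (s.swap (k + 1))) * φ (.t (k + 1) hk s)))

theorem Rel.map {C : BorcherdsCartan I} {ν : Multiset I} {B B' : Type*} [Ring B] [Ring B']
    {φ : Gen ν → B} (f : B →+* B') {x y : B} (h : Rel C φ x y) :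
    Rel C (fun g => f (φ g)) (f x) (f y) := by
  cases h <;> simp only [map_mul, map_add, map_sum, map_pow, map_one, map_zero] <;>
    constructor <;> assumption

theorem Rel.exists_of_map {C : BorcherdsCartan I} {ν : Multiset I} {B B' : Type*} [Ring B]
    [Ring B'] {φ : Gen ν → B} (f : B →+* B') {x y : B'} (h : Rel C (fun g => f (φ g)) x y) :
    ∃ x' y', Rel C φ x' y' ∧ f x' = x ∧ f y' = y := by
  cases h with
  | idem s => exact ⟨_, _, .idem s, by simp, by simp⟩
  | orth s s' h => exact ⟨_, _, .orth s s' h, by simp, by simp⟩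
  | unit => exact ⟨_, _, .unit, by simp, by simp⟩
  | e_x k hk s => exact ⟨_, _, .e_x k hk s, by simp, by simp⟩
  | x_e k hk s => exact ⟨_, _, .x_e k hk s, by simp, by simp⟩
  | e_t k hk s => exact ⟨_, _, .e_t k hk s, by simp, by simp⟩
  | t_e k hk s => exact ⟨_, _, .t_e k hk s, by simp, by simp⟩
  | x_x k l hk hl s => exact ⟨_, _, .x_x k l hk hl s, by simp, by simp⟩
  | x_t k l hk hl s h h' => exact ⟨_, _, .x_t k l hk hl s h h', by simp, by simp⟩
  | t_t k l hk hl s h => exact ⟨_, _, .t_t k l hk hl s h, by simp, by simp⟩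
  | quad_same k hk s h => exact ⟨_, _, .quad_same k hk s h, by simp, by simp⟩
  | quad_orth k hk s h h' => exact ⟨_, _, .quad_orth k hk s h h', by simp, by simp⟩
  | quad k hk s h h' => exact ⟨_, _, .quad k hk s h h', by simp, by simp⟩
  | slide_left_real k hk s h h' => exact ⟨_, _, .slide_left_real k hk s h h', by simp, by simp⟩
  | slide_right_real k hk s h h' => exact ⟨_, _, .slide_right_real k hk s h h', by simp, by simp⟩
  | slide_left k hk s h => exact ⟨_, _, .slide_left k hk s h, by simp, by simp⟩
  | slide_right k hk s h => exact ⟨_, _, .slide_right k hk s h, by simp, by simp⟩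
  | braid_corrected k hk s h => exact ⟨_, _, .braid_corrected k hk s h, by simp, by simp⟩
  | braid k hk s h => exact ⟨_, _, .braid k hk s h, by simp, by simp⟩

variable (𝕜 : Type*) [Field 𝕜] (C : BorcherdsCartan I)

/-- The KLR algebra `R(ν)`. -/
def KLRAlgebra (ν : Multiset I) : Type _ :=
  RingQuot (Rel C (FreeAlgebra.ι 𝕜 : Gen ν → FreeAlgebra 𝕜 (Gen ν)))

instance (ν : Multiset I) : Ring (KLRAlgebra 𝕜 C ν) :=
  inferInstanceAs (Ring (RingQuot (Rel C (FreeAlgebra.ι 𝕜 : Gen ν → FreeAlgebra 𝕜 (Gen ν)))))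

instance (ν : Multiset I) : Algebra 𝕜 (KLRAlgebra 𝕜 C ν) :=
  inferInstanceAs
    (Algebra 𝕜 (RingQuot (Rel C (FreeAlgebra.ι 𝕜 : Gen ν → FreeAlgebra 𝕜 (Gen ν)))))

/-- The quotient map from the free algebra on the generators. -/
def toKLR (ν : Multiset I) : FreeAlgebra 𝕜 (Gen ν) →ₐ[𝕜] KLRAlgebra 𝕜 C ν :=
  RingQuot.mkAlgHom 𝕜 _

theorem toKLR_surjective (ν : Multiset I) : Function.Surjective (toKLR 𝕜 C ν) :=
  RingQuot.mkAlgHom_surjective 𝕜 _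

variable {C} {μ ν ρ : Multiset I}

/-- The generators as elements of the algebra `R(ν)`. -/
def gen (C : BorcherdsCartan I) (g : Gen ν) : KLRAlgebra 𝕜 C ν := toKLR 𝕜 C ν (FreeAlgebra.ι 𝕜 g)

theorem gen_rel {x y : KLRAlgebra 𝕜 C ν} (h : Rel C (gen 𝕜 C) x y) : x = y := by
  obtain ⟨x', y', h', rfl, rfl⟩ := Rel.exists_of_map (φ := FreeAlgebra.ι 𝕜)
    (toKLR 𝕜 C ν).toRingHom h
  exact RingQuot.mkAlgHom_rel 𝕜 h'

/-- An algebra homomorphism out of `R(ν)` from elements that satisfy the relations. -/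
def liftGen {B : Type*} [Ring B] [Algebra 𝕜 B] (φ : Gen ν → B)
    (h : ∀ x y, Rel C φ x y → x = y) : KLRAlgebra 𝕜 C ν →ₐ[𝕜] B :=
  RingQuot.liftAlgHom 𝕜 ⟨FreeAlgebra.lift 𝕜 φ, fun x y hxy => h _ _ <| by
    have := hxy.map (FreeAlgebra.lift 𝕜 φ : FreeAlgebra 𝕜 (Gen ν) →ₐ[𝕜] B).toRingHom
    simpa using this⟩

theorem liftGen_gen {B : Type*} [Ring B] [Algebra 𝕜 B] (φ : Gen ν → B)
    (h : ∀ x y, Rel C φ x y → x = y) (g : Gen ν) : liftGen 𝕜 φ h (gen 𝕜 C g) = φ g :=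
  (RingQuot.liftAlgHom_mkAlgHom_apply 𝕜 _ _ _).trans (FreeAlgebra.lift_ι_apply φ g)

theorem algebra_induction {p : KLRAlgebra 𝕜 C ν → Prop}
    (scalar : ∀ c, p (algebraMap 𝕜 _ c)) (gen : ∀ g, p (gen 𝕜 C g))
    (add : ∀ a b, p a → p b → p (a + b)) (mul : ∀ a b, p a → p b → p (a * b))
    (x : KLRAlgebra 𝕜 C ν) : p x := by
  obtain ⟨y, rfl⟩ := toKLR_surjective 𝕜 C ν x
  induction y using FreeAlgebra.induction with
  | grade0 r => rw [AlgHom.commutes]; exact scalar r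
  | grade1 g => exact gen g
  | add a b ha hb => rw [map_add]; exact add _ _ ha hb
  | mul a b ha hb => rw [map_mul]; exact mul _ _ ha hb

/-- The degree of a word in the generators. -/
def wordDeg (C : BorcherdsCartan I) (w : List (Gen ν)) : ℤ := (w.map (Gen.deg C)).sum

/-- The value of a word in the generators. -/
def wordVal (C : BorcherdsCartan I) (w : List (Gen ν)) : KLRAlgebra 𝕜 C ν :=
  (w.map (gen 𝕜 C)).prod

/-- The grading of `R(ν)`: degree `n` is spanned by the words of degree `n`. -/
def grading (C : BorcherdsCartan I) (ν : Multiset I) (n : ℤ) : Submodule 𝕜 (KLRAlgebra 𝕜 C ν) :=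
  Submodule.span 𝕜 {z | ∃ w : List (Gen ν), wordDeg C w = n ∧ z = wordVal 𝕜 C w}

theorem form_comm (C : BorcherdsCartan I) (i j : I) : C.form i j = C.form j i := C.symm i j

theorem form_toNat (C : BorcherdsCartan I) {i j : I} (h : i ≠ j) :
    ((-C.a i j).toNat : ℤ) * (2 * C.r i) = -C.form i j + -C.form i j := by
  rw [Int.toNat_of_nonneg (by have := C.a_nonpos i j h; omega), BorcherdsCartan.form]
  ring

theorem form_self_of_isReal (C : BorcherdsCartan I) {i : I} (h : C.IsReal i) :
    C.form i i = 2 * C.r i := by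
  rw [BorcherdsCartan.form, h]; ring

theorem single_finset_sum {B ι : Type*} [Ring B] (n : ℤ) (s : Finset ι) (f : ι → B) :
    AddMonoidAlgebra.single n (∑ c ∈ s, f c) = ∑ c ∈ s, AddMonoidAlgebra.single n (f c) :=
  map_sum (AddMonoidAlgebra.singleAddHom n) f s

/-- The relations are homogeneous. -/
theorem coactionGen_rel (x y : AddMonoidAlgebra (KLRAlgebra 𝕜 C ν) ℤ)
    (h : Rel C (fun g => AddMonoidAlgebra.single (Gen.deg C g) (gen 𝕜 C g)) x y) : x = y := by
  cases h with
  | idem s =>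
    simp only [AddMonoidAlgebra.single_mul_single, Gen.deg, add_zero]
    rw [gen_rel 𝕜 (.idem s)]
  | orth s s' h =>
    simp only [AddMonoidAlgebra.single_mul_single, Gen.deg, add_zero]
    rw [gen_rel 𝕜 (.orth s s' h), AddMonoidAlgebra.single_zero]
  | unit =>
    simp only [Gen.deg]
    rw [← single_finset_sum, gen_rel 𝕜 .unit]
    rfl
  | e_x k hk s =>
    simp only [AddMonoidAlgebra.single_mul_single, gen_rel 𝕜 (.e_x k hk s)]
    simp [Gen.deg]
  | x_e k hk s =>
    simp only [AddMonoidAlgebra.single_mul_single, gen_rel 𝕜 (.x_e k hk s)]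
    simp [Gen.deg]
  | e_t k hk s =>
    simp only [AddMonoidAlgebra.single_mul_single, gen_rel 𝕜 (.e_t k hk s)]
    simp [Gen.deg]
  | t_e k hk s =>
    simp only [AddMonoidAlgebra.single_mul_single, gen_rel 𝕜 (.t_e k hk s)]
    simp [Gen.deg]
  | x_x k l hk hl s =>
    simp only [AddMonoidAlgebra.single_mul_single, gen_rel 𝕜 (.x_x k l hk hl s)]
    rw [add_comm]
  | x_t k l hk hl s h h' =>
    simp only [AddMonoidAlgebra.single_mul_single, gen_rel 𝕜 (.x_t k l hk hl s h h')]
    simp only [Gen.deg, Seq.entry_swap_other s k l hk hl h h']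
    rw [add_comm]
  | t_t k l hk hl s h =>
    simp only [AddMonoidAlgebra.single_mul_single, gen_rel 𝕜 (.t_t k l hk hl s h)]
    simp only [Gen.deg]
    rw [Seq.entry_swap_other s k l hk (by omega) (by omega) (by omega),
      Seq.entry_swap_other s k (l + 1) hk (by omega) (by omega) (by omega),
      Seq.entry_swap_other s l k hl (by omega) (by omega) (by omega),
      Seq.entry_swap_other s l (k + 1) hl (by omega) (by omega) (by omega), add_comm]
  | quad_same k hk s h =>
    simp only [AddMonoidAlgebra.single_mul_single, gen_rel 𝕜 (.quad_same k hk s h)]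
    rw [AddMonoidAlgebra.single_zero]
  | quad_orth k hk s h h' =>
    simp only [AddMonoidAlgebra.single_mul_single, gen_rel 𝕜 (.quad_orth k hk s h h')]
    simp only [Gen.deg, Seq.entry_swap_left s k hk, Seq.entry_swap_right s k hk]
    rw [form_comm C (s.entry (k + 1) hk), h', neg_zero, add_zero]
  | quad k hk s h h' =>
    simp only [AddMonoidAlgebra.single_mul_single, gen_rel 𝕜 (.quad k hk s h h'),
      AddMonoidAlgebra.single_pow, AddMonoidAlgebra.single_add]
    simp only [Gen.deg, Seq.entry_swap_left s k hk, Seq.entry_swap_right s k hk, nsmul_eq_mul]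
    rw [form_toNat C h, form_toNat C h.symm, form_comm C (s.entry (k + 1) hk)]
  | slide_left_real k hk s h h' =>
    simp only [AddMonoidAlgebra.single_mul_single, gen_rel 𝕜 (.slide_left_real k hk s h h'),
      AddMonoidAlgebra.single_add]
    simp only [Gen.deg, Seq.entry_swap_left s k hk]
    rw [h, form_self_of_isReal C h', add_neg_cancel, neg_add_cancel]
  | slide_right_real k hk s h h' =>
    simp only [AddMonoidAlgebra.single_mul_single, gen_rel 𝕜 (.slide_right_real k hk s h h'),
      AddMonoidAlgebra.single_add]
    simp only [Gen.deg, Seq.entry_swap_right s k hk]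
    rw [h, form_self_of_isReal C h', add_neg_cancel, neg_add_cancel]
  | slide_left k hk s h =>
    simp only [AddMonoidAlgebra.single_mul_single, gen_rel 𝕜 (.slide_left k hk s h)]
    simp only [Gen.deg, Seq.entry_swap_left s k hk]
    rw [add_comm]
  | slide_right k hk s h =>
    simp only [AddMonoidAlgebra.single_mul_single, gen_rel 𝕜 (.slide_right k hk s h)]
    simp only [Gen.deg, Seq.entry_swap_right s k hk]
    rw [add_comm]
  | braid_corrected k hk s h =>
    simp only [AddMonoidAlgebra.single_mul_single, gen_rel 𝕜 (.braid_corrected k hk s h),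
      AddMonoidAlgebra.single_pow, AddMonoidAlgebra.single_add, single_finset_sum]
    obtain ⟨h1, h2, h3, h4⟩ := h
    simp only [Gen.deg]
    rw [Seq.entry_swap_left (s.swap k) (k + 1) (by omega) (by omega),
      Seq.entry_swap_other (s.swap k) (k + 1) k (by omega) (by omega) (by omega) (by omega),
      Seq.entry_swap_right (s.swap (k + 1)) k (by omega),
      Seq.entry_swap_other (s.swap (k + 1)) k (k + 1 + 1) (by omega) hk (by omega) (by omega),
      Seq.entry_swap_right s (k + 1) hk, Seq.entry_swap_left s k (by omega) (by omega),
      Seq.entry_swap_right s k (by omega), Seq.entry_swap_left s (k + 1) hk (by omega),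
      Seq.entry_swap_other s k (k + 1 + 1) (by omega) hk (by omega) (by omega),
      Seq.entry_swap_other s (k + 1) k hk (by omega) (by omega) (by omega)]
    congr 1
    · congr 1
      ring
    · refine Finset.sum_congr rfl fun c hc => ?_
      congr 1
      rw [Finset.mem_range] at hc
      have e1 : s.entry (k + 1 + 1) hk = s.entry k (by omega) := h1.symm
      rw [e1, form_comm C (s.entry (k + 1) _), form_self_of_isReal C h3]
      have := form_toNat C h2
      generalize (-C.a (s.entry k _) (s.entry (k + 1) _)).toNat = d at *
      obtain ⟨m, rfl⟩ : ∃ m, d = c + m + 1 := ⟨d - 1 - c, by omega⟩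
      rw [show c + m + 1 - 1 - c = m by omega]
      push_cast at this
      simp only [nsmul_eq_mul, add_zero]
      linarith
  | braid k hk s h =>
    simp only [AddMonoidAlgebra.single_mul_single, gen_rel 𝕜 (.braid k hk s h)]
    simp only [Gen.deg]
    rw [Seq.entry_swap_left (s.swap k) (k + 1) (by omega) (by omega),
      Seq.entry_swap_other (s.swap k) (k + 1) k (by omega) (by omega) (by omega) (by omega),
      Seq.entry_swap_right (s.swap (k + 1)) k (by omega),
      Seq.entry_swap_other (s.swap (k + 1)) k (k + 1 + 1) (by omega) hk (by omega) (by omega),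
      Seq.entry_swap_right s (k + 1) hk, Seq.entry_swap_left s k (by omega) (by omega),
      Seq.entry_swap_right s k (by omega), Seq.entry_swap_left s (k + 1) hk (by omega),
      Seq.entry_swap_other s k (k + 1 + 1) (by omega) hk (by omega) (by omega),
      Seq.entry_swap_other s (k + 1) k hk (by omega) (by omega) (by omega)]
    congr 1
    ring

theorem wordVal_mem (w : List (Gen ν)) : wordVal 𝕜 C w ∈ grading 𝕜 C ν (wordDeg C w) :=
  Submodule.subset_span ⟨w, rfl, rfl⟩

theorem gen_mem (g : Gen ν) : gen 𝕜 C g ∈ grading 𝕜 C ν (g.deg C) := by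
  have := wordVal_mem 𝕜 (C := C) [g]
  simpa [wordVal, wordDeg] using this

instance gradedMonoid_grading : SetLike.GradedMonoid (grading 𝕜 C ν) where
  one_mem := by
    have := wordVal_mem 𝕜 (C := C) (ν := ν) []
    simpa [wordVal, wordDeg] using this
  mul_mem := by
    intro m n z w hz hw
    induction hz using Submodule.span_induction with
    | zero => simp
    | add x y _ _ hx hy => rw [add_mul]; exact add_mem hx hy
    | smul c x _ hx => rw [smul_mul_assoc]; exact Submodule.smul_mem _ c hx
    | mem z hz =>
      obtain ⟨u, rfl, rfl⟩ := hz
      induction hw using Submodule.span_induction with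
      | zero => simp
      | add x y _ _ hx hy => rw [mul_add]; exact add_mem hx hy
      | smul c x _ hx => rw [mul_smul_comm]; exact Submodule.smul_mem _ c hx
      | mem w hw =>
        obtain ⟨v, rfl, rfl⟩ := hw
        have := wordVal_mem 𝕜 (C := C) (u ++ v)
        simpa [wordVal, wordDeg] using this

theorem iSup_grading : ⨆ n, grading 𝕜 C ν n = ⊤ := by
  rw [eq_top_iff]
  rintro x -
  induction x using algebra_induction 𝕜 with
  | scalar r =>
    rw [Algebra.algebraMap_eq_smul_one]
    exact Submodule.smul_mem _ _ (Submodule.mem_iSup_of_mem 0 SetLike.GradedOne.one_mem)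
  | gen g => exact Submodule.mem_iSup_of_mem _ (gen_mem 𝕜 g)
  | add a b ha hb => exact add_mem ha hb
  | mul a b ha hb =>
    induction ha using Submodule.iSup_induction' with
    | zero => simp
    | add x y _ _ hx hy => rw [add_mul]; exact add_mem hx hy
    | mem m x hx =>
      induction hb using Submodule.iSup_induction' with
      | zero => simp
      | add x y _ _ hx hy => rw [mul_add]; exact add_mem hx hy
      | mem n y hy => exact Submodule.mem_iSup_of_mem _ (SetLike.GradedMul.mul_mem hx hy)

theorem liftGen_wordVal {B : Type*} [Ring B] [Algebra 𝕜 B] (φ : Gen ν → B)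
    (h : ∀ x y, Rel C φ x y → x = y) (w : List (Gen ν)) :
    liftGen 𝕜 φ h (wordVal 𝕜 C w) = (w.map φ).prod := by
  rw [wordVal, map_list_prod, List.map_map]
  congr 2
  exact funext fun g => liftGen_gen 𝕜 φ h g

theorem prod_single (w : List (Gen ν)) :
    (w.map fun g => AddMonoidAlgebra.single (g.deg C) (gen 𝕜 C g)).prod
      = AddMonoidAlgebra.single (wordDeg C w) (wordVal 𝕜 C w) := by
  induction w with
  | nil => rfl
  | cons g w ih =>
    rw [List.map_cons, List.prod_cons, ih, AddMonoidAlgebra.single_mul_single]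
    simp [wordDeg, wordVal]

instance gradedAlgebra_grading : GradedAlgebra (grading 𝕜 C ν) where
  toDecomposition := DirectSum.IsInternal.chooseDecomposition _ <| by
    refine isInternal_of_coaction _ ((AddMonoidAlgebra.coeffLinearEquiv 𝕜).toLinearMap.comp
      (liftGen 𝕜 _ (coactionGen_rel 𝕜)).toLinearMap) ?_ (iSup_grading 𝕜)
    intro n x hx
    induction hx using Submodule.span_induction with
    | zero => simp
    | add x y _ _ hx hy => rw [map_add, hx, hy, Finsupp.single_add]
    | smul c x _ hx => rw [map_smul, hx, Finsupp.smul_single]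
    | mem x hx =>
      obtain ⟨w, rfl, rfl⟩ := hx
      simp only [LinearMap.comp_apply, AlgHom.toLinearMap_apply, liftGen_wordVal, prod_single]
      rfl

section Corner

variable {R : Type*} [Ring R] [Algebra 𝕜 R] {e : R}

instance cornerModule (he : IsIdempotentElem e) : Module 𝕜 he.Corner where
  smul c r := ⟨c • r.1, by
    obtain ⟨r, y, rfl⟩ := r
    exact ⟨c • y, by simp⟩⟩
  one_smul r := Subtype.ext (one_smul 𝕜 r.1)
  mul_smul a b r := Subtype.ext (mul_smul a b r.1)
  smul_zero a := Subtype.ext (smul_zero a)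
  smul_add a r s := Subtype.ext (smul_add a r.1 s.1)
  add_smul a b r := Subtype.ext (add_smul a b r.1)
  zero_smul r := Subtype.ext (zero_smul 𝕜 r.1)

/-- The corner `eRe` of a `𝕜`-algebra is a `𝕜`-algebra with unit `e`. -/
instance cornerAlgebra (he : IsIdempotentElem e) : Algebra 𝕜 he.Corner :=
  Algebra.ofModule (fun c x y => Subtype.ext (smul_mul_assoc c x.1 y.1))
    (fun c x y => Subtype.ext (mul_smul_comm c x.1 y.1))

/-- The inclusion of the corner, a non-unital homomorphism. -/
def cornerVal (he : IsIdempotentElem e) : he.Corner →ₙₐ[𝕜] R where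
  toFun r := r.1
  map_smul' _ _ := rfl
  map_zero' := rfl
  map_add' _ _ := rfl
  map_mul' _ _ := rfl

theorem cornerVal_injective (he : IsIdempotentElem e) :
    Function.Injective (cornerVal 𝕜 he) := fun _ _ h => Subtype.ext h

theorem cornerVal_pow_mul (he : IsIdempotentElem e) (x y : he.Corner) (n : ℕ) :
    cornerVal 𝕜 he (x ^ n * y) = cornerVal 𝕜 he x ^ n * cornerVal 𝕜 he y := by
  induction n with
  | zero => simp
  | succ n ih => rw [pow_succ', mul_assoc, map_mul, ih, pow_succ', mul_assoc]

end Corner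

/-- A way to place strand diagrams of weight `μ` inside strand diagrams of weight `ρ`, next to
further vertical strands: `Ω` are the possible labels of those, `offset` is their number on the
left, and `place ω s` is the sequence `s` together with the labels `ω`. -/
structure Placement (μ ρ : Multiset I) where
  Ω : Type v
  [fintype : Fintype Ω]
  offset : ℕ
  bound : offset + Multiset.card μ ≤ Multiset.card ρ
  place : Ω → Seq μ → Seq ρ
  inj : ∀ {ω ω' s s'}, place ω s = place ω' s' → ω = ω' ∧ s = s'
  place_swap : ∀ ω s k, k + 1 < Multiset.card μ →
    place ω (s.swap k) = (place ω s).swap (offset + k)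
  place_entry : ∀ ω s k (hk : k < Multiset.card μ),
    (place ω s).entry (offset + k) (by omega) = s.entry k hk

namespace Placement

attribute [instance] Placement.fintype

variable (P : Placement μ ρ)

/-- The generator that acts on the strands of `ρ` singled out by `P` and `ω`. -/
def genAt (ω : P.Ω) : Gen μ → Gen ρ
  | .e s => .e (P.place ω s)
  | .x k hk s => .x (P.offset + k) (by have := P.bound; omega) (P.place ω s)
  | .t k hk s => .t (P.offset + k) (by have := P.bound; omega) (P.place ω s)

/-- The image of a generator: the sum over all labels of the further strands. -/
def image (C : BorcherdsCartan I) (g : Gen μ) : KLRAlgebra 𝕜 C ρ := ∑ ω, gen 𝕜 C (P.genAt ω g)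

/-- The image of the unit. -/
def unit (C : BorcherdsCartan I) : KLRAlgebra 𝕜 C ρ := ∑ s, P.image 𝕜 C (.e s)

end Placement

theorem gen_e_mul_gen_e [DecidableEq (Seq ρ)] (s s' : Seq ρ) :
    gen 𝕜 C (.e s) * gen 𝕜 C (.e s') = if s = s' then gen 𝕜 C (.e s) else 0 := by
  split_ifs with h
  · subst h; exact gen_rel 𝕜 (.idem s)
  · exact gen_rel 𝕜 (.orth s s' h)

namespace Placement

variable (P : Placement μ ρ)

/-- The sequence at the bottom of a generator. -/
def bot : Gen μ → Seq μ
  | .e s => s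
  | .x _ _ s => s
  | .t _ _ s => s

/-- The sequence at the top of a generator. -/
def top : Gen μ → Seq μ
  | .e s => s
  | .x _ _ s => s
  | .t k _ s => s.swap k

theorem gen_mul_bot (g : Gen μ) : gen 𝕜 C g * gen 𝕜 C (.e (bot g)) = gen 𝕜 C g := by
  cases g with
  | e s => exact gen_rel 𝕜 (.idem s)
  | x k hk s => exact gen_rel 𝕜 (.x_e k hk s)
  | t k hk s => exact gen_rel 𝕜 (.t_e k hk s)

theorem top_mul_gen (g : Gen μ) : gen 𝕜 C (.e (top g)) * gen 𝕜 C g = gen 𝕜 C g := by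
  cases g with
  | e s => exact gen_rel 𝕜 (.idem s)
  | x k hk s => exact gen_rel 𝕜 (.e_x k hk s)
  | t k hk s => exact gen_rel 𝕜 (.e_t k hk s)

theorem bot_genAt (ω : P.Ω) (g : Gen μ) : bot (P.genAt ω g) = P.place ω (bot g) := by
  cases g <;> rfl

theorem top_genAt (ω : P.Ω) (g : Gen μ) : top (P.genAt ω g) = P.place ω (top g) := by
  cases g with
  | e s => rfl
  | x k hk s => rfl
  | t k hk s => exact (P.place_swap ω s k hk).symm

/-- Products of sums over labels are taken label by label. -/
theorem sum_mul_sum {s : Seq μ} {F G : P.Ω → KLRAlgebra 𝕜 C ρ}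
    (hF : ∀ ω, F ω * gen 𝕜 C (.e (P.place ω s)) = F ω)
    (hG : ∀ ω, gen 𝕜 C (.e (P.place ω s)) * G ω = G ω) :
    (∑ ω, F ω) * (∑ ω, G ω) = ∑ ω, F ω * G ω := by
  classical
  rw [Finset.sum_mul_sum]
  refine Finset.sum_congr rfl fun ω _ => ?_
  refine Finset.sum_eq_single ω (fun ω' _ h => ?_) (by simp)
  rw [← hF, ← hG, mul_assoc, ← mul_assoc (gen 𝕜 C _) (gen 𝕜 C _), gen_e_mul_gen_e, if_neg,
    zero_mul, mul_zero]
  exact fun h' => h (P.inj h').1.symm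

theorem image_mul_sum (g : Gen μ) {G : P.Ω → KLRAlgebra 𝕜 C ρ}
    (hG : ∀ ω, gen 𝕜 C (.e (P.place ω (bot g))) * G ω = G ω) :
    P.image 𝕜 C g * (∑ ω, G ω) = ∑ ω, gen 𝕜 C (P.genAt ω g) * G ω :=
  P.sum_mul_sum 𝕜 (s := bot g)
    (fun ω => by rw [← bot_genAt, gen_mul_bot]) hG

theorem image_mul_image (g g' : Gen μ) (h : top g' = bot g) :
    P.image 𝕜 C g * P.image 𝕜 C g' = ∑ ω, gen 𝕜 C (P.genAt ω g) * gen 𝕜 C (P.genAt ω g') :=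
  P.image_mul_sum 𝕜 g fun ω => by rw [← h, ← top_genAt, top_mul_gen]

theorem image_e_orth (s s' : Seq μ) (h : s ≠ s') :
    P.image 𝕜 C (.e s) * P.image 𝕜 C (.e s') = 0 := by
  classical
  rw [image, image, Finset.sum_mul_sum]
  refine Finset.sum_eq_zero fun ω _ => Finset.sum_eq_zero fun ω' _ => ?_
  exact (gen_e_mul_gen_e 𝕜 _ _).trans (if_neg fun h' => h (P.inj h').2)

theorem image_mul_bot (g : Gen μ) :
    P.image 𝕜 C g * P.image 𝕜 C (.e (bot g)) = P.image 𝕜 C g := by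
  rw [image_mul_image _ _ _ _ rfl]
  refine Finset.sum_congr rfl fun ω _ => ?_
  have := gen_mul_bot 𝕜 (C := C) (P.genAt ω g)
  rwa [bot_genAt] at this

theorem top_mul_image (g : Gen μ) :
    P.image 𝕜 C (.e (top g)) * P.image 𝕜 C g = P.image 𝕜 C g := by
  rw [image_mul_image _ _ _ _ rfl]
  refine Finset.sum_congr rfl fun ω _ => ?_
  have := top_mul_gen 𝕜 (C := C) (P.genAt ω g)
  rwa [top_genAt] at this

theorem image_mul_unit (g : Gen μ) : P.image 𝕜 C g * P.unit 𝕜 C = P.image 𝕜 C g := by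
  classical
  rw [unit, Finset.mul_sum, Finset.sum_eq_single (bot g), image_mul_bot]
  · intro s _ hs
    rw [← image_mul_bot, mul_assoc, image_e_orth _ _ _ _ hs.symm, mul_zero]
  · simp

theorem unit_mul_image (g : Gen μ) : P.unit 𝕜 C * P.image 𝕜 C g = P.image 𝕜 C g := by
  classical
  rw [unit, Finset.sum_mul, Finset.sum_eq_single (top g), top_mul_image]
  · intro s _ hs
    rw [← top_mul_image 𝕜 P g, ← mul_assoc, image_e_orth _ _ _ _ hs, zero_mul]
  · simp

theorem unit_isIdempotent : IsIdempotentElem (P.unit 𝕜 C) := by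
  rw [IsIdempotentElem]
  conv_lhs => rw [unit, Finset.sum_mul]
  rw [unit]
  exact Finset.sum_congr rfl fun s _ => P.image_mul_unit 𝕜 _

/-- The image of a generator in the corner. -/
def imageCorner {e : KLRAlgebra 𝕜 C ρ} (h : e = P.unit 𝕜 C) (he : IsIdempotentElem e)
    (g : Gen μ) : he.Corner :=
  ⟨P.image 𝕜 C g, P.image 𝕜 C g, by
    subst h
    change P.unit 𝕜 C * P.image 𝕜 C g * P.unit 𝕜 C = _
    rw [unit_mul_image, image_mul_unit]⟩

theorem place_mul_x_pow_mul (ω : P.Ω) (k : ℕ) (hk : k < Multiset.card μ) (s : Seq μ) (n : ℕ)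
    {G : KLRAlgebra 𝕜 C ρ} (hG : gen 𝕜 C (.e (P.place ω s)) * G = G) :
    gen 𝕜 C (.e (P.place ω s)) * (gen 𝕜 C (P.genAt ω (.x k hk s)) ^ n * G)
      = gen 𝕜 C (P.genAt ω (.x k hk s)) ^ n * G := by
  cases n with
  | zero => rw [pow_zero, one_mul, hG]
  | succ n =>
    have := top_mul_gen 𝕜 (C := C) (P.genAt ω (.x k hk s))
    rw [top_genAt] at this
    rw [← mul_assoc, pow_succ', ← mul_assoc]
    congr 2

theorem image_pow_mul (k : ℕ) (hk : k < Multiset.card μ) (s : Seq μ) (n : ℕ)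
    {G : P.Ω → KLRAlgebra 𝕜 C ρ} (hG : ∀ ω, gen 𝕜 C (.e (P.place ω s)) * G ω = G ω) :
    P.image 𝕜 C (.x k hk s) ^ n * (∑ ω, G ω)
      = ∑ ω, gen 𝕜 C (P.genAt ω (.x k hk s)) ^ n * G ω := by
  induction n with
  | zero => simp
  | succ n ih =>
    rw [pow_succ', mul_assoc, ih, P.image_mul_sum 𝕜 (.x k hk s)]
    · exact Finset.sum_congr rfl fun ω _ => by rw [pow_succ', mul_assoc]
    · exact fun ω => P.place_mul_x_pow_mul 𝕜 ω k hk s n (hG ω)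

theorem image_mul_three (g g' g'' : Gen μ) (h : top g' = bot g) (h' : top g'' = bot g') :
    P.image 𝕜 C g * (P.image 𝕜 C g' * P.image 𝕜 C g'') = ∑ ω, gen 𝕜 C (P.genAt ω g) *
      (gen 𝕜 C (P.genAt ω g') * gen 𝕜 C (P.genAt ω g'')) := by
  rw [image_mul_image _ _ _ _ h', image_mul_sum]
  intro ω
  rw [← h, ← top_genAt, ← mul_assoc, top_mul_gen]

theorem imageCorner_rel {e : KLRAlgebra 𝕜 C ρ} (h : e = P.unit 𝕜 C) (he : IsIdempotentElem e)
    (x y : he.Corner) (hxy : Rel C (P.imageCorner 𝕜 h he) x y) : x = y := by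
  have hb := P.bound
  have hv : ∀ g, cornerVal 𝕜 he (P.imageCorner 𝕜 h he g) = P.image 𝕜 C g := fun _ => rfl
  apply cornerVal_injective 𝕜 he
  cases hxy with
  | idem s =>
    rw [map_mul, hv]
    exact P.image_mul_bot 𝕜 (.e s)
  | orth s s' hs =>
    rw [map_mul, hv, hv, map_zero]
    exact P.image_e_orth 𝕜 s s' hs
  | unit =>
    rw [map_sum]
    exact h.symm
  | e_x k hk s =>
    rw [map_mul, hv, hv]
    exact P.top_mul_image 𝕜 (.x k hk s)
  | x_e k hk s =>
    rw [map_mul, hv, hv]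
    exact P.image_mul_bot 𝕜 (.x k hk s)
  | e_t k hk s =>
    rw [map_mul, hv, hv]
    exact P.top_mul_image 𝕜 (.t k hk s)
  | t_e k hk s =>
    rw [map_mul, hv, hv]
    exact P.image_mul_bot 𝕜 (.t k hk s)
  | x_x k l hk hl s =>
    rw [map_mul, map_mul, hv, hv, P.image_mul_image 𝕜 _ _ rfl, P.image_mul_image 𝕜 _ _ rfl]
    exact Finset.sum_congr rfl fun ω _ => gen_rel 𝕜 (.x_x _ _ _ _ _)
  | x_t k l hk hl s h h' =>
    rw [map_mul, map_mul, hv, hv, hv, P.image_mul_image 𝕜 _ _ rfl, P.image_mul_image 𝕜 _ _ rfl]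
    refine Finset.sum_congr rfl fun ω _ => ?_
    simp only [genAt, P.place_swap ω s k hk]
    exact gen_rel 𝕜 (.x_t _ _ _ _ _ (by omega) (by omega))
  | t_t k l hk hl s h =>
    rw [map_mul, map_mul, hv, hv, hv, hv, P.image_mul_image 𝕜 _ _ rfl,
      P.image_mul_image 𝕜 _ _ rfl]
    refine Finset.sum_congr rfl fun ω _ => ?_
    simp only [genAt, P.place_swap ω s k hk, P.place_swap ω s l hl]
    exact gen_rel 𝕜 (.t_t _ _ _ _ _ (by omega))
  | quad_same k hk s h =>
    rw [map_mul, hv, hv, P.image_mul_image 𝕜 _ _ rfl, map_zero]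
    refine Finset.sum_eq_zero fun ω _ => ?_
    simp only [genAt, P.place_swap ω s k hk]
    refine gen_rel 𝕜 (.quad_same _ _ _ ?_)
    rw [P.place_entry]
    exact h.trans (P.place_entry ω s (k + 1) hk).symm
  | quad_orth k hk s h h' =>
    rw [map_mul, hv, hv, hv, P.image_mul_image 𝕜 _ _ rfl]
    refine Finset.sum_congr rfl fun ω _ => ?_
    have e1 := P.place_entry ω s k (by omega)
    have e2 : (P.place ω s).entry (P.offset + k + 1) (by omega) = s.entry (k + 1) hk :=
      P.place_entry ω s (k + 1) hk
    simp only [genAt, P.place_swap ω s k hk]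
    refine gen_rel 𝕜 (.quad_orth _ _ _ ?_ ?_)
    · rwa [e1, e2]
    · rwa [e1, e2]
  | quad k hk s h h' =>
    have hp : ∀ (n m) (hm : m < Multiset.card μ), n ≠ 0 →
        cornerVal 𝕜 he (P.imageCorner 𝕜 ‹_› he (.x m hm s) ^ n)
        = ∑ ω, gen 𝕜 C (P.genAt ω (.x m hm s)) ^ n := by
      intro n m hm hn
      obtain ⟨n, rfl⟩ := Nat.exists_eq_succ_of_ne_zero hn
      rw [Nat.succ_eq_add_one, pow_succ, cornerVal_pow_mul, hv]
      refine (P.image_pow_mul 𝕜 m hm s n ?_).trans ?_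
      rotate_left
      · simp only [pow_succ]
      · intro ω
        have := top_mul_gen 𝕜 (C := C) (P.genAt ω (.x m hm s))
        rwa [top_genAt] at this
    have ha : ∀ i j, i ≠ j → C.form i j ≠ 0 → (-C.a i j).toNat ≠ 0 := by
      intro i j hij hf h0
      have h1 := C.a_nonpos i j hij
      have h2 : C.a i j = 0 := by omega
      exact hf (by rw [BorcherdsCartan.form, h2, mul_zero])
    rw [map_mul, map_add, hv, hv, P.image_mul_image 𝕜 _ _ rfl, hp _ _ _ (ha _ _ h h'),
      hp _ _ _ (ha _ _ h.symm (by rwa [form_comm])), ← Finset.sum_add_distrib]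
    refine Finset.sum_congr rfl fun ω _ => ?_
    have e1 := P.place_entry ω s k (by omega)
    have e2 : (P.place ω s).entry (P.offset + k + 1) (by omega) = s.entry (k + 1) hk :=
      P.place_entry ω s (k + 1) hk
    simp only [genAt, P.place_swap ω s k hk]
    rw [← e1, ← e2] at h h' ⊢
    exact gen_rel 𝕜 (.quad _ _ _ h h')
  | slide_left_real k hk s h h' =>
    rw [map_mul, map_add, map_mul, hv, hv, hv, hv, P.image_mul_image 𝕜 _ _ rfl,
      P.image_mul_image 𝕜 _ _ rfl, image, ← Finset.sum_add_distrib]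
    refine Finset.sum_congr rfl fun ω _ => ?_
    have e1 := P.place_entry ω s k (by omega)
    have e2 : (P.place ω s).entry (P.offset + k + 1) (by omega) = s.entry (k + 1) hk :=
      P.place_entry ω s (k + 1) hk
    simp only [genAt, P.place_swap ω s k hk]
    rw [← e1, ← e2] at h
    rw [← e2] at h'
    exact gen_rel 𝕜 (.slide_left_real _ _ _ h h')
  | slide_right_real k hk s h h' =>
    rw [map_mul, map_add, map_mul, hv, hv, hv, hv, P.image_mul_image 𝕜 _ _ rfl,
      P.image_mul_image 𝕜 _ _ rfl, image, ← Finset.sum_add_distrib]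
    refine Finset.sum_congr rfl fun ω _ => ?_
    have e1 := P.place_entry ω s k (by omega)
    have e2 : (P.place ω s).entry (P.offset + k + 1) (by omega) = s.entry (k + 1) hk :=
      P.place_entry ω s (k + 1) hk
    simp only [genAt, P.place_swap ω s k hk]
    rw [← e1, ← e2] at h
    rw [← e2] at h'
    exact gen_rel 𝕜 (.slide_right_real _ _ _ h h')
  | slide_left k hk s h =>
    rw [map_mul, map_mul, hv, hv, hv, P.image_mul_image 𝕜 _ _ rfl,
      P.image_mul_image 𝕜 _ _ rfl]
    refine Finset.sum_congr rfl fun ω _ => ?_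
    have e1 := P.place_entry ω s k (by omega)
    have e2 : (P.place ω s).entry (P.offset + k + 1) (by omega) = s.entry (k + 1) hk :=
      P.place_entry ω s (k + 1) hk
    simp only [genAt, P.place_swap ω s k hk]
    rw [← e1, ← e2] at h
    exact gen_rel 𝕜 (.slide_left _ _ _ h)
  | slide_right k hk s h =>
    rw [map_mul, map_mul, hv, hv, hv, P.image_mul_image 𝕜 _ _ rfl,
      P.image_mul_image 𝕜 _ _ rfl]
    refine Finset.sum_congr rfl fun ω _ => ?_
    have e1 := P.place_entry ω s k (by omega)
    have e2 : (P.place ω s).entry (P.offset + k + 1) (by omega) = s.entry (k + 1) hk :=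
      P.place_entry ω s (k + 1) hk
    simp only [genAt, P.place_swap ω s k hk]
    rw [← e1, ← e2] at h
    exact gen_rel 𝕜 (.slide_right _ _ _ h)
  | braid_corrected k hk s h =>
    rw [map_add, map_mul, map_mul, map_mul, map_mul, map_sum]
    simp only [cornerVal_pow_mul, hv]
    rw [P.image_mul_three 𝕜 _ _ _ rfl rfl, P.image_mul_three 𝕜 _ _ _ rfl rfl]
    have hs : ∀ c n, P.image 𝕜 C (.x k (by omega) s) ^ c *
        (P.image 𝕜 C (.x (k + 2) hk s) ^ n * P.image 𝕜 C (.e s)) =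
        ∑ ω, gen 𝕜 C (P.genAt ω (.x k (by omega) s)) ^ c *
          (gen 𝕜 C (P.genAt ω (.x (k + 2) hk s)) ^ n * gen 𝕜 C (P.genAt ω (.e s))) := by
      intro c n
      have h0 : ∀ ω, gen 𝕜 C (.e (P.place ω s)) * gen 𝕜 C (P.genAt ω (.e s))
          = gen 𝕜 C (P.genAt ω (.e s)) := fun ω => gen_rel 𝕜 (.idem (P.place ω s))
      change _ * (_ * ∑ ω, gen 𝕜 C (P.genAt ω (.e s))) = _
      rw [P.image_pow_mul 𝕜 _ _ s n h0, P.image_pow_mul 𝕜 _ _ s c]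
      exact fun ω => P.place_mul_x_pow_mul 𝕜 ω _ _ s n (h0 ω)
    simp only [hs]
    rw [Finset.sum_comm, ← Finset.sum_add_distrib]
    refine Finset.sum_congr rfl fun ω _ => ?_
    have e0 := P.place_entry ω s k (by omega)
    have e1 : (P.place ω s).entry (P.offset + k + 1) (by omega) = s.entry (k + 1) (by omega) :=
      P.place_entry ω s (k + 1) (by omega)
    have e2 : (P.place ω s).entry (P.offset + k + 2) (by omega) = s.entry (k + 2) hk :=
      P.place_entry ω s (k + 2) hk
    simp only [genAt, P.place_swap ω _ k (by omega : k + 1 < Multiset.card μ),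
      P.place_swap ω _ (k + 1) hk]
    rw [BraidCorrected, ← e0, ← e1, ← e2] at h
    rw [← e0, ← e1]
    exact gen_rel 𝕜 (.braid_corrected (P.offset + k) (by omega) (P.place ω s) h)
  | braid k hk s h =>
    rw [map_mul, map_mul, map_mul, map_mul]
    simp only [hv]
    rw [P.image_mul_three 𝕜 _ _ _ rfl rfl, P.image_mul_three 𝕜 _ _ _ rfl rfl]
    refine Finset.sum_congr rfl fun ω _ => ?_
    have e0 := P.place_entry ω s k (by omega)
    have e1 : (P.place ω s).entry (P.offset + k + 1) (by omega) = s.entry (k + 1) (by omega) :=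
      P.place_entry ω s (k + 1) (by omega)
    have e2 : (P.place ω s).entry (P.offset + k + 2) (by omega) = s.entry (k + 2) hk :=
      P.place_entry ω s (k + 2) hk
    simp only [genAt, P.place_swap ω _ k (by omega : k + 1 < Multiset.card μ),
      P.place_swap ω _ (k + 1) hk]
    rw [BraidCorrected, ← e0, ← e1, ← e2] at h
    exact gen_rel 𝕜 (.braid (P.offset + k) (by omega) (P.place ω s) h)

/-- The homomorphism `R(μ) → e R(ρ) e` given by the placement. -/
def hom {e : KLRAlgebra 𝕜 C ρ} (h : e = P.unit 𝕜 C) (he : IsIdempotentElem e) :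
    KLRAlgebra 𝕜 C μ →ₐ[𝕜] he.Corner :=
  liftGen 𝕜 (P.imageCorner 𝕜 h he) (P.imageCorner_rel 𝕜 h he)

theorem deg_genAt (ω : P.Ω) (g : Gen μ) : (P.genAt ω g).deg C = g.deg C := by
  have hb := P.bound
  cases g with
  | e s => rfl
  | x k hk s => simp only [genAt, Gen.deg, P.place_entry ω s k hk]
  | t k hk s =>
    have e2 : (P.place ω s).entry (P.offset + k + 1) (by omega) = s.entry (k + 1) hk :=
      P.place_entry ω s (k + 1) hk
    simp only [genAt, Gen.deg, P.place_entry ω s k (by omega), e2]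

theorem image_mem (g : Gen μ) : P.image 𝕜 C g ∈ grading 𝕜 C ρ (g.deg C) :=
  Submodule.sum_mem _ fun ω _ => P.deg_genAt (C := C) ω g ▸ gen_mem 𝕜 (P.genAt ω g)

theorem hom_mem {e : KLRAlgebra 𝕜 C ρ} (h : e = P.unit 𝕜 C) (he : IsIdempotentElem e) (n : ℤ)
    (a : KLRAlgebra 𝕜 C μ) (ha : a ∈ grading 𝕜 C μ n) :
    cornerVal 𝕜 he (P.hom 𝕜 h he a) ∈ grading 𝕜 C ρ n := by
  induction ha using Submodule.span_induction with
  | zero => simp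
  | add x y _ _ hx hy => rw [map_add, map_add]; exact add_mem hx hy
  | smul c x _ hx => rw [map_smul, map_smul]; exact Submodule.smul_mem _ c hx
  | mem x hx =>
    obtain ⟨w, rfl, rfl⟩ := hx
    rw [hom, liftGen_wordVal]
    induction w with
    | nil =>
      change e ∈ _
      rw [h]
      exact Submodule.sum_mem _ fun s _ => P.image_mem 𝕜 (.e s)
    | cons g w ih =>
      rw [List.map_cons, List.prod_cons, map_mul, wordDeg, List.map_cons, List.sum_cons]
      exact SetLike.GradedMul.mul_mem (P.image_mem 𝕜 g) ih

end Placement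

/-- Every sequence of weight `μ` on the left of arbitrary sequences of weight `ν`. -/
@[reducible] def leftPlacement (h : μ + ν = ρ) : Placement μ ρ where
  Ω := Seq ν
  offset := 0
  bound := by rw [← h, Multiset.card_add]; omega
  place t s := s.append h t
  inj {t t' s s'} hst := by
    have h1 := List.append_inj (congrArg Subtype.val hst) (by rw [s.length_eq, s'.length_eq])
    exact ⟨Subtype.ext h1.2, Subtype.ext h1.1⟩
  place_swap t s k hk := Subtype.ext <| by
    change swapList k s.1 ++ t.1 = swapList (0 + k) (s.1 ++ t.1)
    rw [zero_add, swapList_append_left _ _ _ (by rwa [s.length_eq])]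
  place_entry t s k hk := by
    rw [Seq.entry_eq_iff]
    change (s.1 ++ t.1)[0 + k]? = _
    rw [zero_add, List.getElem?_append_left (by rwa [s.length_eq]), ← Seq.entry_eq_iff]

/-- Every sequence of weight `ν` on the right of arbitrary sequences of weight `μ`. -/
@[reducible] def rightPlacement (h : μ + ν = ρ) : Placement ν ρ where
  Ω := Seq μ
  offset := Multiset.card μ
  bound := by rw [← h, Multiset.card_add]
  place s t := s.append h t
  inj {s s' t t'} hst := by
    have h1 := List.append_inj (congrArg Subtype.val hst) (by rw [s.length_eq, s'.length_eq])
    exact ⟨Subtype.ext h1.1, Subtype.ext h1.2⟩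
  place_swap s t k hk := Subtype.ext <| by
    change s.1 ++ swapList k t.1 = swapList (Multiset.card μ + k) (s.1 ++ t.1)
    rw [← s.length_eq, swapList_append_right]
  place_entry s t k hk := by
    rw [Seq.entry_eq_iff]
    change (s.1 ++ t.1)[Multiset.card μ + k]? = _
    rw [List.getElem?_append_right (by rw [s.length_eq]; omega), s.length_eq,
      Nat.add_sub_cancel_left, ← Seq.entry_eq_iff]

/-- The idempotent `1_{μ,ν}` of `R(ρ)`, where `ρ = μ + ν`: the sum of the `1_{st}` over all
concatenations `st` of a sequence `s` of weight `μ` and a sequence `t` of weight `ν`. -/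
def oneTensorOne (C : BorcherdsCartan I) (h : μ + ν = ρ) : KLRAlgebra 𝕜 C ρ :=
  ∑ s : Seq μ, ∑ t : Seq ν, gen 𝕜 C (.e (s.append h t))

theorem oneTensorOne_eq_left (h : μ + ν = ρ) :
    oneTensorOne 𝕜 C h = (leftPlacement h).unit 𝕜 C := rfl

theorem oneTensorOne_eq_right (h : μ + ν = ρ) :
    oneTensorOne 𝕜 C h = (rightPlacement h).unit 𝕜 C := Finset.sum_comm

theorem oneTensorOne_isIdempotent (h : μ + ν = ρ) :
    IsIdempotentElem (oneTensorOne 𝕜 C h) := (leftPlacement h).unit_isIdempotent 𝕜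

open Placement in
theorem gen_comm (h : μ + ν = ρ) (g : Gen μ) (g' : Gen ν) :
    gen 𝕜 C ((leftPlacement h).genAt (top g') g) * gen 𝕜 C ((rightPlacement h).genAt (bot g) g')
      = gen 𝕜 C ((rightPlacement h).genAt (top g) g') *
        gen 𝕜 C ((leftPlacement h).genAt (bot g') g) := by
  have hswapL := (leftPlacement h).place_swap
  have hswapR := (rightPlacement h).place_swap
  have hρ : Multiset.card μ + Multiset.card ν = Multiset.card ρ := by
    rw [← h, Multiset.card_add]
  simp only [leftPlacement, rightPlacement] at hswapL hswapR
  cases g with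
  | e s =>
    cases g' with
    | e t => rfl
    | x k hk t =>
      exact (gen_rel 𝕜 (.e_x _ _ _)).trans (gen_rel 𝕜 (.x_e _ _ _)).symm
    | t k hk t =>
      simp only [genAt, top, bot, hswapR s t k hk]
      exact (gen_rel 𝕜 (.e_t _ _ _)).trans (gen_rel 𝕜 (.t_e _ _ _)).symm
  | x k hk s =>
    cases g' with
    | e t => exact (gen_rel 𝕜 (.x_e _ _ _)).trans (gen_rel 𝕜 (.e_x _ _ _)).symm
    | x l hl t => exact gen_rel 𝕜 (.x_x _ _ _ _ _)
    | t l hl t =>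
      simp only [genAt, top, bot, hswapR s t l hl]
      exact gen_rel 𝕜 (.x_t _ _ _ _ _ (by omega) (by omega))
  | t k hk s =>
    cases g' with
    | e t =>
      simp only [genAt, top, bot, hswapL t s k hk]
      exact (gen_rel 𝕜 (.t_e _ _ _)).trans (gen_rel 𝕜 (.e_t _ _ _)).symm
    | x l hl t =>
      simp only [genAt, top, bot, hswapL t s k hk]
      exact (gen_rel 𝕜 (.x_t _ _ _ _ _ (by omega) (by omega))).symm
    | t l hl t =>
      simp only [genAt, top, bot, hswapL t s k hk, hswapR s t l hl]
      exact (gen_rel 𝕜 (.t_t _ _ _ _ _ (by omega))).symm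

theorem gen_mul_gen_eq_zero (g g' : Gen ρ) (h : Placement.bot g ≠ Placement.top g') :
    gen 𝕜 C g * gen 𝕜 C g' = 0 := by
  rw [← Placement.gen_mul_bot 𝕜 g, ← Placement.top_mul_gen 𝕜 g', mul_assoc,
    ← mul_assoc (gen 𝕜 C (.e _)), gen_rel 𝕜 (.orth _ _ h), zero_mul, mul_zero]

open Placement in
/-- Generators on the left and on the right strands commute. -/
theorem image_comm (h : μ + ν = ρ) (g : Gen μ) (g' : Gen ν) :
    (leftPlacement h).image 𝕜 C g * (rightPlacement h).image 𝕜 C g'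
      = (rightPlacement h).image 𝕜 C g' * (leftPlacement h).image 𝕜 C g := by
  classical
  have hinj : ∀ {s s' : Seq μ} {t t' : Seq ν}, s.append h t = s'.append h t' → s = s' ∧ t = t' :=
    fun hst => ((rightPlacement h).inj hst)
  have h1 : (leftPlacement h).image 𝕜 C g * (rightPlacement h).image 𝕜 C g'
      = gen 𝕜 C ((leftPlacement h).genAt (top g') g) *
        gen 𝕜 C ((rightPlacement h).genAt (bot g) g') := by
    rw [image, image, Finset.sum_mul_sum, Finset.sum_eq_single (top g'),
      Finset.sum_eq_single (bot g)]
    · intro s _ hs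
      refine gen_mul_gen_eq_zero 𝕜 _ _ fun h' => hs ?_
      rw [bot_genAt, top_genAt] at h'
      exact (hinj h').1.symm
    · intro hn; exact absurd (Finset.mem_univ _) hn
    · intro t _ ht
      refine Finset.sum_eq_zero fun s _ => gen_mul_gen_eq_zero 𝕜 _ _ fun h' => ht ?_
      rw [bot_genAt, top_genAt] at h'
      exact (hinj h').2
    · intro hn; exact absurd (Finset.mem_univ _) hn
  have h2 : (rightPlacement h).image 𝕜 C g' * (leftPlacement h).image 𝕜 C g
      = gen 𝕜 C ((rightPlacement h).genAt (top g) g') *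
        gen 𝕜 C ((leftPlacement h).genAt (bot g') g) := by
    rw [image, image, Finset.sum_mul_sum, Finset.sum_eq_single (top g),
      Finset.sum_eq_single (bot g')]
    · intro t _ ht
      refine gen_mul_gen_eq_zero 𝕜 _ _ fun h' => ht ?_
      rw [bot_genAt, top_genAt] at h'
      exact (hinj h').2.symm
    · intro hn; exact absurd (Finset.mem_univ _) hn
    · intro s _ hs
      refine Finset.sum_eq_zero fun t _ => gen_mul_gen_eq_zero 𝕜 _ _ fun h' => hs ?_
      rw [bot_genAt, top_genAt] at h'
      exact (hinj h').1
    · intro hn; exact absurd (Finset.mem_univ _) hn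
  rw [h1, h2, gen_comm]

theorem hom_comm (h : μ + ν = ρ) (a : KLRAlgebra 𝕜 C μ) (b : KLRAlgebra 𝕜 C ν) :
    Commute
      ((leftPlacement h).hom 𝕜 (oneTensorOne_eq_left 𝕜 h) (oneTensorOne_isIdempotent 𝕜 h) a)
      ((rightPlacement h).hom 𝕜 (oneTensorOne_eq_right 𝕜 h) (oneTensorOne_isIdempotent 𝕜 h) b) := by
  induction a using algebra_induction 𝕜 with
  | scalar c => rw [AlgHom.commutes]; exact Algebra.commute_algebraMap_left c _
  | add x y hx hy => rw [map_add]; exact hx.add_left hy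
  | mul x y hx hy => rw [map_mul]; exact hx.mul_left hy
  | gen g =>
    induction b using algebra_induction 𝕜 with
    | scalar c => rw [AlgHom.commutes]; exact Algebra.commute_algebraMap_right c _
    | add x y hx hy => rw [map_add]; exact hx.add_right hy
    | mul x y hx hy => rw [map_mul]; exact hx.mul_right hy
    | gen g' =>
      rw [Placement.hom, Placement.hom, liftGen_gen, liftGen_gen]
      exact Subtype.ext (image_comm 𝕜 h g g')

/-- The homomorphism `R(μ) ⊗ R(ν) → 1_{μ,ν} R(ρ) 1_{μ,ν}` which places diagrams side by side. -/
def juxtaposeCorner (C : BorcherdsCartan I) (h : μ + ν = ρ) :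
    KLRAlgebra 𝕜 C μ ⊗[𝕜] KLRAlgebra 𝕜 C ν →ₐ[𝕜]
      (oneTensorOne_isIdempotent 𝕜 (C := C) h).Corner :=
  Algebra.TensorProduct.lift
    ((leftPlacement h).hom 𝕜 (oneTensorOne_eq_left 𝕜 h) (oneTensorOne_isIdempotent 𝕜 h))
    ((rightPlacement h).hom 𝕜 (oneTensorOne_eq_right 𝕜 h) (oneTensorOne_isIdempotent 𝕜 h))
    (hom_comm 𝕜 h)

/-- The homomorphism `R(μ) ⊗ R(ν) → R(ρ)`, where `ρ = μ + ν`, which places diagrams side by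
side. It maps the unit to the idempotent `1_{μ,ν}`. -/
def juxtapose (C : BorcherdsCartan I) (h : μ + ν = ρ) :
    KLRAlgebra 𝕜 C μ ⊗[𝕜] KLRAlgebra 𝕜 C ν →ₙₐ[𝕜] KLRAlgebra 𝕜 C ρ :=
  (cornerVal 𝕜 (oneTensorOne_isIdempotent 𝕜 h)).comp (juxtaposeCorner 𝕜 C h).toNonUnitalAlgHom

theorem juxtapose_one (h : μ + ν = ρ) : juxtapose 𝕜 C h 1 = oneTensorOne 𝕜 C h :=
  congrArg (cornerVal 𝕜 (oneTensorOne_isIdempotent 𝕜 h)) (map_one (juxtaposeCorner 𝕜 C h))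

theorem juxtapose_tmul (h : μ + ν = ρ) (a : KLRAlgebra 𝕜 C μ) (b : KLRAlgebra 𝕜 C ν) :
    juxtapose 𝕜 C h (a ⊗ₜ b) =
      cornerVal 𝕜 _ ((leftPlacement h).hom 𝕜 (oneTensorOne_eq_left 𝕜 h)
        (oneTensorOne_isIdempotent 𝕜 h) a) *
      cornerVal 𝕜 _ ((rightPlacement h).hom 𝕜 (oneTensorOne_eq_right 𝕜 h)
        (oneTensorOne_isIdempotent 𝕜 h) b) := by
  rw [← map_mul]
  exact congrArg (cornerVal 𝕜 (oneTensorOne_isIdempotent 𝕜 h))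
    (Algebra.TensorProduct.lift_tmul _ _ (hom_comm 𝕜 h) a b)

theorem juxtapose_mem (h : μ + ν = ρ) (n : ℤ) (z : KLRAlgebra 𝕜 C μ ⊗[𝕜] KLRAlgebra 𝕜 C ν)
    (hz : z ∈ tensorDeg (grading 𝕜 C μ) (grading 𝕜 C ν) n) :
    juxtapose 𝕜 C h z ∈ grading 𝕜 C ρ n := by
  induction hz using Submodule.span_induction with
  | zero => rw [map_zero]; exact zero_mem _
  | add x y _ _ hx hy => rw [map_add]; exact add_mem hx hy
  | smul c x _ hx => rw [map_smul]; exact Submodule.smul_mem _ c hx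
  | mem z hz =>
    obtain ⟨p, q, rfl, a, ha, b, hb, rfl⟩ := hz
    rw [juxtapose_tmul]
    exact SetLike.GradedMul.mul_mem (Placement.hom_mem 𝕜 _ _ _ p a ha)
      (Placement.hom_mem 𝕜 _ _ _ q b hb)

end Algebra

section Functors

universe v w w'

variable {I : Type v} {𝕜 : Type*} [Field 𝕜] {C : BorcherdsCartan I} {μ ν ρ : Multiset I}

/-- Graded modules over `R(ν)`. -/
abbrev KLRMod (𝕜 : Type*) [Field 𝕜] (C : BorcherdsCartan I) (ν : Multiset I) :=
  GrMod.{w} (grading 𝕜 C ν)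

/-- The restriction `1_{μ,ν} M`, a graded module over `R(μ) ⊗ R(ν)`, where `ρ = μ + ν`. -/
def Res (h : μ + ν = ρ) (M : KLRMod.{v, w} 𝕜 C ρ) :
    GrMod.{w} (tensorDeg (grading 𝕜 C μ) (grading 𝕜 C ν)) :=
  GrMod.res (juxtapose 𝕜 C h) (juxtapose_mem 𝕜 h) M

/-- The induction `R(ρ) 1_{μ,ν} ⊗_{R(μ) ⊗ R(ν)} W`, where `ρ = μ + ν`. -/
def Ind (h : μ + ν = ρ) (W : GrMod.{w} (tensorDeg (grading 𝕜 C μ) (grading 𝕜 C ν))) :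
    KLRMod 𝕜 C ρ :=
  GrMod.ind (juxtapose 𝕜 C h) (juxtapose_mem 𝕜 h) W

/-- `ε_i(M)`: the largest `n` such that `Δ_{i^n} M = 1_{κ,ni} M` is nonzero, where
`ν = κ + ni`. -/
def eps (i : I) (M : KLRMod.{v, w} 𝕜 C ν) : ℕ :=
  sSup {n | ∃ (κ : Multiset I) (h : κ + Multiset.replicate n i = ν), Nontrivial (Res h M)}

/-- The generators of `R(ni)` that annihilate the generating vector of `V(i^n)`: all dots, and
for imaginary `i` also all crossings. -/
def trivialGens (C : BorcherdsCartan I) (i : I) (n : ℕ) :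
    Set (Gen (Multiset.replicate n i)) :=
  {g | (∃ k hk s, g = .x k hk s) ∨ (¬C.IsReal i ∧ ∃ k hk s, g = .t k hk s)}

open Classical in
/-- The gr-irreducible `R(ni)`-module `V(i^n)`. For real `i` it is
`R(ni) ⊗_{𝕜[x_1, ..., x_n]} 𝕜`, the quotient of `R(ni)` by the left ideal generated by the
`x_k`, shifted by `r_i n(n-1)/2`. For imaginary `i` it is the one-dimensional module in degree
`0` on which all `x_k` and `τ_k` are zero. -/
def V (𝕜 : Type*) [Field 𝕜] (C : BorcherdsCartan I) (i : I) (n : ℕ) :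
    KLRMod 𝕜 C (Multiset.replicate n i) :=
  ((GrMod.regular (grading 𝕜 C (Multiset.replicate n i))).quot
    (Submodule.span _ (gen 𝕜 C '' trivialGens C i n))
    (GrMod.isGraded_span _ _ (by
      rintro _ ⟨g, _, rfl⟩
      exact ⟨_, gen_mem 𝕜 g⟩))).shift (if C.IsReal i then C.r i * (n * (n - 1) / 2 : ℕ) else 0)

end Functors

end KLR

end

noncomputable section

namespace KLR

open DirectSum TensorProduct

/-! ### Presentation of R(ρ) by dots and crossings without labels. -/

section Strands

universe v

variable {I : Type v} {ρ : Multiset I}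

/-! Put m = a + n. The modules are compared through one structure, `IsVacuumHom`: a linear map ι : K
→ M that is R(κ)-linear for diagrams with m vertical strands of label i added on the right, whose
image generates M and is killed by the dots on the added strands. The vectors u ⊗ vac in Δ_{i^a} N ≅
K ⊗ V(i^a) give such a map K → N (`exists_isVacuumHom_of_res_iso`), the vectors 1 ⊗ (u ⊗ vac) give
one N → M, and the composite is one K → M. It shifts degrees by the sum of the degrees of the two
vacuum vectors; comparing with the degree of the vacuum vector of V(i^m) gives d.

The core is `IsVacuumHom.exists_greatest`: a nonzero M with such a map from a finite-dimensional
gr-irreducible K with ε_i(K) = 0 has a greatest proper graded submodule S. Let T be the space of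
vectors supported on sequences whose last m entries are i (`OnTail`), and J the span of the τ_k T
with k in the tail (`crossImage`). A shuffle argument writes M as the span of products of crossings
applied to ι(K). Since no weight of K ends in i, only crossings inside the tail contribute to T
(`tower_support`), so T = ι(K) + J.

Let Z be a graded submodule. For real i some θ in R(ρ) fixes the vectors of T killed by the dots of
the tail, and kills J (`exists_extremal`). If Z ∩ T is nonzero, it contains a nonzero vector killed
by all dots; θ shows that it lies in ι(K), and irreducibility of K gives Z = M. So a proper Z has Z
∩ T = 0. For imaginary i, if Z ∩ T is not inside J, irreducibility of K gives ι(K) ⊆ Z + J, and a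
Nakayama argument for the nil-Coxeter action of the tail crossings (`le_of_le_sup_cross`) gives T ⊆
Z, hence Z = M. So a proper Z has Z ∩ T ⊆ J, and J ≠ T by the same argument. Either property passes
to the sum of all proper graded submodules, which is therefore proper.

For imaginary i the submodule generated by J is proper, so the tail crossings kill the image of K in
M/S. Frobenius reciprocity therefore maps Ind K ⊗ V(i^m) onto M/S. The induced module has a greatest
proper graded submodule too, so its head is M/S up to a shift (`IsVacuumHom.head_iso`). Some tail
weight survives in M/S and longer tails vanish already on M, so ε_i is m there. For real i the tail
idempotents kill S, which bounds ε_i of all other composition factors.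

All this needs the induced modules to be nonzero (`nontrivial_ind`). For this one strand is added at
a time to a module N with nilpotent dots. Over N[z, z⁻¹] every x_k − z is invertible, and R(ν + i)
acts on the functions on the |ν| + 1 possible positions of a new strand with dot z: exchanging it
with a neighbour has one component that leaves it in place, with coefficient ±1/(x − z) if the
neighbour has the same real label and 0 otherwise, and components that move it left and right
(`LocalizedRel.strandRel_ins`). Multiplication by z commutes with this action, and the filtration by
order in z shows that the submodule Y generated by N at the last position is not contained in zY.
The specialization at z = 0 is then a nonzero module which receives a map from the induced one. -/

theorem Seq.swap_swap (s : Seq ρ) (k : ℕ) (hk : k + 1 < Multiset.card ρ) :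
    (s.swap k).swap k = s := by
  refine Seq.ext_entry fun r hr => ?_
  rw [Seq.entry_swap (s.swap k) k r (Equiv.swap k (k + 1) r) hk hr ?_ rfl,
    Seq.entry_swap s k _ r hk _ hr (Equiv.swap_apply_self _ _ _)]
  rw [Equiv.swap_apply_def]
  split_ifs <;> omega

/-- The relations of `R(ρ)` for idempotents `e`, dots `x` and crossings `t` that are not
separated by the labels of the strands. -/
structure StrandRel (C : BorcherdsCartan I) {ρ : Multiset I} {B : Type*} [Ring B]
    (e : Seq ρ → B) (x t : ℕ → B) : Prop where
  idem : ∀ s, e s * e s = e s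
  orth : ∀ s s', s ≠ s' → e s * e s' = 0
  unit : ∑ s, e s = 1
  x_e : ∀ k s, k < Multiset.card ρ → x k * e s = e s * x k
  t_e : ∀ k s, k + 1 < Multiset.card ρ → t k * e s = e (s.swap k) * t k
  x_x : ∀ k l, k < Multiset.card ρ → l < Multiset.card ρ → x k * x l = x l * x k
  x_t : ∀ k l, k + 1 < Multiset.card ρ → l < Multiset.card ρ → l ≠ k → l ≠ k + 1 →
    x l * t k = t k * x l
  t_t : ∀ k l, l + 1 < Multiset.card ρ → k + 1 < l → t l * t k = t k * t l
  quad_same : ∀ (k : ℕ) (hk : k + 1 < Multiset.card ρ) (s : Seq ρ),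
    s.entry k (by omega) = s.entry (k + 1) hk → t k * t k * e s = 0
  quad_orth : ∀ (k : ℕ) (hk : k + 1 < Multiset.card ρ) (s : Seq ρ),
    s.entry k (by omega) ≠ s.entry (k + 1) hk →
    C.form (s.entry k (by omega)) (s.entry (k + 1) hk) = 0 → t k * t k * e s = e s
  quad : ∀ (k : ℕ) (hk : k + 1 < Multiset.card ρ) (s : Seq ρ),
    s.entry k (by omega) ≠ s.entry (k + 1) hk →
    C.form (s.entry k (by omega)) (s.entry (k + 1) hk) ≠ 0 →
    t k * t k * e s = (x k ^ (-C.a (s.entry k (by omega)) (s.entry (k + 1) hk)).toNat +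
      x (k + 1) ^ (-C.a (s.entry (k + 1) hk) (s.entry k (by omega))).toNat) * e s
  slide_left_real : ∀ (k : ℕ) (hk : k + 1 < Multiset.card ρ) (s : Seq ρ),
    s.entry k (by omega) = s.entry (k + 1) hk → C.IsReal (s.entry (k + 1) hk) →
    x k * t k * e s = (t k * x (k + 1) + 1) * e s
  slide_right_real : ∀ (k : ℕ) (hk : k + 1 < Multiset.card ρ) (s : Seq ρ),
    s.entry k (by omega) = s.entry (k + 1) hk → C.IsReal (s.entry (k + 1) hk) →
    t k * x k * e s = (x (k + 1) * t k + 1) * e s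
  slide_left : ∀ (k : ℕ) (hk : k + 1 < Multiset.card ρ) (s : Seq ρ),
    ¬(s.entry k (by omega) = s.entry (k + 1) hk ∧ C.IsReal (s.entry (k + 1) hk)) →
    x k * t k * e s = t k * x (k + 1) * e s
  slide_right : ∀ (k : ℕ) (hk : k + 1 < Multiset.card ρ) (s : Seq ρ),
    ¬(s.entry k (by omega) = s.entry (k + 1) hk ∧ C.IsReal (s.entry (k + 1) hk)) →
    t k * x k * e s = x (k + 1) * t k * e s
  braid_corrected : ∀ (k : ℕ) (hk : k + 2 < Multiset.card ρ) (s : Seq ρ),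
    BraidCorrected C k hk s →
    t k * t (k + 1) * t k * e s = (t (k + 1) * t k * t (k + 1) +
      ∑ c ∈ Finset.range (-C.a (s.entry k (by omega)) (s.entry (k + 1) (by omega))).toNat,
        x k ^ c * x (k + 2) ^
          ((-C.a (s.entry k (by omega)) (s.entry (k + 1) (by omega))).toNat - 1 - c)) * e s
  braid : ∀ (k : ℕ) (hk : k + 2 < Multiset.card ρ) (s : Seq ρ),
    ¬BraidCorrected C k hk s → t k * t (k + 1) * t k * e s = t (k + 1) * t k * t (k + 1) * e s

variable (𝕜 : Type*) [Field 𝕜]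

/-- The dot on the `k`-th strand, whatever the labels. -/
def dot (C : BorcherdsCartan I) (ρ : Multiset I) (k : ℕ) : KLRAlgebra 𝕜 C ρ :=
  if h : k < Multiset.card ρ then ∑ s, gen 𝕜 C (.x k h s) else 0

/-- The crossing of the strands `k` and `k + 1`, whatever the labels. -/
def cross (C : BorcherdsCartan I) (ρ : Multiset I) (k : ℕ) : KLRAlgebra 𝕜 C ρ :=
  if h : k + 1 < Multiset.card ρ then ∑ s, gen 𝕜 C (.t k h s) else 0

variable {C : BorcherdsCartan I}

theorem dot_of_le {k : ℕ} (h : Multiset.card ρ ≤ k) : dot 𝕜 C ρ k = 0 := dif_neg (by omega)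

theorem dot_mul_e {k : ℕ} (h : k < Multiset.card ρ) (s : Seq ρ) :
    dot 𝕜 C ρ k * gen 𝕜 C (.e s) = gen 𝕜 C (.x k h s) := by
  classical
  rw [dot, dif_pos h, Finset.sum_mul, Finset.sum_eq_single s]
  · exact gen_rel 𝕜 (.x_e k h s)
  · intro s' _ hs
    exact gen_mul_gen_eq_zero 𝕜 _ _ hs
  · simp

theorem e_mul_dot {k : ℕ} (h : k < Multiset.card ρ) (s : Seq ρ) :
    gen 𝕜 C (.e s) * dot 𝕜 C ρ k = gen 𝕜 C (.x k h s) := by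
  classical
  rw [dot, dif_pos h, Finset.mul_sum, Finset.sum_eq_single s]
  · exact gen_rel 𝕜 (.e_x k h s)
  · intro s' _ hs
    exact gen_mul_gen_eq_zero 𝕜 _ _ (Ne.symm hs)
  · simp

theorem cross_mul_e {k : ℕ} (h : k + 1 < Multiset.card ρ) (s : Seq ρ) :
    cross 𝕜 C ρ k * gen 𝕜 C (.e s) = gen 𝕜 C (.t k h s) := by
  classical
  rw [cross, dif_pos h, Finset.sum_mul, Finset.sum_eq_single s]
  · exact gen_rel 𝕜 (.t_e k h s)
  · intro s' _ hs
    exact gen_mul_gen_eq_zero 𝕜 _ _ hs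
  · simp

theorem e_swap_mul_cross {k : ℕ} (h : k + 1 < Multiset.card ρ) (s : Seq ρ) :
    gen 𝕜 C (.e (s.swap k)) * cross 𝕜 C ρ k = gen 𝕜 C (.t k h s) := by
  classical
  rw [cross, dif_pos h, Finset.mul_sum, Finset.sum_eq_single s]
  · exact gen_rel 𝕜 (.e_t k h s)
  · intro s' _ hs
    refine gen_mul_gen_eq_zero 𝕜 _ _ fun h' => hs ?_
    change s.swap k = s'.swap k at h'
    rw [← Seq.swap_swap s k h, h', Seq.swap_swap s' k h]
  · simp

/-- The idempotents sum to 1, so an identity may be checked on one label sequence at a time. -/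
theorem eq_of_mul_e {a b : KLRAlgebra 𝕜 C ρ}
    (h : ∀ s, a * gen 𝕜 C (.e s) = b * gen 𝕜 C (.e s)) : a = b := by
  have h1 : ∑ s, gen 𝕜 C (.e s) = (1 : KLRAlgebra 𝕜 C ρ) := gen_rel 𝕜 .unit
  rw [← mul_one a, ← mul_one b, ← h1, Finset.mul_sum, Finset.mul_sum]
  exact Finset.sum_congr rfl fun s _ => h s

/-- Removes the idempotent in the middle of a product of labelled generators. It is the step that
translates between labelled and unlabelled relations. -/
theorem absorb {B : Type*} [Ring B] {e e' y : B} (a : B) (h : y * e = e' * y)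
    (he : e' * e' = e') : a * e' * (y * e) = a * y * e := by
  rw [h, ← mul_assoc, mul_assoc a, he, mul_assoc, ← h, mul_assoc]

theorem mul_e_pow_mul {B : Type*} [Ring B] {e y : B} (h : y * e = e * y) (he : e * e = e)
    (n : ℕ) : (y * e) ^ n * e = y ^ n * e := by
  induction n with
  | zero => simp
  | succ n ih =>
    have h' : (y * e) ^ n * (y * e) = (y * e) ^ n * e * y := by rw [mul_assoc, h]
    rw [pow_succ, mul_assoc, mul_assoc, he, h', ih, mul_assoc, ← h, ← mul_assoc, ← pow_succ]

/-- The zeroth power has to be excluded: there the left side is 1 and the right side is the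
idempotent. In the quadratic relation the exponents are nonzero by `toNat_ne_zero`. -/
theorem mul_e_pow {B : Type*} [Ring B] {e y : B} (h : y * e = e * y) (he : e * e = e)
    {n : ℕ} (hn : n ≠ 0) : (y * e) ^ n = y ^ n * e := by
  obtain ⟨n, rfl⟩ := Nat.exists_eq_succ_of_ne_zero hn
  rw [← mul_e_pow_mul h he, Nat.succ_eq_add_one, pow_succ, mul_assoc, mul_assoc, he]

theorem mul_e_pow_mul_mul {B : Type*} [Ring B] {e y y' : B} (h : y * e = e * y)
    (h' : y' * e = e * y') (he : e * e = e) (n n' : ℕ) :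
    (y * e) ^ n * ((y' * e) ^ n' * e) = y ^ n * y' ^ n' * e := by
  have hc : y' ^ n' * e = e * y' ^ n' := (Commute.pow_left h' n' : Commute _ _)
  rw [mul_e_pow_mul h' he, hc, ← mul_assoc, mul_e_pow_mul h he, mul_assoc, mul_assoc, hc]

theorem toNat_ne_zero (C : BorcherdsCartan I) {i j : I} (h : i ≠ j) (h' : C.form i j ≠ 0) :
    (-C.a i j).toNat ≠ 0 := by
  intro h0
  have h1 := C.a_nonpos i j h
  have h2 : C.a i j = 0 := by omega
  exact h' (by rw [BorcherdsCartan.form, h2, mul_zero])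

/-- Each identity is multiplied by an idempotent on the right; after inner idempotents are absorbed
it becomes one of the labelled defining relations. -/
theorem strandRel_klr :
    StrandRel C (fun s : Seq ρ => gen 𝕜 C (.e s)) (dot 𝕜 C ρ) (cross 𝕜 C ρ) := by
  have idem : ∀ s : Seq ρ, gen 𝕜 C (.e s) * gen 𝕜 C (.e s) = gen 𝕜 C (.e s) :=
    fun s => gen_rel 𝕜 (.idem s)
  have x_e : ∀ k (s : Seq ρ), k < Multiset.card ρ →
      dot 𝕜 C ρ k * gen 𝕜 C (.e s) = gen 𝕜 C (.e s) * dot 𝕜 C ρ k :=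
    fun k s hk => by rw [dot_mul_e 𝕜 hk, e_mul_dot 𝕜 hk]
  have t_e : ∀ k (s : Seq ρ), k + 1 < Multiset.card ρ →
      cross 𝕜 C ρ k * gen 𝕜 C (.e s) = gen 𝕜 C (.e (s.swap k)) * cross 𝕜 C ρ k :=
    fun k s hk => by rw [cross_mul_e 𝕜 hk, e_swap_mul_cross 𝕜 hk]
  have ax : ∀ a k (s : Seq ρ), k < Multiset.card ρ →
      a * gen 𝕜 C (.e s) * (dot 𝕜 C ρ k * gen 𝕜 C (.e s)) = a * dot 𝕜 C ρ k * gen 𝕜 C (.e s) :=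
    fun a k s hk => absorb a (x_e k s hk) (idem s)
  have at' : ∀ a k (s : Seq ρ), k + 1 < Multiset.card ρ →
      a * gen 𝕜 C (.e (s.swap k)) * (cross 𝕜 C ρ k * gen 𝕜 C (.e s))
        = a * cross 𝕜 C ρ k * gen 𝕜 C (.e s) :=
    fun a k s hk => absorb a (t_e k s hk) (idem _)
  -- `ax`, `at'` and `att` drop the idempotent in front of one dot, one crossing and two crossings
  -- respectively.
  have att : ∀ a j l (s : Seq ρ), j + 1 < Multiset.card ρ → l + 1 < Multiset.card ρ →
      a * gen 𝕜 C (.e ((s.swap j).swap l)) * (cross 𝕜 C ρ l * cross 𝕜 C ρ j * gen 𝕜 C (.e s))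
        = a * cross 𝕜 C ρ l * cross 𝕜 C ρ j * gen 𝕜 C (.e s) := fun a j l s hj hl => by
    rw [mul_assoc a (cross 𝕜 C ρ l)]
    exact absorb a (by rw [mul_assoc, t_e j s hj, ← mul_assoc, t_e l _ hl, mul_assoc]) (idem _)
  refine ⟨idem, fun s s' h => gen_rel 𝕜 (.orth s s' h), gen_rel 𝕜 .unit, x_e, t_e, ?_, ?_, ?_,
    ?_, ?_, ?_, ?_, ?_, ?_, ?_, ?_, ?_⟩
  · intro k l hk hl
    refine eq_of_mul_e 𝕜 fun s => ?_
    have h := gen_rel 𝕜 (C := C) (.x_x k l hk hl s)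
    simpa only [← dot_mul_e, ax _ _ _ hk, ax _ _ _ hl] using h
  · intro k l hk hl h h'
    refine eq_of_mul_e 𝕜 fun s => ?_
    have h := gen_rel 𝕜 (C := C) (.x_t k l hk hl s h h')
    simpa only [← dot_mul_e, ← cross_mul_e, at' _ _ _ hk, ax _ _ _ hl] using h
  · intro k l hl h
    have hk : k + 1 < Multiset.card ρ := by omega
    refine eq_of_mul_e 𝕜 fun s => ?_
    have h := gen_rel 𝕜 (C := C) (.t_t k l hk hl s h)
    simpa only [← cross_mul_e, at' _ _ _ hk, at' _ _ _ hl] using h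
  · intro k hk s h
    have h := gen_rel 𝕜 (C := C) (.quad_same k hk s h)
    simpa only [← cross_mul_e, at' _ _ _ hk] using h
  · intro k hk s h h'
    have h := gen_rel 𝕜 (C := C) (.quad_orth k hk s h h')
    simpa only [← cross_mul_e, at' _ _ _ hk] using h
  · intro k hk s h h'
    have h1 := gen_rel 𝕜 (C := C) (.quad k hk s h h')
    simp only [← cross_mul_e, ← dot_mul_e, at' _ _ _ hk] at h1
    rw [h1, mul_e_pow (x_e _ _ (by omega)) (idem s) (toNat_ne_zero C h h'),
      mul_e_pow (x_e _ _ hk) (idem s) (toNat_ne_zero C h.symm (by rwa [form_comm])), add_mul]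
  · intro k hk s h h'
    have h := gen_rel 𝕜 (C := C) (.slide_left_real k hk s h h')
    simpa only [← cross_mul_e, ← dot_mul_e, at' _ _ _ hk, ax _ _ _ hk, add_mul, one_mul] using h
  · intro k hk s h h'
    have h := gen_rel 𝕜 (C := C) (.slide_right_real k hk s h h')
    simpa only [← cross_mul_e, ← dot_mul_e, at' _ _ _ hk, ax _ k _ (by omega), add_mul,
      one_mul] using h
  · intro k hk s h
    have h := gen_rel 𝕜 (C := C) (.slide_left k hk s h)
    simpa only [← cross_mul_e, ← dot_mul_e, at' _ _ _ hk, ax _ _ _ hk] using h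
  · intro k hk s h
    have h := gen_rel 𝕜 (C := C) (.slide_right k hk s h)
    simpa only [← cross_mul_e, ← dot_mul_e, at' _ _ _ hk, ax _ k _ (by omega)] using h
  · intro k hk s h
    have hk' : k + 1 < Multiset.card ρ := by omega
    have h := gen_rel 𝕜 (C := C) (.braid_corrected k hk s h)
    simpa only [← cross_mul_e, ← dot_mul_e, at' _ _ _ hk, at' _ _ _ hk', att _ _ _ s hk' hk,
      att _ _ _ s hk hk', add_mul, Finset.sum_mul,
      mul_e_pow_mul_mul (x_e k s (by omega)) (x_e (k + 2) s hk) (idem s)] using h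
  · intro k hk s h
    have hk' : k + 1 < Multiset.card ρ := by omega
    have h := gen_rel 𝕜 (C := C) (.braid k hk s h)
    simpa only [← cross_mul_e, at' _ _ _ hk, at' _ _ _ hk', att _ _ _ s hk' hk,
      att _ _ _ s hk hk'] using h

namespace StrandRel

variable {B : Type*} [Ring B] {e : Seq ρ → B} {x t : ℕ → B}

/-- The values of the generators. -/
def genVal (e : Seq ρ → B) (x t : ℕ → B) : Gen ρ → B
  | .e s => e s
  | .x k _ s => x k * e s
  | .t k _ s => t k * e s

/-- The converse of `strandRel_klr`: the unlabelled relations imply the labelled ones, so an action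
of R(ρ) can be constructed by checking `StrandRel`. -/
theorem genVal_rel (H : StrandRel C e x t) (y z : B) (h : Rel C (genVal e x t) y z) : y = z := by
  have ax : ∀ a k s, k < Multiset.card ρ → a * e s * (x k * e s) = a * x k * e s :=
    fun a k s hk => absorb a (H.x_e k s hk) (H.idem s)
  have at' : ∀ a k s, k + 1 < Multiset.card ρ →
      a * e (s.swap k) * (t k * e s) = a * t k * e s :=
    fun a k s hk => absorb a (H.t_e k s hk) (H.idem _)
  have att : ∀ a j l s, j + 1 < Multiset.card ρ → l + 1 < Multiset.card ρ →
      a * e ((s.swap j).swap l) * (t l * t j * e s) = a * t l * t j * e s := by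
    intro a j l s hj hl
    rw [mul_assoc a (t l)]
    exact absorb a (by rw [mul_assoc, H.t_e j s hj, ← mul_assoc, H.t_e l _ hl, mul_assoc]) (H.idem _)
  cases h with
  | idem s => exact H.idem s
  | orth s s' h => exact H.orth s s' h
  | unit => exact H.unit
  | e_x k hk s => simp only [genVal]; rw [H.x_e k s hk, ← mul_assoc, H.idem]
  | x_e k hk s => simp only [genVal]; rw [mul_assoc, H.idem]
  | e_t k hk s => simp only [genVal]; rw [H.t_e k s hk, ← mul_assoc, H.idem]
  | t_e k hk s => simp only [genVal]; rw [mul_assoc, H.idem]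
  | x_x k l hk hl s => simp only [genVal, ax _ _ _ hk, ax _ _ _ hl, H.x_x k l hk hl]
  | x_t k l hk hl s h h' =>
    simp only [genVal, at' _ _ _ hk, ax _ _ _ hl, H.x_t k l hk hl h h']
  | t_t k l hk hl s h => simp only [genVal, at' _ _ _ hk, at' _ _ _ hl, H.t_t k l hl h]
  | quad_same k hk s h => simp only [genVal, at' _ _ _ hk, H.quad_same k hk s h]
  | quad_orth k hk s h h' => simp only [genVal, at' _ _ _ hk, H.quad_orth k hk s h h']
  | quad k hk s h h' =>
    simp only [genVal, at' _ _ _ hk, H.quad k hk s h h']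
    rw [mul_e_pow (H.x_e _ _ (by omega)) (H.idem s) (toNat_ne_zero C h h'),
      mul_e_pow (H.x_e _ _ hk) (H.idem s) (toNat_ne_zero C h.symm (by rwa [form_comm])), add_mul]
  | slide_left_real k hk s h h' =>
    simp only [genVal, at' _ _ _ hk, ax _ _ _ hk, H.slide_left_real k hk s h h', add_mul, one_mul]
  | slide_right_real k hk s h h' =>
    simp only [genVal, at' _ _ _ hk, ax _ k _ (by omega : k < _), H.slide_right_real k hk s h h',
      add_mul, one_mul]
  | slide_left k hk s h =>
    simp only [genVal, at' _ _ _ hk, ax _ _ _ hk, H.slide_left k hk s h]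
  | slide_right k hk s h =>
    simp only [genVal, at' _ _ _ hk, ax _ k _ (by omega : k < _), H.slide_right k hk s h]
  | braid_corrected k hk s h =>
    have hk' : k + 1 < Multiset.card ρ := by omega
    simp only [genVal, at' _ _ _ hk, at' _ _ _ hk', att _ _ _ s hk' hk, att _ _ _ s hk hk',
      H.braid_corrected k hk s h, add_mul, Finset.sum_mul,
      mul_e_pow_mul_mul (H.x_e k s (by omega)) (H.x_e (k + 2) s hk) (H.idem s)]
  | braid k hk s h =>
    have hk' : k + 1 < Multiset.card ρ := by omega
    simp only [genVal, at' _ _ _ hk, at' _ _ _ hk', att _ _ _ s hk' hk, att _ _ _ s hk hk',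
      H.braid k hk s h]

variable [Algebra 𝕜 B]

/-- The homomorphism out of `R(ρ)` given by idempotents, dots and crossings. -/
def lift (H : StrandRel C e x t) : KLRAlgebra 𝕜 C ρ →ₐ[𝕜] B :=
  liftGen 𝕜 (genVal e x t) H.genVal_rel

theorem lift_e (H : StrandRel C e x t) (s : Seq ρ) : H.lift 𝕜 (gen 𝕜 C (.e s)) = e s :=
  liftGen_gen 𝕜 _ _ _

theorem lift_dot (H : StrandRel C e x t) {k : ℕ} (hk : k < Multiset.card ρ) :
    H.lift 𝕜 (dot 𝕜 C ρ k) = x k := by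
  rw [dot, dif_pos hk, map_sum]
  simp only [lift, liftGen_gen, genVal]
  rw [← Finset.mul_sum, H.unit, mul_one]

theorem lift_cross (H : StrandRel C e x t) {k : ℕ} (hk : k + 1 < Multiset.card ρ) :
    H.lift 𝕜 (cross 𝕜 C ρ k) = t k := by
  rw [cross, dif_pos hk, map_sum]
  simp only [lift, liftGen_gen, genVal]
  rw [← Finset.mul_sum, H.unit, mul_one]

end StrandRel

end Strands

/-! ### Shuffles: the submodule generated by a subspace stable under the left strands. -/

section Spanning

universe v

variable {I : Type v} {ρ : Multiset I} {𝕜 : Type*} [Field 𝕜] {C : BorcherdsCartan I}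
variable {M : Type*} [AddCommGroup M] [Module 𝕜 M] [Module (KLRAlgebra 𝕜 C ρ) M]

theorem cross_of_le {k : ℕ} (h : Multiset.card ρ ≤ k + 1) : cross 𝕜 C ρ k = 0 :=
  dif_neg (by omega)

theorem e_smul_e_smul (s : Seq ρ) (u : M) :
    gen 𝕜 C (.e s) • gen 𝕜 C (.e s) • u = gen 𝕜 C (.e s) • u := by
  rw [← mul_smul, (strandRel_klr 𝕜).idem]

theorem e_smul_e_smul_of_ne {s s' : Seq ρ} (h : s ≠ s') (u : M) :
    gen 𝕜 C (.e s) • gen 𝕜 C (.e s') • u = 0 := by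
  rw [← mul_smul, (strandRel_klr 𝕜).orth s s' h, zero_smul]

variable (𝕜 C) in
theorem sum_e_smul (u : M) : ∑ s : Seq ρ, gen 𝕜 C (.e s) • u = u := by
  rw [← Finset.sum_smul, (strandRel_klr 𝕜).unit, one_smul]

theorem dot_smul_e_smul (k : ℕ) (s : Seq ρ) (u : M) :
    dot 𝕜 C ρ k • gen 𝕜 C (.e s) • u = gen 𝕜 C (.e s) • dot 𝕜 C ρ k • u := by
  rw [← mul_smul, ← mul_smul]
  by_cases hk : k < Multiset.card ρ
  · rw [(strandRel_klr 𝕜).x_e k s hk]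
  · rw [dot_of_le 𝕜 (by omega), zero_mul, mul_zero]

theorem cross_smul_e_smul (k : ℕ) (s : Seq ρ) (u : M) :
    cross 𝕜 C ρ k • gen 𝕜 C (.e s) • u = gen 𝕜 C (.e (s.swap k)) • cross 𝕜 C ρ k • u := by
  rw [← mul_smul, ← mul_smul]
  by_cases hk : k + 1 < Multiset.card ρ
  · rw [(strandRel_klr 𝕜).t_e k s hk]
  · rw [cross_of_le (by omega), zero_mul, mul_zero]

theorem e_smul_cross_smul (k : ℕ) (s : Seq ρ) (u : M) :
    gen 𝕜 C (.e s) • cross 𝕜 C ρ k • u = cross 𝕜 C ρ k • gen 𝕜 C (.e (s.swap k)) • u := by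
  by_cases hk : k + 1 < Multiset.card ρ
  · rw [cross_smul_e_smul, Seq.swap_swap s k hk]
  · rw [cross_of_le (by omega), zero_smul, zero_smul, smul_zero]

theorem dot_smul_dot_smul (k l : ℕ) (u : M) :
    dot 𝕜 C ρ k • dot 𝕜 C ρ l • u = dot 𝕜 C ρ l • dot 𝕜 C ρ k • u := by
  rw [← mul_smul, ← mul_smul]
  by_cases hk : k < Multiset.card ρ
  · by_cases hl : l < Multiset.card ρ
    · rw [(strandRel_klr 𝕜).x_x k l hk hl]
    · rw [dot_of_le 𝕜 (k := l) (by omega), zero_mul, mul_zero]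
  · rw [dot_of_le 𝕜 (k := k) (by omega), zero_mul, mul_zero]

theorem dot_smul_cross_smul {k l : ℕ} (h : l ≠ k) (h' : l ≠ k + 1) (u : M) :
    dot 𝕜 C ρ l • cross 𝕜 C ρ k • u = cross 𝕜 C ρ k • dot 𝕜 C ρ l • u := by
  rw [← mul_smul, ← mul_smul]
  by_cases hk : k + 1 < Multiset.card ρ
  · by_cases hl : l < Multiset.card ρ
    · rw [(strandRel_klr 𝕜).x_t k l hk hl h h']
    · rw [dot_of_le 𝕜 (k := l) (by omega), zero_mul, mul_zero]
  · rw [cross_of_le (by omega), zero_mul, mul_zero]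

theorem cross_smul_cross_smul {k l : ℕ} (h : k + 1 < l) (u : M) :
    cross 𝕜 C ρ l • cross 𝕜 C ρ k • u = cross 𝕜 C ρ k • cross 𝕜 C ρ l • u := by
  rw [← mul_smul, ← mul_smul]
  by_cases hl : l + 1 < Multiset.card ρ
  · rw [(strandRel_klr 𝕜).t_t k l hl h]
  · rw [cross_of_le (k := l) (by omega), zero_mul, mul_zero]

/-- A dot moves through a crossing, up to a multiple of the identity. -/
theorem dot_smul_cross_smul_e_smul (k j : ℕ) (s : Seq ρ) : ∃ (l : ℕ) (ε : ℤ), ∀ u : M,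
    dot 𝕜 C ρ k • cross 𝕜 C ρ j • gen 𝕜 C (.e s) • u
      = cross 𝕜 C ρ j • dot 𝕜 C ρ l • gen 𝕜 C (.e s) • u + ε • gen 𝕜 C (.e s) • u := by
  by_cases hj : j + 1 < Multiset.card ρ
  swap
  · exact ⟨k, 0, fun u => by rw [cross_of_le (by omega)]; simp⟩
  have H := strandRel_klr 𝕜 (C := C) (ρ := ρ)
  by_cases h1 : k = j
  · subst h1
    refine ⟨k + 1, ?_⟩
    by_cases hs : s.entry k (by omega) = s.entry (k + 1) hj ∧ C.IsReal (s.entry (k + 1) hj)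
    · refine ⟨1, fun u => ?_⟩
      have := congrArg (· • u) (H.slide_left_real k hj s hs.1 hs.2)
      simpa only [mul_smul, add_smul, one_smul] using this
    · refine ⟨0, fun u => ?_⟩
      have := congrArg (· • u) (H.slide_left k hj s hs)
      simpa only [mul_smul, zero_smul, add_zero] using this
  by_cases h2 : k = j + 1
  · subst h2
    refine ⟨j, ?_⟩
    by_cases hs : s.entry j (by omega) = s.entry (j + 1) hj ∧ C.IsReal (s.entry (j + 1) hj)
    · refine ⟨-1, fun u => ?_⟩
      have := congrArg (· • u) (H.slide_right_real j hj s hs.1 hs.2)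
      simp only [mul_smul, add_smul, one_smul] at this
      rw [this]
      simp
    · refine ⟨0, fun u => ?_⟩
      have := congrArg (· • u) (H.slide_right j hj s hs)
      simp only [mul_smul] at this
      rw [this]
      simp
  · exact ⟨k, 0, fun u => by rw [dot_smul_cross_smul h1 h2]; simp⟩

/-- Stability under idempotents, all dots, and the crossings of the first `Q` strands. -/
structure StableBelow (C : BorcherdsCartan I) (ρ : Multiset I) {M : Type*} [AddCommGroup M]
    [Module 𝕜 M] [Module (KLRAlgebra 𝕜 C ρ) M] (Q : ℕ) (U : Submodule 𝕜 M) : Prop where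
  e_mem : ∀ (s : Seq ρ), ∀ u ∈ U, gen 𝕜 C (.e s) • u ∈ U
  dot_mem : ∀ k, ∀ u ∈ U, dot 𝕜 C ρ k • u ∈ U
  cross_mem : ∀ k, k + 1 < Q → ∀ u ∈ U, cross 𝕜 C ρ k • u ∈ U

theorem dot_pow_smul_mem {U : Submodule 𝕜 M}
    (hx : ∀ k, ∀ u ∈ U, dot 𝕜 C ρ k • u ∈ U) (k n : ℕ) {u : M} (hu : u ∈ U) :
    dot 𝕜 C ρ k ^ n • u ∈ U := by
  induction n with
  | zero => simpa using hu
  | succ n ih => rw [pow_succ', mul_smul]; exact hx k _ ih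

/-- On each label sequence the square of a crossing is zero, the idempotent, or a polynomial in the
dots. -/
theorem cross_smul_cross_smul_mem {U : Submodule 𝕜 M}
    (he : ∀ (s : Seq ρ), ∀ u ∈ U, gen 𝕜 C (.e s) • u ∈ U)
    (hx : ∀ k, ∀ u ∈ U, dot 𝕜 C ρ k • u ∈ U) (k : ℕ) {u : M} (hu : u ∈ U) :
    cross 𝕜 C ρ k • cross 𝕜 C ρ k • u ∈ U := by
  by_cases hk : k + 1 < Multiset.card ρ
  swap
  · rw [cross_of_le (by omega), zero_smul]; exact zero_mem _
  rw [← sum_e_smul 𝕜 C (ρ := ρ) u, Finset.smul_sum, Finset.smul_sum]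
  refine Submodule.sum_mem _ fun s _ => ?_
  rw [← mul_smul, ← mul_smul]
  by_cases h : s.entry k (by omega) = s.entry (k + 1) hk
  · rw [(strandRel_klr 𝕜).quad_same k hk s h, zero_smul]; exact zero_mem _
  by_cases h' : C.form (s.entry k (by omega)) (s.entry (k + 1) hk) = 0
  · rw [(strandRel_klr 𝕜).quad_orth k hk s h h']; exact he s u hu
  · rw [(strandRel_klr 𝕜).quad k hk s h h', mul_smul, add_smul]
    exact add_mem (dot_pow_smul_mem hx _ _ (he s u hu)) (dot_pow_smul_mem hx _ _ (he s u hu))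

/-- The correction term of the braid relation is a polynomial in the dots, so the braid relation
holds modulo any space stable under idempotents and dots. -/
theorem braid_sub_braid_mem {U : Submodule 𝕜 M}
    (he : ∀ (s : Seq ρ), ∀ u ∈ U, gen 𝕜 C (.e s) • u ∈ U)
    (hx : ∀ k, ∀ u ∈ U, dot 𝕜 C ρ k • u ∈ U) (k : ℕ) {u : M} (hu : u ∈ U) :
    cross 𝕜 C ρ (k + 1) • cross 𝕜 C ρ k • cross 𝕜 C ρ (k + 1) • u -
      cross 𝕜 C ρ k • cross 𝕜 C ρ (k + 1) • cross 𝕜 C ρ k • u ∈ U := by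
  by_cases hk : k + 2 < Multiset.card ρ
  swap
  · rw [cross_of_le (k := k + 1) (by omega), zero_smul, zero_smul, smul_zero, sub_zero]
    exact zero_mem _
  rw [← sum_e_smul 𝕜 C (ρ := ρ) u]
  simp only [Finset.smul_sum, ← Finset.sum_sub_distrib]
  refine Submodule.sum_mem _ fun s _ => ?_
  have hm : ∀ j l, cross 𝕜 C ρ j • cross 𝕜 C ρ l • cross 𝕜 C ρ j • gen 𝕜 C (.e s) • u
      = (cross 𝕜 C ρ j * cross 𝕜 C ρ l * cross 𝕜 C ρ j * gen 𝕜 C (.e s)) • u := by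
    intro j l; simp only [mul_smul]
  rw [hm, hm]
  by_cases h : BraidCorrected C k hk s
  · rw [(strandRel_klr 𝕜).braid_corrected k hk s h, add_mul, add_smul, sub_add_cancel_left,
      mul_smul, Finset.sum_smul]
    refine neg_mem (Submodule.sum_mem _ fun c _ => ?_)
    rw [mul_smul]
    exact dot_pow_smul_mem hx _ _ (dot_pow_smul_mem hx _ _ (he s u hu))
  · rw [(strandRel_klr 𝕜).braid k hk s h, sub_self]
    exact zero_mem _

variable [IsScalarTower 𝕜 (KLRAlgebra 𝕜 C ρ) M]

/-- The space `τ_{Q-c} ⋯ τ_{Q-1} U`. -/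
def sweep (C : BorcherdsCartan I) (ρ : Multiset I) {M : Type*} [AddCommGroup M]
    [Module 𝕜 M] [Module (KLRAlgebra 𝕜 C ρ) M] [IsScalarTower 𝕜 (KLRAlgebra 𝕜 C ρ) M]
    (Q : ℕ) (U : Submodule 𝕜 M) : ℕ → Submodule 𝕜 M
  | 0 => U
  | c + 1 => (sweep C ρ Q U c).map (Algebra.lsmul 𝕜 𝕜 M (cross 𝕜 C ρ (Q - (c + 1))))

/-- The sum of the spaces `τ_{Q-l} ⋯ τ_{Q-1} U` with `l ≤ c`. -/
def fan (C : BorcherdsCartan I) (ρ : Multiset I) {M : Type*} [AddCommGroup M]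
    [Module 𝕜 M] [Module (KLRAlgebra 𝕜 C ρ) M] [IsScalarTower 𝕜 (KLRAlgebra 𝕜 C ρ) M]
    (Q : ℕ) (U : Submodule 𝕜 M) : ℕ → Submodule 𝕜 M
  | 0 => U
  | c + 1 => sweep C ρ Q U (c + 1) ⊔ fan C ρ Q U c

variable {Q : ℕ} {U : Submodule 𝕜 M}

theorem sweep_le_fan (c : ℕ) : sweep C ρ Q U c ≤ fan C ρ Q U c := by
  cases c with
  | zero => exact le_rfl
  | succ c => exact le_sup_left

theorem fan_mono {c d : ℕ} (h : c ≤ d) : fan C ρ Q U c ≤ fan C ρ Q U d := by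
  induction h with
  | refl => exact le_rfl
  | step _ ih => exact ih.trans le_sup_right

theorem fan_le {W : Submodule 𝕜 M} {c : ℕ} (h : ∀ l ≤ c, sweep C ρ Q U l ≤ W) :
    fan C ρ Q U c ≤ W := by
  induction c with
  | zero => exact h 0 le_rfl
  | succ c ih => exact sup_le (h _ le_rfl) (ih fun l hl => h l (by omega))

theorem smul_mem_of_fan {W : Submodule 𝕜 M} {c : ℕ} (a : KLRAlgebra 𝕜 C ρ)
    (h : ∀ l ≤ c, ∀ u ∈ sweep C ρ Q U l, a • u ∈ W) {u : M} (hu : u ∈ fan C ρ Q U c) :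
    a • u ∈ W := by
  have : fan C ρ Q U c ≤ W.comap (Algebra.lsmul 𝕜 𝕜 M a) := fan_le h
  exact this hu

/-- The position is given by k + (c + 1) = Q instead of k = Q - (c + 1), to avoid truncated
subtraction. -/
theorem cross_smul_mem_sweep {c k : ℕ} (h : k + (c + 1) = Q) {u : M}
    (hu : u ∈ sweep C ρ Q U c) : cross 𝕜 C ρ k • u ∈ sweep C ρ Q U (c + 1) :=
  ⟨u, hu, by rw [← h, Nat.add_sub_cancel]; rfl⟩

theorem exists_of_mem_sweep_succ {c k : ℕ} (h : k + (c + 1) = Q) {u : M}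
    (hu : u ∈ sweep C ρ Q U (c + 1)) : ∃ w ∈ sweep C ρ Q U c, u = cross 𝕜 C ρ k • w := by
  obtain ⟨w, hw, rfl⟩ := hu
  exact ⟨w, hw, by rw [← h, Nat.add_sub_cancel]; rfl⟩

namespace StableBelow

theorem e_sweep (hU : StableBelow C ρ Q U) {c : ℕ} (hc : c ≤ Q) (s : Seq ρ) {u : M}
    (hu : u ∈ sweep C ρ Q U c) : gen 𝕜 C (.e s) • u ∈ sweep C ρ Q U c := by
  induction c generalizing s u with
  | zero => exact hU.e_mem s u hu
  | succ c ih =>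
    obtain ⟨w, hw, rfl⟩ := exists_of_mem_sweep_succ (k := Q - (c + 1)) (by omega) hu
    rw [e_smul_cross_smul]
    exact cross_smul_mem_sweep (by omega) (ih (by omega) _ hw)

theorem e_fan (hU : StableBelow C ρ Q U) {c : ℕ} (hc : c ≤ Q) (s : Seq ρ) {u : M}
    (hu : u ∈ fan C ρ Q U c) : gen 𝕜 C (.e s) • u ∈ fan C ρ Q U c :=
  smul_mem_of_fan _ (fun l hl w hw =>
    fan_mono hl (sweep_le_fan l (hU.e_sweep (by omega) s hw))) hu

/-- The crossing is at distance at least two from all of τ_{Q-c}, …, τ_{Q-1}, so it commutes with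
them and reaches U. -/
theorem cross_sweep (hU : StableBelow C ρ Q U) {c k : ℕ} (hc : k + c + 1 < Q) {u : M}
    (hu : u ∈ sweep C ρ Q U c) : cross 𝕜 C ρ k • u ∈ sweep C ρ Q U c := by
  induction c generalizing u with
  | zero => exact hU.cross_mem k (by omega) u hu
  | succ c ih =>
    obtain ⟨w, hw, rfl⟩ := exists_of_mem_sweep_succ (k := Q - (c + 1)) (by omega) hu
    rw [← cross_smul_cross_smul (by omega)]
    exact cross_smul_mem_sweep (by omega) (ih (by omega) hw)

theorem cross_fan (hU : StableBelow C ρ Q U) {c k : ℕ} (h : k + (c + 1) = Q) {u : M}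
    (hu : u ∈ fan C ρ Q U c) : cross 𝕜 C ρ k • u ∈ fan C ρ Q U (c + 1) := by
  refine smul_mem_of_fan _ (fun l hl w hw => ?_) hu
  by_cases hlc : l = c
  · subst hlc
    exact sweep_le_fan _ (cross_smul_mem_sweep h hw)
  · exact fan_mono (by omega : l ≤ c + 1) (sweep_le_fan l (hU.cross_sweep (by omega) hw))

/-- Sliding the dot through the leftmost crossing leaves at most a multiple of a vector of the
shorter sweep; this error is why the result is only in the fan. -/
theorem dot_sweep (hU : StableBelow C ρ Q U) {c : ℕ} (hc : c ≤ Q) (k : ℕ) {u : M}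
    (hu : u ∈ sweep C ρ Q U c) : dot 𝕜 C ρ k • u ∈ fan C ρ Q U c := by
  induction c generalizing k u with
  | zero => exact hU.dot_mem k u hu
  | succ c ih =>
    obtain ⟨w, hw, rfl⟩ := exists_of_mem_sweep_succ (k := Q - (c + 1)) (by omega) hu
    rw [← sum_e_smul 𝕜 C (ρ := ρ) w, Finset.smul_sum, Finset.smul_sum]
    refine Submodule.sum_mem _ fun s _ => ?_
    obtain ⟨l, ε, h⟩ := dot_smul_cross_smul_e_smul (𝕜 := 𝕜) (C := C) (M := M) k (Q - (c + 1)) s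
    rw [h]
    have hs := hU.e_sweep (by omega) s hw
    refine add_mem (hU.cross_fan (by omega) (ih (by omega) l hs)) (zsmul_mem ?_ ε)
    exact fan_mono (Nat.le_succ c) (sweep_le_fan c hs)

theorem dot_fan (hU : StableBelow C ρ Q U) {c : ℕ} (hc : c ≤ Q) (k : ℕ) {u : M}
    (hu : u ∈ fan C ρ Q U c) : dot 𝕜 C ρ k • u ∈ fan C ρ Q U c :=
  smul_mem_of_fan _ (fun _ hl _ hw => fan_mono hl (hU.dot_sweep (by omega) k hw)) hu

/-- The crossing hits the chain τ_{Q-c} ⋯ τ_{Q-1} in one of three ways. At the leftmost position the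
quadratic relation applies, at the next one the braid relation, and further to the right it commutes
with the leftmost crossing, which leaves a shorter chain. -/
theorem cross_sweep_mem_fan (hU : StableBelow C ρ Q U) {c k : ℕ} (hc : c ≤ Q) (hk : k < Q)
    (hck : Q ≤ k + c) {u : M} (hu : u ∈ sweep C ρ Q U c) :
    cross 𝕜 C ρ k • u ∈ fan C ρ Q U c := by
  induction c generalizing u with
  | zero => omega
  | succ c ih =>
    obtain ⟨w, hw, rfl⟩ := exists_of_mem_sweep_succ (k := Q - (c + 1)) (by omega) hu
    by_cases h1 : k = Q - (c + 1)
    · rw [← h1]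
      exact fan_mono (Nat.le_succ c) (cross_smul_cross_smul_mem
        (fun s u hu => hU.e_fan (by omega) s hu) (fun k u hu => hU.dot_fan (by omega) k hu) k
        (sweep_le_fan c hw))
    by_cases h2 : k = Q - (c + 1) + 1
    · obtain ⟨c, rfl⟩ : ∃ d, c = d + 1 := ⟨c - 1, by omega⟩
      obtain ⟨w, hw', rfl⟩ := exists_of_mem_sweep_succ (k := k) (by omega) hw
      obtain ⟨j, hj⟩ : ∃ j, j = Q - (c + 1 + 1) := ⟨_, rfl⟩
      rw [← hj] at h2 ⊢
      subst h2
      have h3 := fan_mono (by omega : c ≤ c + 1 + 1) (braid_sub_braid_mem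
        (fun s u hu => hU.e_fan (by omega) s hu) (fun k u hu => hU.dot_fan (by omega) k hu) j
        (sweep_le_fan c hw'))
      rw [← sub_add_cancel (cross 𝕜 C ρ (j + 1) • _) _]
      -- After the braid move the innermost τ_j is distant from the remaining chain of length c, so
      -- it stays in that sweep; the two outer crossings then extend the chain.
      refine add_mem h3 (sweep_le_fan _ ?_)
      exact cross_smul_mem_sweep (by omega) (cross_smul_mem_sweep (by omega)
        (hU.cross_sweep (by omega) hw'))
    · rw [cross_smul_cross_smul (by omega)]
      exact hU.cross_fan (by omega) (ih (by omega) (by omega) hw)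

/-- The chains τ_{Q-c} ⋯ τ_{Q-1} with 0 ≤ c ≤ Q represent the minimal left coset representatives of
S_Q in S_{Q+1}, so their span on U absorbs all crossings of one more strand. -/
theorem fan (hU : StableBelow C ρ Q U) : StableBelow C ρ (Q + 1) (fan C ρ Q U Q) where
  e_mem s _ hu := hU.e_fan le_rfl s hu
  dot_mem k _ hu := hU.dot_fan le_rfl k hu
  cross_mem k hk u hu := by
    refine smul_mem_of_fan _ (fun c hc w hw => ?_) hu
    by_cases h1 : k + c + 1 < Q
    · exact fan_mono hc (sweep_le_fan _ (hU.cross_sweep h1 hw))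
    by_cases h2 : k + (c + 1) = Q
    · exact fan_mono (by omega) (sweep_le_fan _ (cross_smul_mem_sweep h2 hw))
    · exact fan_mono hc (hU.cross_sweep_mem_fan hc (by omega) (by omega) hw)

/-- A subspace that is stable under all generators is a submodule. -/
theorem smul_mem (hU : StableBelow C ρ (Multiset.card ρ) U) (a : KLRAlgebra 𝕜 C ρ) {u : M}
    (hu : u ∈ U) : a • u ∈ U := by
  induction a using algebra_induction 𝕜 generalizing u with
  | scalar c => rw [algebraMap_smul]; exact U.smul_mem c hu
  | add a b ha hb => rw [add_smul]; exact add_mem (ha hu) (hb hu)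
  | mul a b ha hb => rw [mul_smul]; exact ha (hb hu)
  | gen g =>
    cases g with
    | e s => exact hU.e_mem s u hu
    | x k hk s => rw [← dot_mul_e 𝕜 hk s, mul_smul]; exact hU.dot_mem k _ (hU.e_mem s u hu)
    | t k hk s => rw [← cross_mul_e 𝕜 hk s, mul_smul]; exact hU.cross_mem k hk _ (hU.e_mem s u hu)

end StableBelow

/-- The subspace generated from `U` by the generators on the first `q + p` strands. -/
def tower (C : BorcherdsCartan I) (ρ : Multiset I) {M : Type*} [AddCommGroup M]
    [Module 𝕜 M] [Module (KLRAlgebra 𝕜 C ρ) M] [IsScalarTower 𝕜 (KLRAlgebra 𝕜 C ρ) M]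
    (q : ℕ) (U : Submodule 𝕜 M) : ℕ → Submodule 𝕜 M
  | 0 => U
  | p + 1 => fan C ρ (q + p) (tower C ρ q U p) (q + p)

theorem StableBelow.tower {q : ℕ} (hU : StableBelow C ρ q U) (p : ℕ) :
    StableBelow C ρ (q + p) (tower C ρ q U p) := by
  induction p with
  | zero => exact hU
  | succ p ih => exact ih.fan

theorem le_tower (q p : ℕ) : U ≤ tower C ρ q U p := by
  induction p with
  | zero => exact le_rfl
  | succ p ih => exact ih.trans (fan_mono (Nat.zero_le (q + p)))

instance finite_sweep [Module.Finite 𝕜 U] (c : ℕ) : Module.Finite 𝕜 (sweep C ρ Q U c) := by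
  induction c with
  | zero => assumption
  | succ c ih => exact Module.Finite.map _ _

instance finite_fan [Module.Finite 𝕜 U] (c : ℕ) : Module.Finite 𝕜 (fan C ρ Q U c) := by
  induction c with
  | zero => assumption
  | succ c ih =>
    have := finite_sweep (C := C) (ρ := ρ) (Q := Q) (U := U) (c + 1)
    exact Submodule.finite_sup _ _

/-- Only finitely many chains occur, so modules generated by a finite-dimensional space of this kind
are finite-dimensional. -/
instance finite_tower [Module.Finite 𝕜 U] (q p : ℕ) : Module.Finite 𝕜 (tower C ρ q U p) := by
  induction p with
  | zero => assumption
  | succ p ih => exact finite_fan _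

/-- The submodule generated by `U`. -/
theorem mem_tower_of_mem_span {q p : ℕ} (hU : StableBelow C ρ q U) (h : q + p = Multiset.card ρ)
    {u : M} (hu : u ∈ Submodule.span (KLRAlgebra 𝕜 C ρ) (U : Set M)) : u ∈ tower C ρ q U p := by
  induction hu using Submodule.span_induction with
  | mem u hu => exact le_tower q p hu
  | zero => exact zero_mem _
  | add _ _ _ _ hx hy => exact add_mem hx hy
  | smul a x _ hx => exact (h ▸ hU.tower p : StableBelow C ρ (Multiset.card ρ) _).smul_mem a hx

end Spanning

/-! ### Sequences ending in i, and the action of dots and crossings on the tail. -/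

section Tails

universe v

variable {I : Type v} {ρ : Multiset I} {𝕜 : Type*} [Field 𝕜] {C : BorcherdsCartan I}

/-- All entries of `s` from position `q` on are equal to `i`. -/
def Tail (i : I) (q : ℕ) (s : Seq ρ) : Prop :=
  ∀ r (hr : r < Multiset.card ρ), q ≤ r → s.entry r hr = i

theorem Tail.mono {i : I} {q q' : ℕ} {s : Seq ρ} (h : Tail i q s) (hq : q ≤ q') : Tail i q' s :=
  fun r hr hqr => h r hr (hq.trans hqr)

theorem Tail.swap_eq {i : I} {q k : ℕ} {s : Seq ρ} (h : Tail i q s) (hk : q ≤ k)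
    (hk' : k + 1 < Multiset.card ρ) : s.swap k = s := by
  refine Seq.ext_entry fun r hr => ?_
  by_cases h1 : r = k
  · subst h1
    rw [Seq.entry_swap_left s r hk', h _ _ (by omega), h _ _ hk]
  by_cases h2 : r = k + 1
  · subst h2
    rw [Seq.entry_swap_right s k hk', h _ _ hk, h _ _ (by omega)]
  · rw [Seq.entry_swap_other s k r hk' hr h1 h2]

theorem tail_swap_iff {i : I} {q k : ℕ} {s : Seq ρ} (hk : k + 1 < q)
    (hk' : k + 1 < Multiset.card ρ) : Tail i q (s.swap k) ↔ Tail i q s := by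
  refine forall_congr' fun r => forall_congr' fun hr => forall_congr' fun hqr => ?_
  rw [Seq.entry_swap_other s k r hk' hr (by omega) (by omega)]

variable {M : Type*} [AddCommGroup M] [Module 𝕜 M] [Module (KLRAlgebra 𝕜 C ρ) M]

/-- The smallest subspace that contains `U` and is stable under the crossings at positions
`k ≥ q`. -/
def crossSpan (C : BorcherdsCartan I) (ρ : Multiset I) {M : Type*} [AddCommGroup M]
    [Module 𝕜 M] [Module (KLRAlgebra 𝕜 C ρ) M] (q : ℕ) (U : Submodule 𝕜 M) : Submodule 𝕜 M :=
  sInf {W | U ≤ W ∧ ∀ k, q ≤ k → ∀ u ∈ W, cross 𝕜 C ρ k • u ∈ W}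

theorem le_crossSpan (q : ℕ) (U : Submodule 𝕜 M) : U ≤ crossSpan C ρ q U :=
  le_sInf fun _ hW => hW.1

theorem cross_smul_mem_crossSpan {q : ℕ} {U : Submodule 𝕜 M} {k : ℕ} (hk : q ≤ k) {u : M}
    (hu : u ∈ crossSpan C ρ q U) : cross 𝕜 C ρ k • u ∈ crossSpan C ρ q U := by
  rw [crossSpan, Submodule.mem_sInf] at hu ⊢
  exact fun W hW => hW.2 k hk u (hu W hW)

theorem crossSpan_le {q : ℕ} {U W : Submodule 𝕜 M} (h : U ≤ W)
    (h' : ∀ k, q ≤ k → ∀ u ∈ W, cross 𝕜 C ρ k • u ∈ W) : crossSpan C ρ q U ≤ W :=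
  sInf_le ⟨h, h'⟩

/-- The vectors supported on the sequences with tail `i, ..., i` from position `q` on. -/
def OnTail (𝕜 : Type*) [Field 𝕜] (C : BorcherdsCartan I) (ρ : Multiset I) {M : Type*} [AddCommGroup M]
    [Module 𝕜 M] [Module (KLRAlgebra 𝕜 C ρ) M] [IsScalarTower 𝕜 (KLRAlgebra 𝕜 C ρ) M]
    (i : I) (q : ℕ) : Submodule 𝕜 M where
  carrier := {u | ∀ s : Seq ρ, ¬Tail i q s → gen 𝕜 C (.e s) • u = 0}
  zero_mem' s _ := smul_zero _
  add_mem' hu hv s hs := by rw [smul_add, hu s hs, hv s hs, add_zero]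
  smul_mem' c u hu s hs := by rw [smul_comm, hu s hs, smul_zero]

variable [IsScalarTower 𝕜 (KLRAlgebra 𝕜 C ρ) M]

section Support

variable {q p : ℕ} {i : I} {U : Submodule 𝕜 M}

/-- The supports of the vectors that are obtained by moving one more strand with label `i` to
the left. -/
theorem sweep_support {Q c : ℕ} {D : Submodule 𝕜 M} (hQ : Q < Multiset.card ρ) (hq : q ≤ Q)
    (hD : ∀ k, q ≤ k → ∀ u ∈ D, cross 𝕜 C ρ k • u ∈ D)
    (h1 : ∀ t : Seq ρ, ¬Tail i Q t → ∀ u ∈ U, gen 𝕜 C (.e t) • u = 0)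
    (h2 : ∀ t : Seq ρ, ∀ q' < q, Tail i q' t → ∀ u ∈ U, gen 𝕜 C (.e t) • u = 0)
    (h3 : ∀ t : Seq ρ, Tail i q t → ∀ u ∈ U, gen 𝕜 C (.e t) • u ∈ D) (hc : c ≤ Q) {u : M}
    (hu : u ∈ sweep C ρ Q U c) (t : Seq ρ) :
    (¬Tail i (Q + 1) t → gen 𝕜 C (.e t) • u = 0) ∧
    (t.entry (Q - c) (by omega) ≠ i → gen 𝕜 C (.e t) • u = 0) ∧
    (∀ q' < q, Tail i q' t → gen 𝕜 C (.e t) • u = 0) ∧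
    (Tail i q t → gen 𝕜 C (.e t) • u ∈ D) ∧
    (Q - c < q → Tail i q t → gen 𝕜 C (.e t) • u = 0) := by
  -- The second conjunct says that the swept strand, now at position Q - c, has label i. The last
  -- one, vanishing on tails from q once that strand has moved left of q, is the strengthening that
  -- carries the induction.
  induction c generalizing u t with
  | zero =>
    refine ⟨fun ht => h1 t (fun h => ht (h.mono (by omega))) u hu, fun ht => ?_,
      fun q' hq' ht => h2 t q' hq' ht u hu, fun ht => h3 t ht u hu, fun h => by omega⟩
    exact h1 t (fun h => ht (h _ _ (by omega))) u hu
  | succ c ih =>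
    obtain ⟨j, hj⟩ : ∃ j, j + (c + 1) = Q := ⟨Q - (c + 1), by omega⟩
    obtain ⟨w, hw, rfl⟩ := exists_of_mem_sweep_succ hj hu
    have hjQ : Q - (c + 1) = j := by omega
    have hjQ' : Q - c = j + 1 := by omega
    have hj' : j + 1 < Multiset.card ρ := by omega
    obtain ⟨g1, g2, g3, g4, g5⟩ := ih (by omega) hw (t.swap j)
    simp only [hjQ, hjQ'] at *
    rw [Seq.entry_swap_right t j hj'] at g2
    rw [e_smul_cross_smul]
    -- Compare the start q' of the tail with the crossing at j. If q' ≤ j the swap fixes the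
    -- sequence; if q' > j + 1 it does not touch the tail. If q' = j + 1, either the entry at j is i
    -- and the swapped sequence has the same tail, or the swept strand would have a label other than
    -- i.
    have key : ∀ q' < q, Tail i q' t → cross 𝕜 C ρ j • gen 𝕜 C (.e (t.swap j)) • w = 0 := by
      intro q' hq' ht
      by_cases hjq : q' ≤ j
      · rw [g3 q' hq' (by rwa [ht.swap_eq hjq hj']), smul_zero]
      by_cases hjq2 : j + 1 = q'
      · by_cases hti : t.entry j (by omega) = i
        · rw [g3 q' hq', smul_zero]
          intro r hr hqr
          by_cases hr' : r = j + 1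
          · subst hr'
            rw [Seq.entry_swap_right t j hj', hti]
          · rw [Seq.entry_swap_other t j r hj' hr (by omega) hr', ht r hr hqr]
        · rw [g2 hti, smul_zero]
      · rw [g3 q' hq' ((tail_swap_iff (by omega) hj').2 ht), smul_zero]
    -- When the strand first crosses position q, an entry i at j would make a tail longer than
    -- allowed, and any other entry contradicts the label of the swept strand.
    have key2 : j < q → Tail i q t → cross 𝕜 C ρ j • gen 𝕜 C (.e (t.swap j)) • w = 0 := by
      intro hjq ht
      by_cases hjq2 : j + 1 = q
      · by_cases hti : t.entry j (by omega) = i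
        · refine key j hjq fun r hr hqr => ?_
          by_cases hr' : r = j
          · subst hr'; exact hti
          · exact ht r hr (by omega)
        · rw [g2 hti, smul_zero]
      · rw [g5 (by omega) ((tail_swap_iff (by omega) hj').2 ht), smul_zero]
    refine ⟨fun ht => ?_, fun ht => ?_, key, fun ht => ?_, key2⟩
    · rw [g1 (by rwa [tail_swap_iff (by omega) hj']), smul_zero]
    · rw [g2 ht, smul_zero]
    · by_cases hjq : q ≤ j
      · rw [ht.swap_eq hjq hj']
        rw [ht.swap_eq hjq hj'] at g4
        exact hD j hjq _ (g4 ht)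
      · rw [key2 (by omega) ht]
        exact zero_mem _

/-- A shuffle that carries a strand from the tail into the left block can only give the full tail
again if it brings another i out of that block, which the absence of longer tails in U forbids.
Hence the components with full tail come from crossings inside the tail alone. This replaces the
Mackey filtration of the restriction of an induced module. -/
theorem tower_support (h1 : ∀ t : Seq ρ, ¬Tail i q t → ∀ u ∈ U, gen 𝕜 C (.e t) • u = 0)
    (h2 : ∀ t : Seq ρ, ∀ q' < q, Tail i q' t → ∀ u ∈ U, gen 𝕜 C (.e t) • u = 0)
    (h3 : ∀ t : Seq ρ, ∀ u ∈ U, gen 𝕜 C (.e t) • u ∈ U) (hp : q + p ≤ Multiset.card ρ) (t : Seq ρ) :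
    (¬Tail i (q + p) t → ∀ u ∈ tower C ρ q U p, gen 𝕜 C (.e t) • u = 0) ∧
    (∀ q' < q, Tail i q' t → ∀ u ∈ tower C ρ q U p, gen 𝕜 C (.e t) • u = 0) ∧
    (Tail i q t → ∀ u ∈ tower C ρ q U p, gen 𝕜 C (.e t) • u ∈ crossSpan C ρ q U) := by
  induction p generalizing t with
  | zero => exact ⟨h1 t, h2 t, fun _ u hu => le_crossSpan q U (h3 t u hu)⟩
  | succ p ih =>
    have ih := fun t => ih (by omega) t
    have key := fun (c : ℕ) (hc : c ≤ q + p) (u : M) hu => sweep_support (c := c) (u := u)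
      (by omega : q + p < Multiset.card ρ) (by omega)
      (fun k hk u hu => cross_smul_mem_crossSpan (𝕜 := 𝕜) (U := U) hk hu)
      (fun t => (ih t).1) (fun t => (ih t).2.1) (fun t => (ih t).2.2) hc hu t
    refine ⟨fun ht u hu => ?_, fun q' hq' ht u hu => ?_, fun ht u hu => ?_⟩
    · rw [← Submodule.mem_bot 𝕜]
      exact smul_mem_of_fan _ (fun c hc w hw => (Submodule.mem_bot 𝕜).2 ((key c hc w hw).1 ht)) hu
    · rw [← Submodule.mem_bot 𝕜]
      exact smul_mem_of_fan _ (fun c hc w hw =>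
        (Submodule.mem_bot 𝕜).2 ((key c hc w hw).2.2.1 q' hq' ht)) hu
    · exact smul_mem_of_fan _ (fun c hc w hw => (key c hc w hw).2.2.2.1 ht) hu

end Support

section Relations

variable {q : ℕ} {i : I} {u : M}

theorem smul_eq_smul_of_onTail {a b : KLRAlgebra 𝕜 C ρ}
    (hu : u ∈ OnTail 𝕜 C ρ i q)
    (h : ∀ s : Seq ρ, Tail i q s → a * gen 𝕜 C (.e s) = b * gen 𝕜 C (.e s)) :
    a • u = b • u := by
  rw [← sum_e_smul 𝕜 C (ρ := ρ) u, Finset.smul_sum, Finset.smul_sum]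
  refine Finset.sum_congr rfl fun s _ => ?_
  by_cases hs : Tail i q s
  · rw [← mul_smul, ← mul_smul, h s hs]
  · rw [hu s hs, smul_zero, smul_zero]

theorem dot_smul_mem_onTail (hu : u ∈ OnTail 𝕜 C ρ i q) (k : ℕ) :
    dot 𝕜 C ρ k • u ∈ OnTail 𝕜 C ρ i q := by
  intro s hs
  rw [← dot_smul_e_smul, hu s hs, smul_zero]

theorem dot_pow_smul_mem_onTail (hu : u ∈ OnTail 𝕜 C ρ i q) (k n : ℕ) :
    dot 𝕜 C ρ k ^ n • u ∈ OnTail 𝕜 C ρ i q :=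
  dot_pow_smul_mem (fun k _ hu => dot_smul_mem_onTail hu k) k n hu

theorem cross_smul_mem_onTail (hu : u ∈ OnTail 𝕜 C ρ i q) {k : ℕ} (hk : q ≤ k) :
    cross 𝕜 C ρ k • u ∈ OnTail 𝕜 C ρ i q := by
  intro s hs
  by_cases hk' : k + 1 < Multiset.card ρ
  · rw [e_smul_cross_smul, hu, smul_zero]
    intro h
    have := h.swap_eq hk hk'
    rw [Seq.swap_swap s k hk'] at this
    rw [← this] at h
    exact hs h
  · rw [cross_of_le (by omega), zero_smul, smul_zero]

/-- All labels on the tail are equal, so the crossings there satisfy the nil-Coxeter relations: this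
one, the uncorrected braid relation `braid_onTail`, and distant commutation. -/
theorem cross_smul_cross_smul_onTail (hu : u ∈ OnTail 𝕜 C ρ i q) {k : ℕ} (hk : q ≤ k) :
    cross 𝕜 C ρ k • cross 𝕜 C ρ k • u = 0 := by
  by_cases hk' : k + 1 < Multiset.card ρ
  swap
  · rw [cross_of_le (by omega), zero_smul]
  rw [← mul_smul, ← zero_smul (KLRAlgebra 𝕜 C ρ) u]
  refine smul_eq_smul_of_onTail hu fun s hs => ?_
  rw [(strandRel_klr 𝕜).quad_same k hk' s (by rw [hs _ _ hk, hs _ _ (by omega)]), zero_mul]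

theorem braid_onTail (hu : u ∈ OnTail 𝕜 C ρ i q) {k : ℕ} (hk : q ≤ k) :
    cross 𝕜 C ρ k • cross 𝕜 C ρ (k + 1) • cross 𝕜 C ρ k • u =
      cross 𝕜 C ρ (k + 1) • cross 𝕜 C ρ k • cross 𝕜 C ρ (k + 1) • u := by
  by_cases hk' : k + 2 < Multiset.card ρ
  swap
  · rw [cross_of_le (k := k + 1) (by omega), zero_smul, zero_smul, smul_zero]
  simp only [← mul_smul]
  refine smul_eq_smul_of_onTail hu fun s hs => ?_
  have := (strandRel_klr 𝕜 (C := C)).braid k hk' s fun h => h.2.1 (by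
    rw [hs _ _ hk, hs _ _ (by omega)])
  simpa only [mul_assoc] using this

theorem dot_succ_smul_cross_smul (hi : C.IsReal i) (hu : u ∈ OnTail 𝕜 C ρ i q) {k : ℕ}
    (hk : q ≤ k) (hk' : k + 1 < Multiset.card ρ) :
    dot 𝕜 C ρ (k + 1) • cross 𝕜 C ρ k • u = cross 𝕜 C ρ k • dot 𝕜 C ρ k • u - u := by
  rw [eq_sub_iff_add_eq]
  nth_rewrite 2 [← one_smul (KLRAlgebra 𝕜 C ρ) u]
  rw [← mul_smul, ← mul_smul, ← add_smul]
  refine (smul_eq_smul_of_onTail hu fun s hs => ?_).symm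
  have h1 := hs k (by omega) hk
  have h2 := hs (k + 1) hk' (by omega)
  exact (strandRel_klr 𝕜).slide_right_real k hk' s (by rw [h1, h2]) (by rwa [h2])

theorem dot_smul_cross_smul_of_not_isReal (hi : ¬C.IsReal i) (hu : u ∈ OnTail 𝕜 C ρ i q) {k : ℕ}
    (hk : q ≤ k) (l : ℕ) : ∃ l', (q ≤ l → q ≤ l') ∧
    dot 𝕜 C ρ l • cross 𝕜 C ρ k • u = cross 𝕜 C ρ k • dot 𝕜 C ρ l' • u := by
  by_cases hk' : k + 1 < Multiset.card ρ
  swap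
  · exact ⟨l, id, by rw [cross_of_le (by omega), zero_smul, zero_smul, smul_zero]⟩
  have hs' : ∀ s : Seq ρ, Tail i q s → ¬(s.entry k (by omega) = s.entry (k + 1) hk' ∧
      C.IsReal (s.entry (k + 1) hk')) := by
    intro s hs h
    rw [hs (k + 1) hk' (by omega)] at h
    exact hi h.2
  by_cases h1 : l = k
  · subst h1
    refine ⟨l + 1, fun _ => by omega, ?_⟩
    rw [← mul_smul, ← mul_smul]
    exact smul_eq_smul_of_onTail hu fun s hs =>
      (strandRel_klr 𝕜).slide_left l hk' s (hs' s hs)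
  by_cases h2 : l = k + 1
  · subst h2
    refine ⟨k, fun _ => hk, ?_⟩
    rw [← mul_smul, ← mul_smul]
    exact smul_eq_smul_of_onTail hu fun s hs =>
      ((strandRel_klr 𝕜).slide_right k hk' s (hs' s hs)).symm
  · exact ⟨l, id, dot_smul_cross_smul h1 h2 u⟩

/-- The product `τ_{j+l-1} ⋯ τ_{j+1} τ_j`. -/
def descend (𝕜 : Type*) [Field 𝕜] (C : BorcherdsCartan I) (ρ : Multiset I) (j : ℕ) :
    ℕ → KLRAlgebra 𝕜 C ρ
  | 0 => 1
  | l + 1 => cross 𝕜 C ρ (j + l) * descend 𝕜 C ρ j l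

theorem descend_succ' (j l : ℕ) :
    descend 𝕜 C ρ j (l + 1) = descend 𝕜 C ρ (j + 1) l * cross 𝕜 C ρ j := by
  induction l with
  | zero => simp [descend]
  | succ l ih =>
    rw [descend, ih, descend, mul_assoc, show j + (l + 1) = j + 1 + l by omega]

theorem descend_smul_mem {W : Submodule 𝕜 M} {j : ℕ}
    (hW : ∀ k, j ≤ k → ∀ u ∈ W, cross 𝕜 C ρ k • u ∈ W) (l : ℕ) (hu : u ∈ W) :
    descend 𝕜 C ρ j l • u ∈ W := by
  induction l with
  | zero => simpa [descend] using hu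
  | succ l ih => rw [descend, mul_smul]; exact hW _ (by omega) _ ih

theorem descend_smul_mem_onTail (hu : u ∈ OnTail 𝕜 C ρ i q) {j : ℕ} (hj : q ≤ j) (l : ℕ) :
    descend 𝕜 C ρ j l • u ∈ OnTail 𝕜 C ρ i q :=
  descend_smul_mem (fun _ hk _ hu => cross_smul_mem_onTail hu (hj.trans hk)) l hu

theorem cross_smul_descend_smul {j l k : ℕ} (hk : j + l < k) (u : M) :
    cross 𝕜 C ρ k • descend 𝕜 C ρ j l • u = descend 𝕜 C ρ j l • cross 𝕜 C ρ k • u := by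
  induction l with
  | zero => simp [descend]
  | succ l ih =>
    rw [descend, mul_smul, mul_smul, cross_smul_cross_smul (by omega), ih (by omega)]

theorem descend_smul_cross_smul_of_lt {j l k : ℕ} (hk : k + 1 < j) (u : M) :
    descend 𝕜 C ρ j l • cross 𝕜 C ρ k • u = cross 𝕜 C ρ k • descend 𝕜 C ρ j l • u := by
  induction l with
  | zero => simp [descend]
  | succ l ih =>
    rw [descend, mul_smul, mul_smul, ih, cross_smul_cross_smul (by omega)]

theorem dot_smul_descend_smul {j l k : ℕ} (hk : j + l < k) (u : M) :
    dot 𝕜 C ρ k • descend 𝕜 C ρ j l • u = descend 𝕜 C ρ j l • dot 𝕜 C ρ k • u := by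
  induction l with
  | zero => simp [descend]
  | succ l ih =>
    rw [descend, mul_smul, mul_smul, dot_smul_cross_smul (by omega) (by omega), ih (by omega)]

theorem descend_smul_cross_smul_self (hu : u ∈ OnTail 𝕜 C ρ i q) {j : ℕ} (hj : q ≤ j) (l : ℕ) :
    descend 𝕜 C ρ j (l + 1) • cross 𝕜 C ρ j • u = 0 := by
  induction l with
  | zero => simpa [descend] using cross_smul_cross_smul_onTail hu hj
  | succ l ih => rw [descend, mul_smul, ih, smul_zero]

/-- The braid relation conjugates crossings along the cycle τ_{j+l-1} ⋯ τ_j and lowers their index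
by one. -/
theorem descend_smul_cross_smul (hu : u ∈ OnTail 𝕜 C ρ i q) {j l k : ℕ} (hj : q ≤ j)
    (hk : j ≤ k) (hk' : k + 1 < j + l) :
    descend 𝕜 C ρ j l • cross 𝕜 C ρ (k + 1) • u = cross 𝕜 C ρ k • descend 𝕜 C ρ j l • u := by
  induction l with
  | zero => omega
  | succ l ih =>
    by_cases h : k + 1 = j + l
    · obtain ⟨l, rfl⟩ : ∃ d, l = d + 1 := ⟨l - 1, by omega⟩
      obtain rfl : k = j + l := by omega
      rw [descend, descend, mul_smul, mul_smul, mul_smul, mul_smul,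
        ← cross_smul_descend_smul (by omega)]
      exact (braid_onTail (k := j + l) (descend_smul_mem_onTail hu hj l) (by omega)).symm
    · rw [descend, mul_smul, ih (by omega), mul_smul, cross_smul_cross_smul (by omega)]

/-- Iterated nilHecke relation. Of the sum of mixed monomials in x_k and x_{k+1} only x_k^n
survives, because x_{k+1} kills u. -/
theorem dot_pow_smul_cross_smul (hi : C.IsReal i) (hu : u ∈ OnTail 𝕜 C ρ i q) {k : ℕ}
    (hk : q ≤ k) (hk' : k + 1 < Multiset.card ρ) (h0 : dot 𝕜 C ρ (k + 1) • u = 0) (n : ℕ) :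
    dot 𝕜 C ρ (k + 1) ^ (n + 1) • cross 𝕜 C ρ k • u =
      cross 𝕜 C ρ k • dot 𝕜 C ρ k ^ (n + 1) • u - dot 𝕜 C ρ k ^ n • u := by
  induction n with
  | zero => simpa using dot_succ_smul_cross_smul hi hu hk hk'
  | succ n ih =>
    have hc : dot 𝕜 C ρ (k + 1) • dot 𝕜 C ρ k ^ n • u = 0 := by
      have : Commute (dot 𝕜 C ρ (k + 1)) (dot 𝕜 C ρ k) :=
        (strandRel_klr 𝕜).x_x _ _ hk' (by omega)
      rw [← mul_smul, (this.pow_right n).eq, mul_smul, h0, smul_zero]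
    rw [pow_succ', mul_smul, ih, smul_sub, hc, sub_zero,
      dot_succ_smul_cross_smul hi (dot_pow_smul_mem_onTail hu k (n + 1)) hk hk',
      ← mul_smul (dot 𝕜 C ρ k), ← pow_succ']

/-- By induction on l, each crossing uses up one power of the dot and contributes a factor -1, as in
the divided differences of a monomial; any further power of the dot gives zero. -/
theorem dot_pow_smul_descend_smul (hi : C.IsReal i) (hu : u ∈ OnTail 𝕜 C ρ i q) (l : ℕ)
    (hl : q + l < Multiset.card ρ) (h0 : ∀ k, q ≤ k → dot 𝕜 C ρ k • u = 0) :
    dot 𝕜 C ρ (q + l) ^ l • descend 𝕜 C ρ q l • u = (-1 : ℤ) ^ l • u ∧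
    ∀ n, l < n → dot 𝕜 C ρ (q + l) ^ n • descend 𝕜 C ρ q l • u = 0 := by
  induction l with
  | zero =>
    refine ⟨by simp [descend], fun n hn => ?_⟩
    obtain ⟨n, rfl⟩ : ∃ d, n = d + 1 := ⟨n - 1, by omega⟩
    rw [descend, one_smul, pow_succ, mul_smul, h0 _ (by omega), smul_zero]
  | succ l ih =>
    obtain ⟨ih1, ih2⟩ := ih (by omega)
    have hd : ∀ n, dot 𝕜 C ρ (q + (l + 1)) ^ (n + 1) • descend 𝕜 C ρ q (l + 1) • u =
        cross 𝕜 C ρ (q + l) • dot 𝕜 C ρ (q + l) ^ (n + 1) • descend 𝕜 C ρ q l • u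
          - dot 𝕜 C ρ (q + l) ^ n • descend 𝕜 C ρ q l • u := by
      intro n
      rw [descend, mul_smul]
      refine dot_pow_smul_cross_smul (k := q + l) hi (descend_smul_mem_onTail hu le_rfl l) (by omega) hl ?_ n
      rw [dot_smul_descend_smul (by omega), h0 _ (by omega), smul_zero]
    refine ⟨?_, fun n hn => ?_⟩
    · rw [hd, ih1, ih2 _ (by omega), smul_zero, zero_sub, pow_succ, mul_neg_one, neg_smul]
    · obtain ⟨n, rfl⟩ : ∃ d, n = d + 1 := ⟨n - 1, by omega⟩
      rw [hd, ih2 _ (by omega), ih2 _ (by omega), smul_zero, sub_zero]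

variable (𝕜 C M) in
/-- For real `i` there is an element which fixes the vectors killed by the dots on the tail, and
kills the images of the crossings on the tail. -/
theorem exists_extremal (hi : C.IsReal i) {q b : ℕ} (hb : q + b ≤ Multiset.card ρ) :
    ∃ θ : KLRAlgebra 𝕜 C ρ,
      (∀ u ∈ OnTail 𝕜 (M := M) C ρ i q, (∀ k, q ≤ k → dot 𝕜 C ρ k • u = 0) → θ • u = u) ∧
      ∀ k, q ≤ k → k + 1 < q + b → ∀ u ∈ OnTail 𝕜 (M := M) C ρ i q, θ • cross 𝕜 C ρ k • u = 0 := by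
  induction b with
  | zero => exact ⟨1, fun u _ _ => one_smul _ u, fun k _ _ => by omega⟩
  | succ b ih =>
    obtain ⟨θ, h1, h2⟩ := ih (by omega)
    -- The element for b + 1 strands precedes the one for b strands by the cycle that moves the
    -- first tail strand to the last place, followed by b dots there. The sign cancels the one in
    -- `dot_pow_smul_descend_smul`.
    refine ⟨(-1 : ℤ) ^ b • (θ * dot 𝕜 C ρ (q + b) ^ b * descend 𝕜 C ρ q b), ?_, ?_⟩
    · intro u hu h0
      have hθ : θ • (-1 : ℤ) ^ b • u = (-1 : ℤ) ^ b • u := by rw [smul_comm, h1 u hu h0]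
      rw [smul_assoc, mul_smul, mul_smul, (dot_pow_smul_descend_smul hi hu b (by omega) h0).1,
        hθ, ← mul_smul, ← mul_pow]
      simp
    · intro k hk hkb u hu
      rw [smul_assoc, mul_smul, mul_smul]
      by_cases hkq : k = q
      · subst hkq
        obtain ⟨b, rfl⟩ : ∃ d, b = d + 1 := ⟨b - 1, by omega⟩
        rw [descend_smul_cross_smul_self hu hk, smul_zero, smul_zero, smul_zero]
      -- A crossing other than τ_q passes the cycle with its index lowered by one, commutes with the
      -- dot on the last strand, and is killed by the element for b strands.
      · obtain ⟨k, rfl⟩ : ∃ d, k = d + 1 := ⟨k - 1, by omega⟩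
        have hu' := descend_smul_mem_onTail hu le_rfl b
        have hc : Commute (dot 𝕜 C ρ (q + b)) (cross 𝕜 C ρ k) :=
          (strandRel_klr 𝕜).x_t _ _ (by omega) (by omega) (by omega) (by omega)
        rw [descend_smul_cross_smul hu le_rfl (by omega) (by omega), ← mul_smul (_ ^ b),
          (hc.pow_left b).eq, mul_smul,
          h2 k (by omega) (by omega) _ (dot_pow_smul_mem_onTail hu' _ b), smul_zero]

/-- A form of Nakayama's lemma for the action of the crossings on the tail. -/
theorem le_of_le_sup_cross {D Z : Submodule 𝕜 M} (hD : D ≤ OnTail 𝕜 C ρ i q)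
    (hDc : ∀ k, q ≤ k → ∀ u ∈ D, cross 𝕜 C ρ k • u ∈ D)
    (hZc : ∀ k, q ≤ k → ∀ u ∈ Z, cross 𝕜 C ρ k • u ∈ Z) (b : ℕ)
    (h : ∀ W : Submodule 𝕜 M, Z ≤ W →
      (∀ k, q ≤ k → k < q + b → ∀ u ∈ D, cross 𝕜 C ρ k • u ∈ W) → D ≤ W) : D ≤ Z := by
  -- The hypothesis says that D is contained in Z plus the images of the crossings below q + b. The
  -- induction removes one crossing position at a time, starting from the last; the case b = 0 is
  -- the claim.
  induction b with
  | zero => exact h Z le_rfl fun k _ _ => by omega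
  | succ b ih =>
    refine ih fun W hZW hW => ?_
    -- Trades the generator P = τ_{q+b} ⋯ τ_j for the longer product that begins one position
    -- further left, while the images of all crossings below q + b are kept.
    have step : ∀ l j, j + l = q + b → q ≤ j →
        (∀ W' : Submodule 𝕜 M, Z ≤ W' →
          (∀ k, q ≤ k → k < q + b → ∀ u ∈ D, cross 𝕜 C ρ k • u ∈ W') →
          (∀ u ∈ D, descend 𝕜 C ρ j (l + 1) • u ∈ W') → D ≤ W') →
        ∀ W' : Submodule 𝕜 M, Z ≤ W' →
          (∀ k, q ≤ k → k < q + b → ∀ u ∈ D, cross 𝕜 C ρ k • u ∈ W') →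
          (∀ k, q ≤ k → k + 1 = j → ∀ u ∈ D, descend 𝕜 C ρ k (l + 2) • u ∈ W') → D ≤ W' := by
      intro l j hlj hj hl W' hZ hc hd
      -- Composing P with one crossing: for k + 1 < j it commutes with P, for k = j - 1 it gives the
      -- longer product, for k = j it gives zero, and for k > j the braid relation turns it into a
      -- crossing with index below q + b applied after P.
      have hmem : ∀ k, ∀ u ∈ D, q ≤ k → k < q + b + 1 →
          descend 𝕜 C ρ j (l + 1) • cross 𝕜 C ρ k • u ∈ W' := by
        intro k u hu hk hkb
        by_cases h1 : k + 1 < j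
        · rw [descend_smul_cross_smul_of_lt h1]
          exact hc k hk (by omega) _
            (descend_smul_mem (fun k hk => hDc k (by omega)) _ hu)
        by_cases h2 : k + 1 = j
        · rw [← mul_smul, ← h2, ← descend_succ']
          exact hd k hk h2 u hu
        by_cases h3 : k = j
        · rw [h3, descend_smul_cross_smul_self (hD hu) hj]
          exact zero_mem _
        · obtain ⟨k, rfl⟩ : ∃ d, k = d + 1 := ⟨k - 1, by omega⟩
          rw [descend_smul_cross_smul (hD hu) hj (by omega) (by omega)]
          exact hc k (by omega) (by omega) _
            (descend_smul_mem (fun k hk => hDc k (by omega)) _ hu)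
      -- The assumption is used twice: for W', which leaves P D ⊆ W' to be shown, and for the
      -- preimage of W' under P. In the latter P² also ends in a crossing applied first by the outer
      -- P, so `hmem` covers it.
      refine hl W' hZ hc fun u hu => ?_
      refine hl (W'.comap (Algebra.lsmul 𝕜 𝕜 M (descend 𝕜 C ρ j (l + 1)))) ?_ ?_ ?_ hu
      · exact fun z hz => hZ (descend_smul_mem (fun k hk => hZc k (by omega)) _ hz)
      · exact fun k hk hkb u hu => hmem k u hu hk (by omega)
      · intro u hu
        rw [descend, mul_smul]
        exact hmem _ _ (descend_smul_mem (fun k hk => hDc k (by omega)) _ hu) (by omega) (by omega)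
    have key : ∀ l, l ≤ b → ∀ W' : Submodule 𝕜 M, Z ≤ W' →
        (∀ k, q ≤ k → k < q + b → ∀ u ∈ D, cross 𝕜 C ρ k • u ∈ W') →
        (∀ u ∈ D, descend 𝕜 C ρ (q + b - l) (l + 1) • u ∈ W') → D ≤ W' := by
      intro l
      induction l with
      | zero =>
        intro _ W' hZ hc hd
        refine h W' hZ fun k hk hkb u hu => ?_
        by_cases hkb' : k = q + b
        · have := hd u hu
          simp only [descend, mul_one, Nat.sub_zero, Nat.add_zero] at this
          rwa [hkb']
        · exact hc k hk (by omega) u hu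
      | succ l ihl =>
        intro hl W' hZ hc hd
        refine step l (q + b - l) (by omega) (by omega) (ihl (by omega)) W' hZ hc
          fun k hk hkj u hu => ?_
        obtain rfl : k = q + b - (l + 1) := by omega
        exact hd u hu
    -- At j = q there is no crossing of the tail further to the left, so the last condition is
    -- empty.
    refine step b q rfl le_rfl ?_ W hZW hW fun k hk hkq => by omega
    have := key b le_rfl
    rwa [Nat.add_sub_cancel] at this

end Relations

end Tails

/-! ### Frobenius reciprocity and homogeneity of module homomorphisms. -/

namespace GrMod

section Induction

variable {𝕜 A : Type*} [Field 𝕜] [Ring A] [Algebra 𝕜 A] {𝒜 : ℤ → Submodule 𝕜 A}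
variable {S : Type*} [Ring S] [Algebra 𝕜 S] {𝒮 : ℤ → Submodule 𝕜 S}
variable [GradedAlgebra 𝒮] [GradedAlgebra 𝒜]
variable (f : S →ₙₐ[𝕜] A) (hf : ∀ p, ∀ s ∈ 𝒮 p, f s ∈ 𝒜 p) (W : GrMod 𝒮)

/-- The map `w ↦ 1 ⊗ w` from a module to the induced module. -/
def indMk : W →ₗ[𝕜] ind f hf W :=
  ((balance f W).mkQ.restrictScalars 𝕜).comp (TensorProduct.mk 𝕜 A W 1)

theorem smul_indMk (s : S) (w : W) : f s • indMk f hf W w = indMk f hf W (s • w) := by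
  change (balance f W).mkQ (f s • (1 : A) ⊗ₜ[𝕜] w) = (balance f W).mkQ (1 ⊗ₜ[𝕜] (s • w))
  rw [← sub_eq_zero, ← map_sub, Submodule.mkQ_apply, Submodule.Quotient.mk_eq_zero,
    TensorProduct.smul_tmul', smul_eq_mul, mul_one]
  exact Submodule.subset_span ⟨s, w, rfl⟩

theorem span_indMk : Submodule.span A (Set.range (indMk f hf W)) = ⊤ := by
  rw [eq_top_iff]
  rintro x -
  obtain ⟨z, rfl⟩ := (balance f W).mkQ_surjective x
  induction z using TensorProduct.induction_on with
  | zero => rw [map_zero]; exact zero_mem _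
  | add x y hx hy => rw [map_add]; exact add_mem hx hy
  | tmul a w =>
    have : a ⊗ₜ[𝕜] w = a • (1 : A) ⊗ₜ[𝕜] w := by
      rw [TensorProduct.smul_tmul', smul_eq_mul, mul_one]
    rw [this, map_smul]
    exact Submodule.smul_mem _ _ (Submodule.subset_span ⟨w, rfl⟩)

theorem indMk_mem_deg {p : ℤ} {w : W} (hw : w ∈ W.deg p) :
    indMk f hf W w ∈ (ind f hf W).deg p := by
  have := tmul_mem_tensorDeg (SetLike.GradedOne.one_mem (A := 𝒜)) hw
  rw [zero_add] at this
  exact ⟨_, this, rfl⟩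

variable {L : Type*} [AddCommGroup L] [Module 𝕜 L] [Module A L] [IsScalarTower 𝕜 A L]

/-- Frobenius reciprocity. -/
def indLift (φ : W →ₗ[𝕜] L) (hφ : ∀ s w, φ (s • w) = f s • φ w) : ind f hf W →ₗ[A] L :=
  (balance f W).liftQ (TensorProduct.AlgebraTensorModule.lift
    (LinearMap.toSpanSingleton A (W →ₗ[𝕜] L) φ)) <| by
  refine Submodule.span_le.2 ?_
  rintro _ ⟨s, w, rfl⟩
  simp [hφ]

theorem indLift_indMk (φ : W →ₗ[𝕜] L) (hφ : ∀ s w, φ (s • w) = f s • φ w) (w : W) :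
    indLift f hf W φ hφ (indMk f hf W w) = φ w := by
  change (1 : A) • φ w = φ w
  rw [one_smul]

end Induction

section Degrees

variable {𝕜 A : Type*} [Field 𝕜] [Ring A] [Algebra 𝕜 A] {𝒜 : ℤ → Submodule 𝕜 A}

theorem decompose_smul (M : GrMod 𝒜) {q : ℤ} {a : A} (ha : a ∈ 𝒜 q) (x : M) (p : ℤ) :
    (decompose M.deg (a • x) (q + p) : M) = a • (decompose M.deg x p : M) := by
  induction x using Decomposition.inductionOn M.deg with
  | zero => simp
  | add x y hx hy => simp [hx, hy]
  | @homogeneous r m =>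
    have h := M.smul_mem_deg ha m.2
    by_cases hr : r = p
    · subst hr
      rw [decompose_of_mem_same _ h, decompose_of_mem_same _ m.2]
    · rw [decompose_of_mem_ne _ h (by omega), decompose_of_mem_ne _ m.2 hr, smul_zero]

/-- Homogeneity of degree d only has to be checked on generators. The generators are homogeneous and
the algebra is graded, so the components of a product a • x are determined by those of x. -/
theorem map_decompose [GradedAlgebra 𝒜] (M L : GrMod 𝒜) (Φ : M →ₗ[A] L) (d : ℤ) (X : Set M)
    (hX : Submodule.span A X = ⊤) (h : ∀ x ∈ X, ∃ p, x ∈ M.deg p ∧ Φ x ∈ L.deg (p + d))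
    (x : M) (p : ℤ) : Φ (decompose M.deg x p) = (decompose L.deg (Φ x) (p + d) : L) := by
  have hx : x ∈ Submodule.span A X := hX ▸ Submodule.mem_top
  induction hx using Submodule.span_induction generalizing p with
  | zero => simp
  | add x y _ _ hx hy => simp [hx, hy]
  | mem x hx =>
    obtain ⟨q, h1, h2⟩ := h x hx
    by_cases hq : q = p
    · subst hq
      rw [decompose_of_mem_same _ h1, decompose_of_mem_same _ h2]
    · rw [decompose_of_mem_ne _ h1 hq, decompose_of_mem_ne _ h2 (by omega), map_zero]
  | smul a x _ hx =>
    induction a using Decomposition.inductionOn 𝒜 with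
    | zero => simp
    | add a b ha hb => simp [add_smul, ha, hb]
    | @homogeneous q a =>
      obtain ⟨p, rfl⟩ : ∃ p', p = q + p' := ⟨p - q, by omega⟩
      rw [decompose_smul M a.2, map_smul, hx, map_smul, add_assoc, decompose_smul L a.2]

end Degrees

end GrMod

/-! ### Adding vertical strands of label i on the right. -/

section StrandHom

universe v

variable {I : Type v} {κ ν ρ : Multiset I} {𝕜 : Type*} [Field 𝕜] {C : BorcherdsCartan I} {i : I}

/-- The constant sequence. -/
def constSeq (i : I) (n : ℕ) : Seq (Multiset.replicate n i) :=
  ⟨List.replicate n i, Multiset.coe_replicate n i⟩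

instance (i : I) (n : ℕ) : Subsingleton (Seq (Multiset.replicate n i)) where
  allEq s t := by
    have key : ∀ s : Seq (Multiset.replicate n i), s.1 = List.replicate n i := fun s =>
      List.perm_replicate.1 (Multiset.coe_eq_coe.1 (s.2.trans (Multiset.coe_replicate n i).symm))
    exact Subtype.ext ((key s).trans (key t).symm)

instance (i : I) (n : ℕ) : Unique (Seq (Multiset.replicate n i)) :=
  @Unique.mk' _ ⟨constSeq i n⟩ _

theorem default_seq (n : ℕ) : (default : Seq (Multiset.replicate n i)) = constSeq i n :=
  Subsingleton.elim _ _

/-- The sequence `s` followed by `n` entries `i`. -/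
def Seq.extend {n : ℕ} (h : κ + Multiset.replicate n i = ρ) (s : Seq κ) : Seq ρ :=
  s.append h (constSeq i n)

variable {n : ℕ} (h : κ + Multiset.replicate n i = ρ)

include h in
theorem card_add_eq : Multiset.card κ + n = Multiset.card ρ := by
  rw [← h, Multiset.card_add, Multiset.card_replicate]

theorem Seq.extend_injective : Function.Injective (Seq.extend h) := fun _ _ hst =>
  ((rightPlacement h).inj hst).1

theorem tail_extend (s : Seq κ) : Tail i (Multiset.card κ) (s.extend h) := by
  intro r hr hq
  rw [Seq.entry_eq_iff]
  change (s.1 ++ List.replicate n i)[r]? = some i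
  have := card_add_eq h
  rw [List.getElem?_append_right (by rwa [s.length_eq]), s.length_eq, List.getElem?_replicate,
    if_pos (by omega)]

theorem exists_extend_of_tail {t : Seq ρ} (ht : Tail i (Multiset.card κ) t) :
    ∃ s : Seq κ, s.extend h = t := by
  have hc := card_add_eq h
  have h1 : t.1.drop (Multiset.card κ) = List.replicate n i := by
    refine List.ext_getElem? fun r => ?_
    rw [List.getElem?_drop, List.getElem?_replicate]
    split_ifs with hr
    · rw [← Seq.entry_eq_iff t _ (by omega)]
      exact ht _ _ (by omega)
    · exact List.getElem?_eq_none (by rw [t.length_eq]; omega)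
  have h2 : t.1.take (Multiset.card κ) ++ List.replicate n i = t.1 := by
    rw [← h1, List.take_append_drop]
  refine ⟨⟨t.1.take (Multiset.card κ), ?_⟩, Subtype.ext h2⟩
  have h3 := t.2
  rw [← h2, ← Multiset.coe_add, Multiset.coe_replicate] at h3
  exact add_right_cancel (h3.trans h.symm)

variable (𝕜 C)

theorem oneTensorOne_eq_sum : oneTensorOne 𝕜 C h = ∑ s : Seq κ, gen 𝕜 C (.e (s.extend h)) := by
  refine Finset.sum_congr rfl fun s _ => ?_
  rw [Fintype.sum_unique, default_seq, Seq.extend]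

theorem gen_e_mul_oneTensorOne (s : Seq κ) :
    gen 𝕜 C (.e (s.extend h)) * oneTensorOne 𝕜 C h = gen 𝕜 C (.e (s.extend h)) := by
  classical
  rw [oneTensorOne_eq_sum, Finset.mul_sum, Finset.sum_eq_single s, (strandRel_klr 𝕜).idem]
  · intro s' _ hs'
    exact (strandRel_klr 𝕜).orth _ _ fun h' => hs' (Seq.extend_injective h h').symm
  · simp

/-- There is only one sequence of weight ni, so the sum over the labels of the right strands has a
single term. -/
theorem juxtapose_left_gen (g : Gen κ) :
    juxtapose 𝕜 C h (gen 𝕜 C g ⊗ₜ 1) = gen 𝕜 C ((leftPlacement h).genAt (constSeq i n) g) := by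
  rw [juxtapose_tmul, map_one, ← map_mul, mul_one, Placement.hom, liftGen_gen]
  change (leftPlacement h).image 𝕜 C g = _
  rw [Placement.image]
  exact Fintype.sum_unique (ι := Seq (Multiset.replicate n i)) _

theorem juxtapose_right_gen (g : Gen (Multiset.replicate n i)) :
    juxtapose 𝕜 C h (1 ⊗ₜ gen 𝕜 C g)
      = ∑ s : Seq κ, gen 𝕜 C ((rightPlacement h).genAt s g) := by
  rw [juxtapose_tmul, map_one, ← map_mul, one_mul, Placement.hom, liftGen_gen]
  rfl

theorem juxtapose_e_left (s : Seq κ) :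
    juxtapose 𝕜 C h (gen 𝕜 C (.e s) ⊗ₜ 1) = gen 𝕜 C (.e (s.extend h)) :=
  juxtapose_left_gen 𝕜 C h _

theorem juxtapose_dot_left {k : ℕ} (hk : k < Multiset.card κ) :
    juxtapose 𝕜 C h (dot 𝕜 C κ k ⊗ₜ 1) = dot 𝕜 C ρ k * oneTensorOne 𝕜 C h := by
  have hc := card_add_eq h
  rw [dot, dif_pos hk, TensorProduct.sum_tmul, map_sum, oneTensorOne_eq_sum, Finset.mul_sum]
  refine Finset.sum_congr rfl fun s _ => ?_
  rw [juxtapose_left_gen, dot_mul_e 𝕜 (by omega)]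
  congr 1
  simp only [Placement.genAt, zero_add]
  rfl

theorem juxtapose_cross_left {k : ℕ} (hk : k + 1 < Multiset.card κ) :
    juxtapose 𝕜 C h (cross 𝕜 C κ k ⊗ₜ 1) = cross 𝕜 C ρ k * oneTensorOne 𝕜 C h := by
  have hc := card_add_eq h
  rw [cross, dif_pos hk, TensorProduct.sum_tmul, map_sum, oneTensorOne_eq_sum, Finset.mul_sum]
  refine Finset.sum_congr rfl fun s _ => ?_
  rw [juxtapose_left_gen, cross_mul_e 𝕜 (by omega)]
  congr 1
  simp only [Placement.genAt, zero_add]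
  rfl

theorem juxtapose_dot_right {k : ℕ} (hk : k < n) :
    juxtapose 𝕜 C h (1 ⊗ₜ dot 𝕜 C (Multiset.replicate n i) k)
      = dot 𝕜 C ρ (Multiset.card κ + k) * oneTensorOne 𝕜 C h := by
  have hc := card_add_eq h
  rw [dot, dif_pos (by rwa [Multiset.card_replicate]), Fintype.sum_unique, default_seq,
    juxtapose_right_gen, oneTensorOne_eq_sum, Finset.mul_sum]
  refine Finset.sum_congr rfl fun s _ => ?_
  rw [dot_mul_e 𝕜 (by omega)]
  rfl

theorem juxtapose_cross_right {k : ℕ} (hk : k + 1 < n) :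
    juxtapose 𝕜 C h (1 ⊗ₜ cross 𝕜 C (Multiset.replicate n i) k)
      = cross 𝕜 C ρ (Multiset.card κ + k) * oneTensorOne 𝕜 C h := by
  have hc := card_add_eq h
  rw [cross, dif_pos (by rwa [Multiset.card_replicate]), Fintype.sum_unique, default_seq,
    juxtapose_right_gen, oneTensorOne_eq_sum, Finset.mul_sum]
  refine Finset.sum_congr rfl fun s _ => ?_
  rw [cross_mul_e 𝕜 (by omega)]
  rfl

variable {𝕜 C}
variable {K : Type*} [AddCommGroup K] [Module 𝕜 K] [Module (KLRAlgebra 𝕜 C κ) K]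
variable [IsScalarTower 𝕜 (KLRAlgebra 𝕜 C κ) K]
variable {M : Type*} [AddCommGroup M] [Module 𝕜 M] [Module (KLRAlgebra 𝕜 C ρ) M]
variable [IsScalarTower 𝕜 (KLRAlgebra 𝕜 C ρ) M]

/-- A linear map from an `R(κ)`-module to an `R(κ + ni)`-module that is linear for diagrams with
`n` vertical strands of label `i` added on the right. -/
structure IsStrandHom (C : BorcherdsCartan I) {κ ρ : Multiset I} {K M : Type*}
    [AddCommGroup K] [Module 𝕜 K] [Module (KLRAlgebra 𝕜 C κ) K]
    [AddCommGroup M] [Module 𝕜 M] [Module (KLRAlgebra 𝕜 C ρ) M] (h : κ + Multiset.replicate n i = ρ) (ι : K →ₗ[𝕜] M) : Prop where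
  e : ∀ (s : Seq κ) u, ι (gen 𝕜 C (.e s) • u) = gen 𝕜 C (.e (s.extend h)) • ι u
  dot : ∀ k < Multiset.card κ, ∀ u, ι (dot 𝕜 C κ k • u) = dot 𝕜 C ρ k • ι u
  cross : ∀ k, k + 1 < Multiset.card κ → ∀ u, ι (cross 𝕜 C κ k • u) = cross 𝕜 C ρ k • ι u

namespace IsStrandHom

variable {h} {ι : K →ₗ[𝕜] M} (H : IsStrandHom C h ι)

include H

theorem mem_onTail (u : K) : ι u ∈ OnTail 𝕜 C ρ i (Multiset.card κ) := by
  intro t ht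
  rw [← sum_e_smul 𝕜 C (ρ := κ) u, map_sum, Finset.smul_sum]
  refine Finset.sum_eq_zero fun s _ => ?_
  rw [H.e, e_smul_e_smul_of_ne]
  rintro rfl
  exact ht (tail_extend h s)

theorem oneTensorOne_smul (u : K) : oneTensorOne 𝕜 C h • ι u = ι u := by
  rw [oneTensorOne_eq_sum, Finset.sum_smul]
  simp_rw [← H.e]
  rw [← map_sum, sum_e_smul 𝕜 C (ρ := κ) u]

/-- Linearity for idempotents, dots and crossings extends to all of R(κ), since these generate it;
scalars are covered because 1_{κ,ni} fixes the image. -/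
theorem juxtapose_smul (a : KLRAlgebra 𝕜 C κ) (u : K) :
    juxtapose 𝕜 C h (a ⊗ₜ 1) • ι u = ι (a • u) := by
  induction a using algebra_induction 𝕜 generalizing u with
  | scalar c =>
    rw [Algebra.algebraMap_eq_smul_one, ← TensorProduct.smul_tmul', map_smul,
      ← Algebra.TensorProduct.one_def, juxtapose_one, smul_assoc, H.oneTensorOne_smul, smul_assoc,
      one_smul, map_smul]
  | add a b ha hb => rw [TensorProduct.add_tmul, map_add, add_smul, ha, hb, add_smul, map_add]
  | mul a b ha hb =>
    rw [show (a * b) ⊗ₜ[𝕜] (1 : KLRAlgebra 𝕜 C (Multiset.replicate n i))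
      = (a ⊗ₜ 1) * (b ⊗ₜ 1) by rw [Algebra.TensorProduct.tmul_mul_tmul, one_mul], map_mul,
      mul_smul, hb, ha, mul_smul]
  | gen g =>
    cases g with
    | e s => rw [juxtapose_e_left, H.e]
    | x k hk s =>
      rw [← dot_mul_e 𝕜 hk s, mul_smul, H.dot k hk, H.e,
        show (KLR.dot 𝕜 C κ k * gen 𝕜 C (.e s)) ⊗ₜ[𝕜] (1 : KLRAlgebra 𝕜 C (Multiset.replicate n i))
        = (KLR.dot 𝕜 C κ k ⊗ₜ 1) * (gen 𝕜 C (.e s) ⊗ₜ 1) by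
          rw [Algebra.TensorProduct.tmul_mul_tmul, one_mul], map_mul, juxtapose_dot_left 𝕜 C h hk,
        juxtapose_e_left, mul_smul, mul_smul, ← H.e, H.oneTensorOne_smul]
    | t k hk s =>
      rw [← cross_mul_e 𝕜 hk s, mul_smul, H.cross k hk, H.e,
        show (KLR.cross 𝕜 C κ k * gen 𝕜 C (.e s)) ⊗ₜ[𝕜] (1 : KLRAlgebra 𝕜 C (Multiset.replicate n i))
        = (KLR.cross 𝕜 C κ k ⊗ₜ 1) * (gen 𝕜 C (.e s) ⊗ₜ 1) by
          rw [Algebra.TensorProduct.tmul_mul_tmul, one_mul], map_mul,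
        juxtapose_cross_left 𝕜 C h hk, juxtapose_e_left, mul_smul, mul_smul, ← H.e,
        H.oneTensorOne_smul]

/-- Every element of `R(κ)` acts on the image as an element of `R(ρ)`. -/
theorem map_smul_eq (a : KLRAlgebra 𝕜 C κ) (u : K) :
    ι (a • u) = juxtapose 𝕜 C h (a ⊗ₜ 1) • ι u := (H.juxtapose_smul a u).symm

end IsStrandHom

/-- The case a = 1 shows that 1_{κ,ni} fixes the image, which removes the idempotent from the images
of dots and crossings. -/
theorem isStrandHom_of_juxtapose {ι : K →ₗ[𝕜] M}
    (H : ∀ (a : KLRAlgebra 𝕜 C κ) u, ι (a • u) = juxtapose 𝕜 C h (a ⊗ₜ 1) • ι u) :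
    IsStrandHom C h ι := by
  have h1 : ∀ u, oneTensorOne 𝕜 C h • ι u = ι u := fun u => by
    have := H 1 u
    rw [one_smul, ← Algebra.TensorProduct.one_def, juxtapose_one] at this
    exact this.symm
  refine ⟨fun s u => ?_, fun k hk u => ?_, fun k hk u => ?_⟩
  · rw [H, juxtapose_e_left]
  · rw [H, juxtapose_dot_left 𝕜 C h hk, mul_smul, h1]
  · rw [H, juxtapose_cross_left 𝕜 C h hk, mul_smul, h1]

end StrandHom

/-! ### The generating vector of V(i^n), and Frobenius reciprocity for K ⊗ V(i^n). -/

section Vacuum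

universe v

variable {I : Type v} {κ ν ρ : Multiset I} {𝕜 : Type*} [Field 𝕜] {C : BorcherdsCartan I} {i : I}
variable {n : ℕ}

variable (𝕜 C i n) in
/-- The generating vector of `V(i^n)`. -/
def vac : V 𝕜 C i n :=
  (Submodule.span (KLRAlgebra 𝕜 C (Multiset.replicate n i)) (gen 𝕜 C '' trivialGens C i n)).mkQ 1

theorem gen_smul_vac {g : Gen (Multiset.replicate n i)} (hg : g ∈ trivialGens C i n) :
    gen 𝕜 C g • vac 𝕜 C i n = 0 := by
  have h : gen 𝕜 C g * 1 ∈ Submodule.span (KLRAlgebra 𝕜 C (Multiset.replicate n i))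
      (gen 𝕜 C '' trivialGens C i n) := by
    rw [mul_one]
    exact Submodule.subset_span ⟨g, hg, rfl⟩
  exact (Submodule.Quotient.mk_eq_zero _).2 h

theorem dot_smul_vac (k : ℕ) : dot 𝕜 C (Multiset.replicate n i) k • vac 𝕜 C i n = 0 := by
  rw [dot]
  split_ifs with hk
  · rw [Finset.sum_smul]
    exact Finset.sum_eq_zero fun s _ => gen_smul_vac (Or.inl ⟨k, hk, s, rfl⟩)
  · rw [zero_smul]

open Classical in
variable (C i n) in
/-- The degree of the generating vector of `V(i^n)`. -/
def vacDeg : ℤ := if C.IsReal i then C.r i * (n * (n - 1) / 2 : ℕ) else 0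

theorem vac_mem_deg : vac 𝕜 C i n ∈ (V 𝕜 C i n).deg (vacDeg C i n) := by
  have h : ∃ x ∈ grading 𝕜 C (Multiset.replicate n i) (vacDeg C i n - vacDeg C i n),
      (Submodule.span (KLRAlgebra 𝕜 C (Multiset.replicate n i))
        (gen 𝕜 C '' trivialGens C i n)).mkQ x = vac 𝕜 C i n :=
    ⟨1, by rw [sub_self]; exact SetLike.GradedOne.one_mem, rfl⟩
  exact h

theorem exists_smul_vac (v : V 𝕜 C i n) :
    ∃ b : KLRAlgebra 𝕜 C (Multiset.replicate n i), b • vac 𝕜 C i n = v := by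
  obtain ⟨b, rfl⟩ := (Submodule.span (KLRAlgebra 𝕜 C (Multiset.replicate n i))
    (gen 𝕜 C '' trivialGens C i n)).mkQ_surjective v
  exact ⟨b, congrArg (Submodule.span (KLRAlgebra 𝕜 C (Multiset.replicate n i))
    (gen 𝕜 C '' trivialGens C i n)).mkQ (mul_one b)⟩

/-- A linear map out of `V(i^n)`. -/
theorem exists_V_lift {L : Type*} [AddCommGroup L] [Module 𝕜 L]
    (φ : KLRAlgebra 𝕜 C (Multiset.replicate n i) →ₗ[𝕜] L)
    (hφ : ∀ b, ∀ g ∈ trivialGens C i n, φ (b * gen 𝕜 C g) = 0) :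
    ∃ ψ : V 𝕜 C i n →ₗ[𝕜] L, ∀ b : KLRAlgebra 𝕜 C (Multiset.replicate n i),
      ψ (b • vac 𝕜 C i n) = φ b := by
  let X := Submodule.span (KLRAlgebra 𝕜 C (Multiset.replicate n i)) (gen 𝕜 C '' trivialGens C i n)
  have hX : X.restrictScalars 𝕜 ≤ LinearMap.ker φ := by
    intro x hx
    have : ∀ b, φ (b * x) = 0 := by
      refine Submodule.span_induction (p := fun x _ => ∀ b, φ (b * x) = 0) ?_ ?_ ?_ ?_ hx
      · rintro _ ⟨g, hg, rfl⟩ b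
        exact hφ b g hg
      · simp
      · intro x y _ _ hx hy b
        rw [mul_add, map_add, hx, hy, add_zero]
      · intro a x _ hx b
        rw [smul_eq_mul, ← mul_assoc, hx]
    rw [LinearMap.mem_ker]
    simpa using this 1
  refine ⟨(X.restrictScalars 𝕜).liftQ φ hX, fun b => ?_⟩
  change φ (b * 1) = φ b
  rw [mul_one]

/-- A strand homomorphism whose image generates and is annihilated by the dots on the new
strands. -/
structure IsVacuumHom (C : BorcherdsCartan I) {κ ρ : Multiset I} {K M : Type*}
    [AddCommGroup K] [Module 𝕜 K] [Module (KLRAlgebra 𝕜 C κ) K]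
    [AddCommGroup M] [Module 𝕜 M] [Module (KLRAlgebra 𝕜 C ρ) M]
    (h : κ + Multiset.replicate n i = ρ) (ι : K →ₗ[𝕜] M) : Prop extends IsStrandHom C h ι where
  dot_eq_zero : ∀ k, Multiset.card κ ≤ k → ∀ u, KLR.dot 𝕜 C ρ k • ι u = 0
  span_eq_top : Submodule.span (KLRAlgebra 𝕜 C ρ) (Set.range ι) = ⊤

section Frobenius

variable (h : κ + Multiset.replicate n i = ρ)

/-- The map `u ↦ 1 ⊗ (u ⊗ 1)` from `K` to the module induced from `K ⊗ V(i^n)`. -/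
def vacMap (K : KLRMod 𝕜 C κ) : K →ₗ[𝕜] Ind h (K.tensor (V 𝕜 C i n)) :=
  (GrMod.indMk (juxtapose 𝕜 C h) (juxtapose_mem 𝕜 h) (K.tensor (V 𝕜 C i n))).comp
    ((TensorProduct.mk 𝕜 K (V 𝕜 C i n)).flip (vac 𝕜 C i n))

variable (K : KLRMod 𝕜 C κ)

theorem juxtapose_smul_vacMap (a : KLRAlgebra 𝕜 C κ)
    (b : KLRAlgebra 𝕜 C (Multiset.replicate n i)) (u : K) :
    juxtapose 𝕜 C h (a ⊗ₜ b) • vacMap h K u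
      = GrMod.indMk (juxtapose 𝕜 C h) (juxtapose_mem 𝕜 h) (K.tensor (V 𝕜 C i n))
        ((a • u) ⊗ₜ[𝕜] (b • vac 𝕜 C i n) : K ⊗[𝕜] V 𝕜 C i n) :=
  GrMod.smul_indMk (juxtapose 𝕜 C h) (juxtapose_mem 𝕜 h) (K.tensor (V 𝕜 C i n)) (a ⊗ₜ b)
    (u ⊗ₜ[𝕜] vac 𝕜 C i n : K ⊗[𝕜] V 𝕜 C i n)

theorem isStrandHom_vacMap : IsStrandHom C h (vacMap h K) :=
  isStrandHom_of_juxtapose h fun a u => by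
    rw [juxtapose_smul_vacMap, one_smul]
    rfl

theorem juxtapose_right_smul_vacMap {b : KLRAlgebra 𝕜 C (Multiset.replicate n i)}
    (hb : b • vac 𝕜 C i n = 0) (u : K) : juxtapose 𝕜 C h (1 ⊗ₜ b) • vacMap h K u = 0 := by
  rw [juxtapose_smul_vacMap, hb, TensorProduct.tmul_zero]
  exact map_zero (GrMod.indMk (juxtapose 𝕜 C h) (juxtapose_mem 𝕜 h) (K.tensor (V 𝕜 C i n)))

/-- The vector vac generates V(i^n) and is killed by its dots, and 1 ⊗ (K ⊗ V(i^n)) generates the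
induced module. -/
theorem isVacuumHom_vacMap : IsVacuumHom C h (vacMap h K) where
  toIsStrandHom := isStrandHom_vacMap h K
  dot_eq_zero k hk u := by
    have hc := card_add_eq h
    by_cases hk' : k < Multiset.card ρ
    · obtain ⟨l, rfl⟩ := Nat.exists_eq_add_of_le hk
      have := juxtapose_right_smul_vacMap h K (dot_smul_vac l) u
      rwa [juxtapose_dot_right 𝕜 C h (by omega), mul_smul,
        (isStrandHom_vacMap h K).oneTensorOne_smul] at this
    · rw [dot_of_le 𝕜 (by omega), zero_smul]
  span_eq_top := by
    let φ : K.tensor (V 𝕜 C i n) →ₗ[𝕜] Ind h (K.tensor (V 𝕜 C i n)) :=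
      GrMod.indMk (juxtapose 𝕜 C h) (juxtapose_mem 𝕜 h) (K.tensor (V 𝕜 C i n))
    have hφ : Submodule.span (KLRAlgebra 𝕜 C ρ) (Set.range φ) = ⊤ := GrMod.span_indMk _ _ _
    rw [eq_top_iff, ← hφ, Submodule.span_le]
    rintro _ ⟨w, rfl⟩
    rw [SetLike.mem_coe]
    induction w using TensorProduct.induction_on with
    | zero => exact (map_zero φ).symm ▸ zero_mem _
    | add x y hx hy => exact (map_add φ x y).symm ▸ add_mem hx hy
    | tmul u v =>
      obtain ⟨b, rfl⟩ := exists_smul_vac v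
      have := juxtapose_smul_vacMap h K 1 b u
      rw [one_smul] at this
      have hmem : juxtapose 𝕜 C h (1 ⊗ₜ b) • vacMap h K u
          ∈ Submodule.span (KLRAlgebra 𝕜 C ρ) (Set.range (vacMap h K)) :=
        Submodule.smul_mem _ _ (Submodule.subset_span ⟨u, rfl⟩)
      exact this ▸ hmem

theorem vacMap_mem_deg {p : ℤ} {u : K} (hu : u ∈ K.deg p) :
    vacMap h K u ∈ (Ind h (K.tensor (V 𝕜 C i n))).deg (p + vacDeg C i n) :=
  GrMod.indMk_mem_deg (juxtapose 𝕜 C h) (juxtapose_mem 𝕜 h) (K.tensor (V 𝕜 C i n))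
    (tmul_mem_tensorDeg hu vac_mem_deg)

variable {L : Type*} [AddCommGroup L] [Module 𝕜 L] [Module (KLRAlgebra 𝕜 C ρ) L]
variable [IsScalarTower 𝕜 (KLRAlgebra 𝕜 C ρ) L]

/-- Frobenius reciprocity for `K ⊗ V(i^n)`. -/
theorem exists_vacMap_lift {ι : K →ₗ[𝕜] L} (H : IsStrandHom C h ι)
    (hx : ∀ k, Multiset.card κ ≤ k → ∀ u, dot 𝕜 C ρ k • ι u = 0)
    (ht : ¬C.IsReal i → ∀ k, Multiset.card κ ≤ k → ∀ u, cross 𝕜 C ρ k • ι u = 0) :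
    ∃ Φ : Ind h (K.tensor (V 𝕜 C i n)) →ₗ[KLRAlgebra 𝕜 C ρ] L, ∀ u, Φ (vacMap h K u) = ι u := by
  have hmul : ∀ b b' : KLRAlgebra 𝕜 C (Multiset.replicate n i),
      juxtapose 𝕜 C h (1 ⊗ₜ (b * b')) = juxtapose 𝕜 C h (1 ⊗ₜ b) * juxtapose 𝕜 C h (1 ⊗ₜ b') := by
    intro b b'
    rw [← map_mul, Algebra.TensorProduct.tmul_mul_tmul, one_mul]
  have hgen : ∀ g ∈ trivialGens C i n, ∀ u, juxtapose 𝕜 C h (1 ⊗ₜ gen 𝕜 C g) • ι u = 0 := by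
    rintro g (⟨k, hk, s, rfl⟩ | ⟨hi, k, hk, s, rfl⟩) u
    · rw [Subsingleton.elim s (constSeq i n)]
      have hk' : k < n := by rwa [Multiset.card_replicate] at hk
      have e1 : gen 𝕜 C (.x k hk (constSeq i n)) = dot 𝕜 C (Multiset.replicate n i) k := by
        rw [dot, dif_pos hk, Fintype.sum_unique, default_seq]
      rw [e1, juxtapose_dot_right 𝕜 C h hk', mul_smul, H.oneTensorOne_smul, hx _ (by omega)]
    · rw [Subsingleton.elim s (constSeq i n)]
      have hk' : k + 1 < n := by rwa [Multiset.card_replicate] at hk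
      have e1 : gen 𝕜 C (.t k hk (constSeq i n)) = cross 𝕜 C (Multiset.replicate n i) k := by
        rw [cross, dif_pos hk, Fintype.sum_unique, default_seq]
      rw [e1, juxtapose_cross_right 𝕜 C h hk', mul_smul, H.oneTensorOne_smul, ht hi _ (by omega)]
  -- The map on K ⊗ V(i^n) has to send u ⊗ b vac to b acting on ι u through the right strands. It is
  -- first defined on b in R(ni) and then factored through V(i^n) by `hgen`.
  let φ : KLRAlgebra 𝕜 C (Multiset.replicate n i) →ₗ[𝕜] K →ₗ[𝕜] L :=
    { toFun := fun b => (Algebra.lsmul 𝕜 𝕜 L (juxtapose 𝕜 C h (1 ⊗ₜ b))).comp ι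
      map_add' := fun b b' => by rw [TensorProduct.tmul_add, map_add, map_add, LinearMap.add_comp]
      map_smul' := fun c b => by
        rw [TensorProduct.tmul_smul, map_smul, map_smul, LinearMap.smul_comp, RingHom.id_apply] }
  obtain ⟨ψ, hψ⟩ := exists_V_lift φ fun b g hg => by
    ext u
    change juxtapose 𝕜 C h (1 ⊗ₜ (b * gen 𝕜 C g)) • ι u = 0
    rw [hmul, mul_smul, hgen g hg, smul_zero]
  have hψ' : ∀ b u, ψ (b • vac 𝕜 C i n) u = juxtapose 𝕜 C h (1 ⊗ₜ b) • ι u := fun b u => by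
    rw [hψ]; rfl
  let θ : K.tensor (V 𝕜 C i n) →ₗ[𝕜] L := TensorProduct.lift ψ.flip
  have hθ : ∀ (u : K) (b : KLRAlgebra 𝕜 C (Multiset.replicate n i)),
      θ (u ⊗ₜ[𝕜] (b • vac 𝕜 C i n) : K ⊗[𝕜] V 𝕜 C i n) = juxtapose 𝕜 C h (1 ⊗ₜ b) • ι u := by
    intro u b
    rw [← hψ']; rfl
  -- On pure tensors the balancing condition says that the actions of the left and the right strands
  -- on ι u combine to that of the product a ⊗ (b b').
  have hbal : ∀ (s : KLRAlgebra 𝕜 C κ ⊗[𝕜] KLRAlgebra 𝕜 C (Multiset.replicate n i))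
      (w : K.tensor (V 𝕜 C i n)), θ (s • w) = juxtapose 𝕜 C h s • θ w := by
    intro s w
    induction s using TensorProduct.induction_on with
    | zero => rw [zero_smul, map_zero, map_zero, zero_smul]
    | add x y hx hy => rw [add_smul, map_add, hx, hy, map_add, add_smul]
    | tmul a b =>
      induction w using TensorProduct.induction_on with
      | zero => exact (congrArg θ (smul_zero (a ⊗ₜ[𝕜] b))).trans (by rw [map_zero]; exact
          ((congrArg _ (map_zero θ)).trans (smul_zero _)).symm)
      | add x y hx hy =>
        have e1 : (a ⊗ₜ[𝕜] b) • (show (K.tensor (V 𝕜 C i n)).carrier from x + y)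
            = (a ⊗ₜ[𝕜] b) • (show (K.tensor (V 𝕜 C i n)).carrier from x)
              + (a ⊗ₜ[𝕜] b) • (show (K.tensor (V 𝕜 C i n)).carrier from y) := smul_add _ _ _
        refine (congrArg θ e1).trans ?_
        rw [map_add, hx, hy, ← smul_add]
        exact congrArg _ (map_add θ x y).symm
      | tmul u v =>
        obtain ⟨b', rfl⟩ := exists_smul_vac v
        have e1 : θ ((a ⊗ₜ[𝕜] b) • (show (K.tensor (V 𝕜 C i n)).carrier from
            u ⊗ₜ[𝕜] (b' • vac 𝕜 C i n))) = juxtapose 𝕜 C h (1 ⊗ₜ (b * b')) • ι (a • u) := by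
          rw [← hθ, mul_smul]; rfl
        refine e1.trans ?_
        refine Eq.trans ?_ (congrArg _ (hθ u b').symm)
        rw [H.map_smul_eq, ← mul_smul, ← mul_smul, ← map_mul, ← map_mul,
          Algebra.TensorProduct.tmul_mul_tmul, Algebra.TensorProduct.tmul_mul_tmul, one_mul,
          mul_one, mul_one]
  refine ⟨GrMod.indLift (juxtapose 𝕜 C h) (juxtapose_mem 𝕜 h) _ θ hbal, fun u => ?_⟩
  have := GrMod.indLift_indMk (juxtapose 𝕜 C h) (juxtapose_mem 𝕜 h) _ θ hbal
    (u ⊗ₜ[𝕜] vac 𝕜 C i n : K ⊗[𝕜] V 𝕜 C i n)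
  refine this.trans ?_
  have e2 := hθ u 1
  rw [one_smul, ← Algebra.TensorProduct.one_def, juxtapose_one, H.oneTensorOne_smul] at e2
  exact e2

end Frobenius

end Vacuum

/-! ### Coefficients for exchanging a new strand with an old one. -/

section Insertion

universe v

variable {I : Type v} {ν ρ : Multiset I} {𝕜 : Type*} [Field 𝕜] {C : BorcherdsCartan I} {i : I}
variable {N : Type*} [AddCommGroup N] [Module 𝕜 N]

/-- Operators that satisfy the relations of `R(ν)`, an operator `z` that commutes with them, and
inverses `d k` of `x k - z`. -/
structure LocalizedRel (C : BorcherdsCartan I) (e : Seq ν → Module.End 𝕜 N)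
    (x t : ℕ → Module.End 𝕜 N) (z : Module.End 𝕜 N) (d : ℕ → Module.End 𝕜 N) : Prop where
  rel : StrandRel C e x t
  z_e : ∀ s, Commute z (e s)
  z_x : ∀ k, Commute z (x k)
  z_t : ∀ k, Commute z (t k)
  d_mul : ∀ k < Multiset.card ν, d k * (x k - z) = 1
  mul_d : ∀ k < Multiset.card ν, (x k - z) * d k = 1

theorem commute_of_inverse {B : Type*} [Ring B] {a b y : B} (h1 : b * a = 1) (h2 : a * b = 1)
    (h : Commute y a) : Commute y b := by
  change y * b = b * y
  calc y * b = b * a * (y * b) := by rw [h1, one_mul]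
    _ = b * (a * y) * b := by noncomm_ring
    _ = b * (y * a) * b := by rw [h.eq]
    _ = b * y * (a * b) := by noncomm_ring
    _ = b * y := by rw [h2, mul_one]

/-- Multiply the relation a y = y a' + w by the inverse of a on the left and by that of a' on the
right. This turns slides of x - z into slides of 1/(x - z). -/
theorem intertwine_of_inverse {B : Type*} [Ring B] {a b a' b' y w : B} (h1 : b * a = 1)
    (h2 : a' * b' = 1) (h : a * y = y * a' + w) : y * b' = b * y + b * w * b' := by
  have : b * (a * y) * b' = b * (y * a' + w) * b' := by rw [h]
  calc y * b' = (b * a) * y * b' := by rw [h1, one_mul]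
    _ = b * (a * y) * b' := by noncomm_ring
    _ = b * y * (a' * b') + b * w * b' := by rw [this]; noncomm_ring
    _ = _ := by rw [h2, mul_one]

open Classical in
variable (C i) in
/-- The coefficients of the exchange of the new strand with a strand of a given label that leave
the new strand in place. -/
def stayCoeff (d : ℕ → Module.End 𝕜 N) (k : ℕ) (a : Option I) : Module.End 𝕜 N :=
  if a = some i ∧ C.IsReal i then d k else 0

open Classical in
variable (C i) in
/-- The coefficients of the exchange that move the new strand to the left. -/
def leftCoeff (a : Option I) : Module.End 𝕜 N :=
  if a = some i ∧ ¬C.IsReal i then 0 else 1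

open Classical in
variable (C i) in
/-- The coefficients of the exchange that move the new strand to the right. -/
def rightCoeff (x : ℕ → Module.End 𝕜 N) (z : Module.End 𝕜 N) (d : ℕ → Module.End 𝕜 N) (k : ℕ) :
    Option I → Module.End 𝕜 N
  | none => 0
  | some a =>
    if a = i then if C.IsReal i then -(d k * d k) else 1
    else if C.form a i = 0 then 1 else x k ^ (-C.a a i).toNat + z ^ (-C.a i a).toNat

/-- The operator which is `c a` on the sequences with entry `a` at position `k`. -/
def diag (e : Seq ν → Module.End 𝕜 N) (k : ℕ) (c : Option I → Module.End 𝕜 N) :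
    Module.End 𝕜 N :=
  ∑ s : Seq ν, c (s.1[k]?) * e s

section Coefficients

variable {e : Seq ν → Module.End 𝕜 N} {x t : ℕ → Module.End 𝕜 N} {z : Module.End 𝕜 N}
variable {d : ℕ → Module.End 𝕜 N}

theorem commute_stayCoeff {y : Module.End 𝕜 N} {k : ℕ} (h : Commute y (d k)) (a : Option I) :
    Commute y (stayCoeff C i d k a) := by
  rw [stayCoeff]
  split_ifs
  exacts [h, Commute.zero_right _]

theorem commute_leftCoeff (y : Module.End 𝕜 N) (a : Option I) : Commute y (leftCoeff C i a) := by
  rw [leftCoeff]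
  split_ifs
  exacts [Commute.zero_right _, Commute.one_right _]

theorem commute_rightCoeff {y : Module.End 𝕜 N} {k : ℕ} (hx : Commute y (x k)) (hz : Commute y z)
    (hd : Commute y (d k)) (a : Option I) : Commute y (rightCoeff C i x z d k a) := by
  cases a with
  | none => exact Commute.zero_right _
  | some a =>
    rw [rightCoeff]
    split_ifs
    exacts [(hd.mul_right hd).neg_right, Commute.one_right _, Commute.one_right _,
      (hx.pow_right _).add_right (hz.pow_right _)]

theorem StrandRel.diag_mul_e (H : StrandRel C e x t) (k : ℕ) (c : Option I → Module.End 𝕜 N)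
    (s : Seq ν) : diag e k c * e s = c (s.1[k]?) * e s := by
  classical
  rw [diag, Finset.sum_mul, Finset.sum_eq_single s, mul_assoc, H.idem]
  · intro s' _ hs
    rw [mul_assoc, H.orth _ _ hs, mul_zero]
  · simp

theorem StrandRel.diag_apply (H : StrandRel C e x t) (k : ℕ) (c : Option I → Module.End 𝕜 N)
    {s : Seq ν} {u : N} (hu : e s u = u) : diag e k c u = c (s.1[k]?) u := by
  have := congrArg (fun f => f u) (H.diag_mul_e k c s)
  simpa [hu] using this

theorem StrandRel.commute_diag {k : ℕ} {c : Option I → Module.End 𝕜 N} {y : Module.End 𝕜 N}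
    (hc : ∀ a, Commute y (c a)) (he : ∀ s, Commute y (e s)) : Commute y (diag e k c) :=
  Commute.sum_right _ _ _ fun s _ => (hc _).mul_right (he s)

theorem getElem?_swap_of_ne (s : Seq ν) {k l : ℕ} (hl : l + 1 < Multiset.card ν) (h : k ≠ l)
    (h' : k ≠ l + 1) : (s.swap l).1[k]? = s.1[k]? := by
  change (swapList l s.1)[k]? = _
  rw [swapList_getElem? l s.1 (by rwa [s.length_eq]), Equiv.swap_apply_of_ne_of_ne h h']

theorem getElem?_swap_left (s : Seq ν) {k : ℕ} (hk : k + 1 < Multiset.card ν) :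
    (s.swap k).1[k]? = s.1[k + 1]? := by
  change (swapList k s.1)[k]? = _
  rw [swapList_getElem? k s.1 (by rwa [s.length_eq]), Equiv.swap_apply_left]

theorem getElem?_swap_right (s : Seq ν) {k : ℕ} (hk : k + 1 < Multiset.card ν) :
    (s.swap k).1[k + 1]? = s.1[k]? := by
  change (swapList k s.1)[k + 1]? = _
  rw [swapList_getElem? k s.1 (by rwa [s.length_eq]), Equiv.swap_apply_right]

/-- A crossing at l does not change the entry at k when k is neither l nor l + 1, so the same
coefficient is selected before and after it. -/
theorem StrandRel.commute_t_diag (H : StrandRel C e x t) {k l : ℕ}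
    {c : Option I → Module.End 𝕜 N} (hl : l + 1 < Multiset.card ν) (h : k ≠ l) (h' : k ≠ l + 1)
    (hc : ∀ a, Commute (t l) (c a)) : Commute (t l) (diag e k c) := by
  change t l * diag e k c = diag e k c * t l
  have key : ∀ s : Seq ν, t l * diag e k c * e s = diag e k c * t l * e s := by
    intro s
    rw [mul_assoc, H.diag_mul_e, mul_assoc (diag e k c), H.t_e l s hl, ← mul_assoc (diag e k c),
      H.diag_mul_e, getElem?_swap_of_ne s hl h h', mul_assoc, ← H.t_e l s hl, ← mul_assoc,
      (hc _).eq, mul_assoc]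
  have h1 : t l * diag e k c * ∑ s, e s = diag e k c * t l * ∑ s, e s := by
    rw [Finset.mul_sum, Finset.mul_sum]
    exact Finset.sum_congr rfl fun s _ => key s
  rwa [H.unit, mul_one, mul_one] at h1

namespace LocalizedRel

variable (H : LocalizedRel C e x t z d)

include H

/-- What commutes with x_k and z commutes with x_k - z, hence with its inverse. -/
theorem commute_d {k : ℕ} (hk : k < Multiset.card ν) {y : Module.End 𝕜 N} (hx : Commute y (x k))
    (hz : Commute y z) : Commute y (d k) :=
  commute_of_inverse (H.d_mul k hk) (H.mul_d k hk) (hx.sub_right hz)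

theorem d_e {k : ℕ} (hk : k < Multiset.card ν) (s : Seq ν) : Commute (e s) (d k) :=
  H.commute_d hk (H.rel.x_e k s hk).symm (H.z_e s).symm

theorem d_z {k : ℕ} (hk : k < Multiset.card ν) : Commute z (d k) :=
  H.commute_d hk (H.z_x k) (Commute.refl z)

theorem d_x {k l : ℕ} (hk : k < Multiset.card ν) (hl : l < Multiset.card ν) :
    Commute (x l) (d k) := H.commute_d hk (H.rel.x_x l k hl hk) (H.z_x l).symm

theorem d_d {k l : ℕ} (hk : k < Multiset.card ν) (hl : l < Multiset.card ν) :
    Commute (d l) (d k) :=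
  H.commute_d hk (H.d_x hl hk).symm (H.d_z hl).symm

theorem d_t {k l : ℕ} (hk : k < Multiset.card ν) (hl : l + 1 < Multiset.card ν) (h : k ≠ l)
    (h' : k ≠ l + 1) : Commute (t l) (d k) :=
  H.commute_d hk (H.rel.x_t l k hl hk h h').symm (H.z_t l).symm

theorem d_apply {k : ℕ} (hk : k < Multiset.card ν) (u : N) : x k (d k u) = z (d k u) + u := by
  have := congrArg (fun f => f u) (H.mul_d k hk)
  simp only [Module.End.mul_apply, LinearMap.sub_apply, Module.End.one_apply] at this
  exact sub_eq_iff_eq_add'.1 this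

end LocalizedRel

end Coefficients

end Insertion

/-! ### Identities in noncommutative rings behind the braid relation. -/

section RingIdentities

variable {B : Type*} [Ring B]

/-- Iterating the slide, the error terms add up to the complete homogeneous polynomial of degree n -
1 in X and Y. It is symmetric, which is why `mul_pow_eq_of_slide` has the same error. -/
theorem pow_mul_eq_of_slide {X Y τ E : B} (hXY : Commute X Y) (hX : Commute X E)
    (hY : Commute Y E) (h : X * τ = τ * Y + E) (n : ℕ) :
    X ^ n * τ = τ * Y ^ n + (∑ r ∈ Finset.range n, X ^ r * Y ^ (n - 1 - r)) * E := by
  induction n with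
  | zero => simp
  | succ n ih =>
    have h1 : ∑ r ∈ Finset.range (n + 1), X ^ r * Y ^ (n + 1 - 1 - r)
        = X * (∑ r ∈ Finset.range n, X ^ r * Y ^ (n - 1 - r)) + Y ^ n := by
      rw [Finset.sum_range_succ', Finset.mul_sum]
      simp only [pow_zero, one_mul, Nat.add_sub_cancel, Nat.sub_zero]
      congr 1
      refine Finset.sum_congr rfl fun r _ => ?_
      rw [pow_succ', mul_assoc, Nat.sub_sub, Nat.add_comm 1 r]
    rw [h1, pow_succ', mul_assoc, ih, mul_add, ← mul_assoc, h, add_mul, add_mul, mul_assoc,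
      ← pow_succ', (hY.pow_left n).eq, mul_assoc]
    abel

theorem mul_pow_eq_of_slide {X Y τ E : B} (hXY : Commute X Y) (hX : Commute X E)
    (hY : Commute Y E) (h : τ * X = Y * τ + E) (n : ℕ) :
    τ * X ^ n = Y ^ n * τ + (∑ r ∈ Finset.range n, X ^ r * Y ^ (n - 1 - r)) * E := by
  induction n with
  | zero => simp
  | succ n ih =>
    have h1 : ∑ r ∈ Finset.range (n + 1), X ^ r * Y ^ (n + 1 - 1 - r)
        = (∑ r ∈ Finset.range n, X ^ r * Y ^ (n - 1 - r)) * X + Y ^ n := by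
      rw [Finset.sum_range_succ', Finset.sum_mul]
      simp only [pow_zero, one_mul, Nat.add_sub_cancel, Nat.sub_zero]
      congr 1
      refine Finset.sum_congr rfl fun r _ => ?_
      rw [mul_assoc, ← (hXY.pow_right _).eq, ← mul_assoc, ← pow_succ, Nat.sub_sub, Nat.add_comm 1 r]
    rw [h1, pow_succ, ← mul_assoc, ih, add_mul, mul_assoc (Y ^ n), h, mul_assoc _ E X, ← hX.eq,
      mul_add, add_mul, pow_succ, mul_assoc, mul_assoc]
    abel

/-- Products that are symmetric in `X` and `Y` commute with the crossing. -/
theorem mul_symmetric_eq {X Y τ w h : B} (hτ : τ * X = Y * τ + h) (hτ' : X * τ = τ * Y + h)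
    (hXY : Commute X Y) (hh : Commute h Y) (hw : Commute τ w) (hwX : Commute w X)
    (hwY : Commute w Y) (hwh : Commute w h) :
    τ * ((Y + w) * (X + w)) = (Y + w) * ((X + w) * τ) := by
  have h1 : τ * Y = X * τ - h := by rw [hτ']; abel
  have h2 : τ * (Y * X) = Y * X * τ := by
    rw [← hXY.eq, ← mul_assoc, hτ, add_mul, mul_assoc, h1, mul_sub, hh.eq, ← mul_assoc, hXY.eq]
    abel
  -- The errors - w h here and + w h in `h4` cancel, while the product Y X produces none.
  have h3 : τ * (Y * w) = w * X * τ - w * h := by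
    rw [← mul_assoc, h1, sub_mul, mul_assoc, hw.eq, ← mul_assoc, hwX.eq, hwh.eq]
  have h4 : τ * (w * X) = Y * w * τ + w * h := by
    rw [← mul_assoc, hw.eq, mul_assoc, hτ, mul_add, ← mul_assoc, hwY.eq]
  have h5 : τ * (w * w) = w * w * τ := (hw.mul_right hw).eq
  have h6 : (Y + w) * (X + w) = Y * X + Y * w + w * X + w * w := by noncomm_ring
  rw [← mul_assoc (Y + w), h6, mul_add, mul_add, mul_add, h2, h3, h4, h5]
  noncomm_ring

/-- The braid identities for three strands with the same real label. -/
theorem braid_same {P Q τ : B} (hPQ : Q * P = P * Q) (h1 : τ * Q = P * τ + P * Q)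
    (h2 : τ * P = Q * τ - P * Q) (h3 : τ * τ = 0) :
    Q * (P * P) + P * (τ * P) + τ * (P * τ) = 0 ∧ -(Q * P) - P * τ + τ * Q = 0 ∧
    P * P * (τ * P) + P * (Q * (P * P)) - Q * (P * P * τ) = 0 ∧
    -(P * P * τ) - P * (Q * P) + τ * (Q * Q) - Q * (P * Q) = 0 ∧
    P * τ - τ * Q + Q * P = 0 ∧ τ * (Q * Q * (P * P)) = Q * Q * (P * P * τ) ∧
    -(τ * (Q * Q * P)) - Q * Q * (P * Q) + Q * (τ * (Q * Q)) = 0 ∧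
    τ * (Q * τ) + Q * Q * P - Q * (τ * Q) = 0 := by
  -- The rewriting rules `c1` to `c4` move τ to the right of P and Q, and P to the left of Q. In
  -- this normal form all eight identities are linear.
  have c1 : ∀ w, Q * (P * w) = P * (Q * w) := fun w => by rw [← mul_assoc, hPQ, mul_assoc]
  have c2 : ∀ w, τ * (Q * w) = P * (τ * w) + P * (Q * w) := fun w => by
    rw [← mul_assoc, h1, add_mul, mul_assoc, mul_assoc]
  have c3 : ∀ w, τ * (P * w) = Q * (τ * w) - P * (Q * w) := fun w => by
    rw [← mul_assoc, h2, sub_mul, mul_assoc, mul_assoc]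
  have c4 : ∀ w, τ * (τ * w) = 0 := fun w => by rw [← mul_assoc, h3, zero_mul]
  refine ⟨?_, ?_, ?_, ?_, ?_, ?_, ?_, ?_⟩ <;>
  simp only [mul_assoc, c1, c2, c3, c4, h1, h2, h3, hPQ, mul_add, mul_sub, mul_zero] <;> abel

end RingIdentities

/-! ### The new strand and two neighbouring strands: dots that slide freely. -/

section Exchange

universe v

variable {I : Type v} {ν ρ : Multiset I} {𝕜 : Type*} [Field 𝕜] {C : BorcherdsCartan I} {i : I}
variable {N : Type*} [AddCommGroup N] [Module 𝕜 N]

/-- The identities behind the braid relation for the new strand and two further strands. -/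
structure BraidIdentities (τ D D' G G' Λ Λ' : Module.End 𝕜 N) (u c₀ c₁ c₂ : N) : Prop where
  h00 : -Λ (D' (G u)) + D (τ (D u)) + τ (D (τ u)) = c₀
  h01 : -Λ (D' (D u)) - D (τ (Λ u)) + τ (Λ (D' u)) = 0
  h02 : Λ (Λ' (τ u)) = τ (Λ (Λ' u))
  h10 : -G (τ (D u)) - D (D' (G u)) + D' (G (τ u)) = 0
  h11 : G (τ (Λ u)) - D (D' (D u)) - Λ' (τ (G' u)) - D' (D (D' u)) = c₁
  h12 : D (Λ' (τ u)) - Λ' (τ (D' u)) + D' (D (Λ' u)) = 0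
  h20 : τ (G' (G u)) = G' (G (τ u))
  h21 : τ (G' (D u)) + G' (D (D' u)) - D' (τ (G' u)) = 0
  h22 : τ (D' (τ u)) - G' (D (Λ' u)) - D' (τ (D' u)) = c₂

variable (C i) in
/-- The part of the exchange at `k` that leaves the new strand in place. -/
def stay (e : Seq ν → Module.End 𝕜 N) (d : ℕ → Module.End 𝕜 N) (k : ℕ) : Module.End 𝕜 N :=
  diag e k (stayCoeff C i d k)

variable (C i) in
/-- The part of the exchange at `k` that moves the new strand to the left. -/
def moveLeft (e : Seq ν → Module.End 𝕜 N) (k : ℕ) : Module.End 𝕜 N :=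
  diag e k (leftCoeff C i)

variable (C i) in
/-- The part of the exchange at `k` that moves the new strand to the right. -/
def moveRight (e : Seq ν → Module.End 𝕜 N) (x : ℕ → Module.End 𝕜 N) (z : Module.End 𝕜 N)
    (d : ℕ → Module.End 𝕜 N) (k : ℕ) : Module.End 𝕜 N :=
  diag e k (rightCoeff C i x z d k)

theorem getElem?_eq_entry (s : Seq ν) {k : ℕ} (hk : k < Multiset.card ν) :
    s.1[k]? = some (s.entry k hk) := (Seq.entry_eq_iff s k hk _).1 rfl

variable {e : Seq ν → Module.End 𝕜 N} {x t : ℕ → Module.End 𝕜 N} {z : Module.End 𝕜 N}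
variable {d : ℕ → Module.End 𝕜 N}

namespace LocalizedRel

variable (H : LocalizedRel C e x t z d) {k : ℕ} (hk : k + 1 < Multiset.card ν) {s : Seq ν}

include H

theorem e_apply_t {u : N} (hk : k + 1 < Multiset.card ν) (hu : e s u = u) :
    e (s.swap k) (t k u) = t k u := by
  have := congrArg (fun f => f u) (H.rel.t_e k s hk)
  simp only [Module.End.mul_apply, hu] at this
  exact this.symm

section Slide

variable (hs : ¬(s.entry k (by omega) = s.entry (k + 1) hk ∧ C.IsReal (s.entry (k + 1) hk)))

include hs

theorem semiconjBy_x : SemiconjBy (t k * e s) (x (k + 1)) (x k) := by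
  change t k * e s * x (k + 1) = x k * (t k * e s)
  rw [mul_assoc, ← H.rel.x_e _ _ hk, ← mul_assoc, ← mul_assoc, H.rel.slide_left k hk s hs]

theorem semiconjBy_x' : SemiconjBy (t k * e s) (x k) (x (k + 1)) := by
  change t k * e s * x k = x (k + 1) * (t k * e s)
  rw [mul_assoc, ← H.rel.x_e _ _ (by omega), ← mul_assoc, ← mul_assoc,
    H.rel.slide_right k hk s hs]

omit hs in
theorem semiconjBy_z : SemiconjBy (t k * e s) z z := ((H.z_t k).mul_right (H.z_e s)).symm

omit hs in
-- This is `intertwine_of_inverse` without error term: if the crossing carries one dot to the other,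
-- it carries the corresponding inverses to each other.
theorem semiconjBy_d {l l' : ℕ} (hl : l < Multiset.card ν) (hl' : l' < Multiset.card ν)
    (h : SemiconjBy (t k * e s) (x l) (x l')) : SemiconjBy (t k * e s) (d l) (d l') := by
  have h1 : (x l' - z) * (t k * e s) = t k * e s * (x l - z) + 0 := by
    rw [add_zero]; exact (h.sub_right (H.semiconjBy_z)).symm
  have := intertwine_of_inverse (H.d_mul l' hl') (H.mul_d l hl) h1
  rwa [mul_zero, zero_mul, add_zero] at this

omit H hs in
theorem semiconjBy_stayCoeff {τ : Module.End 𝕜 N} {l l' : ℕ} (hd : SemiconjBy τ (d l) (d l'))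
    (a : Option I) : SemiconjBy τ (stayCoeff C i d l a) (stayCoeff C i d l' a) := by
  rw [stayCoeff, stayCoeff]
  split_ifs
  exacts [hd, SemiconjBy.zero_right _]

omit H hs in
theorem semiconjBy_rightCoeff {τ : Module.End 𝕜 N} {l l' : ℕ} (hx : SemiconjBy τ (x l) (x l'))
    (hz : SemiconjBy τ z z) (hd : SemiconjBy τ (d l) (d l')) (a : Option I) :
    SemiconjBy τ (rightCoeff C i x z d l a) (rightCoeff C i x z d l' a) := by
  cases a with
  | none => exact SemiconjBy.zero_right _
  | some a =>
    rw [rightCoeff, rightCoeff]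
    split_ifs
    exacts [(hd.mul_right hd).neg_right, SemiconjBy.one_right _, SemiconjBy.one_right _,
      (hx.pow_right _).add_right (hz.pow_right _)]

/-- The braid identities when dots slide freely through the crossing. -/
theorem braidIdentities_slide {u : N} (hu : e s u = u) :
    BraidIdentities (t k) (stay C i e d k) (stay C i e d (k + 1)) (moveRight C i e x z d k)
      (moveRight C i e x z d (k + 1)) (moveLeft C i e k) (moveLeft C i e (k + 1)) u
      (t k (t k (stayCoeff C i d (k + 1) (s.1[k + 1]?) u)) - (leftCoeff C i (s.1[k]?) : Module.End 𝕜 N)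
        (stayCoeff C i d (k + 1) (s.1[k + 1]?) (rightCoeff C i x z d k (s.1[k]?) u)))
      0
      (t k (t k (stayCoeff C i d k (s.1[k]?) u)) - (leftCoeff C i (s.1[k + 1]?) : Module.End 𝕜 N)
        (rightCoeff C i x z d (k + 1) (s.1[k + 1]?) (stayCoeff C i d k (s.1[k]?) u))) := by
  have hk' : k < Multiset.card ν := by omega
  have sx := H.semiconjBy_x hk hs
  have sx' := H.semiconjBy_x' hk hs
  have sz := H.semiconjBy_z (k := k) (s := s)
  have sd := H.semiconjBy_d hk hk' sx
  have sd' := H.semiconjBy_d hk' hk sx'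
  -- The two strands do not share a real label, so at most one of them has the real label i, and
  -- products of the two stay coefficients vanish.
  have hab : s.1[k]? = some i ∧ C.IsReal i → s.1[k + 1]? = some i ∧ C.IsReal i → False := by
    rw [getElem?_eq_entry s hk, getElem?_eq_entry s hk', Option.some_inj, Option.some_inj]
    rintro ⟨h1, h2⟩ ⟨h3, -⟩
    exact hs ⟨h1.trans h3.symm, h3.symm ▸ h2⟩
  generalize ha : s.1[k]? = a at *
  generalize hb : s.1[k + 1]? = b at *
  generalize hDa : stayCoeff C i d k a = Da
  generalize hDb : stayCoeff C i d (k + 1) b = Db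
  generalize hGa : rightCoeff C i x z d k a = Ga
  generalize hGb : rightCoeff C i x z d (k + 1) b = Gb
  generalize hla : (leftCoeff C i a : Module.End 𝕜 N) = la
  generalize hlb : (leftCoeff C i b : Module.End 𝕜 N) = lb
  have cDa : ∀ w, e s (Da w) = Da (e s w) := fun w => congrArg (fun f => f w)
    (hDa ▸ commute_stayCoeff (H.d_e hk' s) a : Commute (e s) Da).eq
  have cDb : ∀ w, e s (Db w) = Db (e s w) := fun w => congrArg (fun f => f w)
    (hDb ▸ commute_stayCoeff (H.d_e hk s) b : Commute (e s) Db).eq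
  have cGa : ∀ w, e s (Ga w) = Ga (e s w) := fun w => congrArg (fun f => f w)
    (hGa ▸ commute_rightCoeff (H.rel.x_e k s hk').symm (H.z_e s).symm (H.d_e hk' s) a :
      Commute (e s) Ga).eq
  have cGb : ∀ w, e s (Gb w) = Gb (e s w) := fun w => congrArg (fun f => f w)
    (hGb ▸ commute_rightCoeff (H.rel.x_e (k + 1) s hk).symm (H.z_e s).symm (H.d_e hk s) b :
      Commute (e s) Gb).eq
  have cla : ∀ (y : Module.End 𝕜 N) w, la (y w) = y (la w) := fun y w => (congrArg (fun f => f w)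
    (hla ▸ commute_leftCoeff y a : Commute y la).eq).symm
  have clb : ∀ (y : Module.End 𝕜 N) w, lb (y w) = y (lb w) := fun y w => (congrArg (fun f => f w)
    (hlb ▸ commute_leftCoeff y b : Commute y lb).eq).symm
  have cDG : ∀ w, Da (Gb w) = Gb (Da w) := fun w => (congrArg (fun f => f w)
    (hDa ▸ commute_stayCoeff (hGb ▸ (commute_rightCoeff (H.d_x hk' hk).symm (H.d_z hk').symm
      (H.d_d hk hk') b).symm) a : Commute Gb Da).eq).symm
  have cGG : ∀ w, Ga (Gb w) = Gb (Ga w) := by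
    have c1 : ∀ y, Commute y (x k) → Commute y z → Commute y (d k) → Commute y Ga :=
      fun y h1 h2 h3 => hGa ▸ commute_rightCoeff h1 h2 h3 a
    have c2 : Commute Ga Gb := hGb ▸ commute_rightCoeff
      (c1 _ (H.rel.x_x _ _ hk hk') (H.z_x _).symm (H.d_x hk' hk)).symm
      (c1 _ (H.z_x _) (Commute.refl _) (H.d_z hk')).symm
      (c1 _ (H.d_x hk hk').symm (H.d_z hk).symm (H.d_d hk' hk)).symm b
    exact fun w => congrArg (fun f => f w) c2.eq
  have hDD : ∀ w, Da (Db w) = 0 := by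
    intro w
    rw [← hDa, ← hDb, stayCoeff, stayCoeff]
    split_ifs with h1 h2
    · exact (hab h1 h2).elim
    all_goals simp
  have hDD' : ∀ w, Db (Da w) = 0 := by
    intro w
    rw [← hDa, ← hDb, stayCoeff, stayCoeff]
    split_ifs with h1 h2
    · exact (hab h2 h1).elim
    all_goals simp
  have onS : ∀ {l : ℕ} {c : Option I → Module.End 𝕜 N} {w : N}, e s w = w →
      diag e l c w = c (s.1[l]?) w := fun hw => H.rel.diag_apply _ _ hw
  -- A coefficient evaluated after the crossing refers to the swapped sequence, and equals the
  -- crossing applied to the coefficient at the other position. The facts S compute the operators on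
  -- weight s, and the facts T on its swap.
  have onT : ∀ {l : ℕ} {c : Option I → Module.End 𝕜 N} {y : Module.End 𝕜 N} {w : N}, e s w = w →
      SemiconjBy (t k * e s) y (c ((s.swap k).1[l]?)) → (∀ w, e s (y w) = y (e s w)) →
      diag e l c (t k w) = t k (y w) := by
    intro l c y w hw hy hc
    rw [H.rel.diag_apply l c (H.e_apply_t hk hw)]
    have := congrArg (fun f => f w) hy.eq
    simp only [Module.End.mul_apply, hw, hc] at this
    exact this.symm
  have S1 : ∀ {w}, e s w = w → stay C i e d k w = Da w := fun hw => by
    rw [stay, onS hw, ha, hDa]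
  have S2 : ∀ {w}, e s w = w → stay C i e d (k + 1) w = Db w := fun hw => by
    rw [stay, onS hw, hb, hDb]
  have S3 : ∀ {w}, e s w = w → moveRight C i e x z d k w = Ga w := fun hw => by
    rw [moveRight, onS hw, ha, hGa]
  have S4 : ∀ {w}, e s w = w → moveRight C i e x z d (k + 1) w = Gb w := fun hw => by
    rw [moveRight, onS hw, hb, hGb]
  have S5 : ∀ {w}, e s w = w → moveLeft C i e k w = la w := fun hw => by
    rw [moveLeft, onS hw, ha, hla]
  have S6 : ∀ {w}, e s w = w → moveLeft C i e (k + 1) w = lb w := fun hw => by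
    rw [moveLeft, onS hw, hb, hlb]
  have T1 : ∀ {w}, e s w = w → stay C i e d k (t k w) = t k (Db w) := fun hw =>
    onT hw (by rw [getElem?_swap_left s hk, hb, ← hDb]; exact semiconjBy_stayCoeff sd b) cDb
  have T2 : ∀ {w}, e s w = w → stay C i e d (k + 1) (t k w) = t k (Da w) := fun hw =>
    onT hw (by rw [getElem?_swap_right s hk, ha, ← hDa]; exact semiconjBy_stayCoeff sd' a) cDa
  have T3 : ∀ {w}, e s w = w → moveRight C i e x z d k (t k w) = t k (Gb w) := fun hw =>
    onT hw (by
      rw [getElem?_swap_left s hk, hb, ← hGb]; exact semiconjBy_rightCoeff sx sz sd b) cGb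
  have T4 : ∀ {w}, e s w = w → moveRight C i e x z d (k + 1) (t k w) = t k (Ga w) := fun hw =>
    onT hw (by
      rw [getElem?_swap_right s hk, ha, ← hGa]; exact semiconjBy_rightCoeff sx' sz sd' a) cGa
  have T5 : ∀ {w}, e s w = w → moveLeft C i e k (t k w) = t k (lb w) := fun hw =>
    onT hw (by rw [getElem?_swap_left s hk, hb, ← hlb]; exact commute_leftCoeff _ b)
      fun w => (clb _ w).symm
  have T6 : ∀ {w}, e s w = w → moveLeft C i e (k + 1) (t k w) = t k (la w) := fun hw =>
    onT hw (by rw [getElem?_swap_right s hk, ha, ← hla]; exact commute_leftCoeff _ a)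
      fun w => (cla _ w).symm
  have cla' : ∀ w, e s (la w) = la (e s w) := fun w => (cla _ w).symm
  have clb' : ∀ w, e s (lb w) = lb (e s w) := fun w => (clb _ w).symm
  -- With all coefficients moved to the right of the crossing, only their commutation and the
  -- vanishing of products of stay coefficients remain. The two terms with a double crossing are
  -- left as they stand in the statement.
  constructor <;>
  simp only [S1, S2, S3, S4, S5, S6, T1, T2, T3, T4, T5, T6, cDa, cDb, cGa, cGb, cla', clb', hu]
  · rw [hDD', map_zero, add_zero]; abel
  · rw [hDD', map_zero, cla Db]; abel
  · rw [cla lb]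
  · rw [hDD, cDG]; abel
  · rw [hDD, hDD', cla Gb]; abel
  · rw [hDD', cla Db]; abel
  · rw [cGG]
  · rw [hDD, map_zero, cDG]; abel
  · rw [hDD, map_zero, clb Gb, clb Da]; abel

end Slide

end LocalizedRel

end Exchange

/-! ### The new strand and two neighbouring strands: correction terms and equal real labels. -/

section Exchange

universe v

variable {I : Type v} {ν ρ : Multiset I} {𝕜 : Type*} [Field 𝕜] {C : BorcherdsCartan I} {i : I}
variable {N : Type*} [AddCommGroup N] [Module 𝕜 N]

theorem Seq.swap_eq_self {s : Seq ν} {k : ℕ} (hk : k + 1 < Multiset.card ν)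
    (hs : s.entry k (by omega) = s.entry (k + 1) hk) : s.swap k = s := by
  refine Seq.ext_entry fun r hr => ?_
  by_cases h1 : r = k
  · subst h1
    rw [Seq.entry_swap_left s r hk, hs]
  by_cases h2 : r = k + 1
  · subst h2
    rw [Seq.entry_swap_right s k hk, hs]
  · rw [Seq.entry_swap_other s k r hk hr h1 h2]

open Classical in
variable (C) in
/-- The correction term of the braid relation for strands with labels `a`, `b`, `c`, where the
first and the last one carry the dots `y` and `y'`. -/
def braidCorrection (a b c : I) (y y' : Module.End 𝕜 N) (u : N) : N :=
  if a = c ∧ a ≠ b ∧ C.IsReal a ∧ C.form a b ≠ 0 then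
    ∑ r ∈ Finset.range (-C.a a b).toNat, (y ^ r) ((y' ^ ((-C.a a b).toNat - 1 - r)) u)
  else 0

variable {e : Seq ν → Module.End 𝕜 N} {x t : ℕ → Module.End 𝕜 N} {z : Module.End 𝕜 N}
variable {d : ℕ → Module.End 𝕜 N}

namespace LocalizedRel

variable (H : LocalizedRel C e x t z d) {k : ℕ} (hk : k + 1 < Multiset.card ν) {s : Seq ν}

include H

theorem t_apply_t_apply_orth {u : N} (hu : e s u = u)
    (h : s.entry k (by omega) ≠ s.entry (k + 1) hk)
    (h' : C.form (s.entry k (by omega)) (s.entry (k + 1) hk) = 0) : t k (t k u) = u := by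
  have := congrArg (fun f => f u) (H.rel.quad_orth k hk s h h')
  simpa only [Module.End.mul_apply, hu] using this

theorem t_apply_t_apply {u : N} (hu : e s u = u)
    (h : s.entry k (by omega) ≠ s.entry (k + 1) hk)
    (h' : C.form (s.entry k (by omega)) (s.entry (k + 1) hk) ≠ 0) :
    t k (t k u) = (x k ^ (-C.a (s.entry k (by omega)) (s.entry (k + 1) hk)).toNat) u +
      (x (k + 1) ^ (-C.a (s.entry (k + 1) hk) (s.entry k (by omega))).toNat) u := by
  have := congrArg (fun f => f u) (H.rel.quad k hk s h h')
  simpa only [Module.End.mul_apply, LinearMap.add_apply, hu] using this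

/-- Since d is the inverse of x - z, this is (x^n - z^n)/(x - z) = ∑ x^r z^(n-1-r), the shape of the
correction term of the braid relation. -/
theorem geom_sum_apply {l : ℕ} (hl : l < Multiset.card ν) (n : ℕ) (u : N) :
    (x l ^ n) (d l u) - (z ^ n) (d l u)
      = ∑ r ∈ Finset.range n, (x l ^ r) ((z ^ (n - 1 - r)) u) := by
  have h := (H.z_x l).symm.geom_sum₂_mul n
  have h' := congrArg (fun f => f (d l u)) h
  simp only [Module.End.mul_apply, LinearMap.sub_apply, LinearMap.sum_apply] at h'
  rw [← h', H.d_apply hl, add_sub_cancel_left]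

theorem geom_sum_apply' {l : ℕ} (hl : l < Multiset.card ν) (n : ℕ) (u : N) :
    (x l ^ n) (d l u) - (z ^ n) (d l u)
      = ∑ r ∈ Finset.range n, (z ^ r) ((x l ^ (n - 1 - r)) u) := by
  rw [H.geom_sum_apply hl]
  have h : ∑ r ∈ Finset.range n, x l ^ r * z ^ (n - 1 - r)
      = ∑ r ∈ Finset.range n, z ^ r * x l ^ (n - 1 - r) := (H.z_x l).symm.geom_sum₂_comm n
  have h' := congrArg (fun f => f u) h
  simpa only [Module.End.mul_apply, LinearMap.sum_apply] using h'

/-- If the right strand has the real label i, the double crossing gives x_k^p + x_{k+1}^q and the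
exchange with the new strand gives x_k^p + z^q. The difference divided by x_{k+1} - z is the
correction term. Otherwise the stay coefficient is zero and no correction occurs. -/
theorem stayCoeff_correction_right {u : N} (hu : e s u = u)
    (hs : ¬(s.entry k (by omega) = s.entry (k + 1) hk ∧ C.IsReal (s.entry (k + 1) hk))) :
    t k (t k (stayCoeff C i d (k + 1) (s.1[k + 1]?) u)) -
      (leftCoeff C i (s.1[k]?) : Module.End 𝕜 N)
        (stayCoeff C i d (k + 1) (s.1[k + 1]?) (rightCoeff C i x z d k (s.1[k]?) u))
    = braidCorrection C i (s.entry k (by omega)) (s.entry (k + 1) hk) z (x (k + 1)) u := by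
  have hk' : k < Multiset.card ν := by omega
  rw [getElem?_eq_entry s hk, getElem?_eq_entry s hk']
  by_cases hi : s.entry (k + 1) hk = i ∧ C.IsReal i
  · obtain ⟨h1, h2⟩ := hi
    have h3 : s.entry k hk' ≠ i := fun h => hs ⟨h.trans h1.symm, h1.symm ▸ h2⟩
    have h4 : s.entry k hk' ≠ s.entry (k + 1) hk := fun h => h3 (h.trans h1)
    have hdu : e s (d (k + 1) u) = d (k + 1) u := by
      rw [← Module.End.mul_apply, (H.d_e hk s).eq, Module.End.mul_apply, hu]
    rw [stayCoeff, if_pos ⟨congrArg some h1, h2⟩, leftCoeff, if_neg (fun h => h.2 h2), rightCoeff,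
      if_neg h3, Module.End.one_apply, braidCorrection]
    by_cases hf : C.form (s.entry k hk') i = 0
    · rw [if_pos hf, H.t_apply_t_apply_orth hk hdu h4 (by rw [h1]; exact hf), Module.End.one_apply,
        sub_self, if_neg]
      rintro ⟨-, -, -, h5⟩
      exact h5 (by rw [form_comm]; exact hf)
    · rw [if_neg hf, H.t_apply_t_apply hk hdu h4 (by rw [h1]; exact hf), h1,
        if_pos ⟨rfl, h3.symm, h2, by rwa [form_comm]⟩, ← H.geom_sum_apply' hk]
      have c1 : Commute (x k ^ (-C.a (s.entry k hk') i).toNat +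
          z ^ (-C.a i (s.entry k hk')).toNat) (d (k + 1)) :=
        ((H.d_x hk hk').pow_left _).add_left ((H.d_z hk).pow_left _)
      rw [← Module.End.mul_apply (d (k + 1)), ← c1.eq, Module.End.mul_apply, LinearMap.add_apply]
      abel
  · rw [stayCoeff, if_neg (by rwa [Option.some_inj]), braidCorrection, if_neg]
    · simp
    · rintro ⟨h1, -, h2, -⟩
      exact hi ⟨h1.symm, h2⟩

/-- The mirror image: now the summands at k + 1 cancel, and x_k^p - z^p is divided by x_k - z. -/
theorem stayCoeff_correction_left {u : N} (hu : e s u = u)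
    (hs : ¬(s.entry k (by omega) = s.entry (k + 1) hk ∧ C.IsReal (s.entry (k + 1) hk))) :
    t k (t k (stayCoeff C i d k (s.1[k]?) u)) - (leftCoeff C i (s.1[k + 1]?) : Module.End 𝕜 N)
        (rightCoeff C i x z d (k + 1) (s.1[k + 1]?) (stayCoeff C i d k (s.1[k]?) u))
    = braidCorrection C (s.entry k (by omega)) (s.entry (k + 1) hk) i (x k) z u := by
  have hk' : k < Multiset.card ν := by omega
  rw [getElem?_eq_entry s hk, getElem?_eq_entry s hk']
  by_cases hi : s.entry k hk' = i ∧ C.IsReal i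
  · obtain ⟨h1, h2⟩ := hi
    have h3 : s.entry (k + 1) hk ≠ i := fun h => hs ⟨h1.trans h.symm, h.symm ▸ h2⟩
    have h4 : s.entry k hk' ≠ s.entry (k + 1) hk := fun h => h3 (h.symm.trans h1)
    have hdu : e s (d k u) = d k u := by
      rw [← Module.End.mul_apply, (H.d_e hk' s).eq, Module.End.mul_apply, hu]
    rw [stayCoeff, if_pos ⟨congrArg some h1, h2⟩, leftCoeff, if_neg (fun h => h.2 h2), rightCoeff,
      if_neg h3, Module.End.one_apply, braidCorrection]
    by_cases hf : C.form (s.entry (k + 1) hk) i = 0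
    · rw [if_pos hf, H.t_apply_t_apply_orth hk hdu h4 (by rw [h1, form_comm]; exact hf),
        Module.End.one_apply, sub_self, if_neg]
      rintro ⟨-, -, -, h5⟩
      exact h5 (by rw [h1, form_comm]; exact hf)
    · have hf' : C.form i (s.entry (k + 1) hk) ≠ 0 := by rwa [form_comm]
      rw [if_neg hf, H.t_apply_t_apply hk hdu h4 (by rw [h1]; exact hf'), h1,
        if_pos ⟨rfl, h3.symm, h2, hf'⟩, ← H.geom_sum_apply hk', LinearMap.add_apply]
      abel
  · rw [stayCoeff, if_neg (by rwa [Option.some_inj]), braidCorrection, if_neg]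
    · simp
    · rintro ⟨h1, -, h2, -⟩
      exact hi ⟨h1, h1 ▸ h2⟩

/-- No strand keeps the new one in place, since their label is not i. What remains is the identity
in the middle, which produces the correction term for labels a, i, a, and the commutation of the
crossing with a product symmetric in the two dots. -/
theorem braidIdentities_same_of_ne {u : N} (hu : e s u = u)
    (hs : s.entry k (by omega) = s.entry (k + 1) hk) (hr : C.IsReal (s.entry (k + 1) hk))
    (hi : s.entry (k + 1) hk ≠ i) :
    BraidIdentities (t k) (stay C i e d k) (stay C i e d (k + 1)) (moveRight C i e x z d k)
      (moveRight C i e x z d (k + 1)) (moveLeft C i e k) (moveLeft C i e (k + 1)) u 0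
      (braidCorrection C (s.entry k (by omega)) i (s.entry (k + 1) hk) (x k) (x (k + 1)) u) 0 := by
  have hk' : k < Multiset.card ν := by omega
  have hsw := Seq.swap_eq_self hk hs
  have ht : ∀ {w}, e s w = w → e s (t k w) = t k w := fun hw => by
    have := H.e_apply_t hk hw
    rwa [hsw] at this
  have hx : ∀ {l n : ℕ} {w}, l < Multiset.card ν → e s w = w → e s ((x l ^ n) w) = (x l ^ n) w := by
    intro l n w hl hw
    have c : Commute (e s) (x l) := (H.rel.x_e l s hl).symm
    rw [← Module.End.mul_apply, (c.pow_right n).eq, Module.End.mul_apply, hw]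
  have hz : ∀ {n : ℕ} {w}, e s w = w → e s ((z ^ n) w) = (z ^ n) w := by
    intro n w hw
    rw [← Module.End.mul_apply, ((H.z_e s).symm.pow_right n).eq, Module.End.mul_apply, hw]
  have ha : s.1[k]? = some (s.entry (k + 1) hk) := by rw [getElem?_eq_entry s hk', hs]
  have hb := getElem?_eq_entry s hk
  rw [hs]
  generalize hae : s.entry (k + 1) hk = a at *
  have S1 : ∀ {w}, e s w = w → stay C i e d k w = 0 := fun hw => by
    rw [stay, H.rel.diag_apply _ _ hw, ha, stayCoeff, if_neg (fun h => hi (Option.some_inj.1 h.1)),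
      LinearMap.zero_apply]
  have S2 : ∀ {w}, e s w = w → stay C i e d (k + 1) w = 0 := fun hw => by
    rw [stay, H.rel.diag_apply _ _ hw, hb, stayCoeff, if_neg (fun h => hi (Option.some_inj.1 h.1)),
      LinearMap.zero_apply]
  have S3 : ∀ {w}, e s w = w → moveLeft C i e k w = w := fun hw => by
    rw [moveLeft, H.rel.diag_apply _ _ hw, ha, leftCoeff,
      if_neg (fun h => hi (Option.some_inj.1 h.1)), Module.End.one_apply]
  have S4 : ∀ {w}, e s w = w → moveLeft C i e (k + 1) w = w := fun hw => by
    rw [moveLeft, H.rel.diag_apply _ _ hw, hb, leftCoeff,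
      if_neg (fun h => hi (Option.some_inj.1 h.1)), Module.End.one_apply]
  have S5 : ∀ {w}, e s w = w → moveRight C i e x z d k w =
      rightCoeff C i x z d k (some a) w := fun hw => by
    rw [moveRight, H.rel.diag_apply _ _ hw, ha]
  have S6 : ∀ {w}, e s w = w → moveRight C i e x z d (k + 1) w =
      rightCoeff C i x z d (k + 1) (some a) w := fun hw => by
    rw [moveRight, H.rel.diag_apply _ _ hw, hb]
  rw [braidCorrection]
  by_cases hf : C.form a i = 0
  · have R : ∀ l, rightCoeff C i x z d l (some a) = 1 := fun l => by
      rw [rightCoeff, if_neg hi, if_pos hf]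
    simp only [R, Module.End.one_apply] at S5 S6
    rw [if_neg (fun h => h.2.2.2 hf)]
    constructor <;> simp [S1, S2, S3, S4, S5, S6, ht, hu]
  · have R : ∀ l, rightCoeff C i x z d l (some a)
        = x l ^ (-C.a a i).toNat + z ^ (-C.a i a).toNat := fun l => by
      rw [rightCoeff, if_neg hi, if_neg hf]
    simp only [R, LinearMap.add_apply] at S5 S6
    rw [if_pos ⟨rfl, hi, hr, hf⟩]
    have hxy : Commute (x k) (x (k + 1)) := H.rel.x_x _ _ hk' hk
    have hxe : Commute (x k) (e s) := H.rel.x_e _ _ hk'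
    have hye : Commute (x (k + 1)) (e s) := H.rel.x_e _ _ hk
    have hte : t k * e s = e s * t k := by rw [H.rel.t_e k s hk, hsw]
    have slide1 : x k * (t k * e s) = t k * e s * x (k + 1) + e s := by
      rw [← mul_assoc, H.rel.slide_left_real k hk s (hs.trans hae.symm) (hae.symm ▸ hr), add_mul,
        one_mul, mul_assoc, hye.eq, mul_assoc]
    have slide2 : t k * e s * x k = x (k + 1) * (t k * e s) + e s := by
      rw [mul_assoc, ← hxe.eq, ← mul_assoc,
        H.rel.slide_right_real k hk s (hs.trans hae.symm) (hae.symm ▸ hr), add_mul, one_mul,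
        mul_assoc]
    have p1 := pow_mul_eq_of_slide hxy hxe hye slide1 (-C.a a i).toNat
    have p2 := mul_pow_eq_of_slide hxy hxe hye slide2 (-C.a a i).toNat
    generalize (-C.a a i).toNat = n at *
    generalize (-C.a i a).toNat = n' at *
    have ctz : Commute (t k) (z ^ n') := (H.z_t k).symm.pow_right n'
    constructor
    · simp [S1, S2, S3, S4, ht, hu, S5, hx, hz, hk', hk]
    · simp [S1, S2, S3, S4, ht, hu]
    · simp [S1, S2, S3, S4, ht, hu]
    · simp [S1 hu, S2 (hx hk' hu), S2 (hz hu), S5 hu, S5 (ht hu), S2 (hx hk' (ht hu)),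
        S2 (hz (ht hu))]
    -- Sliding x_k^n through the crossing leaves the sum of mixed monomials, which is the correction
    -- term; the summands with z commute with the crossing and cancel.
    · have := congrArg (fun f => f u) p1
      simp only [Module.End.mul_apply, LinearMap.add_apply, LinearMap.sum_apply, hu,
        hx hk hu] at this
      rw [S1 hu, S2 hu, S3 hu, S6 hu, S5 (ht hu), this, map_add, S4, map_zero, map_zero, map_zero,
        ← Module.End.mul_apply (z ^ n'), ← ctz.eq, Module.End.mul_apply]
      · abel
      · rw [map_add, ht (hx hk hu), ht (hz hu)]
    · simp [S1, S2, S3, S4, ht, hu]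
    -- The product (x_{k+1}^n + z^{n'})(x_k^n + z^{n'}) commutes with the crossing by
    -- `mul_symmetric_eq`; the preceding facts supply its commutation hypotheses for the error term.
    · have hcS : ∀ y, Commute y (x k) → Commute y (x (k + 1)) →
          Commute y (∑ r ∈ Finset.range n, x k ^ r * x (k + 1) ^ (n - 1 - r)) := fun y h1 h2 =>
        Commute.sum_right _ _ _ fun r _ => (h1.pow_right _).mul_right (h2.pow_right _)
      have hS1 := hcS _ hxe.symm hye.symm
      have hS2 := hcS _ hxy.symm (Commute.refl _)
      have hS3 := hcS _ (H.z_x k) (H.z_x (k + 1))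
      have := mul_symmetric_eq p2 p1 (hxy.pow_pow n n)
        ((hS2.symm.pow_right n).mul_left (hye.symm.pow_right n))
        (ctz.mul_left ((H.z_e s).symm.pow_right n'))
        ((H.z_x k).pow_pow n' n) ((H.z_x (k + 1)).pow_pow n' n)
        ((hS3.pow_left n').mul_right ((H.z_e s).pow_left n'))
      have := congrArg (fun f => f u) this
      simp only [Module.End.mul_apply, LinearMap.add_apply, hu] at this
      rw [S5 hu, S6, S5 (ht hu), S6]
      · have hw : ∀ w, e s w = w → t k (e s w) = t k w := fun w hw => by rw [hw]
        rw [hw _ (by simp only [map_add, hx, hz, hu, hk, hk'])] at this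
        exact this
      · simp only [map_add, hx, hz, ht, hu, hk, hk']
      · simp only [map_add, hx, hz, hu, hk, hk']
    · simp [S1 hu, S2 hu, S6 hu, S2 (ht (hx hk hu)), S2 (ht (hz hu))]
    · simp [S1, S2, S3, S4, ht, hu]

/-- With three equal real labels no correction occurs. The nilHecke slides, rewritten for the
inverses of x_k - z and x_{k+1} - z, satisfy the hypotheses of `braid_same`. -/
theorem braidIdentities_same {u : N} (hu : e s u = u)
    (hs : s.entry k (by omega) = s.entry (k + 1) hk) (hr : C.IsReal i)
    (hi : s.entry (k + 1) hk = i) :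
    BraidIdentities (t k) (stay C i e d k) (stay C i e d (k + 1)) (moveRight C i e x z d k)
      (moveRight C i e x z d (k + 1)) (moveLeft C i e k) (moveLeft C i e (k + 1)) u 0 0 0 := by
  have hk' : k < Multiset.card ν := by omega
  have hsw := Seq.swap_eq_self hk hs
  have hte : Commute (t k) (e s) := by
    have := H.rel.t_e k s hk
    rwa [hsw] at this
  have hP : Commute (d k) (e s) := (H.d_e hk' s).symm
  have hQ : Commute (d (k + 1)) (e s) := (H.d_e hk s).symm
  have hPQ : Commute (d (k + 1)) (d k) := H.d_d hk' hk
  have ha : s.1[k]? = some i := by rw [getElem?_eq_entry s hk', hs, hi]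
  have hb : s.1[k + 1]? = some i := by rw [getElem?_eq_entry s hk, hi]
  have hxe : Commute (x k) (e s) := H.rel.x_e _ _ hk'
  have hye : Commute (x (k + 1)) (e s) := H.rel.x_e _ _ hk
  have slide1 : (x k - z) * (t k * e s) = t k * e s * (x (k + 1) - z) + e s := by
    rw [sub_mul, ← mul_assoc, H.rel.slide_left_real k hk s hs (hi.symm ▸ hr), add_mul,
      one_mul, mul_assoc, hye.eq, ← mul_assoc, ← mul_assoc, (H.z_t k).eq, mul_assoc _ z, (H.z_e s).eq]
    noncomm_ring
  have slide2 : (x (k + 1) - z) * (t k * e s) = t k * e s * (x k - z) + -e s := by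
    rw [mul_sub, mul_assoc (t k) (e s) (x k), ← hxe.eq, ← mul_assoc (t k),
      H.rel.slide_right_real k hk s hs (hi.symm ▸ hr), sub_mul, ← mul_assoc z, (H.z_t k).eq,
      mul_assoc _ z, (H.z_e s).eq]
    noncomm_ring
  have q1 := intertwine_of_inverse (H.d_mul k hk') (H.mul_d (k + 1) hk) slide1
  have q2 := intertwine_of_inverse (H.d_mul (k + 1) hk) (H.mul_d k hk') slide2
  have hE : e s * e s = e s := H.rel.idem s
  have hτ : t k * t k * e s = 0 := H.rel.quad_same k hk s hs
  have cE : ∀ {y : Module.End 𝕜 N}, Commute y (e s) → ∀ w, e s * (y * w) = y * (e s * w) :=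
    fun hy w => by rw [← mul_assoc, ← hy.eq, mul_assoc]
  have cEE : ∀ w, e s * (e s * w) = e s * w := fun w => by rw [← mul_assoc, hE]
  -- The relations hold only on weight s, so all three operators are cut down by the idempotent of
  -- s, which is fixed by the swap.
  have b := braid_same (P := d k * e s) (Q := d (k + 1) * e s) (τ := t k * e s)
    (by
      simp only [mul_assoc, cE hP, cE hQ, hE]
      rw [← mul_assoc, hPQ.eq, mul_assoc])
    (by
      have := congrArg (· * e s) q1
      simpa only [mul_assoc, cE hP, cE hQ, cE hte, hE, add_mul] using this)
    (by
      have := congrArg (· * e s) q2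
      simp only [mul_assoc, cE hP, cE hQ, cE hte, hE, add_mul, neg_mul, mul_neg] at this ⊢
      rw [this, ← mul_assoc (d (k + 1)) (d k), hPQ.eq, mul_assoc (d k), sub_eq_add_neg])
    (by simpa only [mul_assoc, cE hte, hE] using hτ)
  have v1 : ∀ w, e s (d k w) = d k (e s w) := fun w => congrArg (fun f => f w) hP.symm.eq
  have v2 : ∀ w, e s (d (k + 1) w) = d (k + 1) (e s w) := fun w =>
    congrArg (fun f => f w) hQ.symm.eq
  have v3 : ∀ w, e s (t k w) = t k (e s w) := fun w => congrArg (fun f => f w) hte.symm.eq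
  have S1 : ∀ {w}, e s w = w → stay C i e d k w = d k w := fun hw => by
    rw [stay, H.rel.diag_apply _ _ hw, ha, stayCoeff, if_pos ⟨rfl, hr⟩]
  have S2 : ∀ {w}, e s w = w → stay C i e d (k + 1) w = d (k + 1) w := fun hw => by
    rw [stay, H.rel.diag_apply _ _ hw, hb, stayCoeff, if_pos ⟨rfl, hr⟩]
  have S3 : ∀ {w}, e s w = w → moveLeft C i e k w = w := fun hw => by
    rw [moveLeft, H.rel.diag_apply _ _ hw, leftCoeff, if_neg (fun h => h.2 hr),
      Module.End.one_apply]
  have S4 : ∀ {w}, e s w = w → moveLeft C i e (k + 1) w = w := fun hw => by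
    rw [moveLeft, H.rel.diag_apply _ _ hw, leftCoeff, if_neg (fun h => h.2 hr),
      Module.End.one_apply]
  have S5 : ∀ {w}, e s w = w → moveRight C i e x z d k w = -d k (d k w) := fun hw => by
    rw [moveRight, H.rel.diag_apply _ _ hw, ha, rightCoeff, if_pos rfl, if_pos hr]
    rfl
  have S6 : ∀ {w}, e s w = w → moveRight C i e x z d (k + 1) w = -d (k + 1) (d (k + 1) w) :=
    fun hw => by
      rw [moveRight, H.rel.diag_apply _ _ hw, hb, rightCoeff, if_pos rfl, if_pos hr]
      rfl
  obtain ⟨b1, b2, b3, b4, b5, b6, b7, b8⟩ := b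
  replace b1 := congrArg (fun f => f u) b1
  replace b2 := congrArg (fun f => f u) b2
  replace b3 := congrArg (fun f => f u) b3
  replace b4 := congrArg (fun f => f u) b4
  replace b5 := congrArg (fun f => f u) b5
  replace b6 := congrArg (fun f => f u) b6
  replace b7 := congrArg (fun f => f u) b7
  replace b8 := congrArg (fun f => f u) b8
  simp only [Module.End.mul_apply, LinearMap.add_apply, LinearMap.sub_apply, LinearMap.neg_apply,
    LinearMap.zero_apply, v1, v2, v3, hu, sub_eq_add_neg] at b1 b2 b3 b4 b5 b6 b7 b8
  constructor <;>
  simp only [S1, S2, S3, S4, S5, S6, v1, v2, v3, hu, map_neg, neg_neg, sub_eq_add_neg] <;>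
  assumption

/-- The identities behind the braid relation. -/
theorem braidIdentities {u : N} (hu : e s u = u) :
    BraidIdentities (t k) (stay C i e d k) (stay C i e d (k + 1)) (moveRight C i e x z d k)
      (moveRight C i e x z d (k + 1)) (moveLeft C i e k) (moveLeft C i e (k + 1)) u
      (braidCorrection C i (s.entry k (by omega)) (s.entry (k + 1) hk) z (x (k + 1)) u)
      (braidCorrection C (s.entry k (by omega)) i (s.entry (k + 1) hk) (x k) (x (k + 1)) u)
      (braidCorrection C (s.entry k (by omega)) (s.entry (k + 1) hk) i (x k) z u) := by
  by_cases hs : s.entry k (by omega) = s.entry (k + 1) hk ∧ C.IsReal (s.entry (k + 1) hk)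
  · obtain ⟨hs, hr⟩ := hs
    by_cases hi : s.entry (k + 1) hk = i
    · have := H.braidIdentities_same hk hu hs (hi ▸ hr) hi
      rw [hs, hi]
      simpa [braidCorrection] using this
    · have := H.braidIdentities_same_of_ne hk hu hs hr hi
      rw [hs] at this ⊢
      convert this using 1
      · rw [braidCorrection, if_neg (fun h => hi h.1.symm)]
      · rw [braidCorrection, if_neg (fun h => hi h.1)]
  · have := H.braidIdentities_slide (i := i) hk hs hu
    rw [H.stayCoeff_correction_left hk hu hs, H.stayCoeff_correction_right hk hu hs] at this
    convert this using 1
    rw [braidCorrection, if_neg]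
    exact fun h => hs ⟨h.1, h.1 ▸ h.2.2.1⟩

end LocalizedRel

end Exchange

/-! ### Inserting one entry into a sequence. -/

section InsertSeq

universe v

variable {I : Type v} {ν ρ : Multiset I} {i : I}

/-- The sequence `t` arises from `s` by inserting an entry `i` at position `j`. -/
def IsInsert (i : I) (j : ℕ) (s : Seq ν) (t : Seq ρ) : Prop := t.1 = s.1.insertIdx j i

variable {s : Seq ν} {t : Seq ρ} {j k : ℕ}

theorem IsInsert.eq_left {s' : Seq ν} (h : IsInsert i j s t) (h' : IsInsert i j s' t) : s = s' :=
  Subtype.ext (List.insertIdx_injective j i (h.symm.trans h'))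

theorem IsInsert.eq_right {t' : Seq ρ} (h : IsInsert i j s t) (h' : IsInsert i j s t') : t = t' :=
  Subtype.ext (h.trans h'.symm)

variable (hρ : ν + Multiset.replicate 1 i = ρ)

include hρ in
theorem card_eq_succ : Multiset.card ρ = Multiset.card ν + 1 := (card_add_eq hρ).symm

include hρ in
theorem exists_isInsert (s : Seq ν) (hj : j ≤ Multiset.card ν) :
    ∃ t : Seq ρ, IsInsert i j s t := by
  refine ⟨⟨s.1.insertIdx j i, ?_⟩, rfl⟩
  rw [Multiset.coe_eq_coe.2 (List.perm_insertIdx i s.1 (by rwa [s.length_eq])),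
    ← Multiset.cons_coe, s.2, ← hρ, Multiset.replicate_one, Multiset.add_comm,
    Multiset.singleton_add]

theorem IsInsert.getElem?_lt (h : IsInsert i j s t) {r : ℕ} (hr : r < j) : t.1[r]? = s.1[r]? := by
  rw [h, List.getElem?_insertIdx, if_pos hr]

theorem IsInsert.getElem?_eq (h : IsInsert i j s t) (hj : j ≤ Multiset.card ν) :
    t.1[j]? = some i := by
  rw [h, List.getElem?_insertIdx, if_neg (lt_irrefl j), if_pos rfl, if_pos (by rwa [s.length_eq])]

theorem IsInsert.getElem?_gt (h : IsInsert i j s t) {r : ℕ} (hr : j ≤ r) :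
    t.1[r + 1]? = s.1[r]? := by
  rw [h, List.getElem?_insertIdx, if_neg (by omega), if_neg (by omega), Nat.add_sub_cancel]

theorem isInsert_iff (hc : Multiset.card ρ = Multiset.card ν + 1) (hj : j ≤ Multiset.card ν) :
    IsInsert i j s t ↔ (∀ r < j, t.1[r]? = s.1[r]?) ∧ t.1[j]? = some i ∧
      ∀ r, j ≤ r → t.1[r + 1]? = s.1[r]? := by
  refine ⟨fun h => ⟨fun r hr => h.getElem?_lt hr, h.getElem?_eq hj, fun r hr => h.getElem?_gt hr⟩,
    fun ⟨h1, h2, h3⟩ => List.ext_getElem? fun r => ?_⟩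
  rw [List.getElem?_insertIdx]
  split_ifs with h4 h5 h6
  · exact h1 r h4
  · rw [h5, h2]
  · rw [s.length_eq] at h6; omega
  · have := h3 (r - 1) (by omega)
    rwa [show r - 1 + 1 = r by omega] at this

variable (hc : Multiset.card ρ = Multiset.card ν + 1) (hk : k < Multiset.card ν)

include hc hk

-- The four swap lemmas translate crossings of the longer sequence into moves of the pair (s, j): to
-- the right of the inserted entry the crossing acts on s with index lowered by one, to the left
-- with the same index, and at the inserted entry it moves j by one.
omit hk in
theorem IsInsert.swap_lt (hk : k + 1 < Multiset.card ν) (h : IsInsert i j s t) (hj : j ≤ k) :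
    IsInsert i j (s.swap k) (t.swap (k + 1)) := by
  have hjm : j ≤ Multiset.card ν := by omega
  have hk2 : k + 1 + 1 < Multiset.card ρ := by omega
  rw [isInsert_iff hc hjm]
  refine ⟨fun r hr => ?_, ?_, fun r hr => ?_⟩
  · rw [getElem?_swap_of_ne t hk2 (by omega) (by omega),
      getElem?_swap_of_ne s hk (by omega) (by omega), h.getElem?_lt hr]
  · rw [getElem?_swap_of_ne t hk2 (by omega) (by omega), h.getElem?_eq hjm]
  · by_cases h1 : r = k
    · rw [h1, getElem?_swap_left s hk, getElem?_swap_left t hk2, h.getElem?_gt (by omega)]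
    by_cases h2 : r = k + 1
    · rw [h2, getElem?_swap_right t hk2, getElem?_swap_right s hk, h.getElem?_gt (by omega)]
    · rw [getElem?_swap_of_ne t hk2 (by omega) (by omega),
        getElem?_swap_of_ne s hk (by omega) (by omega), h.getElem?_gt hr]

theorem IsInsert.swap_gt (h : IsInsert i j s t) (hj : k + 1 < j) (hjm : j ≤ Multiset.card ν) :
    IsInsert i j (s.swap k) (t.swap k) := by
  have hk1 : k + 1 < Multiset.card ν := by omega
  have hk2 : k + 1 < Multiset.card ρ := by omega
  rw [isInsert_iff hc hjm]
  refine ⟨fun r hr => ?_, ?_, fun r hr => ?_⟩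
  · by_cases h1 : r = k
    · rw [h1, getElem?_swap_left s hk1, getElem?_swap_left t hk2, h.getElem?_lt hj]
    by_cases h2 : r = k + 1
    · rw [h2, getElem?_swap_right s hk1, getElem?_swap_right t hk2, h.getElem?_lt (by omega)]
    · rw [getElem?_swap_of_ne t hk2 h1 h2, getElem?_swap_of_ne s hk1 h1 h2, h.getElem?_lt hr]
  · rw [getElem?_swap_of_ne t hk2 (by omega) (by omega), h.getElem?_eq hjm]
  · rw [getElem?_swap_of_ne t hk2 (by omega) (by omega),
      getElem?_swap_of_ne s hk1 (by omega) (by omega), h.getElem?_gt hr]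

theorem IsInsert.swap_left (h : IsInsert i k s t) : IsInsert i (k + 1) s (t.swap k) := by
  have hk2 : k + 1 < Multiset.card ρ := by omega
  rw [isInsert_iff hc (by omega)]
  refine ⟨fun r hr => ?_, ?_, fun r hr => ?_⟩
  · by_cases h1 : r = k
    · rw [h1, getElem?_swap_left t hk2, h.getElem?_gt le_rfl]
    · rw [getElem?_swap_of_ne t hk2 h1 (by omega), h.getElem?_lt (by omega)]
  · rw [getElem?_swap_right t hk2, h.getElem?_eq hk.le]
  · rw [getElem?_swap_of_ne t hk2 (by omega) (by omega), h.getElem?_gt (by omega)]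

theorem IsInsert.swap_right (h : IsInsert i (k + 1) s t) : IsInsert i k s (t.swap k) := by
  have hk2 : k + 1 < Multiset.card ρ := by omega
  rw [isInsert_iff hc (by omega)]
  refine ⟨fun r hr => ?_, ?_, fun r hr => ?_⟩
  · rw [getElem?_swap_of_ne t hk2 (by omega) (by omega), h.getElem?_lt (by omega)]
  · rw [getElem?_swap_left t hk2, h.getElem?_eq (by omega)]
  · by_cases h1 : r = k
    · rw [h1, getElem?_swap_right t hk2, h.getElem?_lt (by omega)]
    · rw [getElem?_swap_of_ne t hk2 (by omega) (by omega), h.getElem?_gt (by omega)]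

/-- Inserting i just before or just after an entry i gives the same sequence. Therefore the part of
the exchange that leaves the new strand in place is compatible with weights. -/
theorem IsInsert.succ (h : IsInsert i k s t) (hs : s.1[k]? = some i) : IsInsert i (k + 1) s t := by
  rw [isInsert_iff hc (by omega)]
  refine ⟨fun r hr => ?_, ?_, fun r hr => h.getElem?_gt (by omega)⟩
  · by_cases h1 : r = k
    · rw [h1, h.getElem?_eq hk.le, hs]
    · rw [h.getElem?_lt (by omega)]
  · rw [h.getElem?_gt le_rfl, hs]

theorem IsInsert.pred (h : IsInsert i (k + 1) s t) (hs : s.1[k]? = some i) : IsInsert i k s t := by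
  rw [isInsert_iff hc (by omega)]
  refine ⟨fun r hr => h.getElem?_lt (by omega), ?_, fun r hr => ?_⟩
  · rw [h.getElem?_lt (by omega), hs]
  · by_cases h1 : r = k
    · rw [h1, h.getElem?_eq (by omega), hs]
    · rw [h.getElem?_gt (by omega)]

end InsertSeq

/-! ### The insertion module and its weights. -/

section InsertionModule

universe v

variable {I : Type v} {ν ρ : Multiset I} {𝕜 : Type*} [Field 𝕜] {C : BorcherdsCartan I} {i : I}
variable {N : Type*} [AddCommGroup N] [Module 𝕜 N]

variable (ν N 𝕜) in
/-- Functions on the positions at which a new strand can be inserted. -/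
def InsFun : Submodule 𝕜 (ℕ → N) where
  carrier := {f | ∀ j, Multiset.card ν < j → f j = 0}
  zero_mem' _ _ := rfl
  add_mem' hf hg j hj := by rw [Pi.add_apply, hf j hj, hg j hj, add_zero]
  smul_mem' c f hf j hj := by rw [Pi.smul_apply, hf j hj, smul_zero]

variable (e : Seq ν → Module.End 𝕜 N) (x t : ℕ → Module.End 𝕜 N) (z : Module.End 𝕜 N)
variable (d : ℕ → Module.End 𝕜 N)

open Classical in
variable (i) in
/-- The idempotents of the insertion module. -/
def insE (τ : Seq ρ) : Module.End 𝕜 (InsFun ν 𝕜 N) :=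
  LinearMap.restrict (p := InsFun ν 𝕜 N) (q := InsFun ν 𝕜 N)
    (LinearMap.pi fun j => (∑ s : Seq ν, if IsInsert i j s τ then e s else 0).comp
      (LinearMap.proj j)) fun f hf j hj => by
    rw [LinearMap.pi_apply, LinearMap.comp_apply, LinearMap.proj_apply, hf j hj, map_zero]

/-- The action of the `k`-th dot if the new strand is at position `j`. -/
def insDot (k j : ℕ) : Module.End 𝕜 N := if k < j then x k else if k = j then z else x (k - 1)

/-- The dots of the insertion module. -/
def insX (k : ℕ) : Module.End 𝕜 (InsFun ν 𝕜 N) :=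
  LinearMap.restrict (p := InsFun ν 𝕜 N) (q := InsFun ν 𝕜 N)
    (LinearMap.pi fun j => (insDot x z k j).comp (LinearMap.proj j)) fun f hf j hj => by
    rw [LinearMap.pi_apply, LinearMap.comp_apply, LinearMap.proj_apply, hf j hj, map_zero]

/-- Beyond the last strand the entry is `none`, so a coefficient family with value 0 there gives no
contribution. -/
theorem diag_eq_zero {k : ℕ} (hk : Multiset.card ν ≤ k) {c : Option I → Module.End 𝕜 N}
    (hc : c none = 0) : diag e k c = 0 := by
  refine Finset.sum_eq_zero fun s _ => ?_
  rw [List.getElem?_eq_none (by rwa [s.length_eq]), hc, zero_mul]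

variable (C i) in
/-- The component at `j` of the `k`-th crossing of the insertion module. -/
def insCross (k j : ℕ) : (ℕ → N) →ₗ[𝕜] N :=
  if j < k then (t (k - 1)).comp (LinearMap.proj j)
  else if j = k then (moveLeft C i e k).comp (LinearMap.proj (k + 1)) -
    (stay C i e d k).comp (LinearMap.proj k)
  else if j = k + 1 then (moveRight C i e x z d k).comp (LinearMap.proj k) +
    (stay C i e d k).comp (LinearMap.proj (k + 1))
  else (t k).comp (LinearMap.proj j)

variable (C i) in
/-- The crossings of the insertion module. -/
def insT (k : ℕ) : Module.End 𝕜 (InsFun ν 𝕜 N) :=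
  LinearMap.restrict (p := InsFun ν 𝕜 N) (q := InsFun ν 𝕜 N)
    (LinearMap.pi (insCross C i e x t z d k)) fun f hf j hj => by
    rw [LinearMap.pi_apply, insCross]
    split_ifs with h1 h2 h3
    · simp [hf j hj]
    · subst h2
      simp [hf j hj, hf (j + 1) (by omega)]
    · subst h3
      -- The value 0 of `rightCoeff` at `none` keeps the new strand from leaving the last admissible
      -- position.
      rw [moveRight, diag_eq_zero e (by omega) rfl]
      simp [hf _ hj]
    · simp [hf j hj]

variable {e x t z d} {f : InsFun ν 𝕜 N} {j k : ℕ}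

open Classical in
theorem insE_apply (τ : Seq ρ) : (insE i e τ f).1 j
    = (∑ s : Seq ν, if IsInsert i j s τ then e s else 0 : Module.End 𝕜 N) (f.1 j) := rfl

theorem insX_apply : (insX x z k f).1 j = insDot x z k j (f.1 j) := rfl

theorem insX_pow_apply (n : ℕ) : ((insX x z k ^ n) f).1 j = (insDot x z k j ^ n) (f.1 j) := by
  induction n generalizing f with
  | zero => rfl
  | succ n ih => rw [pow_succ, Module.End.mul_apply, ih, insX_apply, pow_succ, Module.End.mul_apply]

theorem insDot_self : insDot x z k k = z := by rw [insDot, if_neg (lt_irrefl k), if_pos rfl]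

theorem insDot_lt (h : k < j) : insDot x z k j = x k := if_pos h

theorem insDot_gt (h : j ≤ k) : insDot x z (k + 1) j = x k := by
  rw [insDot, if_neg (by omega), if_neg (by omega), Nat.add_sub_cancel]

theorem insT_apply_left : (insT C i e x t z d k f).1 k
    = moveLeft C i e k (f.1 (k + 1)) - stay C i e d k (f.1 k) := by
  change insCross C i e x t z d _ _ f.1 = _
  rw [insCross, if_neg (lt_irrefl k), if_pos rfl]
  rfl

theorem insT_apply_right : (insT C i e x t z d k f).1 (k + 1)
    = moveRight C i e x z d k (f.1 k) + stay C i e d k (f.1 (k + 1)) := by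
  change insCross C i e x t z d _ _ f.1 = _
  rw [insCross, if_neg (by omega), if_neg (by omega), if_pos rfl]
  rfl

theorem insT_apply_lt (h : j ≤ k) : (insT C i e x t z d (k + 1) f).1 j = t k (f.1 j) := by
  change insCross C i e x t z d _ _ f.1 = _
  rw [insCross, if_pos (by omega)]
  rfl

theorem insT_apply_gt (h : k + 1 < j) : (insT C i e x t z d k f).1 j = t k (f.1 j) := by
  change insCross C i e x t z d _ _ f.1 = _
  rw [insCross, if_neg (by omega), if_neg (by omega), if_neg (by omega)]
  rfl

variable (i e) in
/-- The functions of weight `τ`. -/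
def HasWeight (τ : Seq ρ) (f : InsFun ν 𝕜 N) : Prop :=
  ∀ j ≤ Multiset.card ν, f.1 j = 0 ∨ ∃ s : Seq ν, IsInsert i j s τ ∧ e s (f.1 j) = f.1 j

theorem InsFun.ext {f g : InsFun ν 𝕜 N} (h : ∀ j ≤ Multiset.card ν, f.1 j = g.1 j) : f = g := by
  refine Subtype.ext (funext fun j => ?_)
  by_cases hj : j ≤ Multiset.card ν
  · exact h j hj
  · rw [f.2 j (by omega), g.2 j (by omega)]

section Weights

variable (H : StrandRel C e x t) (hρ : ν + Multiset.replicate 1 i = ρ)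

include H in
theorem hasWeight_insE (τ : Seq ρ) : HasWeight i e τ (insE i e τ f) := by
  classical
  intro j hj
  rw [insE_apply]
  by_cases h : ∃ s : Seq ν, IsInsert i j s τ
  · obtain ⟨s, hs⟩ := h
    refine Or.inr ⟨s, hs, ?_⟩
    rw [Finset.sum_eq_single s, if_pos hs, ← Module.End.mul_apply, H.idem]
    · exact fun s' _ hs' => if_neg fun h => hs' (h.eq_left hs)
    · simp
  · refine Or.inl ?_
    rw [Finset.sum_eq_zero, LinearMap.zero_apply]
    exact fun s _ => if_neg fun h' => h ⟨s, h'⟩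

theorem HasWeight.insE_eq {τ : Seq ρ} (hf : HasWeight i e τ f) : insE i e τ f = f := by
  classical
  refine InsFun.ext fun j hj => ?_
  rw [insE_apply]
  obtain h | ⟨s, hs, h⟩ := hf j hj
  · rw [h, map_zero]
  · rw [Finset.sum_eq_single s, if_pos hs, h]
    · exact fun s' _ hs' => if_neg fun h => hs' (h.eq_left hs)
    · simp

include H in
theorem HasWeight.insE_eq_zero {τ τ' : Seq ρ} (hf : HasWeight i e τ f) (h : τ' ≠ τ) :
    insE i e τ' f = 0 := by
  classical
  refine InsFun.ext fun j hj => ?_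
  rw [insE_apply]
  change _ = (0 : N)
  obtain h | ⟨s, hs, h'⟩ := hf j hj
  · rw [h, map_zero]
  · rw [LinearMap.sum_apply]
    refine Finset.sum_eq_zero fun s' _ => ?_
    split_ifs with h1
    · have : s' ≠ s := by
        rintro rfl
        exact h (h1.eq_right hs)
      rw [← h', ← Module.End.mul_apply, H.orth _ _ this, LinearMap.zero_apply]
    · rfl

-- For a fixed position every s has exactly one insertion, so after exchanging the sums each
-- idempotent of s occurs once.
include H hρ in
theorem sum_insE : ∑ τ : Seq ρ, insE i e τ f = f := by
  classical
  refine InsFun.ext fun j hj => ?_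
  have h1 : (∑ τ : Seq ρ, insE i e τ f).1 j = ∑ τ : Seq ρ, (insE i e τ f).1 j := by
    rw [AddSubmonoidClass.coe_finsetSum, Finset.sum_apply]
  rw [h1]
  simp only [insE_apply, LinearMap.sum_apply]
  rw [Finset.sum_comm]
  calc _ = ∑ s : Seq ν, e s (f.1 j) := by
        refine Finset.sum_congr rfl fun s _ => ?_
        obtain ⟨τ, hτ⟩ := exists_isInsert hρ s hj
        rw [Finset.sum_eq_single τ, if_pos hτ]
        · exact fun τ' _ h => by rw [if_neg fun h' => h (h'.eq_right hτ), LinearMap.zero_apply]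
        · simp
    _ = f.1 j := by rw [← LinearMap.sum_apply, H.unit, Module.End.one_apply]

include H hρ in
/-- Operators that permute the weights permute the idempotents. -/
theorem mul_insE_eq {A : Module.End 𝕜 (InsFun ν 𝕜 N)} {σ : Seq ρ → Seq ρ}
    (hσ : Function.Injective σ)
    (hA : ∀ τ (f : InsFun ν 𝕜 N), HasWeight i e τ f → HasWeight i e (σ τ) (A f)) (τ : Seq ρ) :
    A * insE i e τ = insE i e (σ τ) * A := by
  classical
  refine LinearMap.ext fun f => ?_
  rw [Module.End.mul_apply, Module.End.mul_apply]
  conv_rhs => rw [← sum_insE (f := f) H hρ]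
  rw [map_sum, map_sum, Finset.sum_eq_single τ]
  · exact (hA τ _ (hasWeight_insE H τ)).insE_eq.symm
  · exact fun τ' _ h => (hA τ' _ (hasWeight_insE H τ')).insE_eq_zero H fun h' => h (hσ h').symm
  · simp

end Weights

end InsertionModule

/-! ### Weights of the crossings and the quadratic relation in the insertion module. -/

section InsertionRelations

universe v

variable {I : Type v} {ν ρ : Multiset I} {𝕜 : Type*} [Field 𝕜] {C : BorcherdsCartan I} {i : I}
variable {N : Type*} [AddCommGroup N] [Module 𝕜 N]
variable {e : Seq ν → Module.End 𝕜 N} {x t : ℕ → Module.End 𝕜 N} {z : Module.End 𝕜 N}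
variable {d : ℕ → Module.End 𝕜 N} {f : InsFun ν 𝕜 N} {j k : ℕ}

theorem entry_eq_entry {s : Seq ν} {τ : Seq ρ} {k l : ℕ} (h : s.1[l]? = τ.1[k]?)
    (hl : l < Multiset.card ν) (hk : k < Multiset.card ρ) : s.entry l hl = τ.entry k hk := by
  rw [Seq.entry_eq_iff, h, ← Seq.entry_eq_iff]

open Classical in
variable (C) in
/-- The value of a double crossing of strands with labels `a`, `b` and dots `y`, `y'`. -/
def doubleCross (a b : I) (y y' : Module.End 𝕜 N) : Module.End 𝕜 N :=
  if a = b then 0 else if C.form a b = 0 then 1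
  else y ^ (-C.a a b).toNat + y' ^ (-C.a b a).toNat

open Classical in
variable (C) in
/-- The difference of the two sides of a dot slide. -/
def slideTerm (a b : I) : Module.End 𝕜 N := if a = b ∧ C.IsReal b then 1 else 0

section Local

variable (H : StrandRel C e x t) (hk : k + 1 < Multiset.card ν) {s : Seq ν} {u : N}

include H

theorem StrandRel.t_apply_t_apply (hu : e s u = u) : t k (t k u)
    = doubleCross C (s.entry k (by omega)) (s.entry (k + 1) hk) (x k) (x (k + 1)) u := by
  rw [doubleCross]
  split_ifs with h1 h2
  · have := congrArg (fun f => f u) (H.quad_same k hk s h1)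
    simpa only [Module.End.mul_apply, hu] using this
  · have := congrArg (fun f => f u) (H.quad_orth k hk s h1 h2)
    simpa only [Module.End.mul_apply, Module.End.one_apply, hu] using this
  · have := congrArg (fun f => f u) (H.quad k hk s h1 h2)
    simpa only [Module.End.mul_apply, LinearMap.add_apply, hu] using this

theorem StrandRel.x_apply_t_apply (hu : e s u = u) : x k (t k u)
    = t k (x (k + 1) u) + (slideTerm C (s.entry k (by omega)) (s.entry (k + 1) hk) :
        Module.End 𝕜 N) u := by
  rw [slideTerm]
  split_ifs with h1
  · have := congrArg (fun f => f u) (H.slide_left_real k hk s h1.1 h1.2)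
    simpa only [Module.End.mul_apply, LinearMap.add_apply, Module.End.one_apply, hu] using this
  · have := congrArg (fun f => f u) (H.slide_left k hk s h1)
    simpa only [Module.End.mul_apply, hu, LinearMap.zero_apply, add_zero] using this

theorem StrandRel.t_apply_x_apply (hu : e s u = u) : t k (x k u)
    = x (k + 1) (t k u) + (slideTerm C (s.entry k (by omega)) (s.entry (k + 1) hk) :
        Module.End 𝕜 N) u := by
  rw [slideTerm]
  split_ifs with h1
  · have := congrArg (fun f => f u) (H.slide_right_real k hk s h1.1 h1.2)
    simpa only [Module.End.mul_apply, LinearMap.add_apply, Module.End.one_apply, hu] using this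
  · have := congrArg (fun f => f u) (H.slide_right k hk s h1)
    simpa only [Module.End.mul_apply, hu, LinearMap.zero_apply, add_zero] using this

end Local

theorem StrandRel.braid_apply (H : StrandRel C e x t) {s : Seq ν} {u : N} {l : ℕ}
    (hl : l + 2 < Multiset.card ν) (hu : e s u = u) :
    t l (t (l + 1) (t l u)) = t (l + 1) (t l (t (l + 1) u)) +
      braidCorrection C (s.entry l (by omega)) (s.entry (l + 1) (by omega)) (s.entry (l + 2) hl)
        (x l) (x (l + 2)) u := by
  rw [braidCorrection]
  split_ifs with h1
  · have := congrArg (fun f => f u) (H.braid_corrected l hl s h1)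
    simpa only [Module.End.mul_apply, hu, LinearMap.add_apply, LinearMap.sum_apply] using this
  · have := congrArg (fun f => f u) (H.braid l hl s h1)
    simpa only [Module.End.mul_apply, hu, add_zero] using this

section Far

variable (hρ : ν + Multiset.replicate 1 i = ρ)

include hρ

/-- Away from the new strand, the crossings act by crossings. -/
theorem exists_far (hj : j ≤ Multiset.card ν) (hk : k + 1 < Multiset.card ρ) (h1 : j ≠ k)
    (h2 : j ≠ k + 1) : ∃ l, l + 1 < Multiset.card ν ∧
      (∀ f : InsFun ν 𝕜 N, (insT C i e x t z d k f).1 j = t l (f.1 j)) ∧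
      insDot x z k j = x l ∧ insDot x z (k + 1) j = x (l + 1) ∧
      ∀ (s : Seq ν) (τ : Seq ρ), IsInsert i j s τ →
        s.1[l]? = τ.1[k]? ∧ s.1[l + 1]? = τ.1[k + 1]? ∧ IsInsert i j (s.swap l) (τ.swap k) := by
  have hc := card_eq_succ hρ
  by_cases h : j < k
  · obtain ⟨l, rfl⟩ : ∃ l, k = l + 1 := ⟨k - 1, by omega⟩
    refine ⟨l, by omega, fun f => insT_apply_lt (by omega), insDot_gt (by omega),
      insDot_gt (by omega), fun s τ hs => ⟨(hs.getElem?_gt (by omega)).symm,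
      (hs.getElem?_gt (by omega)).symm, hs.swap_lt hc (by omega) (by omega)⟩⟩
  · exact ⟨k, by omega, fun f => insT_apply_gt (by omega), insDot_lt (by omega),
      insDot_lt (by omega), fun s τ hs => ⟨(hs.getElem?_lt (by omega)).symm,
      (hs.getElem?_lt (by omega)).symm, hs.swap_gt hc (by omega) (by omega) hj⟩⟩

theorem exists_far_braid (hj : j ≤ Multiset.card ν) (hk : k + 2 < Multiset.card ρ) (h1 : j ≠ k)
    (h2 : j ≠ k + 1) (h3 : j ≠ k + 2) : ∃ l, l + 2 < Multiset.card ν ∧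
      (∀ f : InsFun ν 𝕜 N, (insT C i e x t z d k f).1 j = t l (f.1 j)) ∧
      (∀ f : InsFun ν 𝕜 N, (insT C i e x t z d (k + 1) f).1 j = t (l + 1) (f.1 j)) ∧
      insDot x z k j = x l ∧ insDot x z (k + 2) j = x (l + 2) ∧
      ∀ (s : Seq ν) (τ : Seq ρ), IsInsert i j s τ →
        s.1[l]? = τ.1[k]? ∧ s.1[l + 1]? = τ.1[k + 1]? ∧ s.1[l + 2]? = τ.1[k + 2]? := by
  have hc := card_eq_succ hρ
  by_cases h : j < k
  · obtain ⟨l, rfl⟩ : ∃ l, k = l + 1 := ⟨k - 1, by omega⟩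
    exact ⟨l, by omega, fun f => insT_apply_lt (by omega), fun f => insT_apply_lt (by omega),
      insDot_gt (by omega), insDot_gt (by omega), fun s τ hs => ⟨(hs.getElem?_gt (by omega)).symm,
      (hs.getElem?_gt (by omega)).symm, (hs.getElem?_gt (by omega)).symm⟩⟩
  · exact ⟨k, by omega, fun f => insT_apply_gt (by omega), fun f => insT_apply_gt (by omega),
      insDot_lt (by omega), insDot_lt (by omega), fun s τ hs => ⟨(hs.getElem?_lt (by omega)).symm,
      (hs.getElem?_lt (by omega)).symm, (hs.getElem?_lt (by omega)).symm⟩⟩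

end Far

theorem commute_insDot {y : Module.End 𝕜 N} (hx : ∀ l < Multiset.card ν, Commute y (x l))
    (hz : Commute y z) (hk : k ≤ Multiset.card ν) (hj : j ≤ Multiset.card ν) :
    Commute y (insDot x z k j) := by
  rw [insDot]
  split_ifs
  exacts [hx _ (by omega), hz, hx _ (by omega)]

namespace LocalizedRel

variable (H : LocalizedRel C e x t z d) (hρ : ν + Multiset.replicate 1 i = ρ)

include H

section Coefficients

variable (hk : k < Multiset.card ν)

include hk

theorem commute_e_stay (s : Seq ν) : Commute (e s) (stay C i e d k) :=
  StrandRel.commute_diag (commute_stayCoeff (H.d_e hk s)) fun s' => by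
    classical
    by_cases h : s = s'
    · rw [h]
    · change _ * _ = _ * _
      rw [H.rel.orth _ _ h, H.rel.orth _ _ (Ne.symm h)]

theorem commute_e_moveRight (s : Seq ν) : Commute (e s) (moveRight C i e x z d k) :=
  StrandRel.commute_diag (commute_rightCoeff (H.rel.x_e k s hk).symm (H.z_e s).symm (H.d_e hk s))
    fun s' => by
    classical
    by_cases h : s = s'
    · rw [h]
    · change _ * _ = _ * _
      rw [H.rel.orth _ _ h, H.rel.orth _ _ (Ne.symm h)]

omit hk in
theorem commute_e_moveLeft (s : Seq ν) : Commute (e s) (moveLeft C i e k) :=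
  StrandRel.commute_diag (commute_leftCoeff (e s)) fun s' => by
    classical
    by_cases h : s = s'
    · rw [h]
    · change _ * _ = _ * _
      rw [H.rel.orth _ _ h, H.rel.orth _ _ (Ne.symm h)]

theorem stay_apply {s : Seq ν} {u : N} (hu : e s u = u) :
    stay C i e d k u = stayCoeff C i d k (s.1[k]?) u := H.rel.diag_apply _ _ hu

theorem stay_apply_eq_zero {s : Seq ν} {u : N} (hu : e s u = u) (hs : s.1[k]? ≠ some i) :
    stay C i e d k u = 0 := by
  rw [H.stay_apply hk hu, stayCoeff, if_neg fun h => hs h.1, LinearMap.zero_apply]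

end Coefficients

include hρ

theorem hasWeight_insX (hk : k < Multiset.card ρ) {τ : Seq ρ} (hf : HasWeight i e τ f) :
    HasWeight i e τ (insX x z k f) := by
  have hc := card_eq_succ hρ
  intro j hj
  rw [insX_apply]
  obtain h | ⟨s, hs, h⟩ := hf j hj
  · exact Or.inl (by rw [h, map_zero])
  · refine Or.inr ⟨s, hs, ?_⟩
    have : Commute (e s) (insDot x z k j) := commute_insDot
      (fun l hl => (H.rel.x_e l s hl).symm) (H.z_e s).symm (by omega) hj
    rw [← Module.End.mul_apply, this.eq, Module.End.mul_apply, h]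

/-- The moving parts change the position of the new strand exactly as the swap changes the sequence.
The part that stays is nonzero only next to an entry i, where the swap does not change the sequence.
-/
theorem hasWeight_insT (hk : k + 1 < Multiset.card ρ) {τ : Seq ρ} (hf : HasWeight i e τ f) :
    HasWeight i e (τ.swap k) (insT C i e x t z d k f) := by
  have hc := card_eq_succ hρ
  have hk' : k < Multiset.card ν := by omega
  have cD : ∀ {s : Seq ν} {u : N}, e s u = u → e s (stay C i e d k u) = stay C i e d k u := by
    intro s u hu
    rw [← Module.End.mul_apply, (H.commute_e_stay hk' s).eq, Module.End.mul_apply, hu]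
  have cG : ∀ {s : Seq ν} {u : N}, e s u = u →
      e s (moveRight C i e x z d k u) = moveRight C i e x z d k u := by
    intro s u hu
    rw [← Module.End.mul_apply, (H.commute_e_moveRight hk' s).eq, Module.End.mul_apply, hu]
  have cL : ∀ {s : Seq ν} {u : N}, e s u = u → e s (moveLeft C i e k u) = moveLeft C i e k u := by
    intro s u hu
    rw [← Module.End.mul_apply, (H.commute_e_moveLeft s).eq, Module.End.mul_apply, hu]
  intro j hj
  by_cases h1 : j = k
  · subst h1
    rw [insT_apply_left]
    have hD : stay C i e d j (f.1 j) = 0 ∨ ∃ s : Seq ν, IsInsert i (j + 1) s τ ∧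
        e s (stay C i e d j (f.1 j)) = stay C i e d j (f.1 j) := by
      obtain h | ⟨s, hs, h⟩ := hf j hj
      · exact Or.inl (by rw [h, map_zero])
      by_cases hi : s.1[j]? = some i
      · exact Or.inr ⟨s, hs.succ hc hk' hi, cD h⟩
      · exact Or.inl (H.stay_apply_eq_zero hk' h hi)
    obtain h | ⟨s, hs, h⟩ := hf (j + 1) (by omega)
    · rw [h, map_zero, zero_sub]
      obtain h' | ⟨s, hs, h'⟩ := hD
      · exact Or.inl (by rw [h', neg_zero])
      · exact Or.inr ⟨s, hs.swap_right hc hk', by rw [map_neg, h']⟩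
    · refine Or.inr ⟨s, hs.swap_right hc hk', ?_⟩
      rw [map_sub, cL h]
      obtain h' | ⟨s', hs', h'⟩ := hD
      · rw [h', map_zero]
      · rw [hs.eq_left hs', h']
  by_cases h2 : j = k + 1
  · subst h2
    rw [insT_apply_right]
    have hD : stay C i e d k (f.1 (k + 1)) = 0 ∨ ∃ s : Seq ν, IsInsert i k s τ ∧
        e s (stay C i e d k (f.1 (k + 1))) = stay C i e d k (f.1 (k + 1)) := by
      obtain h | ⟨s, hs, h⟩ := hf (k + 1) hj
      · exact Or.inl (by rw [h, map_zero])
      by_cases hi : s.1[k]? = some i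
      · exact Or.inr ⟨s, hs.pred hc hk' hi, cD h⟩
      · exact Or.inl (H.stay_apply_eq_zero hk' h hi)
    obtain h | ⟨s, hs, h⟩ := hf k (by omega)
    · rw [h, map_zero, zero_add]
      obtain h' | ⟨s, hs, h'⟩ := hD
      · exact Or.inl h'
      · exact Or.inr ⟨s, hs.swap_left hc hk', h'⟩
    · refine Or.inr ⟨s, hs.swap_left hc hk', ?_⟩
      rw [map_add, cG h]
      obtain h' | ⟨s', hs', h'⟩ := hD
      · rw [h', map_zero]
      · rw [hs.eq_left hs', h']
  · obtain ⟨l, hl, hT, -, -, hins⟩ := exists_far (C := C) (e := e) (x := x) (t := t) (z := z)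
      (d := d) hρ hj hk h1 h2
    rw [hT]
    obtain h | ⟨s, hs, h⟩ := hf j hj
    · exact Or.inl (by rw [h, map_zero])
    · exact Or.inr ⟨s.swap l, (hins s τ hs).2.2, H.e_apply_t hl h⟩

/-- On positions k and k + 1 the crossing is a 2 × 2 matrix with diagonal entries of opposite sign.
The coefficients commute, so the square is diagonal, with entries left · right + stay². Elsewhere
the crossing is one of R(ν). -/
theorem insT_insT {τ : Seq ρ} (hk : k + 1 < Multiset.card ρ) (hf : HasWeight i e τ f)
    (hj : j ≤ Multiset.card ν) :
    (insT C i e x t z d k (insT C i e x t z d k f)).1 j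
      = doubleCross C (τ.entry k (by omega)) (τ.entry (k + 1) hk) (insDot x z k j)
        (insDot x z (k + 1) j) (f.1 j) := by
  have hc := card_eq_succ hρ
  have hk' : k < Multiset.card ν := by omega
  -- For a = i real this is -d² + d² = 0, for a = i imaginary it is 0 · 1, and for a ≠ i it is the
  -- value of the double crossing itself.
  have key : ∀ a : I, (leftCoeff C i (some a) * rightCoeff C i x z d k (some a)
      + stayCoeff C i d k (some a) * stayCoeff C i d k (some a) : Module.End 𝕜 N)
      = doubleCross C a i (x k) z := by
    intro a
    rw [leftCoeff, rightCoeff, stayCoeff, doubleCross]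
    by_cases h1 : a = i
    · by_cases h2 : C.IsReal i <;> simp [h1, h2]
    · simp [h1]
  have hsymm : ∀ (a b : I) (y y' : Module.End 𝕜 N), doubleCross C a b y y' = doubleCross C b a y' y := by
    intro a b y y'
    by_cases h : a = b
    · rw [doubleCross, doubleCross, if_pos h, if_pos h.symm]
    · rw [doubleCross, doubleCross, form_comm C b a, add_comm, if_neg h, if_neg (Ne.symm h)]
  have cDL : ∀ u, stay C i e d k (moveLeft C i e k u) = moveLeft C i e k (stay C i e d k u) := by
    intro u
    have : Commute (stay C i e d k) (moveLeft C i e k) :=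
      StrandRel.commute_diag (commute_leftCoeff _) fun s => (H.commute_e_stay hk' s).symm
    exact congrArg (fun f => f u) this.eq
  have cDG : ∀ {s : Seq ν} {u}, e s u = u →
      stay C i e d k (moveRight C i e x z d k u) = moveRight C i e x z d k (stay C i e d k u) := by
    intro s u hu
    have : Commute (stay C i e d k) (moveRight C i e x z d k) := by
      refine StrandRel.commute_diag (fun a => ?_) fun s => (H.commute_e_stay hk' s).symm
      refine (StrandRel.commute_diag (fun b => ?_) fun s => ?_).symm
      · exact commute_stayCoeff (commute_rightCoeff (H.d_x hk' hk').symm (H.d_z hk').symm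
          (Commute.refl _) a).symm b
      · exact (commute_rightCoeff (H.rel.x_e k s hk').symm (H.z_e s).symm (H.d_e hk' s) a).symm
    exact congrArg (fun f => f u) this.eq
  have sq : ∀ {s : Seq ν} {u : N} {a : I}, e s u = u → s.1[k]? = some a →
      moveLeft C i e k (moveRight C i e x z d k u) + stay C i e d k (stay C i e d k u)
        = doubleCross C a i (x k) z u := by
    intro s u a hu hs
    have h1 : e s (moveRight C i e x z d k u) = moveRight C i e x z d k u := by
      rw [← Module.End.mul_apply, (H.commute_e_moveRight hk' s).eq, Module.End.mul_apply, hu]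
    have h2 : e s (stay C i e d k u) = stay C i e d k u := by
      rw [← Module.End.mul_apply, (H.commute_e_stay hk' s).eq, Module.End.mul_apply, hu]
    rw [← key, LinearMap.add_apply, Module.End.mul_apply, Module.End.mul_apply, moveLeft,
      H.rel.diag_apply _ _ h1, H.stay_apply hk' h2, H.stay_apply hk' hu, moveRight,
      H.rel.diag_apply _ _ hu, hs]
  have cGL : ∀ u, moveRight C i e x z d k (moveLeft C i e k u)
      = moveLeft C i e k (moveRight C i e x z d k u) := by
    intro u
    have : Commute (moveRight C i e x z d k) (moveLeft C i e k) :=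
      StrandRel.commute_diag (commute_leftCoeff _) fun s => (H.commute_e_moveRight hk' s).symm
    exact congrArg (fun f => f u) this.eq
  by_cases h1 : j = k
  · subst h1
    rw [insT_apply_left, insT_apply_left, insT_apply_right, insDot_self, insDot_gt le_rfl, map_add,
      map_sub, cDL]
    have e1 : ∀ a b c : N, a + b - (b - c) = a + c := fun a b c => by abel
    rw [e1]
    obtain h | ⟨s, hs, h⟩ := hf j hj
    · rw [h]; simp
    · rw [sq h (getElem?_eq_entry s hk'), hsymm]
      congr 2
      · rw [eq_comm, Seq.entry_eq_iff, hs.getElem?_eq hj]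
      · exact entry_eq_entry (hs.getElem?_gt le_rfl).symm _ _
  by_cases h2 : j = k + 1
  · subst h2
    rw [insT_apply_right, insT_apply_left, insT_apply_right, insDot_self, insDot_lt (by omega),
      map_add, map_sub, cGL]
    have e1 : moveRight C i e x z d k (stay C i e d k (f.1 k))
        = stay C i e d k (moveRight C i e x z d k (f.1 k)) := by
      obtain h | ⟨s, hs, h⟩ := hf k (by omega)
      · rw [h]; simp
      · rw [cDG h]
    have e2 : ∀ a b c : N, a - b + (b + c) = a + c := fun a b c => by abel
    rw [e1, e2]
    obtain h | ⟨s, hs, h⟩ := hf (k + 1) hj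
    · rw [h]; simp
    · rw [sq h (getElem?_eq_entry s hk')]
      congr 2
      · exact entry_eq_entry (hs.getElem?_lt (by omega)).symm _ _
      · rw [eq_comm, Seq.entry_eq_iff, hs.getElem?_eq hj]
  · obtain ⟨l, hl, hT, hx1, hx2, hins⟩ := exists_far (C := C) (e := e) (x := x) (t := t) (z := z)
      (d := d) hρ hj hk h1 h2
    rw [hT, hT, hx1, hx2]
    obtain h | ⟨s, hs, h⟩ := hf j hj
    · rw [h]; simp
    · obtain ⟨e1, e2, -⟩ := hins s τ hs
      rw [H.rel.t_apply_t_apply hl h, entry_eq_entry e1 _ (by omega), entry_eq_entry e2 _ hk]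

end LocalizedRel

end InsertionRelations

/-! ### Dot slides, distant relations and the braid relation in the insertion module. -/

section InsertionRelations

universe v

variable {I : Type v} {ν ρ : Multiset I} {𝕜 : Type*} [Field 𝕜] {C : BorcherdsCartan I} {i : I}
variable {N : Type*} [AddCommGroup N] [Module 𝕜 N]
variable {e : Seq ν → Module.End 𝕜 N} {x t : ℕ → Module.End 𝕜 N} {z : Module.End 𝕜 N}
variable {d : ℕ → Module.End 𝕜 N} {f : InsFun ν 𝕜 N} {j k : ℕ}

theorem apply_apply_of_commute {a b : Module.End 𝕜 N} (h : Commute a b) (u : N) :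
    a (b u) = b (a u) := congrArg (fun f => f u) h.eq

namespace LocalizedRel

variable (H : LocalizedRel C e x t z d)

include H

section Coefficients

theorem commute_stay {y : Module.End 𝕜 N} (hk : k < Multiset.card ν) (he : ∀ s, Commute y (e s))
    (hx : Commute y (x k)) (hz : Commute y z) : Commute y (stay C i e d k) :=
  StrandRel.commute_diag (commute_stayCoeff (H.commute_d hk hx hz)) he

theorem commute_moveRight {y : Module.End 𝕜 N} (hk : k < Multiset.card ν)
    (he : ∀ s, Commute y (e s)) (hx : Commute y (x k)) (hz : Commute y z) :
    Commute y (moveRight C i e x z d k) :=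
  StrandRel.commute_diag (commute_rightCoeff hx hz (H.commute_d hk hx hz)) he

omit H in
theorem commute_moveLeft {y : Module.End 𝕜 N} (he : ∀ s, Commute y (e s)) :
    Commute y (moveLeft C i e k) := StrandRel.commute_diag (commute_leftCoeff y) he

theorem commute_t_stay {l : ℕ} (hk : k < Multiset.card ν) (hl : l + 1 < Multiset.card ν)
    (h : k ≠ l) (h' : k ≠ l + 1) : Commute (t l) (stay C i e d k) :=
  H.rel.commute_t_diag hl h h' (commute_stayCoeff (H.d_t hk hl h h'))

theorem commute_t_moveRight {l : ℕ} (hk : k < Multiset.card ν) (hl : l + 1 < Multiset.card ν)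
    (h : k ≠ l) (h' : k ≠ l + 1) : Commute (t l) (moveRight C i e x z d k) :=
  H.rel.commute_t_diag hl h h'
    (commute_rightCoeff (H.rel.x_t l k hl hk h h').symm (H.z_t l).symm (H.d_t hk hl h h'))

theorem commute_t_moveLeft {l : ℕ} (hl : l + 1 < Multiset.card ν)
    (h : k ≠ l) (h' : k ≠ l + 1) : Commute (t l) (moveLeft C i e k) :=
  H.rel.commute_t_diag hl h h' (commute_leftCoeff _)

/-- The stay coefficient is the inverse of x_k - z exactly when the neighbour has the real label i.
So exchanging x_k for z costs the identity in that case and nothing otherwise. -/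
theorem stay_apply_sub (hk : k < Multiset.card ν) {s : Seq ν} {u : N} (hu : e s u = u) :
    stay C i e d k (x k u) = stay C i e d k (z u) +
      (slideTerm C (s.entry k hk) i : Module.End 𝕜 N) u := by
  have h1 : e s (x k u) = x k u := by
    rw [← Module.End.mul_apply, ← H.rel.x_e k s hk, Module.End.mul_apply, hu]
  have h2 : e s (z u) = z u := by
    rw [← Module.End.mul_apply, ← (H.z_e s).eq, Module.End.mul_apply, hu]
  rw [H.stay_apply hk h1, H.stay_apply hk h2, getElem?_eq_entry s hk, stayCoeff, slideTerm]
  have h3 := congrArg (fun f => f u) (H.d_mul k hk)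
  simp only [Module.End.mul_apply, LinearMap.sub_apply, Module.End.one_apply, map_sub] at h3
  by_cases h : s.entry k hk = i ∧ C.IsReal i
  · rw [if_pos ⟨by rw [h.1], h.2⟩, if_pos h, Module.End.one_apply]
    exact sub_eq_iff_eq_add'.1 h3
  · rw [if_neg fun h' => h ⟨Option.some_injective _ h'.1, h'.2⟩, if_neg h]
    simp

end Coefficients

variable (hρ : ν + Multiset.replicate 1 i = ρ)

include hρ

theorem slideTerm_comm (a b : I) :
    (slideTerm C a b : Module.End 𝕜 N) = slideTerm C b a := by
  rw [slideTerm, slideTerm]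
  by_cases h : a = b
  · rw [h]
  · rw [if_neg fun h' => h h'.1, if_neg fun h' => h h'.1.symm]

/-- Next to the new strand the moving parts commute with the dots, which are relabelled by the move,
and the constant term comes from the part that stays. Elsewhere the slide is that of R(ν). -/
theorem insX_insT {τ : Seq ρ} (hk : k + 1 < Multiset.card ρ) (hf : HasWeight i e τ f)
    (hj : j ≤ Multiset.card ν) :
    (insX x z k (insT C i e x t z d k f)).1 j = (insT C i e x t z d k (insX x z (k + 1) f)).1 j +
      (slideTerm C (τ.entry k (by omega)) (τ.entry (k + 1) hk) : Module.End 𝕜 N) (f.1 j) := by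
  have hc := card_eq_succ hρ
  have hk' : k < Multiset.card ν := by omega
  have he : ∀ s, Commute (x k) (e s) := fun s => H.rel.x_e k s hk'
  by_cases h1 : j = k
  · subst h1
    rw [insT_apply_left, insX_apply, insX_apply, insX_apply, insT_apply_left, insDot_self,
      insDot_self, insDot_gt le_rfl, map_sub, apply_apply_of_commute (commute_moveLeft H.z_e),
      apply_apply_of_commute (H.commute_stay hk' H.z_e (H.z_x j) (Commute.refl z))]
    obtain h | ⟨s, hs, h⟩ := hf j hj
    · rw [h]; simp
    · rw [H.stay_apply_sub hk' h,
        slideTerm_comm H hρ, ← entry_eq_entry (hs.getElem?_gt le_rfl).symm hk' hk,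
        (Seq.entry_eq_iff τ j (by omega) i).2 (hs.getElem?_eq hj)]
      abel
  by_cases h2 : j = k + 1
  · subst h2
    rw [insT_apply_right, insX_apply, insX_apply, insX_apply, insT_apply_right, insDot_self,
      insDot_gt le_rfl, insDot_lt (by omega), map_add,
      apply_apply_of_commute (H.commute_moveRight hk' he (Commute.refl _) (H.z_x k).symm),
      apply_apply_of_commute (H.commute_stay hk' he (Commute.refl _) (H.z_x k).symm)]
    obtain h | ⟨s, hs, h⟩ := hf (k + 1) hj
    · rw [h]; simp
    · rw [H.stay_apply_sub hk' h,
        ← entry_eq_entry (hs.getElem?_lt (by omega)).symm hk' (by omega),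
        (Seq.entry_eq_iff τ (k + 1) hk i).2 (hs.getElem?_eq hj)]
      abel
  · obtain ⟨l, hl, hT, hx1, hx2, hins⟩ := exists_far (C := C) (e := e) (x := x) (t := t) (z := z)
      (d := d) hρ hj hk h1 h2
    rw [insX_apply, hT, hT, insX_apply, hx1, hx2]
    obtain h | ⟨s, hs, h⟩ := hf j hj
    · rw [h]; simp
    · obtain ⟨e1, e2, -⟩ := hins s τ hs
      rw [H.rel.x_apply_t_apply hl h, entry_eq_entry e1 _ (by omega), entry_eq_entry e2 _ hk]

theorem insT_insX {τ : Seq ρ} (hk : k + 1 < Multiset.card ρ) (hf : HasWeight i e τ f)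
    (hj : j ≤ Multiset.card ν) :
    (insT C i e x t z d k (insX x z k f)).1 j = (insX x z (k + 1) (insT C i e x t z d k f)).1 j +
      (slideTerm C (τ.entry k (by omega)) (τ.entry (k + 1) hk) : Module.End 𝕜 N) (f.1 j) := by
  have hc := card_eq_succ hρ
  have hk' : k < Multiset.card ν := by omega
  have he : ∀ s, Commute (x k) (e s) := fun s => H.rel.x_e k s hk'
  by_cases h1 : j = k
  · subst h1
    rw [insT_apply_left, insX_apply, insX_apply, insX_apply, insT_apply_left, insDot_self,
      insDot_lt (by omega), insDot_gt le_rfl, map_sub,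
      apply_apply_of_commute (commute_moveLeft he),
      apply_apply_of_commute (H.commute_stay hk' he (Commute.refl _) (H.z_x j).symm)]
    obtain h | ⟨s, hs, h⟩ := hf j hj
    · rw [h]; simp
    · rw [H.stay_apply_sub hk' h,
        slideTerm_comm H hρ, ← entry_eq_entry (hs.getElem?_gt le_rfl).symm hk' hk,
        (Seq.entry_eq_iff τ j (by omega) i).2 (hs.getElem?_eq hj)]
      abel
  by_cases h2 : j = k + 1
  · subst h2
    rw [insT_apply_right, insX_apply, insX_apply, insX_apply, insT_apply_right, insDot_self,
      insDot_self, insDot_lt (by omega), map_add,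
      apply_apply_of_commute (H.commute_moveRight hk' H.z_e (H.z_x k) (Commute.refl _)),
      apply_apply_of_commute (H.commute_stay hk' H.z_e (H.z_x k) (Commute.refl _))]
    obtain h | ⟨s, hs, h⟩ := hf (k + 1) hj
    · rw [h]; simp
    · rw [H.stay_apply_sub hk' h,
        ← entry_eq_entry (hs.getElem?_lt (by omega)).symm hk' (by omega),
        (Seq.entry_eq_iff τ (k + 1) hk i).2 (hs.getElem?_eq hj)]
      abel
  · obtain ⟨l, hl, hT, hx1, hx2, hins⟩ := exists_far (C := C) (e := e) (x := x) (t := t) (z := z)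
      (d := d) hρ hj hk h1 h2
    rw [insX_apply, hT, hT, insX_apply, hx1, hx2]
    obtain h | ⟨s, hs, h⟩ := hf j hj
    · rw [h]; simp
    · obtain ⟨e1, e2, -⟩ := hins s τ hs
      rw [H.rel.t_apply_x_apply hl h, entry_eq_entry e1 _ (by omega), entry_eq_entry e2 _ hk]

omit hρ in
theorem insX_mul_insX {l : ℕ} (hk : k ≤ Multiset.card ν) (hl : l ≤ Multiset.card ν) :
    insX (ν := ν) x z k * insX x z l = insX x z l * insX x z k := by
  refine LinearMap.ext fun f => InsFun.ext fun j hj => ?_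
  have h : Commute (insDot x z k j) (insDot x z l j) := by
    refine commute_insDot (fun r hr => ?_) ?_ hl hj
    · exact (commute_insDot (fun r' hr' => H.rel.x_x r r' hr hr') (H.z_x r).symm hk hj).symm
    · exact (commute_insDot (fun r' _ => H.z_x r') (Commute.refl z) hk hj).symm
  exact apply_apply_of_commute h _

omit hρ in
theorem insX_mul_insT {l : ℕ} (hk : k < Multiset.card ν) (hl : l ≤ Multiset.card ν) (h : l ≠ k)
    (h' : l ≠ k + 1) :
    insX x z l * insT C i e x t z d k = insT C i e x t z d k * insX x z l := by
  refine LinearMap.ext fun f => InsFun.ext fun j hj => ?_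
  rw [Module.End.mul_apply, Module.End.mul_apply, insX_apply]
  -- A dot away from both strands of the crossing acts by the same operator y whether the new strand
  -- is at k or at k + 1, and y commutes with all coefficients.
  have hy : ∀ y : Module.End 𝕜 N, (∀ s, Commute y (e s)) → Commute y (x k) → Commute y z →
      insDot x z l k = y → insDot x z l (k + 1) = y → (j = k ∨ j = k + 1) →
      insDot x z l j ((insT C i e x t z d k f).1 j)
        = (insT C i e x t z d k (insX x z l f)).1 j := by
    rintro y he hx hz h1 h2 (rfl | rfl)
    · rw [insT_apply_left, insT_apply_left, insX_apply, insX_apply, h1, h2, map_sub,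
        apply_apply_of_commute (commute_moveLeft he), apply_apply_of_commute (H.commute_stay hk he hx hz)]
    · rw [insT_apply_right, insT_apply_right, insX_apply, insX_apply, h1, h2, map_add,
        apply_apply_of_commute (H.commute_moveRight hk he hx hz),
        apply_apply_of_commute (H.commute_stay hk he hx hz)]
  by_cases h1 : j = k ∨ j = k + 1
  · by_cases h2 : l < k
    · exact hy (x l) (fun s => H.rel.x_e l s (by omega)) (H.rel.x_x l k (by omega) hk)
        (H.z_x l).symm (insDot_lt h2) (insDot_lt (by omega)) h1
    · obtain ⟨r, rfl⟩ : ∃ r, l = r + 1 := ⟨l - 1, by omega⟩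
      exact hy (x r) (fun s => H.rel.x_e r s (by omega)) (H.rel.x_x r k (by omega) hk)
        (H.z_x r).symm (insDot_gt (by omega)) (insDot_gt (by omega)) h1
  · have key : ∀ r, r + 1 < Multiset.card ν →
        (∀ f : InsFun ν 𝕜 N, (insT C i e x t z d k f).1 j = t r (f.1 j)) →
        (j ≤ r ∧ k = r + 1 ∨ r + 1 < j ∧ k = r) → insDot x z l j ((insT C i e x t z d k f).1 j)
          = (insT C i e x t z d k (insX x z l f)).1 j := by
      intro r hr hT hjr
      rw [hT, hT, insX_apply]
      have : Commute (insDot x z l j) (t r) := by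
        rw [insDot]
        split_ifs with h2 h3
        · exact H.rel.x_t r l hr (by omega) (by omega) (by omega)
        · exact H.z_t r
        · exact H.rel.x_t r (l - 1) hr (by omega) (by omega) (by omega)
      exact apply_apply_of_commute this _
    by_cases h2 : j < k
    · obtain ⟨r, rfl⟩ : ∃ r, k = r + 1 := ⟨k - 1, by omega⟩
      exact key r (by omega) (fun f => insT_apply_lt (by omega)) (Or.inl ⟨by omega, rfl⟩)
    · exact key k (by omega) (fun f => insT_apply_gt (by omega)) (Or.inr ⟨by omega, rfl⟩)

omit hρ in
theorem insT_mul_insT {l : ℕ} (hl : l < Multiset.card ν) (h : k + 1 < l) :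
    insT C i e x t z d l * insT C i e x t z d k = insT C i e x t z d k * insT C i e x t z d l := by
  obtain ⟨l, rfl⟩ : ∃ r, l = r + 1 := ⟨l - 1, by omega⟩
  have hk : k < Multiset.card ν := by omega
  refine LinearMap.ext fun f => InsFun.ext fun j hj => ?_
  rw [Module.End.mul_apply, Module.End.mul_apply]
  by_cases h1 : j = k
  · subst h1
    rw [insT_apply_lt (by omega), insT_apply_left, insT_apply_left, insT_apply_lt (by omega),
      insT_apply_lt (by omega), map_sub,
      apply_apply_of_commute (H.commute_t_moveLeft hl (by omega) (by omega)),
      apply_apply_of_commute (H.commute_t_stay hk hl (by omega) (by omega))]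
  by_cases h2 : j = k + 1
  · subst h2
    rw [insT_apply_lt (by omega), insT_apply_right, insT_apply_right, insT_apply_lt (by omega),
      insT_apply_lt (by omega), map_add,
      apply_apply_of_commute (H.commute_t_moveRight hk hl (by omega) (by omega)),
      apply_apply_of_commute (H.commute_t_stay hk hl (by omega) (by omega))]
  by_cases h3 : j = l + 1
  · subst h3
    rw [insT_apply_left, insT_apply_gt (by omega), insT_apply_gt (by omega),
      insT_apply_gt (by omega), insT_apply_left, map_sub,
      apply_apply_of_commute (H.commute_t_moveLeft (by omega) (by omega) (by omega)),
      apply_apply_of_commute (H.commute_t_stay hl (by omega) (by omega) (by omega))]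
  by_cases h4 : j = l + 2
  · subst h4
    rw [insT_apply_right, insT_apply_gt (by omega), insT_apply_gt (by omega),
      insT_apply_gt (by omega), insT_apply_right, map_add,
      apply_apply_of_commute (H.commute_t_moveRight hl (by omega) (by omega) (by omega)),
      apply_apply_of_commute (H.commute_t_stay hl (by omega) (by omega) (by omega))]
  have htt : ∀ r r', r' + 1 < Multiset.card ν → r + 1 < r' → ∀ u, t r' (t r u) = t r (t r' u) :=
    fun r r' hr hr' u => congrArg (fun f => f u) (H.rel.t_t r r' hr hr')
  by_cases h5 : j < k
  · obtain ⟨r, rfl⟩ : ∃ r, k = r + 1 := ⟨k - 1, by omega⟩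
    rw [insT_apply_lt (by omega), insT_apply_lt (by omega), insT_apply_lt (by omega),
      insT_apply_lt (by omega), htt _ _ (by omega) (by omega)]
  by_cases h6 : j ≤ l
  · rw [insT_apply_lt (by omega), insT_apply_gt (by omega), insT_apply_gt (by omega),
      insT_apply_lt (by omega), htt _ _ (by omega) (by omega)]
  · rw [insT_apply_gt (by omega), insT_apply_gt (by omega), insT_apply_gt (by omega),
      insT_apply_gt (by omega), htt _ _ (by omega) (by omega)]

/-- A component of a vector of weight τ is zero or lives on the unique s with insertion τ, where
`braidIdentities` applies. The last clause identifies its correction terms with those for the labels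
of τ, according to the position of the new strand. -/
theorem exists_braidIdentities {τ : Seq ρ} (hk : k + 1 < Multiset.card ν)
    (hf : HasWeight i e τ f) (hj : j ≤ Multiset.card ν) : ∃ c₀ c₁ c₂ : N,
    BraidIdentities (t k) (stay C i e d k) (stay C i e d (k + 1)) (moveRight C i e x z d k)
      (moveRight C i e x z d (k + 1)) (moveLeft C i e k) (moveLeft C i e (k + 1)) (f.1 j)
      c₀ c₁ c₂ ∧ ∀ y y' : Module.End 𝕜 N, ∀ h0 h1 h2, ∀ c,
        (j = k ∧ y = z ∧ y' = x (k + 1) ∧ c = c₀ ∨ j = k + 1 ∧ y = x k ∧ y' = x (k + 1) ∧ c = c₁ ∨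
          j = k + 2 ∧ y = x k ∧ y' = z ∧ c = c₂) →
        braidCorrection C (τ.entry k h0) (τ.entry (k + 1) h1) (τ.entry (k + 2) h2) y y' (f.1 j)
          = c := by
  obtain h | ⟨s, hs, h⟩ := hf j hj
  · refine ⟨0, 0, 0, by constructor <;> simp [h], fun y y' h0 h1 h2 c hc => ?_⟩
    have : c = 0 := by tauto
    rw [h, this, braidCorrection]
    simp
  · refine ⟨_, _, _, H.braidIdentities hk h, fun y y' h0 h1 h2 c hc => ?_⟩
    obtain ⟨rfl, rfl, rfl, rfl⟩ | ⟨rfl, rfl, rfl, rfl⟩ | ⟨rfl, rfl, rfl, rfl⟩ := hc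
    · rw [(Seq.entry_eq_iff τ j h0 i).2 (hs.getElem?_eq hj),
        ← entry_eq_entry (hs.getElem?_gt le_rfl).symm (by omega) h1,
        ← entry_eq_entry (hs.getElem?_gt (by omega)).symm (by omega) h2]
    · rw [(Seq.entry_eq_iff τ (k + 1) h1 i).2 (hs.getElem?_eq hj),
        ← entry_eq_entry (hs.getElem?_lt (by omega)).symm (by omega) h0,
        ← entry_eq_entry (hs.getElem?_gt (by omega)).symm (by omega) h2]
    · rw [(Seq.entry_eq_iff τ (k + 2) h2 i).2 (hs.getElem?_eq hj),
        ← entry_eq_entry (hs.getElem?_lt (by omega)).symm (by omega) h0,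
        ← entry_eq_entry (hs.getElem?_lt (by omega)).symm (by omega) h1]

/-- On positions k, k + 1, k + 2 both sides are 3 × 3 matrices. The field h_{rs} of
`BraidIdentities` is the entry from position k + s to position k + r, so each target position needs
three of them. Away from these positions the relation is that of R(ν). -/
theorem insT_braid {τ : Seq ρ} (hk : k + 2 < Multiset.card ρ) (hf : HasWeight i e τ f)
    (hj : j ≤ Multiset.card ν) :
    (insT C i e x t z d k (insT C i e x t z d (k + 1) (insT C i e x t z d k f))).1 j =
      (insT C i e x t z d (k + 1) (insT C i e x t z d k (insT C i e x t z d (k + 1) f))).1 j +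
      braidCorrection C (τ.entry k (by omega)) (τ.entry (k + 1) (by omega)) (τ.entry (k + 2) hk)
        (insDot x z k j) (insDot x z (k + 2) j) (f.1 j) := by
  have hc := card_eq_succ hρ
  have hk' : k + 1 < Multiset.card ν := by omega
  obtain ⟨a0, a1, a2, A, hA⟩ := H.exists_braidIdentities (j := k) hρ hk' hf (by omega)
  obtain ⟨b0, b1, b2, B, hB⟩ := H.exists_braidIdentities (j := k + 1) hρ hk' hf (by omega)
  obtain ⟨c0, c1, c2, Γ, hΓ⟩ := H.exists_braidIdentities (j := k + 2) hρ hk' hf (by omega)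
  by_cases h1 : j = k
  · subst h1
    rw [hA _ _ _ _ _ _ (Or.inl ⟨rfl, insDot_self, insDot_gt (by omega), rfl⟩),
      insT_apply_left, insT_apply_left, insT_apply_lt le_rfl, insT_apply_left, insT_apply_right,
      insT_apply_gt (by omega), insT_apply_lt le_rfl, insT_apply_left, insT_apply_left,
      insT_apply_lt le_rfl]
    simp only [map_add, map_sub]
    have e0 := A.h00
    have e1 := B.h01
    have e2 := Γ.h02
    linear_combination (norm := module) e0 + e1 + e2
  by_cases h2 : j = k + 1
  · subst h2
    rw [hB _ _ _ _ _ _ (Or.inr (Or.inl ⟨rfl, insDot_lt (by omega), insDot_gt (by omega), rfl⟩)),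
      insT_apply_right, insT_apply_left, insT_apply_lt le_rfl, insT_apply_left, insT_apply_right,
      insT_apply_gt (by omega), insT_apply_left, insT_apply_right, insT_apply_left,
      insT_apply_gt (by omega), insT_apply_lt le_rfl, insT_apply_right]
    simp only [map_add, map_sub]
    have e0 := A.h10
    have e1 := B.h11
    have e2 := Γ.h12
    linear_combination (norm := module) e0 + e1 + e2
  by_cases h3 : j = k + 2
  · subst h3
    rw [hΓ _ _ _ _ _ _ (Or.inr (Or.inr ⟨rfl, insDot_lt (by omega), insDot_self, rfl⟩)),
      insT_apply_gt (by omega), insT_apply_right, insT_apply_right, insT_apply_gt (by omega),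
      insT_apply_right, insT_apply_right, insT_apply_lt le_rfl, insT_apply_left,
      insT_apply_gt (by omega), insT_apply_right]
    simp only [map_add, map_sub]
    have e0 := A.h20
    have e1 := B.h21
    have e2 := Γ.h22
    linear_combination (norm := module) e0 + e1 + e2
  · obtain ⟨l, hl, hT, hT', hx1, hx2, hins⟩ := exists_far_braid (C := C) (e := e) (x := x)
      (t := t) (z := z) (d := d) hρ hj hk h1 h2 h3
    rw [hT, hT', hT, hT', hT, hT', hx1, hx2]
    obtain h | ⟨s, hs, h⟩ := hf j hj
    · rw [h, braidCorrection]; simp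
    · obtain ⟨e1, e2, e3⟩ := hins s τ hs
      rw [H.rel.braid_apply hl h, entry_eq_entry e1 _ (by omega), entry_eq_entry e2 _ (by omega),
        entry_eq_entry e3 _ hk]

/-- The insertion of a new strand turns a localized module over `R(ν)` into a module over
`R(ν + i)`. -/
theorem strandRel_ins : StrandRel C (ρ := ρ) (insE i e) (insX x z) (insT C i e x t z d) := by
  have hc := card_eq_succ hρ
  have hE := fun τ : Seq ρ => fun f : InsFun ν 𝕜 N => hasWeight_insE (f := f) (i := i) H.rel τ
  refine
  { idem := fun τ => LinearMap.ext fun f => (hE τ f).insE_eq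
    orth := fun τ τ' h => LinearMap.ext fun f => (hE τ' f).insE_eq_zero H.rel h
    unit := LinearMap.ext fun f => by
      rw [LinearMap.sum_apply, sum_insE H.rel hρ, Module.End.one_apply]
    x_e := fun k τ hk => mul_insE_eq (σ := id) H.rel hρ Function.injective_id
      (fun τ f hf => H.hasWeight_insX hρ hk hf) τ
    t_e := fun k τ hk => mul_insE_eq (σ := fun τ => τ.swap k) H.rel hρ
      (fun τ τ' h => by rw [← Seq.swap_swap τ k hk, ← Seq.swap_swap τ' k hk]; exact congrArg _ h)
      (fun τ f hf => H.hasWeight_insT hρ hk hf) τ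
    x_x := fun k l hk hl => H.insX_mul_insX (by omega) (by omega)
    x_t := fun k l hk hl h h' => H.insX_mul_insT (by omega) (by omega) h h'
    t_t := fun k l hl h => H.insT_mul_insT (by omega) h
    quad_same := fun k hk τ h => LinearMap.ext fun f => InsFun.ext fun j hj => ?_
    quad_orth := fun k hk τ h h' => LinearMap.ext fun f => InsFun.ext fun j hj => ?_
    quad := fun k hk τ h h' => LinearMap.ext fun f => InsFun.ext fun j hj => ?_
    slide_left_real := fun k hk τ h h' => LinearMap.ext fun f => InsFun.ext fun j hj => ?_
    slide_right_real := fun k hk τ h h' => LinearMap.ext fun f => InsFun.ext fun j hj => ?_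
    slide_left := fun k hk τ h => LinearMap.ext fun f => InsFun.ext fun j hj => ?_
    slide_right := fun k hk τ h => LinearMap.ext fun f => InsFun.ext fun j hj => ?_
    braid_corrected := fun k hk τ h => LinearMap.ext fun f => InsFun.ext fun j hj => ?_
    braid := fun k hk τ h => LinearMap.ext fun f => InsFun.ext fun j hj => ?_ }
  · refine (H.insT_insT hρ hk (hE τ f) hj).trans ?_
    rw [doubleCross, if_pos h]
    rfl
  · refine (H.insT_insT hρ hk (hE τ f) hj).trans ?_
    rw [doubleCross, if_neg h, if_pos h']
    rfl
  · refine (H.insT_insT hρ hk (hE τ f) hj).trans ?_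
    rw [doubleCross, if_neg h, if_neg h', LinearMap.add_apply, ← insX_pow_apply, ← insX_pow_apply]
    rfl
  · refine (H.insX_insT hρ hk (hE τ f) hj).trans ?_
    rw [slideTerm, if_pos ⟨h, h'⟩]
    rfl
  · refine (H.insT_insX hρ hk (hE τ f) hj).trans ?_
    rw [slideTerm, if_pos ⟨h, h'⟩]
    rfl
  · refine (H.insX_insT hρ hk (hE τ f) hj).trans ?_
    rw [slideTerm, if_neg h]
    exact add_zero _
  · refine (H.insT_insX hρ hk (hE τ f) hj).trans ?_
    rw [slideTerm, if_neg h]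
    exact add_zero _
  · refine (H.insT_braid hρ hk (hE τ f) hj).trans ?_
    rw [braidCorrection]
    split_ifs with h'
    swap
    · exact absurd h h'
    simp only [Module.End.mul_apply, LinearMap.add_apply, LinearMap.sum_apply, Submodule.coe_add,
      Pi.add_apply, AddSubmonoidClass.coe_finsetSum, Finset.sum_apply, insX_pow_apply]
  · refine (H.insT_braid hρ hk (hE τ f) hj).trans ?_
    rw [braidCorrection]
    split_ifs with h'
    · exact absurd h' h
    exact add_zero _

end LocalizedRel

end InsertionRelations

/-! ### Laurent polynomials over a module with nilpotent dots. -/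

section Laurent

universe v

variable {I : Type v} {ν ρ : Multiset I} {𝕜 : Type*} [Field 𝕜] {C : BorcherdsCartan I} {i : I}

theorem StrandRel.map {B B' : Type*} [Ring B] [Ring B'] {e : Seq ρ → B} {x t : ℕ → B}
    (H : StrandRel C e x t) (f : B →+* B') :
    StrandRel C (fun s => f (e s)) (fun k => f (x k)) (fun k => f (t k)) where
  idem s := by rw [← map_mul, H.idem]
  orth s s' h := by rw [← map_mul, H.orth s s' h, map_zero]
  unit := by rw [← map_sum, H.unit, map_one]
  x_e k s hk := by rw [← map_mul, H.x_e k s hk, map_mul]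
  t_e k s hk := by rw [← map_mul, H.t_e k s hk, map_mul]
  x_x k l hk hl := by rw [← map_mul, H.x_x k l hk hl, map_mul]
  x_t k l hk hl h h' := by rw [← map_mul, H.x_t k l hk hl h h', map_mul]
  t_t k l hl h := by rw [← map_mul, H.t_t k l hl h, map_mul]
  quad_same k hk s h := by simpa only [map_mul, map_zero] using congrArg f (H.quad_same k hk s h)
  quad_orth k hk s h h' := by simpa only [map_mul] using congrArg f (H.quad_orth k hk s h h')
  quad k hk s h h' := by
    simpa only [map_mul, map_add, map_pow] using congrArg f (H.quad k hk s h h')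
  slide_left_real k hk s h h' := by
    simpa only [map_mul, map_add, map_one] using congrArg f (H.slide_left_real k hk s h h')
  slide_right_real k hk s h h' := by
    simpa only [map_mul, map_add, map_one] using congrArg f (H.slide_right_real k hk s h h')
  slide_left k hk s h := by simpa only [map_mul] using congrArg f (H.slide_left k hk s h)
  slide_right k hk s h := by simpa only [map_mul] using congrArg f (H.slide_right k hk s h)
  braid_corrected k hk s h := by
    simpa only [map_mul, map_add, map_sum, map_pow] using congrArg f (H.braid_corrected k hk s h)
  braid k hk s h := by simpa only [map_mul] using congrArg f (H.braid k hk s h)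

variable {N : Type*} [AddCommGroup N] [Module 𝕜 N]

variable (𝕜 N) in
/-- Multiplication of Laurent polynomials with coefficients in `N` by `z ^ b`. -/
def laurentShift (b : ℤ) : Module.End 𝕜 (ℤ →₀ N) := Finsupp.lmapDomain N 𝕜 (· + b)

variable (𝕜 N) in
/-- The Laurent polynomials of order at least `p`. -/
def laurentGE (p : ℤ) : Submodule 𝕜 (ℤ →₀ N) := Finsupp.supported N 𝕜 (Set.Ici p)

theorem laurentShift_single (b p : ℤ) (u : N) :
    laurentShift 𝕜 N b (Finsupp.single p u) = Finsupp.single (p + b) u :=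
  Finsupp.mapDomain_single

theorem laurentShift_mul (b c : ℤ) :
    laurentShift 𝕜 N b * laurentShift 𝕜 N c = laurentShift 𝕜 N (b + c) := by
  refine Finsupp.lhom_ext fun p u => ?_
  rw [Module.End.mul_apply, laurentShift_single, laurentShift_single, laurentShift_single]
  congr 1
  ring

theorem laurentShift_zero : laurentShift 𝕜 N 0 = 1 := by
  refine Finsupp.lhom_ext fun p u => ?_
  rw [laurentShift_single, add_zero, Module.End.one_apply]

theorem laurentGE_anti {p q : ℤ} (h : q ≤ p) : laurentGE 𝕜 N p ≤ laurentGE 𝕜 N q :=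
  Finsupp.supported_mono (Set.Ici_subset_Ici.2 h)

theorem laurentShift_mem {p : ℤ} (b : ℤ) {f : ℤ →₀ N} (hf : f ∈ laurentGE 𝕜 N p) :
    laurentShift 𝕜 N b f ∈ laurentGE 𝕜 N (p + b) := by
  classical
  have h := (Finsupp.mem_supported 𝕜 f).1 hf
  refine (Finsupp.mem_supported 𝕜 _).2 fun q hq => ?_
  obtain ⟨r, hr, rfl⟩ := Finset.mem_image.1 (Finsupp.mapDomain_support hq)
  have := Set.mem_Ici.1 (h hr)
  exact Set.mem_Ici.2 (by omega)

theorem eq_zero_of_mem_laurentGE {f : ℤ →₀ N} (h : ∀ p, f ∈ laurentGE 𝕜 N p) : f = 0 := by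
  ext p
  by_contra hp
  have := (Finsupp.mem_supported 𝕜 f).1 (h (p + 1)) (Finsupp.mem_support_iff.2 hp)
  simp at this

/-- Operators that lower the order of a Laurent polynomial by a bounded amount. -/
def LowersBoundedly (a : Module.End 𝕜 (ℤ →₀ N)) : Prop :=
  ∃ b : ℕ, ∀ p, ∀ f ∈ laurentGE 𝕜 N p, a f ∈ laurentGE 𝕜 N (p - b)

namespace LowersBoundedly

variable {a a' : Module.End 𝕜 (ℤ →₀ N)}

theorem zero : LowersBoundedly (0 : Module.End 𝕜 (ℤ →₀ N)) := ⟨0, fun _ _ _ => zero_mem _⟩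

theorem one : LowersBoundedly (1 : Module.End 𝕜 (ℤ →₀ N)) :=
  ⟨0, fun p f hf => by simpa using hf⟩

theorem add (h : LowersBoundedly a) (h' : LowersBoundedly a') : LowersBoundedly (a + a') := by
  obtain ⟨b, h⟩ := h
  obtain ⟨b', h'⟩ := h'
  exact ⟨b + b', fun p f hf => add_mem (laurentGE_anti (by push_cast; omega) (h p f hf))
    (laurentGE_anti (by push_cast; omega) (h' p f hf))⟩

theorem neg (h : LowersBoundedly a) : LowersBoundedly (-a) := by
  obtain ⟨b, h⟩ := h
  exact ⟨b, fun p f hf => neg_mem (h p f hf)⟩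

theorem mul (h : LowersBoundedly a) (h' : LowersBoundedly a') : LowersBoundedly (a * a') := by
  obtain ⟨b, h⟩ := h
  obtain ⟨b', h'⟩ := h'
  refine ⟨b + b', fun p f hf => ?_⟩
  have := h _ _ (h' p f hf)
  rwa [sub_sub, add_comm (b' : ℤ), ← Nat.cast_add] at this

theorem pow (h : LowersBoundedly a) (n : ℕ) : LowersBoundedly (a ^ n) := by
  induction n with
  | zero => exact one
  | succ n ih => exact ih.mul h

theorem sum {ι : Type*} {s : Finset ι} {a : ι → Module.End 𝕜 (ℤ →₀ N)}
    (h : ∀ j ∈ s, LowersBoundedly (a j)) : LowersBoundedly (∑ j ∈ s, a j) := by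
  classical
  induction s using Finset.induction_on with
  | empty => exact zero
  | insert j s hj ih =>
    rw [Finset.sum_insert hj]
    exact (h j (Finset.mem_insert_self j s)).add
      (ih fun l hl => h l (Finset.mem_insert_of_mem hl))

theorem shift (b : ℤ) : LowersBoundedly (laurentShift 𝕜 N b) :=
  ⟨b.natAbs, fun _ _ hf => laurentGE_anti (by omega) (laurentShift_mem b hf)⟩

end LowersBoundedly

section Coefficientwise

variable [Module (KLRAlgebra 𝕜 C ν) N] [IsScalarTower 𝕜 (KLRAlgebra 𝕜 C ν) N]

variable (𝕜 C ν N) in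
/-- The coefficientwise action on Laurent polynomials. -/
def laurentAct : KLRAlgebra 𝕜 C ν →ₐ[𝕜] Module.End 𝕜 (ℤ →₀ N) := Algebra.lsmul 𝕜 𝕜 (ℤ →₀ N)

theorem laurentAct_single (a : KLRAlgebra 𝕜 C ν) (p : ℤ) (u : N) :
    laurentAct ν 𝕜 C N a (Finsupp.single p u) = Finsupp.single p (a • u) :=
  Finsupp.smul_single a p u

theorem laurentAct_mem (a : KLRAlgebra 𝕜 C ν) {p : ℤ} {f : ℤ →₀ N} (hf : f ∈ laurentGE 𝕜 N p) :
    laurentAct ν 𝕜 C N a f ∈ laurentGE 𝕜 N p := by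
  have := (Finsupp.mem_supported 𝕜 f).1 hf
  exact (Finsupp.mem_supported 𝕜 _).2 fun q hq => this (Finsupp.support_smul hq)

theorem lowersBoundedly_laurentAct (a : KLRAlgebra 𝕜 C ν) :
    LowersBoundedly (laurentAct ν 𝕜 C N a) :=
  ⟨0, fun p f hf => by simpa using laurentAct_mem a hf⟩

theorem commute_laurentShift (b : ℤ) (a : KLRAlgebra 𝕜 C ν) :
    Commute (laurentShift 𝕜 N b) (laurentAct ν 𝕜 C N a) := by
  refine Finsupp.lhom_ext fun p u => ?_
  rw [Module.End.mul_apply, Module.End.mul_apply, laurentAct_single, laurentShift_single,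
    laurentShift_single, laurentAct_single]

/-- The inverse of `x - z`, where `x ^ c = 0`. -/
def laurentInv (𝕜 N : Type*) [Field 𝕜] [AddCommGroup N] [Module 𝕜 N]
    (y : Module.End 𝕜 (ℤ →₀ N)) (c : ℕ) : Module.End 𝕜 (ℤ →₀ N) :=
  -∑ r ∈ Finset.range c, y ^ r * laurentShift 𝕜 N (-((r : ℤ) + 1))

/-- The products (y - z) y^r z^(-r-1) telescope to y^c z^(-c) - 1, and y^c = 0. -/
theorem laurentInv_spec {y : Module.End 𝕜 (ℤ →₀ N)} {c : ℕ} (hy : y ^ c = 0)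
    (h : ∀ b, Commute (laurentShift 𝕜 N b) y) :
    laurentInv 𝕜 N y c * (y - laurentShift 𝕜 N 1) = 1 ∧
      (y - laurentShift 𝕜 N 1) * laurentInv 𝕜 N y c = 1 := by
  have key : (y - laurentShift 𝕜 N 1) * laurentInv 𝕜 N y c = 1 := by
    have e1 : ∀ r : ℕ, (y - laurentShift 𝕜 N 1) * (y ^ r * laurentShift 𝕜 N (-((r : ℤ) + 1)))
        = y ^ (r + 1) * laurentShift 𝕜 N (-((r + 1 : ℕ) : ℤ)) -
          y ^ r * laurentShift 𝕜 N (-(r : ℤ)) := by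
      intro r
      rw [sub_mul, ← mul_assoc, ← mul_assoc, ((h 1).pow_right r).eq, mul_assoc _ (laurentShift 𝕜 N 1),
        laurentShift_mul, ← pow_succ']
      congr 3
      ring
    refine (mul_neg (y - laurentShift 𝕜 N 1) _).trans ?_
    rw [Finset.mul_sum, Finset.sum_congr rfl fun r _ => e1 r,
      Finset.sum_range_sub (fun r : ℕ => y ^ r * laurentShift 𝕜 N (-(r : ℤ))), hy]
    simp [laurentShift_zero]
  refine ⟨?_, key⟩
  have hc : Commute (laurentInv 𝕜 N y c) (y - laurentShift 𝕜 N 1) := by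
    refine Commute.neg_left (Commute.sum_left _ _ _ fun r _ => ?_)
    refine Commute.mul_left ?_ ?_
    · exact ((Commute.refl y).pow_left r).sub_right ((h 1).pow_right r).symm
    · refine (h _).sub_right ?_
      change _ * _ = _ * _
      rw [laurentShift_mul, laurentShift_mul, add_comm]
  rw [hc.eq, key]

variable {c : ℕ → ℕ} (hc : ∀ k (u : N), dot 𝕜 C ν k ^ c k • u = 0)

variable (𝕜 C ν N c) in
/-- The inverses of the differences of the dots and of the variable. -/
def laurentD (k : ℕ) : Module.End 𝕜 (ℤ →₀ N) :=
  laurentInv 𝕜 N (laurentAct ν 𝕜 C N (dot 𝕜 C ν k)) (c k)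

-- Nilpotent dots become distinct from the invertible variable z in the strongest sense: each x_k -
-- z is invertible, with the geometric series as inverse.
include hc in
theorem localizedRel_laurent : LocalizedRel C (fun s => laurentAct ν 𝕜 C N (gen 𝕜 C (.e s)))
    (fun k => laurentAct ν 𝕜 C N (dot 𝕜 C ν k)) (fun k => laurentAct ν 𝕜 C N (cross 𝕜 C ν k))
    (laurentShift 𝕜 N 1) (laurentD ν 𝕜 C N c) := by
  have hn : ∀ k, laurentAct ν 𝕜 C N (dot 𝕜 C ν k) ^ c k = 0 := fun k => by
    refine Finsupp.lhom_ext fun p u => ?_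
    rw [← map_pow, laurentAct_single, hc, Finsupp.single_zero, LinearMap.zero_apply]
  exact {
    rel := (strandRel_klr 𝕜).map (laurentAct ν 𝕜 C N).toRingHom
    z_e := fun s => commute_laurentShift _ _
    z_x := fun k => commute_laurentShift _ _
    z_t := fun k => commute_laurentShift _ _
    d_mul := fun k _ => (laurentInv_spec (hn k) fun b => commute_laurentShift _ _).1
    mul_d := fun k _ => (laurentInv_spec (hn k) fun b => commute_laurentShift _ _).2 }

theorem lowersBoundedly_laurentD (k : ℕ) : LowersBoundedly (laurentD ν 𝕜 C N c k) :=
  (LowersBoundedly.sum fun _ _ =>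
    ((lowersBoundedly_laurentAct _).pow _).mul (LowersBoundedly.shift _)).neg

theorem lowersBoundedly_diag {k : ℕ} {f : Option I → Module.End 𝕜 (ℤ →₀ N)}
    (h : ∀ a, LowersBoundedly (f a)) :
    LowersBoundedly (diag (fun s => laurentAct ν 𝕜 C N (gen 𝕜 C (.e s))) k f) :=
  LowersBoundedly.sum fun _ _ => (h _).mul (lowersBoundedly_laurentAct _)

end Coefficientwise

end Laurent

/-! ### Multiplication by z, the order filtration, and the last position. -/

section Specialization

universe v w

variable {I : Type v} {ν ρ : Multiset I} {𝕜 : Type*} [Field 𝕜] {C : BorcherdsCartan I} {i : I}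

section Filtered

variable {X : Type*} [AddCommGroup X] [Module 𝕜 X] [Module (KLRAlgebra 𝕜 C ρ) X]
variable [IsScalarTower 𝕜 (KLRAlgebra 𝕜 C ρ) X]

/-- If the crossings lower a separated filtration by bounded amounts, then an operator that raises
it is not surjective on a finitely generated submodule. -/
theorem not_le_map_of_filtration {G : ℤ → Submodule 𝕜 X} (hG : Antitone G)
    (hG0 : ∀ f, (∀ p, f ∈ G p) → f = 0)
    (hT : ∀ k, ∃ b : ℕ, ∀ p, ∀ f ∈ G p, cross 𝕜 C ρ k • f ∈ G (p - b))
    {Z : X →ₗ[KLRAlgebra 𝕜 C ρ] X} (hZ : ∀ p, ∀ f ∈ G p, Z f ∈ G (p + 1)) {q p : ℕ}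
    (hqp : q + p = Multiset.card ρ) {U : Submodule 𝕜 X} (hU : StableBelow C ρ q U) (hU0 : U ≤ G 0)
    {Y : Submodule (KLRAlgebra 𝕜 C ρ) X} (hY : Y ≤ Submodule.span _ (U : Set X)) (hY0 : Y ≠ ⊥) :
    ¬Y ≤ Y.map Z := by
  -- The submodule generated by U is reached by finitely many chains of crossings, each lowering the
  -- filtration boundedly, so it lies in one step G (-b).
  have sweep_bound : ∀ (U : Submodule 𝕜 X) (Q : ℕ), (∃ b : ℕ, U ≤ G (-b)) → ∀ c,
      ∃ b : ℕ, sweep C ρ Q U c ≤ G (-b) := by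
    intro U Q hU c
    induction c with
    | zero => exact hU
    | succ c ih =>
      obtain ⟨b, hb⟩ := ih
      obtain ⟨b', hb'⟩ := hT (Q - (c + 1))
      refine ⟨b + b', ?_⟩
      rintro _ ⟨u, hu, rfl⟩
      have := hb' _ u (hb hu)
      rwa [← neg_add', ← Nat.cast_add] at this
  have fan_bound : ∀ (U : Submodule 𝕜 X) (Q : ℕ), (∃ b : ℕ, U ≤ G (-b)) → ∀ c,
      ∃ b : ℕ, fan C ρ Q U c ≤ G (-b) := by
    intro U Q hU c
    induction c with
    | zero => exact hU
    | succ c ih =>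
      obtain ⟨b, hb⟩ := ih
      obtain ⟨b', hb'⟩ := sweep_bound U Q hU (c + 1)
      exact ⟨b + b', sup_le (hb'.trans (hG (by push_cast; omega)))
        (hb.trans (hG (by push_cast; omega)))⟩
  have tower_bound : ∀ p, ∃ b : ℕ, tower C ρ q U p ≤ G (-b) := by
    intro p
    induction p with
    | zero => exact ⟨0, by rw [Nat.cast_zero, neg_zero]; exact hU0⟩
    | succ p ih => exact fan_bound _ _ ih _
  obtain ⟨b, hb⟩ := tower_bound p
  intro hle
  refine hY0 ((Submodule.eq_bot_iff _).2 fun f hf => hG0 f fun r => ?_)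
  -- If Y ⊆ Z Y, every element of Y is the n-fold image of an element of Y, and each application of
  -- Z raises the lower bound -b by one.
  have key : ∀ n : ℕ, ∀ f ∈ Y, f ∈ G (-b + n) := by
    intro n
    induction n with
    | zero => exact fun f hf => by simpa using hb (mem_tower_of_mem_span hU hqp (hY hf))
    | succ n ih =>
      intro f hf
      obtain ⟨g, hg, rfl⟩ := hle hf
      have := hZ _ g (ih g hg)
      rwa [add_assoc, ← Nat.cast_succ] at this
  exact hG (by omega) (key (r + b).toNat f hf)

end Filtered

variable {N : Type*} [AddCommGroup N] [Module 𝕜 N]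
variable {e : Seq ν → Module.End 𝕜 N} {x t : ℕ → Module.End 𝕜 N} {z : Module.End 𝕜 N}
variable {d : ℕ → Module.End 𝕜 N}

variable (ν z) in
/-- The componentwise action of `z` on the insertion module. -/
def insZ : Module.End 𝕜 (InsFun ν 𝕜 N) :=
  LinearMap.restrict (p := InsFun ν 𝕜 N) (q := InsFun ν 𝕜 N)
    (LinearMap.pi fun j => z.comp (LinearMap.proj j)) fun f hf j hj => by
    rw [LinearMap.pi_apply, LinearMap.comp_apply, LinearMap.proj_apply, hf j hj, map_zero]

theorem insZ_apply (f : InsFun ν 𝕜 N) (j : ℕ) : (insZ ν z f).1 j = z (f.1 j) := rfl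

theorem StrandRel.commute_lift {Y : Type*} [AddCommGroup Y] [Module 𝕜 Y]
    {e : Seq ρ → Module.End 𝕜 Y} {x t : ℕ → Module.End 𝕜 Y} (H : StrandRel C e x t)
    {y : Module.End 𝕜 Y} (he : ∀ s, Commute y (e s))
    (hx : ∀ k < Multiset.card ρ, Commute y (x k))
    (ht : ∀ k, k + 1 < Multiset.card ρ → Commute y (t k)) (a : KLRAlgebra 𝕜 C ρ) :
    Commute y (H.lift 𝕜 a) := by
  induction a using algebra_induction 𝕜 with
  | scalar c => rw [AlgHom.commutes]; exact Algebra.commute_algebraMap_right c y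
  | add a b ha hb => rw [map_add]; exact ha.add_right hb
  | mul a b ha hb => rw [map_mul]; exact ha.mul_right hb
  | gen g =>
    cases g with
    | e s => rw [H.lift_e 𝕜]; exact he s
    | x k hk s =>
      rw [← dot_mul_e 𝕜 hk, map_mul, H.lift_e 𝕜, H.lift_dot 𝕜 hk]
      exact (hx k hk).mul_right (he s)
    | t k hk s =>
      rw [← cross_mul_e 𝕜 hk, map_mul, H.lift_e 𝕜, H.lift_cross 𝕜 hk]
      exact (ht k hk).mul_right (he s)

namespace LocalizedRel

variable (H : LocalizedRel C e x t z d) (hρ : ν + Multiset.replicate 1 i = ρ)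

include H

theorem commute_insZ_insE (τ : Seq ρ) : Commute (insZ ν z) (insE i e τ) := by
  classical
  refine LinearMap.ext fun f => InsFun.ext fun j hj => ?_
  rw [Module.End.mul_apply, Module.End.mul_apply, insZ_apply, insE_apply, insE_apply, insZ_apply]
  have : Commute z (∑ s : Seq ν, if IsInsert i j s τ then e s else 0) := by
    refine Commute.sum_right _ _ _ fun s _ => ?_
    split_ifs
    exacts [H.z_e s, Commute.zero_right _]
  exact apply_apply_of_commute this _

theorem commute_insZ_insX {k : ℕ} (hk : k ≤ Multiset.card ν) :
    Commute (insZ ν z) (insX x z k) := by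
  refine LinearMap.ext fun f => InsFun.ext fun j hj => ?_
  exact apply_apply_of_commute (commute_insDot (fun l _ => H.z_x l) (Commute.refl z) hk hj) _

include hρ in
theorem commute_insZ_insT {k : ℕ} (hk : k < Multiset.card ν) :
    Commute (insZ ν z) (insT C i e x t z d k) := by
  have hc := card_eq_succ hρ
  refine LinearMap.ext fun f => InsFun.ext fun j hj => ?_
  rw [Module.End.mul_apply, Module.End.mul_apply, insZ_apply]
  have hD := H.commute_stay (i := i) hk H.z_e (H.z_x k) (Commute.refl z)
  by_cases h1 : j = k
  · subst h1
    rw [insT_apply_left, insT_apply_left, insZ_apply, insZ_apply, map_sub,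
      apply_apply_of_commute (commute_moveLeft H.z_e), apply_apply_of_commute hD]
  by_cases h2 : j = k + 1
  · subst h2
    rw [insT_apply_right, insT_apply_right, insZ_apply, insZ_apply, map_add,
      apply_apply_of_commute (H.commute_moveRight hk H.z_e (H.z_x k) (Commute.refl z)),
      apply_apply_of_commute hD]
  · obtain ⟨l, hl, hT, -⟩ := exists_far (C := C) (e := e) (x := x) (t := t) (z := z)
      (d := d) hρ hj (by omega) h1 h2
    rw [hT, hT, insZ_apply, apply_apply_of_commute (H.z_t l)]

include hρ in
theorem commute_insZ_lift (a : KLRAlgebra 𝕜 C ρ) :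
    Commute (insZ ν z) ((H.strandRel_ins hρ).lift 𝕜 a) := by
  have hc := card_eq_succ hρ
  exact (H.strandRel_ins hρ).commute_lift (fun s => H.commute_insZ_insE s)
    (fun k hk => H.commute_insZ_insX (by omega)) (fun k hk => H.commute_insZ_insT hρ (by omega)) a

end LocalizedRel

section LastPosition

variable (ν 𝕜) in
/-- The functions that vanish outside the last position. -/
def insLast : N →ₗ[𝕜] InsFun ν 𝕜 N :=
  LinearMap.codRestrict (InsFun ν 𝕜 N) (LinearMap.single 𝕜 (fun _ => N) (Multiset.card ν))
    fun u j hj => by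
    rw [LinearMap.single_apply, Pi.single_eq_of_ne (by omega)]

theorem insLast_self (u : N) : (insLast ν 𝕜 u).1 (Multiset.card ν) = u := Pi.single_eq_same _ _

theorem insLast_of_ne {j : ℕ} (h : j ≠ Multiset.card ν) (u : N) : (insLast ν 𝕜 u).1 j = 0 :=
  Pi.single_eq_of_ne h _

theorem eq_insLast {f : InsFun ν 𝕜 N} (h : ∀ j < Multiset.card ν, f.1 j = 0) :
    f = insLast ν 𝕜 (f.1 (Multiset.card ν)) := by
  refine InsFun.ext fun j hj => ?_
  by_cases h1 : j = Multiset.card ν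
  · rw [h1, insLast_self]
  · rw [insLast_of_ne h1, h j (by omega)]

theorem insX_insLast_lt {k : ℕ} (hk : k < Multiset.card ν) (u : N) :
    insX x z k (insLast ν 𝕜 u) = insLast ν 𝕜 (x k u) := by
  rw [eq_insLast (f := insX x z k (insLast ν 𝕜 u)), insX_apply, insLast_self, insDot_lt hk]
  exact fun j hj => by rw [insX_apply, insLast_of_ne (by omega), map_zero]

theorem insX_insLast_self (u : N) :
    insX x z (Multiset.card ν) (insLast ν 𝕜 u) = insLast ν 𝕜 (z u) := by
  rw [eq_insLast (f := insX x z _ (insLast ν 𝕜 u)), insX_apply, insLast_self, insDot_self]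
  exact fun j hj => by rw [insX_apply, insLast_of_ne (by omega), map_zero]

theorem insZ_insLast (u : N) : insZ ν z (insLast ν 𝕜 u) = insLast ν 𝕜 (z u) := by
  rw [eq_insLast (f := insZ ν z (insLast ν 𝕜 u)), insZ_apply, insLast_self]
  exact fun j hj => by rw [insZ_apply, insLast_of_ne (by omega), map_zero]

theorem insT_insLast_lt {k : ℕ} (hk : k + 1 < Multiset.card ν) (u : N) :
    insT C i e x t z d k (insLast ν 𝕜 u) = insLast ν 𝕜 (t k u) := by
  rw [eq_insLast (f := insT C i e x t z d k (insLast ν 𝕜 u)), insT_apply_gt hk, insLast_self]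
  intro j hj
  change insCross C i e x t z d k j _ = 0
  rw [insCross]
  split_ifs <;> simp [insLast_of_ne, hj.ne, hk.ne, show k ≠ Multiset.card ν by omega]

theorem insE_insLast (H : StrandRel C e x t) (hρ : ν + Multiset.replicate 1 i = ρ) {s : Seq ν}
    (u : N) : insE (ρ := ρ) i e (s.extend hρ) (insLast ν 𝕜 u) = insLast ν 𝕜 (e s u) := by
  classical
  rw [eq_insLast (f := insE (ρ := ρ) i e _ (insLast ν 𝕜 u)), insE_apply, insLast_self,
    Finset.sum_eq_single s]
  · rw [if_pos]
    change s.1 ++ List.replicate 1 i = _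
    rw [← s.length_eq, List.insertIdx_length_self]
    rfl
  · intro s' _ hs'
    refine if_neg fun h => hs' ?_
    change s.1 ++ List.replicate 1 i = _ at h
    rw [← s'.length_eq, List.insertIdx_length_self] at h
    exact Subtype.ext (List.append_inj_left' h rfl).symm
  · simp
  · exact fun j hj => by rw [insE_apply, insLast_of_ne (by omega), map_zero]

theorem insE_insLast_eq_zero (τ : Seq ρ) (hτ : ∀ s : Seq ν, ¬IsInsert i (Multiset.card ν) s τ)
    (u : N) : insE i e τ (insLast ν 𝕜 u) = 0 := by
  classical
  refine InsFun.ext fun j hj => ?_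
  rw [insE_apply]
  by_cases h : j = Multiset.card ν
  · subst h
    rw [Finset.sum_eq_zero fun s _ => if_neg (hτ s)]
    rfl
  · rw [insLast_of_ne h, map_zero]
    rfl

/-- For imaginary i the new strand next to an entry i neither stays nor moves to the left. This
provides the vanishing of the crossings that V(i^n) requires. -/
theorem insT_insLast_eq_zero (H : LocalizedRel C e x t z d) (hi : ¬C.IsReal i) {k : ℕ}
    (hk : k + 1 = Multiset.card ν) {s : Seq ν} (hs : s.1[k]? = some i) {u : N} (hu : e s u = u) :
    insT C i e x t z d k (insLast ν 𝕜 u) = 0 := by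
  have hD : stay C i e d k u = 0 := by
    rw [H.stay_apply (by omega) hu, stayCoeff, if_neg fun h => hi h.2, LinearMap.zero_apply]
  have hL : moveLeft C i e k u = 0 := by
    rw [moveLeft, H.rel.diag_apply _ _ hu, leftCoeff, if_pos ⟨hs, hi⟩, LinearMap.zero_apply]
  refine InsFun.ext fun j hj => ?_
  change insCross C i e x t z d k j _ = 0
  have h1 : (insLast ν 𝕜 u).1 (k + 1) = u := by rw [hk, insLast_self]
  have h2 : (insLast ν 𝕜 u).1 k = 0 := insLast_of_ne (by omega) u
  rw [insCross]
  split_ifs with h3 h4 h5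
  · simp [insLast_of_ne (𝕜 := 𝕜) (show j ≠ Multiset.card ν by omega) u]
  · simp [h1, h2, hL]
  · simp [h1, h2, hD]
  · simp [insLast_of_ne (𝕜 := 𝕜) (show j ≠ Multiset.card ν by omega) u]

end LastPosition

end Specialization

/-! ### Adding one strand: the specialization at z = 0. -/

section AddStrand

universe v w

variable {I : Type v} {ν ρ : Multiset I} {𝕜 : Type*} [Field 𝕜] {C : BorcherdsCartan I} {i : I}
variable {N : Type w} [AddCommGroup N] [Module 𝕜 N] [Module (KLRAlgebra 𝕜 C ν) N]

/-- A nonzero `R(ρ)`-module `L` with nilpotent dots that is generated by the image of a module `N`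
over `R(ν)`, where `ρ = ν + ni`, on which the additional dots (and, for imaginary `i`, the
additional crossings) act by zero. -/
structure Extension (𝕜 : Type*) [Field 𝕜] (C : BorcherdsCartan I) {n : ℕ}
    (hρ : ν + Multiset.replicate n i = ρ) (N : Type w) [AddCommGroup N] [Module 𝕜 N] [Module (KLRAlgebra 𝕜 C ν) N] where
  carrier : Type w
  [addCommGroup : AddCommGroup carrier]
  [scalars : Module 𝕜 carrier]
  [action : Module (KLRAlgebra 𝕜 C ρ) carrier]
  [tower : IsScalarTower 𝕜 (KLRAlgebra 𝕜 C ρ) carrier]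
  [nontrivial : Nontrivial carrier]
  nilpotent : ∀ k, ∃ c, ∀ u : carrier, dot 𝕜 C ρ k ^ c • u = 0
  hom : N →ₗ[𝕜] carrier
  isVacuumHom : IsVacuumHom C hρ hom

attribute [instance] Extension.addCommGroup Extension.scalars Extension.action Extension.tower
  Extension.nontrivial

section Quotient

variable {X : Type w} [AddCommGroup X] [Module 𝕜 X] [Module (KLRAlgebra 𝕜 C ρ) X]
variable [IsScalarTower 𝕜 (KLRAlgebra 𝕜 C ρ) X]

/-- Let Y be generated by the image of f. Modulo Z Y the new dot, which acts on that image as Z,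
becomes zero, and the quotient is nonzero because Y is not contained in Z Y. -/
theorem exists_extension_of_quotient (hρ : ν + Multiset.replicate 1 i = ρ) {f : N →ₗ[𝕜] X}
    (hf : IsStrandHom C hρ f) {Z : X →ₗ[KLRAlgebra 𝕜 C ρ] X}
    (hZ : ∀ u, dot 𝕜 C ρ (Multiset.card ν) • f u = Z (f u))
    (hZn : ∀ k, ∃ c, ∀ y, dot 𝕜 C ρ k ^ (c + 1) • y = Z (dot 𝕜 C ρ k ^ c • y))
    (hY : ¬Submodule.span (KLRAlgebra 𝕜 C ρ) (Set.range f)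
      ≤ (Submodule.span (KLRAlgebra 𝕜 C ρ) (Set.range f)).map Z) :
    ∃ E : Extension 𝕜 C hρ N, ∀ k u, cross 𝕜 C ρ k • f u = 0 → cross 𝕜 C ρ k • E.hom u = 0 := by
  have hc := card_eq_succ hρ
  let Y := Submodule.span (KLRAlgebra 𝕜 C ρ) (Set.range f)
  let W : Submodule (KLRAlgebra 𝕜 C ρ) Y := (Y.map Z).comap Y.subtype
  have hfY : ∀ u, f u ∈ Y := fun u => Submodule.subset_span ⟨u, rfl⟩
  let g : N →ₗ[𝕜] Y := LinearMap.codRestrict (Y.restrictScalars 𝕜) f hfY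
  let ι : N →ₗ[𝕜] (Y ⧸ W) := (W.mkQ.restrictScalars 𝕜).comp g
  have hι : ∀ (a : KLRAlgebra 𝕜 C ρ) (u u' : N), f u' = a • f u → ι u' = a • ι u := by
    intro a u u' h
    change W.mkQ (g u') = a • W.mkQ (g u)
    rw [← map_smul]
    exact congrArg _ (Subtype.ext h)
  have hι0 : ∀ (a : KLRAlgebra 𝕜 C ρ) (u : N), a • f u ∈ Y.map Z → a • ι u = 0 := by
    intro a u h
    change a • W.mkQ (g u) = 0
    rw [← map_smul]
    exact (Submodule.Quotient.mk_eq_zero _).2 h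
  have hW : W ≠ ⊤ := fun h => hY fun y hy => by
    have : (⟨y, hy⟩ : Y) ∈ W := h ▸ Submodule.mem_top
    exact this
  have : Nontrivial (Y ⧸ W) := Submodule.Quotient.nontrivial_iff.2 hW
  refine ⟨{ carrier := Y ⧸ W, nilpotent := fun k => ?_, hom := ι, isVacuumHom := ⟨⟨fun s u => ?_,
    fun k hk u => ?_, fun k hk u => ?_⟩, fun k hk u => ?_, ?_⟩ }, fun k u h => ?_⟩
  -- The vector dot^(c+1) y is Z of dot^c y, hence zero in the quotient.
  · obtain ⟨c, hc⟩ := hZn k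
    refine ⟨c + 1, fun u => ?_⟩
    obtain ⟨y, rfl⟩ := W.mkQ_surjective u
    rw [← map_smul]
    refine (Submodule.Quotient.mk_eq_zero _).2 ?_
    exact ⟨dot 𝕜 C ρ k ^ c • y, Submodule.smul_mem _ _ y.2, (hc y).symm⟩
  · exact hι _ _ _ (hf.e s u)
  · exact hι _ _ _ (hf.dot k hk u)
  · exact hι _ _ _ (hf.cross k hk u)
  · by_cases h : k = Multiset.card ν
    · subst h
      exact hι0 _ _ ⟨f u, hfY u, (hZ u).symm⟩
    · rw [dot_of_le 𝕜 (by omega), zero_smul]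
  · rw [eq_top_iff]
    rintro y -
    obtain ⟨⟨y, hy⟩, rfl⟩ := W.mkQ_surjective y
    induction hy using Submodule.span_induction with
    | mem y hy =>
      obtain ⟨u, rfl⟩ := hy
      exact Submodule.subset_span ⟨u, rfl⟩
    | zero => exact zero_mem _
    | add a b ha hb h1 h2 => exact add_mem h1 h2
    | smul a b hb h1 => exact Submodule.smul_mem _ a h1
  · refine hι0 _ _ ?_
    rw [h]
    exact zero_mem _

end Quotient

variable [IsScalarTower 𝕜 (KLRAlgebra 𝕜 C ν) N]

/-- The module is the specialization at z = 0 of the submodule of the insertion module over N[z,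
z⁻¹] that is generated by N · z⁰ at the last position. -/
theorem exists_extension_one [Nontrivial N] (hn : ∀ k, ∃ c, ∀ u : N, dot 𝕜 C ν k ^ c • u = 0)
    (hρ : ν + Multiset.replicate 1 i = ρ) :
    ∃ E : Extension 𝕜 C hρ N, ¬C.IsReal i → ∀ (k : ℕ) (s : Seq ν) (u : N), k + 1 = Multiset.card ν →
      s.1[k]? = some i → gen 𝕜 C (.e s) • u = u → cross 𝕜 C ρ k • E.hom u = 0 := by
  have hcard := card_eq_succ hρ
  choose c hc using hn
  have H := localizedRel_laurent hc
  have HR := H.strandRel_ins hρ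
  set A := laurentAct ν 𝕜 C N with hA
  set d := laurentD ν 𝕜 C N c with hd
  letI : Module (KLRAlgebra 𝕜 C ρ) (InsFun ν 𝕜 (ℤ →₀ N)) :=
    Module.compHom _ (HR.lift 𝕜).toRingHom
  have hact : ∀ (a : KLRAlgebra 𝕜 C ρ) (f : InsFun ν 𝕜 (ℤ →₀ N)), a • f = HR.lift 𝕜 a f :=
    fun _ _ => rfl
  have : IsScalarTower 𝕜 (KLRAlgebra 𝕜 C ρ) (InsFun ν 𝕜 (ℤ →₀ N)) := ⟨fun b a f => by
    rw [hact, hact, map_smul, LinearMap.smul_apply]⟩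
  have hE : ∀ (s : Seq ρ) (f : InsFun ν 𝕜 (ℤ →₀ N)), gen 𝕜 C (.e s) • f = insE i _ s f :=
    fun s f => by rw [hact, HR.lift_e 𝕜]
  have hX : ∀ k < Multiset.card ρ, ∀ f : InsFun ν 𝕜 (ℤ →₀ N), dot 𝕜 C ρ k • f = insX _ _ k f :=
    fun k hk f => by rw [hact, HR.lift_dot 𝕜 hk]
  have hT : ∀ k, k + 1 < Multiset.card ρ → ∀ f : InsFun ν 𝕜 (ℤ →₀ N),
      cross 𝕜 C ρ k • f = insT C i _ _ _ _ _ k f :=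
    fun k hk f => by rw [hact, HR.lift_cross 𝕜 hk]
  -- Multiplication by z in every position is R(ρ)-linear, because z commutes with all coefficients
  -- of the action.
  let Z : InsFun ν 𝕜 (ℤ →₀ N) →ₗ[KLRAlgebra 𝕜 C ρ] InsFun ν 𝕜 (ℤ →₀ N) :=
    { insZ ν (laurentShift 𝕜 N 1) with
      map_smul' := fun a f => apply_apply_of_commute (H.commute_insZ_lift hρ a) f }
  have hZ : ∀ f, Z f = insZ ν (laurentShift 𝕜 N 1) f := fun _ => rfl
  let f : N →ₗ[𝕜] InsFun ν 𝕜 (ℤ →₀ N) := (insLast ν 𝕜).comp (Finsupp.lsingle 0)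
  have hfu : ∀ u, f u = insLast ν 𝕜 (Finsupp.single 0 u) := fun _ => rfl
  have hf : IsStrandHom C hρ f := by
    refine ⟨fun s u => ?_, fun k hk u => ?_, fun k hk u => ?_⟩
    · rw [hE, hfu, hfu, insE_insLast H.rel hρ, hA, laurentAct_single]
    · rw [hX k (by omega), hfu, hfu, insX_insLast_lt hk, hA, laurentAct_single]
    · rw [hT k (by omega), hfu, hfu, insT_insLast_lt hk, hA, laurentAct_single]
  have hpow : ∀ k < Multiset.card ρ, ∀ n (f : InsFun ν 𝕜 (ℤ →₀ N)),
      dot 𝕜 C ρ k ^ n • f = (insX (fun k => A (dot 𝕜 C ν k)) (laurentShift 𝕜 N 1) k ^ n) f := by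
    intro k hk n f
    rw [hact, map_pow, HR.lift_dot 𝕜 hk]
  have hcross : ¬C.IsReal i → ∀ (k : ℕ) (s : Seq ν) (u : N), k + 1 = Multiset.card ν →
      s.1[k]? = some i → gen 𝕜 C (.e s) • u = u → cross 𝕜 C ρ k • f u = 0 := by
    intro hi k s u hk hs hu
    rw [hT k (by omega), hfu]
    refine insT_insLast_eq_zero H hi hk hs ?_
    rw [hA, laurentAct_single, hu]
  refine Exists.elim (exists_extension_of_quotient hρ hf (Z := Z) (fun u => ?_) (fun k => ?_) ?_)
    fun E hE' => ⟨E, fun hi k s u hk hs hu => hE' k u (hcross hi k s u hk hs hu)⟩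
  · rw [hX _ (by omega), hZ, hfu, insX_insLast_self, insZ_insLast]
  · by_cases hk : k < Multiset.card ρ
    swap
    · exact ⟨1, fun y => by rw [dot_of_le 𝕜 (by omega)]; simp⟩
    -- Depending on the position of the new strand, the k-th dot acts as x_k, as z, or as x_{k-1}.
    -- The sum of the two exponents kills the first and the last of these; for z the equation holds
    -- with any exponent.
    refine ⟨c k + c (k - 1), fun y => ?_⟩
    rw [hpow k hk, hpow k hk, hZ]
    refine InsFun.ext fun j hj => ?_
    rw [insZ_apply, insX_pow_apply, insX_pow_apply, pow_succ', Module.End.mul_apply]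
    have key : ∀ l n, c l ≤ n → ∀ g : ℤ →₀ N, (A (dot 𝕜 C ν l) ^ n) g = 0 := by
      intro l n hn g
      obtain ⟨r, rfl⟩ := Nat.exists_eq_add_of_le hn
      rw [← map_pow, add_comm, pow_add, map_mul, Module.End.mul_apply]
      have : A (dot 𝕜 C ν l ^ c l) = 0 := Finsupp.lhom_ext fun p u => by
        rw [hA, laurentAct_single, hc, Finsupp.single_zero, LinearMap.zero_apply]
      rw [this, LinearMap.zero_apply, map_zero]
    rw [insDot]
    split_ifs
    · rw [key k _ (by omega), map_zero, map_zero]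
    · rfl
    · rw [key (k - 1) _ (by omega), map_zero, map_zero]
  -- The filtration is by order in z in every position. The inverses of x_k - z have bounded pole
  -- order, so each crossing lowers it boundedly, and z raises it by one.
  · let G : ℤ → Submodule 𝕜 (InsFun ν 𝕜 (ℤ →₀ N)) := fun p =>
      { carrier := {f | ∀ j, f.1 j ∈ laurentGE 𝕜 N p}
        zero_mem' := fun j => zero_mem _
        add_mem' := fun ha hb j => add_mem (ha j) (hb j)
        smul_mem' := fun a f hf j => Submodule.smul_mem _ a (hf j) }
    -- All power series exponents ≥ 0 are allowed at the last position, so that U is stable under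
    -- the new dot, which acts as z.
    let U : Submodule 𝕜 (InsFun ν 𝕜 (ℤ →₀ N)) := (laurentGE 𝕜 N 0).map (insLast ν 𝕜)
    have hU : StableBelow C ρ (Multiset.card ν) U := by
      refine ⟨?_, ?_, ?_⟩
      · rintro τ _ ⟨g, hg, rfl⟩
        rw [hE]
        by_cases hτ : ∃ s : Seq ν, s.extend hρ = τ
        · obtain ⟨s, rfl⟩ := hτ
          rw [insE_insLast H.rel hρ]
          exact ⟨_, laurentAct_mem _ hg, rfl⟩
        · rw [insE_insLast_eq_zero]
          · exact zero_mem _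
          · intro s hs
            refine hτ ⟨s, Subtype.ext ?_⟩
            rw [hs, ← s.length_eq, List.insertIdx_length_self]
            rfl
      · rintro k _ ⟨g, hg, rfl⟩
        by_cases h1 : k < Multiset.card ν
        · rw [hX k (by omega), insX_insLast_lt h1]
          exact ⟨_, laurentAct_mem _ hg, rfl⟩
        by_cases h2 : k = Multiset.card ν
        · rw [hX k (by omega), h2, insX_insLast_self]
          exact ⟨_, laurentGE_anti (by omega) (laurentShift_mem 1 hg), rfl⟩
        · rw [dot_of_le 𝕜 (by omega), zero_smul]
          exact zero_mem _
      · rintro k hk _ ⟨g, hg, rfl⟩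
        rw [hT k (by omega), insT_insLast_lt hk]
        exact ⟨_, laurentAct_mem _ hg, rfl⟩
    refine not_le_map_of_filtration (G := G) (U := U) (q := Multiset.card ν) (p := 1) ?_ ?_ ?_ ?_
      hcard.symm hU ?_ ?_ ?_
    · exact fun p q hpq g hg j => laurentGE_anti hpq (hg j)
    · intro g hg
      exact InsFun.ext fun j _ => eq_zero_of_mem_laurentGE fun p => hg p j
    · intro k
      by_cases hk : k + 1 < Multiset.card ρ
      swap
      · exact ⟨0, fun p g _ => by rw [cross_of_le (by omega), zero_smul]; exact zero_mem _⟩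
      have cD : LowersBoundedly (stay C i (fun s => A (gen 𝕜 C (.e s))) d k) := by
        refine lowersBoundedly_diag fun a => ?_
        rw [stayCoeff]
        split_ifs
        exacts [lowersBoundedly_laurentD k, LowersBoundedly.zero]
      have cL : LowersBoundedly (moveLeft C i (fun s => A (gen 𝕜 C (.e s))) k) := by
        refine lowersBoundedly_diag fun a => ?_
        rw [leftCoeff]
        split_ifs
        exacts [LowersBoundedly.zero, LowersBoundedly.one]
      have cG : LowersBoundedly (moveRight C i (fun s => A (gen 𝕜 C (.e s)))
          (fun k => A (dot 𝕜 C ν k)) (laurentShift 𝕜 N 1) d k) := by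
        refine lowersBoundedly_diag fun a => ?_
        cases a with
        | none => exact LowersBoundedly.zero
        | some a =>
          rw [rightCoeff]
          split_ifs
          · exact ((lowersBoundedly_laurentD k).mul (lowersBoundedly_laurentD k)).neg
          · exact LowersBoundedly.one
          · exact LowersBoundedly.one
          · exact ((lowersBoundedly_laurentAct _).pow _).add ((LowersBoundedly.shift _).pow _)
      obtain ⟨bD, hD⟩ := cD
      obtain ⟨bL, hL⟩ := cL
      obtain ⟨bG, hG⟩ := cG
      refine ⟨bD + bL + bG, fun p g hg j => ?_⟩
      rw [hT k hk]
      change insCross C i _ _ _ _ _ k j g.1 ∈ _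
      rw [insCross]
      split_ifs with h1 h2 h3
      · exact laurentGE_anti (by push_cast; omega) (laurentAct_mem _ (hg j))
      · exact sub_mem (laurentGE_anti (by push_cast; omega) (hL p _ (hg (k + 1))))
          (laurentGE_anti (by push_cast; omega) (hD p _ (hg k)))
      · exact add_mem (laurentGE_anti (by push_cast; omega) (hG p _ (hg k)))
          (laurentGE_anti (by push_cast; omega) (hD p _ (hg (k + 1))))
      · exact laurentGE_anti (by push_cast; omega) (laurentAct_mem _ (hg j))
    · exact fun p g hg j => laurentShift_mem 1 (hg j)
    · rintro _ ⟨g, hg, rfl⟩ j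
      by_cases hj : j = Multiset.card ν
      · rw [hj, insLast_self]; exact hg
      · rw [insLast_of_ne hj]; exact zero_mem _
    · refine Submodule.span_mono ?_
      rintro _ ⟨u, rfl⟩
      exact ⟨Finsupp.single 0 u, Finsupp.single_mem_supported 𝕜 u (Set.mem_Ici.2 le_rfl), rfl⟩
    -- The generated submodule is nonzero because a vector of N is recovered from its image as the
    -- coefficient of z⁰ at the last position.
    · intro h
      obtain ⟨u, hu⟩ := exists_ne (0 : N)
      have h1 : f u = 0 := by
        have : f u ∈ Submodule.span (KLRAlgebra 𝕜 C ρ) (Set.range f) :=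
          Submodule.subset_span ⟨u, rfl⟩
        rwa [h, Submodule.mem_bot] at this
      have h2 := congrArg (fun g => (g.1 (Multiset.card ν)) 0) h1
      rw [hfu] at h2
      simp only [insLast_self, Finsupp.single_eq_same] at h2
      exact hu h2

end AddStrand

/-! ### Composing strand homomorphisms. -/

section Composition

universe v w

variable {I : Type v} {κ ν ρ : Multiset I} {𝕜 : Type*} [Field 𝕜] {C : BorcherdsCartan I} {i : I}
variable {K : Type*} [AddCommGroup K] [Module 𝕜 K] [Module (KLRAlgebra 𝕜 C κ) K]
variable {N : Type*} [AddCommGroup N] [Module 𝕜 N] [Module (KLRAlgebra 𝕜 C ν) N]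
variable {M : Type*} [AddCommGroup M] [Module 𝕜 M] [Module (KLRAlgebra 𝕜 C ρ) M]
variable {n m : ℕ} {h₁ : κ + Multiset.replicate n i = ν} {h₂ : ν + Multiset.replicate m i = ρ}
variable {ι₁ : K →ₗ[𝕜] N} {ι₂ : N →ₗ[𝕜] M}

theorem Seq.extend_extend (h₁ : κ + Multiset.replicate n i = ν)
    (h₂ : ν + Multiset.replicate m i = ρ) (h₃ : κ + Multiset.replicate (n + m) i = ρ)
    (s : Seq κ) : (s.extend h₁).extend h₂ = s.extend h₃ := by
  refine Subtype.ext ?_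
  change (s.1 ++ List.replicate n i) ++ List.replicate m i = s.1 ++ List.replicate (n + m) i
  rw [List.append_assoc, List.replicate_append_replicate]

theorem IsStrandHom.comp (H₂ : IsStrandHom C h₂ ι₂) (H₁ : IsStrandHom C h₁ ι₁)
    (h₃ : κ + Multiset.replicate (n + m) i = ρ) : IsStrandHom C h₃ (ι₂.comp ι₁) := by
  have hc := card_add_eq h₁
  refine ⟨fun s u => ?_, fun k hk u => ?_, fun k hk u => ?_⟩
  · rw [LinearMap.comp_apply, LinearMap.comp_apply, H₁.e, H₂.e, Seq.extend_extend h₁ h₂ h₃]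
  · rw [LinearMap.comp_apply, LinearMap.comp_apply, H₁.dot k hk, H₂.dot k (by omega)]
  · rw [LinearMap.comp_apply, LinearMap.comp_apply, H₁.cross k hk, H₂.cross k (by omega)]

variable [IsScalarTower 𝕜 (KLRAlgebra 𝕜 C ν) N] [IsScalarTower 𝕜 (KLRAlgebra 𝕜 C ρ) M]

theorem span_comp_eq_top (H₂ : IsStrandHom C h₂ ι₂)
    (h : Submodule.span (KLRAlgebra 𝕜 C ν) (Set.range ι₁) = ⊤)
    (h' : Submodule.span (KLRAlgebra 𝕜 C ρ) (Set.range ι₂) = ⊤) :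
    Submodule.span (KLRAlgebra 𝕜 C ρ) (Set.range (ι₂.comp ι₁)) = ⊤ := by
  rw [eq_top_iff, ← h', Submodule.span_le]
  rintro _ ⟨u, rfl⟩
  have hu : u ∈ Submodule.span (KLRAlgebra 𝕜 C ν) (Set.range ι₁) := h ▸ Submodule.mem_top
  induction hu using Submodule.span_induction with
  | mem u hu =>
    obtain ⟨w, rfl⟩ := hu
    exact Submodule.subset_span ⟨w, rfl⟩
  | zero => rw [map_zero]; exact zero_mem _
  | add a b _ _ ha hb => rw [map_add]; exact add_mem ha hb
  | smul a b _ hb =>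
    rw [H₂.map_smul_eq]
    exact Submodule.smul_mem _ _ hb

/-- Dots on the strands added first pass through the second map and are killed by the first; the
remaining ones are killed by the second. -/
theorem IsVacuumHom.comp (H₂ : IsVacuumHom C h₂ ι₂) (H₁ : IsVacuumHom C h₁ ι₁)
    (h₃ : κ + Multiset.replicate (n + m) i = ρ) : IsVacuumHom C h₃ (ι₂.comp ι₁) where
  toIsStrandHom := H₂.toIsStrandHom.comp H₁.toIsStrandHom h₃
  dot_eq_zero k hk u := by
    rw [LinearMap.comp_apply]
    by_cases h : k < Multiset.card ν
    · rw [← H₂.dot k h, H₁.dot_eq_zero k hk, map_zero]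
    · exact H₂.dot_eq_zero k (by omega) _
  span_eq_top := span_comp_eq_top H₂.toIsStrandHom H₁.span_eq_top H₂.span_eq_top

end Composition

/-! ### Induced modules are nonzero. -/

section Nonvanishing

universe v w

variable {I : Type v} {ν ρ : Multiset I} {𝕜 : Type*} [Field 𝕜] {C : BorcherdsCartan I} {i : I}

/-- Strands are added one at a time by `exists_extension_one`; nilpotency of the dots is carried
along because the next step needs it. -/
theorem exists_extension {N : Type w} [AddCommGroup N] [Module 𝕜 N]
    [Module (KLRAlgebra 𝕜 C ν) N] [IsScalarTower 𝕜 (KLRAlgebra 𝕜 C ν) N] [Nontrivial N]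
    (hn : ∀ k, ∃ c, ∀ u : N, dot 𝕜 C ν k ^ c • u = 0) {n : ℕ}
    (hρ : ν + Multiset.replicate n i = ρ) : ∃ E : Extension 𝕜 C hρ N,
      ¬C.IsReal i → ∀ k, Multiset.card ν ≤ k → ∀ u, cross 𝕜 C ρ k • E.hom u = 0 := by
  induction n generalizing ρ with
  | zero =>
    obtain rfl : ν = ρ := by simpa using hρ
    refine ⟨{ carrier := N, nilpotent := hn, hom := LinearMap.id, isVacuumHom :=
      ⟨⟨fun s u => ?_, fun _ _ _ => rfl, fun _ _ _ => rfl⟩, fun k hk u => ?_, ?_⟩ },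
      fun _ k hk u => ?_⟩
    · have : s.extend hρ = s := Subtype.ext (List.append_nil s.1)
      rw [this]
      rfl
    · rw [dot_of_le 𝕜 hk, zero_smul]
    · refine eq_top_iff.2 fun u _ => Submodule.subset_span ⟨u, rfl⟩
    · rw [cross_of_le (by omega), zero_smul]
  | succ n ih =>
    obtain ⟨E, hE⟩ := ih (ρ := ν + Multiset.replicate n i) rfl
    have h₂ : ν + Multiset.replicate n i + Multiset.replicate 1 i = ρ := by
      rw [add_assoc, ← Multiset.replicate_add, hρ]
    obtain ⟨E', hE'⟩ := exists_extension_one (N := E.carrier) E.nilpotent h₂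
    have hc := card_add_eq (rfl : ν + Multiset.replicate n i = _)
    have hc' := card_add_eq h₂
    refine ⟨{ carrier := E'.carrier, nilpotent := E'.nilpotent, hom := E'.hom.comp E.hom,
              isVacuumHom := E'.isVacuumHom.comp E.isVacuumHom hρ }, fun hi k hk u => ?_⟩
    change cross 𝕜 C ρ k • E'.hom (E.hom u) = 0
    by_cases h : k + 1 < Multiset.card (ν + Multiset.replicate n i)
    · rw [← E'.isVacuumHom.cross k h, hE hi k hk, map_zero]
    by_cases h' : k + 1 = Multiset.card (ν + Multiset.replicate n i)
    -- The only new crossing is that of the last two strands. On each weight the penultimate strand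
    -- belongs to the tail and has label i, which is the situation of the last clause of
    -- `exists_extension_one`.
    · rw [← sum_e_smul 𝕜 C (ρ := ν + Multiset.replicate n i) (E.hom u), map_sum, Finset.smul_sum]
      refine Finset.sum_eq_zero fun s _ => ?_
      by_cases hs : Tail i (Multiset.card ν) s
      · refine hE' hi k s _ h' ?_ (e_smul_e_smul s _)
        rw [getElem?_eq_entry s (by omega), hs k (by omega) hk]
      · rw [E.isVacuumHom.mem_onTail u s hs, map_zero, smul_zero]
    · rw [cross_of_le (by omega), zero_smul]

/-- Only finitely many degrees of a finite-dimensional graded module are nonzero. -/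
theorem exists_deg_bound {A : Type*} [Ring A] [Algebra 𝕜 A] {𝒜 : ℤ → Submodule 𝕜 A}
    (M : GrMod 𝒜) [Module.Finite 𝕜 M] : ∃ b : ℕ, ∀ p, M.deg p ≠ ⊥ → -(b : ℤ) ≤ p ∧ p ≤ b := by
  have h : iSupIndep M.deg := (Decomposition.isInternal M.deg).submodule_iSupIndep
  have hf : {p | M.deg p ≠ ⊥}.Finite := WellFoundedGT.finite_ne_bot_of_iSupIndep h
  refine ⟨∑ p ∈ hf.toFinset, p.natAbs, fun p hp => ?_⟩
  have := Finset.single_le_sum (f := fun p : ℤ => p.natAbs) (fun _ _ => Nat.zero_le _)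
    (hf.mem_toFinset.2 hp)
  omega

/-- Dots are nilpotent on finite-dimensional graded modules. -/
theorem exists_dot_pow_smul_eq_zero (M : KLRMod.{v, w} 𝕜 C ρ) [Module.Finite 𝕜 M] :
    ∃ c, ∀ k, ∀ u : M, dot 𝕜 C ρ k ^ c • u = 0 := by
  obtain ⟨b, hb⟩ := exists_deg_bound M
  -- Filtration by degree at least p. Dots raise the degree by 2 r > 0, but by an amount depending
  -- on the label, so a filtration is used and not a single degree.
  let F : ℤ → Submodule 𝕜 M := fun p => ⨆ q : {q : ℤ // p ≤ q}, M.deg q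
  have hF : ∀ {p q : ℤ}, p ≤ q → M.deg q ≤ F p := fun {p q} h =>
    le_iSup (fun q : {q : ℤ // p ≤ q} => M.deg q) ⟨q, h⟩
  have hdot : ∀ k p, F p ≤ (F (p + 1)).comap (Algebra.lsmul 𝕜 𝕜 M (dot 𝕜 C ρ k)) := by
    intro k p
    refine iSup_le fun ⟨q, hq⟩ u hu => ?_
    change dot 𝕜 C ρ k • u ∈ F (p + 1)
    rw [dot]
    split_ifs with hk
    · rw [Finset.sum_smul]
      refine Submodule.sum_mem _ fun s _ => hF ?_ (M.smul_mem_deg (gen_mem 𝕜 _) hu)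
      have := C.r_pos (s.entry k hk)
      change p + 1 ≤ 2 * (C.r (s.entry k hk) : ℤ) + q
      omega
    · rw [zero_smul]; exact zero_mem _
  have htop : ∀ u : M, u ∈ F (-b) := by
    intro u
    induction u using Decomposition.inductionOn M.deg with
    | zero => exact zero_mem _
    | add x y hx hy => exact add_mem hx hy
    | @homogeneous p m =>
      by_cases hm : M.deg p = ⊥
      · have : (m : M) = 0 := (Submodule.mem_bot 𝕜).1 (hm ▸ m.2)
        rw [this]; exact zero_mem _
      · exact hF (hb p hm).1 m.2
  have hbot : F (b + 1) = ⊥ := by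
    refine iSup_eq_bot.2 fun ⟨q, hq⟩ => ?_
    by_contra h
    have := (hb q h).2
    omega
  have key : ∀ k (c : ℕ) (u : M), dot 𝕜 C ρ k ^ c • u ∈ F (-b + c) := by
    intro k c u
    induction c with
    | zero => simpa using htop u
    | succ c ih =>
      rw [pow_succ', mul_smul]
      have := hdot k _ ih
      rwa [add_assoc] at this
  -- The degrees lie between -b and b, so 2 b + 1 dots lead beyond them.
  refine ⟨2 * b + 1, fun k u => ?_⟩
  have := key k (2 * b + 1) u
  rw [show -(b : ℤ) + (2 * b + 1 : ℕ) = b + 1 by push_cast; ring, hbot] at this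
  exact (Submodule.mem_bot 𝕜).1 this

/-- Frobenius reciprocity gives a homomorphism from the induced module to a nonzero module generated
by the images of the vectors 1 ⊗ (u ⊗ vac). -/
theorem nontrivial_ind {n : ℕ} (hρ : ν + Multiset.replicate n i = ρ) (N : KLRMod.{v, w} 𝕜 C ν)
    [Module.Finite 𝕜 N] [Nontrivial N] : Nontrivial (Ind hρ (N.tensor (V 𝕜 C i n))) := by
  obtain ⟨c, hc⟩ := exists_dot_pow_smul_eq_zero N
  obtain ⟨E, hE⟩ := exists_extension (N := N) (fun k => ⟨c, hc k⟩) hρ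
  obtain ⟨Φ, hΦ⟩ := exists_vacMap_lift hρ N E.isVacuumHom.toIsStrandHom
    E.isVacuumHom.dot_eq_zero hE
  by_contra h
  rw [not_nontrivial_iff_subsingleton] at h
  have h0 : ∀ u, E.hom u = 0 := fun u => by
    rw [← hΦ, Subsingleton.elim (vacMap hρ N u) 0, map_zero]
  have : (⊤ : Submodule (KLRAlgebra 𝕜 C ρ) E.carrier) = ⊥ := by
    rw [← E.isVacuumHom.span_eq_top, Submodule.span_eq_bot]
    rintro _ ⟨u, rfl⟩
    exact h0 u
  exact top_ne_bot this

end Nonvanishing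

/-! ### Maps that shift degrees, graded heads and composition series. -/

namespace GrMod

section DegreeShift

variable {𝕜 A B : Type*} [Field 𝕜] [Ring A] [Algebra 𝕜 A] [Ring B] [Algebra 𝕜 B]
variable {𝒜 : ℤ → Submodule 𝕜 A} {ℬ : ℤ → Submodule 𝕜 B}

/-- Linear maps that shift degrees by `d`. -/
def DegreeShift (M : GrMod 𝒜) (L : GrMod ℬ) (f : M →ₗ[𝕜] L) (d : ℤ) : Prop :=
  ∀ x p, f (decompose M.deg x p) = (decompose L.deg (f x) (p + d) : L)

variable {M : GrMod 𝒜} {L : GrMod ℬ} {f : M →ₗ[𝕜] L} {d : ℤ}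

theorem degreeShift_of_mem (h : ∀ p, ∀ x ∈ M.deg p, f x ∈ L.deg (p + d)) :
    DegreeShift M L f d := by
  intro x p
  induction x using Decomposition.inductionOn M.deg with
  | zero => simp
  | add x y hx hy => simp [hx, hy]
  | @homogeneous q x =>
    by_cases hq : q = p
    · subst hq
      rw [decompose_of_mem_same _ x.2, decompose_of_mem_same _ (h q x x.2)]
    · rw [decompose_of_mem_ne _ x.2 hq, decompose_of_mem_ne _ (h q x x.2) (by omega), map_zero]

theorem DegreeShift.map_mem (H : DegreeShift M L f d) {p : ℤ} {x : M} (hx : x ∈ M.deg p) :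
    f x ∈ L.deg (p + d) := by
  have := H x p
  rw [decompose_of_mem_same _ hx] at this
  rw [this]
  exact SetLike.coe_mem _

end DegreeShift

variable {𝕜 A : Type*} [Field 𝕜] [Ring A] [Algebra 𝕜 A] {𝒜 : ℤ → Submodule 𝕜 A}
variable {M L : GrMod 𝒜} {d : ℤ}

/-- The projection to a quotient. -/
def proj (M : GrMod 𝒜) (X : Submodule A M) (hX : M.IsGraded X) : M →ₗ[A] M.quot X hX := X.mkQ

theorem proj_surjective (M : GrMod 𝒜) (X : Submodule A M) (hX : M.IsGraded X) :
    Function.Surjective (M.proj X hX) := X.mkQ_surjective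

theorem ker_proj (M : GrMod 𝒜) (X : Submodule A M) (hX : M.IsGraded X) :
    LinearMap.ker (M.proj X hX) = X := X.ker_mkQ

/-- The inclusion of a graded submodule. -/
def incl (M : GrMod 𝒜) (X : Submodule A M) (hX : M.IsGraded X) : M.sub X hX →ₗ[A] M := X.subtype

theorem incl_injective (M : GrMod 𝒜) (X : Submodule A M) (hX : M.IsGraded X) :
    Function.Injective (M.incl X hX) := X.subtype_injective

theorem range_incl (M : GrMod 𝒜) (X : Submodule A M) (hX : M.IsGraded X) :
    LinearMap.range (M.incl X hX) = X := X.range_subtype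

theorem inter_eq_comap (M : GrMod 𝒜) (X Y : Submodule A M) (hX : M.IsGraded X) :
    M.inter X Y hX = Y.comap (M.incl X hX) := rfl

theorem degreeShift_proj (M : GrMod 𝒜) (X : Submodule A M) (hX : M.IsGraded X) :
    DegreeShift M (M.quot X hX) ((M.proj X hX).restrictScalars 𝕜) 0 :=
  degreeShift_of_mem fun p x hx => by rw [add_zero]; exact ⟨x, hx, rfl⟩

theorem degreeShift_incl (M : GrMod 𝒜) (X : Submodule A M) (hX : M.IsGraded X) :
    DegreeShift (M.sub X hX) M ((M.incl X hX).restrictScalars 𝕜) 0 :=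
  degreeShift_of_mem fun p x hx => by rw [add_zero]; exact hx

theorem DegreeShift.isGraded_comap {Φ : M →ₗ[A] L} (H : DegreeShift M L (Φ.restrictScalars 𝕜) d)
    {X : Submodule A L} (hX : L.IsGraded X) : M.IsGraded (X.comap Φ) := by
  intro p x hx
  have : Φ (decompose M.deg x p) = (decompose L.deg (Φ x) (p + d) : L) := H x p
  rw [Submodule.mem_comap, this]
  exact hX _ hx

theorem DegreeShift.isGraded_map {Φ : M →ₗ[A] L} (H : DegreeShift M L (Φ.restrictScalars 𝕜) d)
    {X : Submodule A M} (hX : M.IsGraded X) : L.IsGraded (X.map Φ) := by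
  rintro p _ ⟨x, hx, rfl⟩
  have : Φ (decompose M.deg x (p - d)) = (decompose L.deg (Φ x) (p - d + d) : L) := H x (p - d)
  rw [sub_add_cancel] at this
  exact ⟨_, hX (p - d) hx, this⟩

theorem isGraded_bot (M : GrMod 𝒜) : M.IsGraded ⊥ := by
  intro p x hx
  rw [(Submodule.mem_bot A).1 hx]
  simp

theorem isGraded_top (M : GrMod 𝒜) : M.IsGraded ⊤ := fun _ _ _ => Submodule.mem_top

theorem isGraded_sSup (M : GrMod 𝒜) (S : Set (Submodule A M)) (hS : ∀ X ∈ S, M.IsGraded X) :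
    M.IsGraded (sSup S) := by
  intro p x hx
  rw [sSup_eq_iSup'] at hx ⊢
  induction hx using Submodule.iSup_induction' with
  | mem X x hx => exact Submodule.mem_iSup_of_mem X (hS X X.2 p hx)
  | zero => simp
  | add x y _ _ hx hy =>
    rw [decompose_add, DirectSum.add_apply, Submodule.coe_add]
    exact add_mem hx hy

/-- The homomorphism theorem for homomorphisms that shift degrees. -/
theorem exists_quot_equiv {Φ : M →ₗ[A] L} (H : DegreeShift M L (Φ.restrictScalars 𝕜) d)
    (hΦ : Function.Surjective Φ) {X : Submodule A M} (hX : M.IsGraded X)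
    (hker : LinearMap.ker Φ = X) :
    ∃ e : M.quot X hX ≃ₗ[A] L, ∀ n x, x ∈ (M.quot X hX).deg n ↔ e x ∈ L.deg (n + d) := by
  obtain ⟨e, he⟩ : ∃ e : M.quot X hX ≃ₗ[A] L, ∀ x, e (M.proj X hX x) = Φ x :=
    ⟨(Submodule.quotEquivOfEq X (LinearMap.ker Φ) hker.symm).trans
      (Φ.quotKerEquivOfSurjective hΦ), fun _ => rfl⟩
  refine ⟨e, fun n x => ?_⟩
  obtain ⟨x, rfl⟩ := M.proj_surjective X hX x
  rw [he]
  constructor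
  · rintro ⟨y, hy, hyx⟩
    have : Φ y = Φ x := by rw [← he, ← he]; exact congrArg e hyx
    rw [← this]
    exact H.map_mem hy
  · intro hx
    refine ⟨decompose M.deg x n, SetLike.coe_mem _, e.injective ?_⟩
    refine (he _).trans (Eq.trans ?_ (he x).symm)
    refine (H x n).trans ?_
    exact decompose_of_mem_same L.deg hx

theorem isIrreducible_quot {X : Submodule A M} (hX : M.IsGraded X) (hne : X ≠ ⊤)
    (hmax : ∀ Y, M.IsGraded Y → X ≤ Y → Y = X ∨ Y = ⊤) : (M.quot X hX).IsIrreducible := by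
  refine ⟨Submodule.Quotient.nontrivial_iff.2 hne, fun Y hY => ?_⟩
  have hg := (degreeShift_proj M X hX).isGraded_comap hY
  have hle : X ≤ Y.comap (M.proj X hX) := by
    conv_lhs => rw [← M.ker_proj X hX]
    exact Submodule.comap_mono bot_le
  have hmap := Submodule.map_comap_eq_of_surjective (M.proj_surjective X hX) Y
  obtain h | h := hmax _ hg hle
  · left
    rw [← hmap, h, eq_bot_iff, Submodule.map_le_iff_le_comap]
    exact (M.ker_proj X hX).ge
  · right
    rw [← hmap, h, Submodule.map_top, LinearMap.range_eq_top.2 (M.proj_surjective X hX)]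

theorem eq_or_eq_top_of_isIrreducible_quot {X : Submodule A M} (hX : M.IsGraded X)
    (h : (M.quot X hX).IsIrreducible) {Y : Submodule A M} (hY : M.IsGraded Y) (hXY : X ≤ Y) :
    Y = X ∨ Y = ⊤ := by
  have hcm : (Y.map (M.proj X hX)).comap (M.proj X hX) = Y := by
    rw [Submodule.comap_map_eq, M.ker_proj, sup_eq_left.2 hXY]
  obtain h | h := h.2 _ ((degreeShift_proj M X hX).isGraded_map hY)
  · left
    rw [← hcm, h]
    exact M.ker_proj X hX
  · right
    rw [← hcm, h, Submodule.comap_top]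

/-- A greatest proper graded submodule is the only maximal one, so the intersection defining the
radical has one member. -/
theorem radical_eq {S : Submodule A M} (hS : M.IsGraded S) (hne : S ≠ ⊤)
    (h : ∀ Z, M.IsGraded Z → Z ≠ ⊤ → Z ≤ S) : M.radical = S := by
  have : M.maximalGraded = {S} := by
    ext X
    constructor
    · intro hX
      replace hX : Maximal (fun Y => M.IsGraded Y ∧ Y ≠ ⊤) X := hX
      exact hX.eq_of_le ⟨hS, hne⟩ (h X hX.prop.1 hX.prop.2)
    · rintro rfl
      exact ⟨⟨hS, hne⟩, fun Y hY _ => h Y hY.1 hY.2⟩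
  rw [radical, this, sInf_singleton]

theorem isIrreducible_head {S : Submodule A M} (hS : M.IsGraded S) (hne : S ≠ ⊤)
    (h : ∀ Z, M.IsGraded Z → Z ≠ ⊤ → Z ≤ S) : M.head.IsIrreducible := by
  have hr := radical_eq hS hne h
  refine isIrreducible_quot M.isGraded_radical (hr ▸ hne) fun Y hY hle => ?_
  by_cases hY' : Y = ⊤
  · exact Or.inr hY'
  · exact Or.inl (le_antisymm (hr ▸ h Y hY hY') hle)

section CompositionSeries

theorem isIrreducible_subquot {X Y : Submodule A M} (hX : M.IsGraded X) (hY : M.IsGraded Y)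
    (hlt : Y < X) (hcov : ∀ Z, M.IsGraded Z → Y ≤ Z → Z ≤ X → Z = Y ∨ Z = X) :
    (M.subquot X Y hX hY).IsIrreducible := by
  have hinj := M.incl_injective X hX
  have hmap : ∀ Z ≤ X, (Z.comap (M.incl X hX)).map (M.incl X hX) = Z := fun Z hZ => by
    rw [Submodule.map_comap_eq, M.range_incl, inf_eq_right.2 hZ]
  refine isIrreducible_quot _ (fun h => hlt.ne ?_) fun Z hZ hle => ?_
  · rw [← hmap Y hlt.le, ← M.inter_eq_comap, h, Submodule.map_top, M.range_incl]
  · have hc := Submodule.comap_map_eq_of_injective hinj Z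
    have hle' : Z.map (M.incl X hX) ≤ X := by
      conv_rhs => rw [← M.range_incl X hX]
      exact LinearMap.map_le_range
    obtain h | h := hcov _ ((degreeShift_incl M X hX).isGraded_map hZ)
      (by rw [← hmap Y hlt.le]; exact Submodule.map_mono hle) hle'
    · exact Or.inl (by rw [← hc, h, M.inter_eq_comap])
    · refine Or.inr ?_
      rw [← hc, h, eq_top_iff]
      intro x _
      exact (M.range_incl X hX).le ⟨x, rfl⟩

/-- Finite-dimensional graded modules have graded composition series. -/
theorem nonempty_compositionSeries (M : GrMod 𝒜) [Module.Finite 𝕜 M] :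
    Nonempty M.CompositionSeries := by
  have : IsNoetherian A M := isNoetherian_of_tower 𝕜 inferInstance
  have : IsArtinian A M := isArtinian_of_tower 𝕜 inferInstance
  -- The chain is taken in the ordered set of graded submodules, which inherits both chain
  -- conditions from the finite-dimensional module.
  let G := {X : Submodule A M // M.IsGraded X}
  obtain ⟨a, h0, n, hn, hcov⟩ := exists_covBy_seq_of_wellFoundedLT_wellFoundedGT_of_le
    (α := G) (x := ⟨⊥, M.isGraded_bot⟩) (y := ⟨⊤, M.isGraded_top⟩)
    (Subtype.mk_le_mk.2 bot_le)
  refine ⟨{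
    length := n
    -- The terms beyond the length are set to the whole module so that the chain stays increasing.
    term := fun k => if k ≤ n then (a k).1 else ⊤
    isGraded := fun k => by
      split_ifs
      exacts [(a k).2, M.isGraded_top]
    term_zero := by rw [if_pos (Nat.zero_le n), h0]
    term_length := by rw [if_pos le_rfl, hn]
    le_succ := fun k => by
      split_ifs with h1 h2
      · exact (hcov k (by omega)).le
      · exact le_top
      · omega
      · exact le_rfl
    irreducible := fun k hk => by
      have h := hcov k hk
      refine isIrreducible_subquot _ _ ?_ ?_
      · rw [if_pos hk.le, if_pos (Nat.succ_le_of_lt hk)]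
        exact h.lt
      · rw [if_pos hk.le, if_pos (Nat.succ_le_of_lt hk)]
        intro Z hZ h1 h2
        obtain h' | h' := h.eq_or_eq (c := ⟨Z, hZ⟩) h1 h2
        · exact Or.inl (congrArg Subtype.val h')
        · exact Or.inr (congrArg Subtype.val h') }⟩

variable {S : Submodule A M} (hS : M.IsGraded S) (hne : S ≠ ⊤)
  (h : ∀ Z, M.IsGraded Z → Z ≠ ⊤ → Z ≤ S)

include hS hne h

/-- If the head is irreducible then it is the last factor of every composition series, and the
other factors are subquotients of the radical. -/
theorem CompositionSeries.exists_factor_iso_head (F : M.CompositionSeries) :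
    ∃ k < F.length, (F.factor k).Iso M.head ∧ ∀ l < F.length, l ≠ k → F.term (l + 1) ≤ S := by
  have hmono : Monotone F.term := monotone_nat_of_le_succ F.le_succ
  have hlen : F.length ≠ 0 := by
    intro h0
    have h1 := F.term_length
    rw [h0, F.term_zero] at h1
    exact hne (eq_top_iff.2 (h1 ▸ bot_le))
  obtain ⟨k, hk⟩ := Nat.exists_eq_succ_of_ne_zero hlen
  have hirr : ((M.sub _ (F.isGraded (k + 1))).quot (M.inter _ (F.term k) (F.isGraded (k + 1)))
      (M.inter_isGraded _ _ _ (F.isGraded k))).IsIrreducible := F.irreducible k (by omega)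
  have htop : F.term (k + 1) = ⊤ := by rw [← Nat.succ_eq_add_one, ← hk, F.term_length]
  have hktop : F.term k ≠ ⊤ := by
    intro hk'
    have := hirr.1
    obtain ⟨y, hy⟩ := exists_ne (0 : (M.sub _ (F.isGraded (k + 1))).quot
      (M.inter _ (F.term k) (F.isGraded (k + 1))) (M.inter_isGraded _ _ _ (F.isGraded k)))
    obtain ⟨x, rfl⟩ := GrMod.proj_surjective _ _ (M.inter_isGraded _ _ (F.isGraded _) (F.isGraded _)) y
    refine hy (LinearMap.mem_ker.1 ?_)
    rw [GrMod.ker_proj, M.inter_eq_comap, hk', Submodule.comap_top]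
    exact Submodule.mem_top
  have hmap : ∀ Y : Submodule A M, (Y.comap (M.incl _ (F.isGraded (k + 1)))).map (M.incl _ _) = Y :=
    fun Y => by rw [Submodule.map_comap_eq, M.range_incl, htop, top_inf_eq]
  -- The last proper term lies in S, and irreducibility of the last factor leaves no graded
  -- submodule strictly between it and the whole module.
  have hkS : F.term k = S := by
    have hle := h _ (F.isGraded k) hktop
    have hg := (degreeShift_incl M _ (F.isGraded (k + 1))).isGraded_comap hS
    obtain h1 | h1 := eq_or_eq_top_of_isIrreducible_quot _ hirr hg (Submodule.comap_mono hle)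
    · rw [← hmap S, h1, M.inter_eq_comap, hmap]
    · refine absurd ?_ hne
      rw [← hmap S, h1, Submodule.map_top, M.range_incl, htop]
  refine ⟨k, by omega, ?_, fun l hl hlk => hkS ▸ hmono (by omega)⟩
  have hrad := radical_eq hS hne h
  obtain ⟨e, he⟩ := exists_quot_equiv (M := M.sub _ (F.isGraded (k + 1))) (L := M.head)
    (Φ := (M.proj M.radical M.isGraded_radical).comp (M.incl _ (F.isGraded (k + 1))))
    (d := 0) (degreeShift_of_mem fun p x hx => by rw [add_zero]; exact ⟨x.1, hx, rfl⟩)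
    (fun y => by
      obtain ⟨x, rfl⟩ := M.proj_surjective _ M.isGraded_radical y
      have hx : x ∈ LinearMap.range (M.incl _ (F.isGraded (k + 1))) := by
        rw [M.range_incl, htop]; exact Submodule.mem_top
      obtain ⟨x, rfl⟩ := hx
      exact ⟨x, rfl⟩)
    (M.inter_isGraded _ (F.term k) (F.isGraded _) (F.isGraded _)) (by
      refine (LinearMap.ker_comp (M.incl _ (F.isGraded (k + 1)))
        (M.proj M.radical M.isGraded_radical)).trans ?_
      rw [M.ker_proj, hrad, hkS, M.inter_eq_comap])
  refine ⟨e, fun n x => (he n x).trans ?_⟩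
  rw [add_zero]
  exact Iff.rfl

end CompositionSeries

end GrMod

/-! ### The number ε_i in terms of idempotents. -/

section Eps

universe v w

variable {I : Type v} {κ ρ : Multiset I} {𝕜 : Type*} [Field 𝕜] {C : BorcherdsCartan I} {i : I}
variable {M : KLRMod.{v, w} 𝕜 C ρ} {n : ℕ}

/-- The idempotent 1_{κ,ni} is the sum of the orthogonal idempotents of the sequences with tail i,
…, i from |κ| on. -/
theorem nontrivial_res_iff (h : κ + Multiset.replicate n i = ρ) :
    Nontrivial (Res h M) ↔
      ∃ t : Seq ρ, Tail i (Multiset.card κ) t ∧ ∃ u : M, gen 𝕜 C (.e t) • u ≠ 0 := by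
  have hres : Nontrivial (Res h M) ↔ ∃ u : M, oneTensorOne 𝕜 C h • u ≠ 0 := by
    rw [show Nontrivial (Res h M) ↔
      Nontrivial (LinearMap.range (Algebra.lsmul 𝕜 𝕜 M (juxtapose 𝕜 C h 1))) from Iff.rfl,
      Submodule.nontrivial_iff_ne_bot, Ne, LinearMap.range_eq_bot, juxtapose_one, LinearMap.ext_iff,
      not_forall]
    rfl
  rw [hres]
  constructor
  · rintro ⟨u, hu⟩
    rw [oneTensorOne_eq_sum, Finset.sum_smul] at hu
    obtain ⟨s, -, hs⟩ := Finset.exists_ne_zero_of_sum_ne_zero hu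
    exact ⟨_, tail_extend h s, u, hs⟩
  · rintro ⟨t, ht, u, hu⟩
    obtain ⟨s, rfl⟩ := exists_extend_of_tail h ht
    refine ⟨u, fun h0 => hu ?_⟩
    rw [← gen_e_mul_oneTensorOne, mul_smul, h0, smul_zero]

theorem le_eps {q : ℕ} (hq : q + n = Multiset.card ρ) {t : Seq ρ} (ht : Tail i q t) {u : M}
    (hu : gen 𝕜 C (.e t) • u ≠ 0) : n ≤ eps i M := by
  have hlen := t.length_eq
  -- The supremum in ℕ is meaningful only for a bounded set; the number of strands is a bound.
  refine le_csSup ⟨Multiset.card ρ, ?_⟩ ⟨(t.1.take q : List I), ?_, ?_⟩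
  · rintro m ⟨κ, h, -⟩
    have := card_add_eq h
    omega
  · have h1 : t.1.drop q = List.replicate n i := by
      refine List.ext_getElem? fun r => ?_
      rw [List.getElem?_drop, List.getElem?_replicate]
      split_ifs with hr
      · rw [← Seq.entry_eq_iff t _ (by omega)]
        exact ht _ _ (by omega)
      · exact List.getElem?_eq_none (by omega)
    rw [← Multiset.coe_replicate, Multiset.coe_add, ← h1, List.take_append_drop, t.2]
  · refine (nontrivial_res_iff _).2 ⟨t, ?_, u, hu⟩
    rwa [Multiset.coe_card, List.length_take, min_eq_left (by omega)]

/-- The set defining ε_i is bounded and contains 0 for a nonzero module, so its supremum is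
attained. -/
theorem exists_tail_eps [Nontrivial M] : ∃ q, q + eps i M = Multiset.card ρ ∧
    ∃ t : Seq ρ, Tail i q t ∧ ∃ u : M, gen 𝕜 C (.e t) • u ≠ 0 := by
  have hne : {n | ∃ (κ : Multiset I) (h : κ + Multiset.replicate n i = ρ),
      Nontrivial (Res h M)}.Nonempty := by
    refine ⟨0, ρ, by simp, (nontrivial_res_iff _).2 ?_⟩
    obtain ⟨u, hu⟩ := exists_ne (0 : M)
    rw [← sum_e_smul 𝕜 C (ρ := ρ) u] at hu
    obtain ⟨s, -, hs⟩ := Finset.exists_ne_zero_of_sum_ne_zero hu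
    exact ⟨s, fun r hr hr' => by omega, u, hs⟩
  obtain ⟨κ, h, hnt⟩ := Nat.sSup_mem hne ⟨Multiset.card ρ, by
    rintro m ⟨κ, h, -⟩
    have := card_add_eq h
    omega⟩
  exact ⟨Multiset.card κ, card_add_eq h, (nontrivial_res_iff h).1 hnt⟩

theorem eps_lt [Nontrivial M] {q : ℕ} (hq : q + n = Multiset.card ρ)
    (h : ∀ t : Seq ρ, Tail i q t → ∀ u : M, gen 𝕜 C (.e t) • u = 0) : eps i M < n := by
  obtain ⟨q', hq', t, ht, u, hu⟩ := exists_tail_eps (i := i) (M := M)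
  by_contra hlt
  exact hu (h t (ht.mono (by omega)) u)

theorem eps_eq {q : ℕ} (hq : q + n = Multiset.card ρ) {t : Seq ρ} (ht : Tail i q t) {u : M}
    (hu : gen 𝕜 C (.e t) • u ≠ 0)
    (h : ∀ q' < q, ∀ t : Seq ρ, Tail i q' t → ∀ u : M, gen 𝕜 C (.e t) • u = 0) :
    eps i M = n := by
  have : Nontrivial M := ⟨_, _, hu⟩
  refine le_antisymm ?_ (le_eps hq ht hu)
  obtain ⟨q', hq', t', ht', u', hu'⟩ := exists_tail_eps (i := i) (M := M)
  by_contra hlt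
  exact hu' (h q' (by omega) t' ht' u')

theorem e_smul_eq_zero_of_eps_lt {q : ℕ} (hq : q + n = Multiset.card ρ) (h : eps i M < n)
    {t : Seq ρ} (ht : Tail i q t) (u : M) : gen 𝕜 C (.e t) • u = 0 := by
  by_contra hu
  exact absurd (le_eps hq ht hu) (by omega)

end Eps

/-! ### The space of vectors on the tail and the images of its crossings. -/

section TailSpace

universe v

variable {I : Type v} {ρ : Multiset I} {𝕜 : Type*} [Field 𝕜] {C : BorcherdsCartan I} {i : I}
variable {M : Type*} [AddCommGroup M] [Module 𝕜 M] [Module (KLRAlgebra 𝕜 C ρ) M]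
variable [IsScalarTower 𝕜 (KLRAlgebra 𝕜 C ρ) M] {q : ℕ}

theorem e_smul_mem_onTail {t : Seq ρ} (ht : Tail i q t) (u : M) :
    gen 𝕜 C (.e t) • u ∈ OnTail 𝕜 C ρ i q := by
  intro s hs
  refine e_smul_e_smul_of_ne ?_ u
  rintro rfl
  exact hs ht

theorem mem_of_onTail {W : Submodule 𝕜 M} {u : M} (hu : u ∈ OnTail 𝕜 C ρ i q)
    (h : ∀ t : Seq ρ, Tail i q t → gen 𝕜 C (.e t) • u ∈ W) : u ∈ W := by
  rw [← sum_e_smul 𝕜 C (ρ := ρ) u]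
  refine Submodule.sum_mem _ fun t _ => ?_
  by_cases ht : Tail i q t
  · exact h t ht
  · rw [hu t ht]; exact zero_mem _

variable (ρ 𝕜 C M) in
theorem stableBelow_onTail (hq : q ≤ Multiset.card ρ) :
    StableBelow C ρ q (OnTail 𝕜 (M := M) C ρ i q) where
  e_mem t u hu := by
    by_cases ht : Tail i q t
    · exact e_smul_mem_onTail ht u
    · rw [hu t ht]; exact zero_mem _
  dot_mem k u hu := dot_smul_mem_onTail hu k
  cross_mem k hk u hu t ht := by
    rw [e_smul_cross_smul, hu, smul_zero]
    rwa [tail_swap_iff hk (by omega)]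

/-- The span of the images of the crossings on the tail. -/
def crossImage (𝕜 : Type*) [Field 𝕜] (C : BorcherdsCartan I) (ρ : Multiset I) (M : Type*)
    [AddCommGroup M] [Module 𝕜 M] [Module (KLRAlgebra 𝕜 C ρ) M]
    [IsScalarTower 𝕜 (KLRAlgebra 𝕜 C ρ) M] (i : I) (q : ℕ) : Submodule 𝕜 M :=
  Submodule.span 𝕜 {x | ∃ k, q ≤ k ∧ ∃ u ∈ OnTail 𝕜 (M := M) C ρ i q, cross 𝕜 C ρ k • u = x}

theorem cross_smul_mem_crossImage {k : ℕ} (hk : q ≤ k) {u : M} (hu : u ∈ OnTail 𝕜 C ρ i q) :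
    cross 𝕜 C ρ k • u ∈ crossImage 𝕜 C ρ M i q :=
  Submodule.subset_span ⟨k, hk, u, hu, rfl⟩

theorem crossImage_le_onTail : crossImage 𝕜 C ρ M i q ≤ OnTail 𝕜 C ρ i q := by
  refine Submodule.span_le.2 ?_
  rintro _ ⟨k, hk, u, hu, rfl⟩
  exact cross_smul_mem_onTail hu hk

theorem smul_mem_of_crossImage {W : Submodule 𝕜 M} {a : KLRAlgebra 𝕜 C ρ}
    (h : ∀ k, q ≤ k → ∀ u ∈ OnTail 𝕜 C ρ i q, a • cross 𝕜 C ρ k • u ∈ W) {x : M}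
    (hx : x ∈ crossImage 𝕜 C ρ M i q) : a • x ∈ W := by
  have : crossImage 𝕜 C ρ M i q ≤ W.comap (Algebra.lsmul 𝕜 𝕜 M a) := by
    refine Submodule.span_le.2 ?_
    rintro _ ⟨k, hk, u, hu, rfl⟩
    exact h k hk u hu
  exact this hx

-- For imaginary i dots slide through the crossings of the tail without error, so the images of
-- these crossings are stable under dots. For real i the constant term of the slide would spoil
-- this.
variable (ρ 𝕜 C M) in
theorem stableBelow_crossImage (hi : ¬C.IsReal i) (hq : q ≤ Multiset.card ρ) :
    StableBelow C ρ q (crossImage 𝕜 C ρ M i q) where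
  e_mem t _ hx := smul_mem_of_crossImage (fun k hk u hu => by
    rw [e_smul_cross_smul]
    exact cross_smul_mem_crossImage hk ((stableBelow_onTail ρ 𝕜 C M hq).e_mem _ u hu)) hx
  dot_mem l _ hx := smul_mem_of_crossImage (fun k hk u hu => by
    obtain ⟨l', -, h⟩ := dot_smul_cross_smul_of_not_isReal hi hu hk l
    rw [h]
    exact cross_smul_mem_crossImage hk (dot_smul_mem_onTail hu l')) hx
  cross_mem j hj _ hx := smul_mem_of_crossImage (fun k hk u hu => by
    rw [← cross_smul_cross_smul (by omega)]
    exact cross_smul_mem_crossImage hk ((stableBelow_onTail ρ 𝕜 C M hq).cross_mem j hj u hu)) hx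

/-- The images of the crossings on the tail do not span a nonzero tail space. -/
theorem not_onTail_le_crossImage (hne : OnTail 𝕜 (M := M) C ρ i q ≠ ⊥) :
    ¬OnTail 𝕜 (M := M) C ρ i q ≤ crossImage 𝕜 C ρ M i q := by
  intro hle
  refine hne (eq_bot_iff.2 ?_)
  -- Nakayama with Z = 0: if the crossing images spanned the tail space, it would vanish.
  refine le_of_le_sup_cross (i := i) (q := q) le_rfl
    (fun k hk u hu => cross_smul_mem_onTail hu hk) (fun k _ u hu => ?_) (Multiset.card ρ)
    fun W _ hW => hle.trans (Submodule.span_le.2 ?_)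
  · rw [(Submodule.mem_bot 𝕜).1 hu, smul_zero]; exact zero_mem _
  · rintro _ ⟨k, hk, u, hu, rfl⟩
    by_cases h : k < q + Multiset.card ρ
    · exact hW k hk h u hu
    · rw [cross_of_le (by omega), zero_smul]; exact zero_mem _

/-- The dots are commuting nilpotent operators. Treating them one after another, apply the highest
power of the next dot that does not kill the vector; earlier dots still kill the result. -/
theorem exists_killed_by_dots {c : ℕ} (hc : ∀ k, ∀ u : M, dot 𝕜 C ρ k ^ c • u = 0)
    {X : Submodule 𝕜 M} (hX : ∀ k, ∀ u ∈ X, dot 𝕜 C ρ k • u ∈ X) (hne : X ≠ ⊥) :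
    ∃ w ∈ X, w ≠ 0 ∧ ∀ k, dot 𝕜 C ρ k • w = 0 := by
  have key : ∀ b, ∃ w ∈ X, w ≠ 0 ∧ ∀ k < b, dot 𝕜 C ρ k • w = 0 := by
    intro b
    induction b with
    | zero =>
      obtain ⟨w, hw, h0⟩ := X.exists_mem_ne_zero_of_ne_bot hne
      exact ⟨w, hw, h0, fun k hk => absurd hk (Nat.not_lt_zero k)⟩
    | succ b ih =>
      obtain ⟨w, hw, h0, hk⟩ := ih
      classical
      have hex : ∃ n, dot 𝕜 C ρ b ^ n • w = 0 := ⟨c, hc b w⟩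
      obtain ⟨d, hd⟩ : ∃ d, Nat.find hex = d + 1 := by
        refine Nat.exists_eq_succ_of_ne_zero fun h => h0 ?_
        have := Nat.find_spec hex
        rwa [h, pow_zero, one_smul] at this
      refine ⟨dot 𝕜 C ρ b ^ d • w, dot_pow_smul_mem hX b d hw, Nat.find_min hex (by omega), ?_⟩
      intro k hkb
      obtain rfl | hlt := Nat.eq_or_lt_of_le (Nat.le_of_lt_succ hkb)
      · have := Nat.find_spec hex
        rwa [hd, pow_succ', mul_smul] at this
      · have : ∀ n, dot 𝕜 C ρ k • dot 𝕜 C ρ b ^ n • w = 0 := fun n => by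
          induction n with
          | zero => rw [pow_zero, one_smul, hk k hlt]
          | succ n ih => rw [pow_succ', mul_smul, dot_smul_dot_smul, ih, smul_zero]
        exact this d
  obtain ⟨w, hw, h0, hk⟩ := key (Multiset.card ρ)
  refine ⟨w, hw, h0, fun k => ?_⟩
  by_cases h : k < Multiset.card ρ
  · exact hk k h
  · rw [dot_of_le 𝕜 (by omega), zero_smul]

end TailSpace

/-! ### Homogeneity of the crossing images. -/

section HomogeneousTail

universe v w

variable {I : Type v} {ρ : Multiset I} {𝕜 : Type*} [Field 𝕜] {C : BorcherdsCartan I} {i : I}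
variable {M : KLRMod.{v, w} 𝕜 C ρ} {q : ℕ}

/-- An unlabelled crossing is a sum of generators whose degrees depend on the labels, so the vector
is first split along the idempotents; each labelled crossing is homogeneous. -/
theorem decompose_mem_crossImage {x : M} (hx : x ∈ crossImage 𝕜 C ρ M i q) (p : ℤ) :
    (decompose M.deg x p : M) ∈ crossImage 𝕜 C ρ M i q := by
  induction hx using Submodule.span_induction with
  | zero => simp
  | add x y _ _ hx hy => rw [decompose_add, DirectSum.add_apply, Submodule.coe_add]; exact add_mem hx hy
  | smul a x _ hx => 
    rw [decompose_smul, DirectSum.smul_apply, Submodule.coe_smul]; exact Submodule.smul_mem _ a hx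
  | mem x hx =>
    obtain ⟨k, hk, u, hu, rfl⟩ := hx
    by_cases hk' : k + 1 < Multiset.card ρ
    swap
    · rw [cross_of_le (by omega), zero_smul, decompose_zero]; exact zero_mem _
    rw [← sum_e_smul 𝕜 C (ρ := ρ) u, Finset.smul_sum, decompose_sum, DFinsupp.finset_sum_apply,
      AddSubmonoidClass.coe_finsetSum]
    refine Submodule.sum_mem _ fun s _ => ?_
    by_cases hs : Tail i q s
    · have h := M.decompose_smul (gen_mem 𝕜 (C := C) (.t k hk' s)) u (p - Gen.deg C (.t k hk' s))
      rw [add_sub_cancel, ← cross_mul_e 𝕜 hk' s, mul_smul, mul_smul] at h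
      rw [h]
      exact cross_smul_mem_crossImage hk (e_smul_mem_onTail hs _)
    · rw [hu s hs, smul_zero, decompose_zero]; exact zero_mem _

end HomogeneousTail

/-! ### Graded submodules of a module generated by a vacuum image. -/

section VacuumStructure

universe v w w'

variable {I : Type v} {κ ρ : Multiset I} {𝕜 : Type*} [Field 𝕜] {C : BorcherdsCartan I} {i : I}
variable {m : ℕ} {h : κ + Multiset.replicate m i = ρ}
variable {K : KLRMod.{v, w} 𝕜 C κ} {M : KLRMod.{v, w'} 𝕜 C ρ} {ι : K →ₗ[𝕜] M} {d : ℤ}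

theorem IsVacuumHom.stableBelow_range (H : IsVacuumHom C h ι) :
    StableBelow C ρ (Multiset.card κ) (LinearMap.range ι) where
  e_mem := by
    rintro t _ ⟨u, rfl⟩
    by_cases ht : Tail i (Multiset.card κ) t
    · obtain ⟨s, rfl⟩ := exists_extend_of_tail h ht
      exact ⟨_, H.e s u⟩
    · rw [H.mem_onTail u t ht]; exact zero_mem _
  dot_mem := by
    rintro k _ ⟨u, rfl⟩
    by_cases hk : k < Multiset.card κ
    · exact ⟨_, H.dot k hk u⟩
    · rw [H.dot_eq_zero k (by omega)]; exact zero_mem _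
  cross_mem := by
    rintro k hk _ ⟨u, rfl⟩
    exact ⟨_, H.cross k hk u⟩

theorem IsVacuumHom.mem_tower (H : IsVacuumHom C h ι) (u : M) :
    u ∈ tower C ρ (Multiset.card κ) (LinearMap.range ι) m :=
  mem_tower_of_mem_span H.stableBelow_range (card_add_eq h) (H.span_eq_top ▸ Submodule.mem_top)

theorem IsVacuumHom.finite (H : IsVacuumHom C h ι) [Module.Finite 𝕜 K] : Module.Finite 𝕜 M := by
  have : Module.Finite 𝕜 (LinearMap.range ι) := Module.Finite.range ι
  exact Module.Finite.of_surjective (tower C ρ (Multiset.card κ) (LinearMap.range ι) m).subtype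
    fun u => ⟨⟨u, H.mem_tower u⟩, rfl⟩

theorem tail_of_tail_extend {s : Seq κ} {q' : ℕ} (ht : Tail i q' (s.extend h)) : Tail i q' s := by
  intro r hr hqr
  have hc := card_add_eq h
  have := (Seq.entry_eq_iff _ _ _ _).1 (ht r (by omega) hqr)
  refine (Seq.entry_eq_iff _ _ _ _).2 ?_
  change (s.1 ++ List.replicate m i)[r]? = some i at this
  rwa [List.getElem?_append_left (by rwa [s.length_eq])] at this

/-- As ε_i(K) = 0, no weight of K ends in i, so no weight of the image of K has a tail starting
before |κ|, and the general support lemma applies to this image. -/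
theorem IsVacuumHom.tower_support (H : IsVacuumHom C h ι) (hε : eps i K = 0) (t : Seq ρ) (u : M) :
    (∀ q' < Multiset.card κ, Tail i q' t → gen 𝕜 C (.e t) • u = 0) ∧
    (Tail i (Multiset.card κ) t →
      gen 𝕜 C (.e t) • u ∈ crossSpan C ρ (Multiset.card κ) (LinearMap.range ι)) := by
  have hc := card_add_eq h
  obtain ⟨-, h2, h3⟩ := KLR.tower_support (i := i) (U := LinearMap.range ι) (q := Multiset.card κ)
    (p := m) (by
      rintro t ht _ ⟨u, rfl⟩
      exact H.mem_onTail u t ht) (by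
      rintro t q' hq ht _ ⟨u, rfl⟩
      obtain ⟨s, rfl⟩ := exists_extend_of_tail h (ht.mono hq.le)
      rw [← H.e, e_smul_eq_zero_of_eps_lt (i := i) (n := Multiset.card κ - q') (q := q') (by omega)
        (by omega) (tail_of_tail_extend ht), map_zero])
    H.stableBelow_range.e_mem hc.le t
  exact ⟨fun q' hq ht => h2 q' hq ht u (H.mem_tower u), fun ht => h3 ht u (H.mem_tower u)⟩

/-- Tail vectors lie in the closure of ι(K) under the tail crossings. The sum of ι(K) and the
crossing images is such a closed space, since both consist of tail vectors. -/
theorem IsVacuumHom.onTail_le (H : IsVacuumHom C h ι) (hε : eps i K = 0) :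
    OnTail 𝕜 (M := M) C ρ i (Multiset.card κ) ≤
      LinearMap.range ι ⊔ crossImage 𝕜 C ρ M i (Multiset.card κ) := by
  refine fun u hu => mem_of_onTail hu fun t ht => ?_
  refine crossSpan_le le_sup_left (fun k hk x hx => ?_) ((H.tower_support hε t u).2 ht)
  refine Submodule.mem_sup_right (cross_smul_mem_crossImage hk ?_)
  have hle : LinearMap.range ι ≤ OnTail 𝕜 C ρ i (Multiset.card κ) := by
    rintro _ ⟨u, rfl⟩
    exact H.mem_onTail u
  exact sup_le hle crossImage_le_onTail hx

theorem IsVacuumHom.exists_ne_zero (H : IsVacuumHom C h ι) [Nontrivial M] : ∃ u, ι u ≠ 0 := by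
  by_contra! h0
  have : Submodule.span (KLRAlgebra 𝕜 C ρ) (Set.range ι) = ⊥ := by
    rw [Submodule.span_eq_bot]
    rintro _ ⟨u, rfl⟩
    exact h0 u
  exact bot_ne_top (this.symm.trans H.span_eq_top)

/-- Irreducibility of `K` for the graded subspaces of `M`. -/
theorem IsVacuumHom.range_le (H : IsVacuumHom C h ι) (hd : GrMod.DegreeShift K M ι d)
    (hK : K.IsIrreducible) {W : Submodule 𝕜 M} (hW : StableBelow C ρ (Multiset.card κ) W)
    (hg : ∀ x ∈ W, ∀ p, (decompose M.deg x p : M) ∈ W) {u : K} (hu : ι u ∈ W) (h0 : u ≠ 0) :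
    LinearMap.range ι ≤ W := by
  -- The preimage of W in K is a graded R(κ)-submodule; it contains the nonzero vector u, so it is
  -- all of K.
  let X : Submodule (KLRAlgebra 𝕜 C κ) K :=
    { carrier := {u | ι u ∈ W}
      zero_mem' := by change ι 0 ∈ W; rw [map_zero]; exact zero_mem _
      add_mem' := fun {a b} ha hb => by
        change ι (a + b) ∈ W
        rw [map_add]
        exact add_mem ha hb
      smul_mem' := fun a u hu => by
        induction a using algebra_induction 𝕜 generalizing u with
        | scalar c =>
          change ι (algebraMap 𝕜 _ c • u) ∈ W
          rw [algebraMap_smul, map_smul]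
          exact W.smul_mem c hu
        | add a b ha hb =>
          change ι ((a + b) • u) ∈ W
          rw [add_smul, map_add]
          exact add_mem (ha u hu) (hb u hu)
        | mul a b ha hb =>
          rw [mul_smul]
          exact ha _ (hb u hu)
        | gen g =>
          change ι (gen 𝕜 C g • u) ∈ W
          cases g with
          | e s => rw [H.e]; exact hW.e_mem _ _ hu
          | x k hk s =>
            rw [← dot_mul_e 𝕜 hk s, mul_smul, H.dot k hk, H.e]
            exact hW.dot_mem _ _ (hW.e_mem _ _ hu)
          | t k hk s =>
            rw [← cross_mul_e 𝕜 hk s, mul_smul, H.cross k hk, H.e]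
            exact hW.cross_mem _ hk _ (hW.e_mem _ _ hu) }
  have hX : K.IsGraded X := fun p u hu => by
    change ι _ ∈ W
    rw [hd]
    exact hg _ hu _
  obtain hb | ht := hK.2 X hX
  · exact absurd ((Submodule.mem_bot _).1 (hb ▸ (show u ∈ X from hu))) h0
  · rintro _ ⟨v, rfl⟩
    exact (ht ▸ Submodule.mem_top : v ∈ X)

theorem stableBelow_restrictScalars (Z : Submodule (KLRAlgebra 𝕜 C ρ) M) (q : ℕ) :
    StableBelow C ρ q (Z.restrictScalars 𝕜) :=
  ⟨fun _ _ hu => Z.smul_mem _ hu, fun _ _ hu => Z.smul_mem _ hu, fun _ _ _ hu => Z.smul_mem _ hu⟩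

variable (H : IsVacuumHom C h ι) (hd : GrMod.DegreeShift K M ι d) (hK : K.IsIrreducible)
  (hε : eps i K = 0)

include H

theorem IsVacuumHom.eq_top_of_range_le {Z : Submodule (KLRAlgebra 𝕜 C ρ) M}
    (h : LinearMap.range ι ≤ Z.restrictScalars 𝕜) : Z = ⊤ := by
  rw [eq_top_iff, ← H.span_eq_top, Submodule.span_le]
  rintro _ ⟨u, rfl⟩
  exact h ⟨u, rfl⟩

include hd hK hε

/-- A nonzero intersection contains a nonzero vector killed by all dots. The element of
`exists_extremal` fixes it and kills its part in the crossing images, so it lies in ι(K).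
Irreducibility of K then puts ι(K), and with it M, into Z. -/
theorem IsVacuumHom.inf_onTail_eq_bot (hi : C.IsReal i) [Module.Finite 𝕜 K]
    {Z : Submodule (KLRAlgebra 𝕜 C ρ) M} (hZ : M.IsGraded Z) (hne : Z ≠ ⊤) :
    Z.restrictScalars 𝕜 ⊓ OnTail 𝕜 C ρ i (Multiset.card κ) = ⊥ := by
  by_contra hbot
  have hcard := card_add_eq h
  have := H.finite
  obtain ⟨c, hc⟩ := exists_dot_pow_smul_eq_zero M
  obtain ⟨w, ⟨hwZ, hwT⟩, hw0, hwd⟩ := exists_killed_by_dots hc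
    (X := Z.restrictScalars 𝕜 ⊓ OnTail 𝕜 C ρ i (Multiset.card κ)) (fun k u hu => ⟨Z.smul_mem _ hu.1, dot_smul_mem_onTail hu.2 k⟩) hbot
  obtain ⟨θ, h1, h2⟩ := exists_extremal 𝕜 C M hi hcard.le
  obtain ⟨x, ⟨u, rfl⟩, y, hy, hxy⟩ := Submodule.mem_sup.1 (H.onTail_le hε hwT)
  have hθy : θ • y = 0 := by
    refine (Submodule.mem_bot 𝕜).1 (smul_mem_of_crossImage (fun k hk v hv => ?_) hy)
    by_cases hk' : k + 1 < Multiset.card κ + m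
    · rw [h2 k hk hk' v hv]; exact zero_mem _
    · rw [cross_of_le (by omega), zero_smul, smul_zero]; exact zero_mem _
  have hw : w = ι u := by
    -- Apply θ to w = ι u + y: it fixes w and ι u, which the tail dots kill, and it annihilates y.
    rw [← h1 w hwT fun k _ => hwd k, ← hxy, smul_add, hθy, add_zero,
      h1 _ (H.mem_onTail u) fun k hk => H.dot_eq_zero k hk u]
  refine hne (H.eq_top_of_range_le (H.range_le hd hK (stableBelow_restrictScalars Z _)
    (fun x hx p => hZ p hx) (u := u) (hw ▸ hwZ) ?_))
  rintro rfl
  exact hw0 (by rw [hw, map_zero])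

/-- A vector of Z on the tail outside J differs by an element of J from some ι u with u ≠ 0. So Z +
J meets ι(K) and contains it by irreducibility, and Nakayama removes J. -/
theorem IsVacuumHom.inf_onTail_le_crossImage (hi : ¬C.IsReal i)
    {Z : Submodule (KLRAlgebra 𝕜 C ρ) M} (hZ : M.IsGraded Z) (hne : Z ≠ ⊤) :
    Z.restrictScalars 𝕜 ⊓ OnTail 𝕜 C ρ i (Multiset.card κ) ≤
      crossImage 𝕜 C ρ M i (Multiset.card κ) := by
  have hcard := card_add_eq h
  rintro z ⟨hzZ, hzT⟩
  by_contra hz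
  obtain ⟨x, ⟨u, rfl⟩, y, hy, hxy⟩ := Submodule.mem_sup.1 (H.onTail_le hε hzT)
  have hZs := stableBelow_restrictScalars Z (Multiset.card κ)
  have hJs := stableBelow_crossImage ρ 𝕜 C M hi (q := Multiset.card κ) (by omega)
  have hsup : ∀ {a : KLRAlgebra 𝕜 C ρ}, (∀ u ∈ Z.restrictScalars 𝕜, a • u ∈ Z.restrictScalars 𝕜) →
      (∀ u ∈ crossImage 𝕜 C ρ M i (Multiset.card κ),
        a • u ∈ crossImage 𝕜 C ρ M i (Multiset.card κ)) →
      ∀ u ∈ Z.restrictScalars 𝕜 ⊔ crossImage 𝕜 C ρ M i (Multiset.card κ),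
        a • u ∈ Z.restrictScalars 𝕜 ⊔ crossImage 𝕜 C ρ M i (Multiset.card κ) := by
    intro a h1 h2 u hu
    obtain ⟨x, hx, y, hy, rfl⟩ := Submodule.mem_sup.1 hu
    rw [smul_add]
    exact Submodule.add_mem_sup (h1 x hx) (h2 y hy)
  have hle : LinearMap.range ι ≤
      Z.restrictScalars 𝕜 ⊔ crossImage 𝕜 C ρ M i (Multiset.card κ) := by
    refine H.range_le hd hK ⟨fun s => hsup (hZs.e_mem s) (hJs.e_mem s),
      fun k => hsup (hZs.dot_mem k) (hJs.dot_mem k),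
      fun k hk => hsup (hZs.cross_mem k hk) (hJs.cross_mem k hk)⟩ (fun x hx p => ?_) (u := u) ?_ ?_
    · obtain ⟨x, hx', y, hy, rfl⟩ := Submodule.mem_sup.1 hx
      rw [decompose_add, DirectSum.add_apply, Submodule.coe_add]
      exact Submodule.add_mem_sup (hZ p hx') (decompose_mem_crossImage hy p)
    · rw [eq_sub_of_add_eq hxy]
      exact sub_mem (Submodule.mem_sup_left hzZ) (Submodule.mem_sup_right hy)
    · rintro rfl
      rw [map_zero, zero_add] at hxy
      exact hz (hxy ▸ hy)
  -- Any W that contains Z and the images of the tail crossings contains Z + J, hence ι(K) + J,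
  -- hence the whole tail space; this is the hypothesis of `le_of_le_sup_cross`.
  have hDZ : OnTail 𝕜 C ρ i (Multiset.card κ) ≤ Z.restrictScalars 𝕜 := by
    refine le_of_le_sup_cross (i := i) (q := Multiset.card κ) le_rfl
      (fun k hk u hu => cross_smul_mem_onTail hu hk) (fun k _ u hu => Z.smul_mem _ hu) m
      fun W hW hWc => ?_
    have hJW : crossImage 𝕜 C ρ M i (Multiset.card κ) ≤ W := by
      refine Submodule.span_le.2 ?_
      rintro _ ⟨k, hk, v, hv, rfl⟩
      by_cases hk' : k < Multiset.card κ + m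
      · exact hWc k hk hk' v hv
      · rw [cross_of_le (by omega), zero_smul]; exact zero_mem _
    exact (H.onTail_le hε).trans (sup_le (hle.trans (sup_le hW hJW)) hJW)
  refine hne (H.eq_top_of_range_le (le_trans ?_ hDZ))
  rintro _ ⟨u, rfl⟩
  exact H.mem_onTail u

omit hd hK in
/-- For imaginary `i` the images of the crossings on the tail generate a proper submodule. -/
theorem IsVacuumHom.exists_crossImage_le (hi : ¬C.IsReal i) [Nontrivial M] :
    ∃ Z : Submodule (KLRAlgebra 𝕜 C ρ) M, M.IsGraded Z ∧ Z ≠ ⊤ ∧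
      crossImage 𝕜 C ρ M i (Multiset.card κ) ≤ Z.restrictScalars 𝕜 := by
  have hcard := card_add_eq h
  classical
  let J := crossImage 𝕜 C ρ M i (Multiset.card κ)
  have hJs : StableBelow C ρ (Multiset.card κ) J :=
    stableBelow_crossImage ρ 𝕜 C M hi (q := Multiset.card κ) (by omega)
  let Z := Submodule.span (KLRAlgebra 𝕜 C ρ) (J : Set M)
  -- The crossing images satisfy the hypotheses of `tower_support`, since longer tails vanish on M,
  -- and they are closed under tail crossings. So the tail components of the submodule they generate
  -- remain in J, which is smaller than the tail space.
  have hZJ : ∀ t : Seq ρ, Tail i (Multiset.card κ) t → ∀ z ∈ Z, gen 𝕜 C (.e t) • z ∈ J := by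
    intro t ht z hz
    have hs := (KLR.tower_support (i := i) (U := J) (q := Multiset.card κ) (p := m)
      (fun t ht u hu => crossImage_le_onTail hu t ht)
      (fun t q' hq ht u _ => (H.tower_support hε t u).1 q' hq ht)
      (fun t u hu => hJs.e_mem t u hu) hcard.le t).2.2 ht z (mem_tower_of_mem_span hJs hcard hz)
    exact crossSpan_le le_rfl
      (fun k hk u hu => cross_smul_mem_crossImage hk (crossImage_le_onTail hu)) hs
  refine ⟨Z, ?_, fun htop => ?_, Submodule.subset_span⟩
  -- The crossing images contain the homogeneous components of their elements, so Z is generated by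
  -- homogeneous elements.
  · have hspan : Z = Submodule.span (KLRAlgebra 𝕜 C ρ) {x : M | x ∈ J ∧ ∃ p, x ∈ M.deg p} := by
      refine le_antisymm (Submodule.span_le.2 fun x hx => ?_) (Submodule.span_mono fun x hx => hx.1)
      rw [SetLike.mem_coe, ← sum_support_decompose M.deg x]
      exact Submodule.sum_mem _ fun p _ => Submodule.subset_span
        ⟨decompose_mem_crossImage hx p, p, SetLike.coe_mem _⟩
    rw [hspan]
    exact M.isGraded_span _ fun x hx => hx.2
  · obtain ⟨u, hu⟩ := H.exists_ne_zero
    refine not_onTail_le_crossImage (i := i) (q := Multiset.card κ) (𝕜 := 𝕜) (C := C) (M := M)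
      (fun h => hu ?_) fun x hx => mem_of_onTail hx fun t ht => hZJ t ht x (htop ▸ Submodule.mem_top)
    exact (Submodule.mem_bot 𝕜).1 (h ▸ H.mem_onTail u)

/-- A module generated by a vacuum image of an irreducible module has a greatest proper graded
submodule. -/
theorem IsVacuumHom.exists_greatest [Nontrivial M] [Module.Finite 𝕜 K] :
    ∃ S : Submodule (KLRAlgebra 𝕜 C ρ) M, M.IsGraded S ∧ S ≠ ⊤ ∧
      (∀ Z, M.IsGraded Z → Z ≠ ⊤ → Z ≤ S) ∧
      (¬C.IsReal i → ∀ k, Multiset.card κ ≤ k → ∀ u, cross 𝕜 C ρ k • ι u ∈ S) ∧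
      (C.IsReal i → ∀ t : Seq ρ, Tail i (Multiset.card κ) t → ∀ z ∈ S, gen 𝕜 C (.e t) • z = 0) := by
  -- A common bound for the tail parts of all proper graded submodules: zero for real i, the
  -- crossing images for imaginary i. In both cases it is not the whole tail space.
  obtain ⟨J, hJne, hJ, hJr⟩ : ∃ J : Submodule 𝕜 M,
      ¬OnTail 𝕜 C ρ i (Multiset.card κ) ≤ J ∧
      (∀ Z : Submodule (KLRAlgebra 𝕜 C ρ) M, M.IsGraded Z → Z ≠ ⊤ →
        Z.restrictScalars 𝕜 ⊓ OnTail 𝕜 C ρ i (Multiset.card κ) ≤ J) ∧ (C.IsReal i → J = ⊥) := by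
    obtain ⟨u, hu⟩ := H.exists_ne_zero
    have hne : OnTail 𝕜 (M := M) C ρ i (Multiset.card κ) ≠ ⊥ := fun h =>
      hu ((Submodule.mem_bot 𝕜).1 (h ▸ H.mem_onTail u))
    by_cases hi : C.IsReal i
    · exact ⟨⊥, fun h => hne (le_bot_iff.1 h),
        fun Z hZ hZ' => (H.inf_onTail_eq_bot hd hK hε hi hZ hZ').le, fun _ => rfl⟩
    · exact ⟨crossImage 𝕜 C ρ M i (Multiset.card κ), not_onTail_le_crossImage hne,
        fun Z hZ hZ' => H.inf_onTail_le_crossImage hd hK hε hi hZ hZ', fun h => absurd h hi⟩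
  let 𝒵 : Set (Submodule (KLRAlgebra 𝕜 C ρ) M) := {Z | M.IsGraded Z ∧ Z ≠ ⊤}
  have hle : ∀ Z, M.IsGraded Z → Z ≠ ⊤ → Z ≤ sSup 𝒵 := fun Z h1 h2 => le_sSup ⟨h1, h2⟩
  -- The bound J is a subspace and the tail idempotents act linearly, so the bound passes to the sum
  -- of all proper graded submodules and shows that this sum is proper.
  have hSJ : ∀ t : Seq ρ, Tail i (Multiset.card κ) t → ∀ z ∈ sSup 𝒵, gen 𝕜 C (.e t) • z ∈ J := by
    intro t ht z hz
    rw [sSup_eq_iSup'] at hz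
    induction hz using Submodule.iSup_induction' with
    | mem Z z hz =>
      exact hJ Z.1 Z.2.1 Z.2.2 ⟨Z.1.smul_mem _ hz, e_smul_mem_onTail ht z⟩
    | zero => rw [smul_zero]; exact zero_mem _
    | add x y _ _ hx hy => rw [smul_add]; exact add_mem hx hy
  refine ⟨sSup 𝒵, M.isGraded_sSup _ fun Z hZ => hZ.1, fun htop => ?_, hle, fun hi k hk u => ?_,
    fun hi t ht z hz => ?_⟩
  · exact hJne fun x hx => mem_of_onTail hx fun t ht => hSJ t ht x (htop ▸ Submodule.mem_top)
  · obtain ⟨Z, hZ, hZ', hZJ⟩ := H.exists_crossImage_le hε hi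
    exact hle Z hZ hZ' (hZJ (cross_smul_mem_crossImage hk (H.mem_onTail u)))
  · have := hSJ t ht z hz
    rwa [hJr hi, Submodule.mem_bot] at this

-- Since S is proper, some ι u is not in S, and one of its weight components, all of which have the
-- tail, is not either. Longer tails vanish already on M.
omit hd hK in
theorem IsVacuumHom.eps_quot {S : Submodule (KLRAlgebra 𝕜 C ρ) M} (hS : M.IsGraded S)
    (hne : S ≠ ⊤) : eps i (M.quot S hS) = m := by
  obtain ⟨u, hu⟩ : ∃ u, ι u ∉ S := by
    by_contra! hall
    refine hne (H.eq_top_of_range_le ?_)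
    rintro _ ⟨u, rfl⟩
    exact hall u
  obtain ⟨t, ht, hmem⟩ : ∃ t : Seq ρ, Tail i (Multiset.card κ) t ∧ gen 𝕜 C (.e t) • ι u ∉ S := by
    by_contra! hall
    exact hu (mem_of_onTail (W := S.restrictScalars 𝕜) (H.mem_onTail u) hall)
  refine eps_eq (M := M.quot S hS) (card_add_eq h) ht (u := M.proj S hS (ι u)) (fun h0 => hmem ?_)
    fun q' hq t ht x => ?_
  · rw [← map_smul, ← LinearMap.mem_ker, M.ker_proj] at h0
    exact h0
  · obtain ⟨x, rfl⟩ := M.proj_surjective S hS x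
    rw [← map_smul, (H.tower_support hε t x).1 q' hq ht, map_zero]

end VacuumStructure

/-! ### Restriction, the comparison of heads, and the composition factors. -/

section Main

universe v w w'

variable {I : Type v} {κ ν ρ : Multiset I} {𝕜 : Type*} [Field 𝕜] {C : BorcherdsCartan I} {i : I}

section ResIncl

variable {n : ℕ} (h : κ + Multiset.replicate n i = ρ) (M : KLRMod.{v, w} 𝕜 C ρ)

/-- The inclusion of a restriction. -/
def resIncl : Res h M →ₗ[𝕜] M := (GrMod.resSpace (juxtapose 𝕜 C h) M).subtype

theorem resIncl_injective : Function.Injective (resIncl h M) := Subtype.val_injective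

theorem resIncl_smul (a : KLRAlgebra 𝕜 C κ ⊗[𝕜] KLRAlgebra 𝕜 C (Multiset.replicate n i))
    (x : Res h M) : resIncl h M (a • x) = juxtapose 𝕜 C h a • resIncl h M x := rfl

theorem resIncl_mem_deg {p : ℤ} {x : Res h M} (hx : x ∈ (Res h M).deg p) :
    resIncl h M x ∈ M.deg p := hx

end ResIncl

/-- The vectors `u ⊗ vac` in `Δ_{i^n} N ≅ K ⊗ V(i^n)` generate `N`. -/
theorem exists_isVacuumHom_of_res_iso {n : ℕ} {h : κ + Multiset.replicate n i = ν}
    {N : KLRMod.{v, w} 𝕜 C ν} (hN : N.IsIrreducible) (hε : eps i N = n)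
    {K : KLRMod.{v, w'} 𝕜 C κ} (hiso : (Res h N).Iso (K.tensor (V 𝕜 C i n))) :
    ∃ ι : K →ₗ[𝕜] N, IsVacuumHom C h ι ∧ GrMod.DegreeShift K N ι (vacDeg C i n) := by
  obtain ⟨e, he⟩ := hiso
  have hcard := card_add_eq h
  let T := K.tensor (V 𝕜 C i n)
  let τ : K →ₗ[𝕜] V 𝕜 C i n →ₗ[𝕜] T := TensorProduct.mk 𝕜 K (V 𝕜 C i n)
  have hτ : ∀ (a : KLRAlgebra 𝕜 C κ) (b : KLRAlgebra 𝕜 C (Multiset.replicate n i)) u v,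
      (a ⊗ₜ[𝕜] b) • τ u v = τ (a • u) (b • v) := fun _ _ _ _ => rfl
  let ι : K →ₗ[𝕜] N := (resIncl h N).comp
    ((e.symm.toLinearMap.restrictScalars 𝕜).comp (τ.flip (vac 𝕜 C i n)))
  have hι : ∀ u, ι u = resIncl h N (e.symm (τ u (vac 𝕜 C i n))) := fun _ => rfl
  have hact : ∀ (a : KLRAlgebra 𝕜 C κ) (b : KLRAlgebra 𝕜 C (Multiset.replicate n i)) u,
      juxtapose 𝕜 C h (a ⊗ₜ b) • ι u
        = resIncl h N (e.symm (τ (a • u) (b • vac 𝕜 C i n))) := by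
    intro a b u
    rw [hι, ← resIncl_smul, ← map_smul, hτ]
  have hstrand : IsStrandHom C h ι := isStrandHom_of_juxtapose h fun a u => by
    rw [hact, one_smul, hι]
  have hdeg : ∀ p, ∀ u ∈ K.deg p, ι u ∈ N.deg (p + vacDeg C i n) := by
    intro p u hu
    rw [hι]
    refine resIncl_mem_deg h N ((he _ _).2 ?_)
    rw [e.apply_symm_apply]
    exact tmul_mem_tensorDeg hu vac_mem_deg
  have := hN.1
  refine ⟨ι, ⟨hstrand, fun k hk u => ?_, ?_⟩, GrMod.degreeShift_of_mem hdeg⟩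
  · by_cases hk' : k < Multiset.card ν
    · obtain ⟨l, rfl⟩ := Nat.exists_eq_add_of_le hk
      have := hact 1 (dot 𝕜 C (Multiset.replicate n i) l) u
      rwa [juxtapose_dot_right 𝕜 C h (by omega), mul_smul, hstrand.oneTensorOne_smul, dot_smul_vac,
        map_zero, map_zero, map_zero] at this
    · rw [dot_of_le 𝕜 (by omega), zero_smul]
  · classical
    -- Images of homogeneous vectors suffice as generators, so the submodule generated by the image
    -- is graded, and irreducibility of N makes it 0 or N.
    have hspan : Submodule.span (KLRAlgebra 𝕜 C ν) (Set.range ι)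
        = Submodule.span (KLRAlgebra 𝕜 C ν) {x | ∃ p, ∃ u ∈ K.deg p, ι u = x} := by
      refine le_antisymm (Submodule.span_le.2 ?_) (Submodule.span_mono ?_)
      · rintro _ ⟨u, rfl⟩
        rw [SetLike.mem_coe, ← sum_support_decompose K.deg u, map_sum]
        exact Submodule.sum_mem _ fun p _ => Submodule.subset_span
          ⟨p, _, SetLike.coe_mem _, rfl⟩
      · rintro _ ⟨p, u, -, rfl⟩
        exact ⟨u, rfl⟩
    have hg : N.IsGraded (Submodule.span (KLRAlgebra 𝕜 C ν) (Set.range ι)) := by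
      rw [hspan]
      refine N.isGraded_span _ ?_
      rintro _ ⟨p, u, hu, rfl⟩
      exact ⟨_, hdeg p u hu⟩
    obtain hb | ht := hN.2 _ hg
    swap
    · exact ht
    exfalso
    rw [Submodule.span_eq_bot] at hb
    -- If it were 0, all u ⊗ vac would vanish. As vac generates V(i^n), the tensor product and with
    -- it the restriction of N would vanish, against ε_i(N) = n.
    have h0 : ∀ u, τ u (vac 𝕜 C i n) = 0 := by
      intro u
      have h1 : resIncl h N (e.symm (τ u (vac 𝕜 C i n))) = resIncl h N 0 := by
        rw [map_zero]; exact hb _ ⟨u, rfl⟩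
      exact (LinearEquiv.map_eq_zero_iff e.symm).1 (resIncl_injective h N h1)
    have hT : ∀ x : T, x = 0 := by
      intro x
      have h1 : ∀ u v, τ u v = 0 := by
        intro u v
        obtain ⟨b, rfl⟩ := exists_smul_vac v
        have := hτ 1 b u (vac 𝕜 C i n)
        rw [h0, smul_zero, one_smul] at this
        exact this.symm
      induction x using TensorProduct.induction_on with
      | zero => rfl
      | add x y hx hy => exact (congrArg₂ (· + ·) hx hy).trans (add_zero (0 : T))
      | tmul u v => exact h1 u v
    have hres : Nontrivial (Res h N) := by
      obtain ⟨q, hq, t, ht, u, hu⟩ := exists_tail_eps (i := i) (M := N)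
      obtain rfl : q = Multiset.card κ := by omega
      exact (nontrivial_res_iff h).2 ⟨t, ht, u, hu⟩
    obtain ⟨x, hx⟩ := exists_ne (0 : Res h N)
    exact hx ((LinearEquiv.map_eq_zero_iff e).1 (hT (e x)))

variable {m : ℕ} {h : κ + Multiset.replicate m i = ρ}
variable {K : KLRMod.{v, w} 𝕜 C κ} {M : KLRMod.{v, w'} 𝕜 C ρ} {ι : K →ₗ[𝕜] M} {d : ℤ}
variable (H : IsVacuumHom C h ι) (hd : GrMod.DegreeShift K M ι d) (hK : K.IsIrreducible)
  (hε : eps i K = 0)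

include H hd hK hε

/-- The head of a module generated by a vacuum image of `K` is determined by `K`. -/
theorem IsVacuumHom.head_iso [Nontrivial M] [Module.Finite 𝕜 K] :
    M.head.Iso ((Ind h (K.tensor (V 𝕜 C i m))).head.shift (d - vacDeg C i m)) := by
  classical
  have := hK.1
  let M' := Ind h (K.tensor (V 𝕜 C i m))
  have H' : IsVacuumHom C h (vacMap h K) := isVacuumHom_vacMap h K
  have hd' : GrMod.DegreeShift K M' (vacMap h K) (vacDeg C i m) :=
    GrMod.degreeShift_of_mem fun p u hu => vacMap_mem_deg h K hu
  have : Nontrivial M' := nontrivial_ind h K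
  obtain ⟨S, hS, hne, hgr, hcr, -⟩ := H.exists_greatest hd hK hε
  obtain ⟨S', hS', hne', hgr', -, -⟩ := H'.exists_greatest hd' hK hε
  have hirr : (M.quot M.radical M.isGraded_radical).IsIrreducible :=
    GrMod.isIrreducible_head hS hne hgr
  obtain rfl := GrMod.radical_eq hS hne hgr
  let π := M.proj M.radical hS
  have hπ : Function.Surjective π := M.proj_surjective _ hS
  have hπ0 : ∀ x, π x = 0 ↔ x ∈ M.radical := fun x => by
    rw [← LinearMap.mem_ker, M.ker_proj]
  let ι' : K →ₗ[𝕜] M.quot M.radical hS := (π.restrictScalars 𝕜).comp ι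
  have hι' : ∀ u, ι' u = π (ι u) := fun _ => rfl
  -- For imaginary i the crossings on the added strands send ι(K) into the radical, so after passing
  -- to the head the map satisfies all hypotheses of Frobenius reciprocity.
  obtain ⟨Φ, hΦ⟩ := exists_vacMap_lift h K (ι := ι')
    ⟨fun s u => by rw [hι', hι', H.e, map_smul], fun k hk u => by rw [hι', hι', H.dot k hk, map_smul],
      fun k hk u => by rw [hι', hι', H.cross k hk, map_smul]⟩
    (fun k hk u => by rw [hι', ← map_smul, H.dot_eq_zero k hk, map_zero])
    (fun hi k hk u => by rw [hι', ← map_smul, hπ0]; exact hcr hi k hk u)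
  have hsurj : Function.Surjective Φ := by
    rw [← LinearMap.range_eq_top, eq_top_iff, ← LinearMap.range_eq_top.2 hπ,
      LinearMap.range_eq_map, ← H.span_eq_top, Submodule.map_span, Submodule.span_le]
    rintro _ ⟨_, ⟨u, rfl⟩, rfl⟩
    exact ⟨_, hΦ u⟩
  have hshift : GrMod.DegreeShift M' (M.quot M.radical hS) (Φ.restrictScalars 𝕜)
      (d - vacDeg C i m) := by
    refine GrMod.map_decompose M' (M.quot M.radical hS) Φ (d - vacDeg C i m)
      {x | ∃ p, ∃ u ∈ K.deg p, vacMap h K u = x} ?_ ?_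
    · rw [eq_top_iff, ← H'.span_eq_top, Submodule.span_le]
      rintro _ ⟨u, rfl⟩
      rw [SetLike.mem_coe, ← sum_support_decompose K.deg u, map_sum]
      exact Submodule.sum_mem _ fun p _ => Submodule.subset_span ⟨p, _, SetLike.coe_mem _, rfl⟩
    · rintro _ ⟨p, u, hu, rfl⟩
      refine ⟨_, vacMap_mem_deg h K hu, ?_⟩
      rw [hΦ, add_assoc, add_sub_cancel]
      exact ⟨_, hd.map_mem hu, rfl⟩
  -- The kernel is proper and graded, so it lies in the greatest one S'. The image of S' is zero or
  -- everything by irreducibility; the latter would make S' + ker Φ, which is S', the whole induced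
  -- module.
  have hker : LinearMap.ker Φ = M'.radical := by
    rw [GrMod.radical_eq hS' hne' hgr']
    have := hirr.1
    have hle : LinearMap.ker Φ ≤ S' := by
      refine hgr' _ (hshift.isGraded_comap (GrMod.isGraded_bot _)) fun htop => ?_
      obtain ⟨y, hy⟩ := exists_ne (0 : M.quot M.radical hS)
      obtain ⟨x, rfl⟩ := hsurj y
      exact hy (LinearMap.mem_ker.1 (htop ▸ Submodule.mem_top))
    refine le_antisymm hle ?_
    obtain h0 | h0 := hirr.2 _ (hshift.isGraded_map hS')
    · exact Submodule.map_le_iff_le_comap.1 h0.le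
    · refine absurd (eq_top_iff.2 fun x _ => ?_) hne'
      have hx : Φ x ∈ S'.map Φ := h0 ▸ Submodule.mem_top
      obtain ⟨y, hy, hyx⟩ := hx
      rw [← sub_add_cancel x y]
      exact add_mem (hle (by rw [LinearMap.mem_ker, map_sub, hyx, sub_self])) hy
  obtain ⟨e, he⟩ := GrMod.exists_quot_equiv hshift hsurj M'.isGraded_radical hker
  refine ⟨e.symm, fun p (x : M.quot M.radical hS) => ?_⟩
  have := he (p - (d - vacDeg C i m)) (e.symm x)
  rw [e.apply_symm_apply, sub_add_cancel] at this
  exact this.symm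

theorem IsVacuumHom.isIrreducible_head [Nontrivial M] [Module.Finite 𝕜 K] :
    M.head.IsIrreducible := by
  obtain ⟨S, hS, hne, hgr, -⟩ := H.exists_greatest hd hK hε
  exact GrMod.isIrreducible_head hS hne hgr

theorem IsVacuumHom.eps_head [Nontrivial M] [Module.Finite 𝕜 K] : eps i M.head = m := by
  obtain ⟨S, hS, hne, hgr, -⟩ := H.exists_greatest hd hK hε
  obtain rfl := GrMod.radical_eq hS hne hgr
  exact H.eps_quot hε M.isGraded_radical hne

/-- The factors other than the head are subquotients of S, and for real i the idempotents with a
tail of length m vanish on S. -/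
theorem IsVacuumHom.exists_factor (hi : C.IsReal i) [Nontrivial M] [Module.Finite 𝕜 K]
    (F : M.CompositionSeries) : ∃ k < F.length, (F.factor k).Iso M.head ∧
      ∀ l < F.length, l ≠ k → eps i (F.factor l) < m := by
  obtain ⟨S, hS, hne, hgr, -, hSt⟩ := H.exists_greatest hd hK hε
  obtain ⟨k, hk, hiso, hle⟩ := F.exists_factor_iso_head hS hne hgr
  refine ⟨k, hk, hiso, fun l hl hlk => ?_⟩
  let X := M.sub _ (F.isGraded (l + 1))
  let Y := M.inter _ (F.term l) (F.isGraded (l + 1))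
  have hY : X.IsGraded Y := M.inter_isGraded _ _ _ (F.isGraded l)
  have : Nontrivial (X.quot Y hY) := (F.irreducible l hl).1
  refine eps_lt (M := X.quot Y hY) (card_add_eq h) fun t ht y => ?_
  obtain ⟨x, rfl⟩ := X.proj_surjective Y hY y
  have hx : M.incl _ (F.isGraded (l + 1)) x ∈ F.term (l + 1) :=
    (M.range_incl _ (F.isGraded (l + 1))).le ⟨x, rfl⟩
  have h0 : gen 𝕜 C (.e t) • x = 0 := by
    refine M.incl_injective _ (F.isGraded (l + 1)) ?_
    rw [map_smul, map_zero]
    exact hSt hi t ht _ (hle l hl hlk hx)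
  rw [← map_smul, h0, map_zero]

omit H hd hK hε

-- For real i this is r_i times binom(a,2) + binom(n,2) - binom(a+n,2) = -a n.
open Classical in
theorem vacDeg_add (a n : ℕ) : vacDeg C i a + vacDeg C i n - vacDeg C i (a + n)
    = if C.IsReal i then -(C.r i * a * n : ℤ) else 0 := by
  -- The product n (n - 1) is even, so the natural division by 2 is exact; the truncated n - 1 at n
  -- = 0 is harmless.
  have key : ∀ n : ℕ, (2 : ℤ) * ((n * (n - 1) / 2 : ℕ) : ℤ) = n * n - n := by
    intro n
    have h := Nat.div_mul_cancel (Nat.even_mul_pred_self n).two_dvd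
    cases n with
    | zero => simp
    | succ n =>
      rw [Nat.add_sub_cancel] at h ⊢
      zify at h
      push_cast
      linear_combination h
  simp only [vacDeg]
  split_ifs
  · have h1 := key a
    have h2 := key n
    have h3 := key (a + n)
    push_cast [-Nat.cast_ofNat] at h1 h2 h3 ⊢
    refine mul_left_cancel₀ (two_ne_zero : (2 : ℤ) ≠ 0) ?_
    linear_combination (C.r i : ℤ) * (h1 + h2 - h3)
  · rfl

end Main

end KLR

end

open Classical in
theorem propositionP1 {𝕜 : Type*} [Field 𝕜] [IsAlgClosed 𝕜] {I : Type*}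
    (C : KLR.BorcherdsCartan I) (i : I) (a n : ℕ) (κ ν ρ : Multiset I)
    (hν : κ + Multiset.replicate a i = ν) (hρ : ν + Multiset.replicate n i = ρ)
    (hρ' : κ + Multiset.replicate (a + n) i = ρ)
    (N : KLR.KLRMod 𝕜 C ν) [Module.Finite 𝕜 N] (hN : N.IsIrreducible)
    (K : KLR.KLRMod 𝕜 C κ) [Module.Finite 𝕜 K] (hK : K.IsIrreducible)
    (hεN : KLR.eps i N = a) (hεK : KLR.eps i K = 0)
    (hΔ : (KLR.Res hν N).Iso (K.tensor (KLR.V 𝕜 C i a)))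
    (M : KLR.KLRMod 𝕜 C ρ) (hM : M = KLR.Ind hρ (N.tensor (KLR.V 𝕜 C i n))) :
    M.head.Iso ((KLR.Ind hρ' (K.tensor (KLR.V 𝕜 C i (a + n)))).head.shift
        (if C.IsReal i then -(C.r i * a * n) else 0)) ∧
      M.head.IsIrreducible ∧
      KLR.eps i M.head = a + n ∧
      (C.IsReal i → Nonempty M.CompositionSeries ∧
        ∀ F : M.CompositionSeries, ∃ k < F.length, (F.factor k).Iso M.head ∧
          ∀ l < F.length, l ≠ k → KLR.eps i (F.factor l) < a + n) := by
  subst hM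
  have := hN.1
  have : Nontrivial (KLR.Ind hρ (N.tensor (KLR.V 𝕜 C i n))) := KLR.nontrivial_ind hρ N
  obtain ⟨ι, hι, hd⟩ := KLR.exists_isVacuumHom_of_res_iso hN hεN hΔ
  -- The composite K → N → M is a vacuum homomorphism for a + n added strands, to which all four
  -- claims refer.
  have H := (KLR.isVacuumHom_vacMap hρ N).comp hι hρ'
  have hD : KLR.GrMod.DegreeShift K (KLR.Ind hρ (N.tensor (KLR.V 𝕜 C i n)))
      ((KLR.vacMap hρ N).comp ι) (KLR.vacDeg C i a + KLR.vacDeg C i n) := by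
    refine KLR.GrMod.degreeShift_of_mem fun p u hu => ?_
    rw [← add_assoc]
    exact KLR.vacMap_mem_deg hρ N (hd.map_mem hu)
  refine ⟨?_, H.isIrreducible_head hD hK hεK, H.eps_head hD hK hεK, fun hi => ⟨?_, fun F =>
    H.exists_factor hD hK hεK hi F⟩⟩
  · rw [← KLR.vacDeg_add]
    exact H.head_iso hD hK hεK
  · have := H.finite
    exact KLR.GrMod.nonempty_compositionSeries _
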